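/- Let $Q$ be a smooth ($n$-dimensional, Hausdorff, second countable) manifold with a smooth torsion-free connection $\nabla$ and a positive smooth volume density $\mu$; let $\pi:T^*Q\to Q$ be the projection, $\iota$ the zero section, and let $\theta$ be the one-form with $\nabla_X\mu=\theta(X)\mu$. For $\gamma\in\Gamma^\infty(T^*Q)$ let $(\mathsf F(\gamma)f)(\zeta)=\frac{d}{dt}\big|_{t=0}f(\zeta+t\gamma(q))$ for $\zeta\in T_q^*Q$; extend $\mathsf F$ multiplicatively to $\Gamma^\infty(\bigvee^\bullet T^*Q)$, with $u\in C^\infty(Q)$ acting as multiplication by $\pi^*u$. Let $\mathsf D$ be the symmetrized covariant derivative and $\varrho_S(f)u=\iota^*\mathsf F(\exp(-i\lambda\mathsf D)u)f$. Let $\star_S$ be the standard-ordered star product on $C^\infty(T^*Q)[[\lambda]]$ determined by $\nabla$: the differential star product with $\varrho_S(f\star_S g)=\varrho_S(f)\varrho_S(g)$ and $(\pi^*u)\star_S f=(\pi^*u)f$ whose cochains preserve the functions polynomial in the momenta. In bundle coordinates $(q,p)$, with $\Gamma^l_{jk}$ the Christoffel symbols of $\nabla$, let $$\Delta=\sum_k\frac{\partial^2}{\partial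 p_k\partial q^k}+\sum_{j,k,l}p_l\,\pi^*\Gamma^l_{jk}\frac{\partial^2}{\partial p_j\partial p_k}+\sum_{j,k}\pi^*\Gamma^j_{jk}\frac{\partial}{\partial p_k},$$ and for $\kappa\in\mathbb R$ put $N_\kappa=\exp(-i\kappa\lambda(\Delta+\mathsf F(\theta)))$ and $f\star_\kappa g=N_\kappa^{-1}(N_\kappa f\star_S N_\kappa g)$. Let $E\to Q$ be a smooth complex vector bundle of rank $k$, $\{\mathcal O_\alpha\}$ an open cover of $Q$ with smooth frames $\epsilon_\alpha$ of $E|_{\mathcal O_\alpha}$ and transition matrices $\varphi_{\alpha\beta}$ on $\mathcal O_\alpha\cap\mathcal O_\beta$ (so $s_\alpha=\varphi_{\alpha\beta}s_\beta$ for the coefficient columns of a section), and let $e_\alpha=\pi^*\epsilon_\alpha$ be the induced frames of $\pi^*E\to T^*Q$. Then, for every $\kappa\in\mathbb R$: (0) The star product $\star_S$ exists, and $\star_\kappa$ is a star product on $T^*Q$ with its canonical Poisson bracket. (1) The classical transition matrices $\phi_{\alpha\beta}=\pi^*\varphi_{\alpha\beta}$ of $\pi^*E$ satisfy the quantum cocycle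 condition $$\phi_{\alpha\beta}\star_\kappa\phi_{\beta\gamma}\star_\kappa\phi_{\gamma\alpha}=\mathbf 1,\qquad \phi_{\alpha\beta}\star_\kappa\phi_{\beta\alpha}=\mathbf 1$$ over triple and double intersections, respectively. (2) For $s\in\Gamma^\infty(\pi^*E)[[\lambda]]$, $s=e_\alpha s_\alpha$ on $T^*\mathcal O_\alpha$, and $f\in C^\infty(T^*Q)[[\lambda]]$, the local formula $$s\bullet_\kappa f\big|_{T^*\mathcal O_\alpha}:=e_\alpha\,(s_\alpha\star_S N_\kappa f)=e_\alpha\,N_\kappa\big(N_\kappa^{-1}(s_\alpha)\star_\kappa f\big)$$ (with both expressions equal) is independent of $\alpha$ on overlaps and defines a global deformation quantization of $\pi^*E$ with respect to $\star_\kappa$: $s\bullet_\kappa f=\sum_r\lambda^rR_r(s,f)$ with bidifferential operators $R_r$, $R_0(s,f)=sf$, and $s\bullet_\kappa(f\star_\kappa g)=(s\bullet_\kappa f)\bullet_\kappa g$. The same holds for local $s$ and $f$ over any open subset of $T^*Q$. (3) With respect to $\bullet_\kappa$ and the undeformed frames $e_\alpha$: every $s\in\Gamma^\infty(\pi^*E|_{T^*\mathcal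 O_\alpha})[[\lambda]]$ has unique quantum coefficients $\boldsymbol s_\alpha^{(\kappa)}\in C^\infty(T^*\mathcal O_\alpha)^k[[\lambda]]$ with $s=e_\alpha\bullet_\kappa\boldsymbol s_\alpha^{(\kappa)}$, namely $\boldsymbol s^{(\kappa)}_\alpha=N_\kappa^{-1}(s_\alpha)$, where $s=e_\alpha s_\alpha$; and the quantum transition matrices, i.e. the unique matrices $\Phi_{\alpha\beta}$ of formal functions on $T^*(\mathcal O_\alpha\cap\mathcal O_\beta)$ with $\boldsymbol s^{(\kappa)}_\alpha=\Phi_{\alpha\beta}\star_\kappa\boldsymbol s^{(\kappa)}_\beta$ for all $s$, are the classical ones, $\Phi_{\alpha\beta}=\phi_{\alpha\beta}=\pi^*\varphi_{\alpha\beta}$. -/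

import Mathlib

open Bundle
open scoped Manifold ContDiff Topology

noncomputable section

/-! ## Formal power series in `λ`

A formal series with coefficients in `X` is its sequence of coefficients.  Functions and sections
are total, and those of interest are smooth on the open set under consideration; equality of two
formal objects over an open set is equality of all their coefficients there. -/

/-- `X[[λ]]`, as sequences of coefficients. -/
abbrev Formal (X : Type*) := ℕ → X

/-- The embedding `X → X[[λ]]` in order zero. -/
def Formal.const {X : Type*} [Zero X] (x : X) : Formal X := fun N => if N = 0 then x else 0

/-- The `ℂ[[λ]]`-bilinear map `∑ λ^r B_r` determined by a sequence of bilinear maps `B_r`. -/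
def formalBilin {X Y Z : Type*} [AddCommMonoid Z] (B : ℕ → X → Y → Z) (f : Formal X)
    (g : Formal Y) : Formal Z :=
  fun N => ∑ m ∈ Finset.HasAntidiagonal.antidiagonal N, ∑ m' ∈ Finset.HasAntidiagonal.antidiagonal m.2,
    B m.1 (f m'.1) (g m'.2)

/-- `exp(c λ P) f = ∑_r (c λ)^r / r! P^r f` for an operator `P` and a scalar `c`. -/
def formalExp {X : Type*} [AddCommMonoid X] [Module ℂ X] (c : ℂ) (P : X → X) (f : Formal X) :
    Formal X :=
  fun N => ∑ m ∈ Finset.HasAntidiagonal.antidiagonal N, (c ^ m.1 / (m.1.factorial : ℂ)) • P^[m.1] (f m.2)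

/-- Equality over `U` of two formal functions (or sections). -/
def FormalEqOn {M : Type*} {W : M → Type*} (U : Set M) (s t : Formal (∀ x, W x)) : Prop :=
  ∀ N, ∀ x ∈ U, s N x = t N x

/-! ## Smooth functions, smooth sections, multidifferential operators -/

section General

variable {E : Type*} [NormedAddCommGroup E] [NormedSpace ℝ E]
  {H : Type*} [TopologicalSpace H] (J : ModelWithCorners ℝ E H)
  {M : Type*} [TopologicalSpace M] [ChartedSpace H M]

/-- `f ∈ C^∞(U)`, complex valued. -/
def SmoothFunOn (U : Set M) (f : M → ℂ) : Prop := ContMDiffOn J 𝓘(ℝ, ℂ) ∞ f U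

/-- `f ∈ C^∞(U)[[λ]]`. -/
def FormalSmoothFunOn (U : Set M) (f : Formal (M → ℂ)) : Prop := ∀ N, SmoothFunOn J U (f N)

variable (F : Type*) [NormedAddCommGroup F] [NormedSpace ℂ F]
  {W : M → Type*} [∀ x, TopologicalSpace (W x)] [TopologicalSpace (TotalSpace F W)]
  [FiberBundle F W]

/-- `s ∈ Γ^∞(W|_U)`: in each local trivialization, `s` is a smooth function on `U`. -/
def SmoothSecOn (U : Set M) (s : ∀ x, W x) : Prop :=
  ∀ (e : Trivialization F (π F W)) [MemTrivializationAtlas e],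
    ContMDiffOn J 𝓘(ℝ, F) ∞ (fun x => (e ⟨x, s x⟩).2) (U ∩ e.baseSet)

/-- `s ∈ Γ^∞(W|_U)[[λ]]`. -/
def FormalSmoothSecOn (U : Set M) (s : Formal (∀ x, W x)) : Prop :=
  ∀ N, SmoothSecOn J F U (s N)

/-- A smooth complex vector bundle over a real manifold: a complex vector bundle whose
transition functions are smooth. -/
class SmoothComplexVectorBundle (W : M → Type*) [∀ x, TopologicalSpace (W x)]
    [TopologicalSpace (TotalSpace F W)] [∀ x, AddCommMonoid (W x)] [∀ x, Module ℂ (W x)]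
    [FiberBundle F W] [VectorBundle ℂ F W] : Prop where
  smooth_coordChange : ∀ (e e' : Trivialization F (π F W)) [MemTrivializationAtlas e]
    [MemTrivializationAtlas e'],
    ContMDiffOn J 𝓘(ℝ, F →L[ℂ] F) ∞ (fun x => (e.coordChangeL ℂ e' x : F →L[ℂ] F))
      (e.baseSet ∩ e'.baseSet)

/-- The operator `P`, on the module `S` over the algebra `A` of smooth functions on `U`, is a
differential operator of order at most `N` over `U`: all its `(N+1)`-fold commutators with
multiplications by elements of `A` vanish. -/
def OrderLE {M : Type*} {X Y : M → Type*} [∀ x, AddCommMonoid (X x)] [∀ x, Module ℂ (X x)]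
    [∀ x, AddCommMonoid (Y x)] [∀ x, Module ℂ (Y x)] (U : Set M) (A : Set (M → ℂ))
    (S : Set (∀ x, X x)) : ℕ → ((∀ x, X x) → ∀ x, Y x) → Prop
  | 0, P => ∀ a ∈ A, ∀ s ∈ S, ∀ x ∈ U, P (fun y => a y • s y) x = a x • P s x
  | N + 1, P => ∀ a ∈ A,
      OrderLE U A S N (fun s x => P (fun y => a y • s y) x + (-a x) • P s x)

/-- A bidifferential operator `X × C^∞ → Y`, acting over every open set: it is local,
`ℂ`-bilinear, maps smooth objects (the predicates `SX`, `SY`) to smooth ones, and has finite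
order in each of its arguments. -/
structure IsBidifferential {X Y : M → Type*} [∀ x, AddCommMonoid (X x)] [∀ x, Module ℂ (X x)]
    [∀ x, AddCommMonoid (Y x)] [∀ x, Module ℂ (Y x)]
    (SX : Set M → (∀ x, X x) → Prop) (SY : Set M → (∀ x, Y x) → Prop)
    (R : (∀ x, X x) → (M → ℂ) → ∀ x, Y x) : Prop where
  smooth : ∀ U, IsOpen U → ∀ s f, SX U s → SmoothFunOn J U f → SY U (R s f)
  isLocal : ∀ U, IsOpen U → ∀ s s' f f', SX U s → SX U s' → SmoothFunOn J U f →
    SmoothFunOn J U f' → Set.EqOn f f' U → (∀ x ∈ U, s x = s' x) → ∀ x ∈ U, R s f x = R s' f' x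
  add_left : ∀ U, IsOpen U → ∀ s s' f, SX U s → SX U s' → SmoothFunOn J U f →
    ∀ x ∈ U, R (s + s') f x = R s f x + R s' f x
  smul_left : ∀ U, IsOpen U → ∀ (c : ℂ) s f, SX U s → SmoothFunOn J U f →
    ∀ x ∈ U, R (c • s) f x = c • R s f x
  add_right : ∀ U, IsOpen U → ∀ s f f', SX U s → SmoothFunOn J U f → SmoothFunOn J U f' →
    ∀ x ∈ U, R s (f + f') x = R s f x + R s f' x
  smul_right : ∀ U, IsOpen U → ∀ (c : ℂ) s f, SX U s → SmoothFunOn J U f →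
    ∀ x ∈ U, R s (c • f) x = c • R s f x
  finite_order : ∃ N, ∀ U, IsOpen U →
    (∀ f, SmoothFunOn J U f →
      OrderLE U {a | SmoothFunOn J U a} {s | SX U s} N (fun s => R s f)) ∧
    (∀ s, SX U s →
      OrderLE (X := fun _ => ℂ) U {a | SmoothFunOn J U a} {f | SmoothFunOn J U f} N
        (fun f => R s f))

/-- `star` is a star product on `M` with respect to the Poisson bracket `br`. -/
structure IsStarProduct (br : (M → ℂ) → (M → ℂ) → M → ℂ)
    (star : Formal (M → ℂ) → Formal (M → ℂ) → Formal (M → ℂ)) : Prop where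
  /-- `f ⋆ g = ∑ λ^r C_r(f, g)` with bidifferential operators `C_r`, `C_0(f, g) = f g` and
  `C_1(f, g) - C_1(g, f) = i {f, g}`. -/
  cochains : ∃ C : ℕ → (M → ℂ) → (M → ℂ) → M → ℂ,
    (∀ r, IsBidifferential J (X := fun _ => ℂ) (Y := fun _ => ℂ) (SmoothFunOn J)
      (SmoothFunOn J) (C r)) ∧
    (∀ U, IsOpen U → ∀ f g, FormalSmoothFunOn J U f → FormalSmoothFunOn J U g →
      FormalEqOn U (star f g) (formalBilin C f g)) ∧
    (∀ U, IsOpen U → ∀ f g, SmoothFunOn J U f → SmoothFunOn J U g →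
      ∀ x ∈ U, C 0 f g x = f x * g x) ∧
    (∀ U, IsOpen U → ∀ f g, SmoothFunOn J U f → SmoothFunOn J U g →
      ∀ x ∈ U, C 1 f g x - C 1 g f x = Complex.I * br f g x)
  assoc : ∀ U, IsOpen U → ∀ f g h, FormalSmoothFunOn J U f → FormalSmoothFunOn J U g →
    FormalSmoothFunOn J U h → FormalEqOn U (star (star f g) h) (star f (star g h))

/-- `bullet` is a deformation quantization of the complex vector bundle `W → M` with respect to
the star product `star`. -/
structure IsDeformationQuantization [∀ x, AddCommMonoid (W x)] [∀ x, Module ℂ (W x)]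
    (star : Formal (M → ℂ) → Formal (M → ℂ) → Formal (M → ℂ))
    (bullet : Formal (∀ x, W x) → Formal (M → ℂ) → Formal (∀ x, W x)) : Prop where
  /-- `s • f = ∑ λ^r R_r(s, f)` with bidifferential operators `R_r` and `R_0(s, f) = s f`. -/
  cochains : ∃ R : ℕ → (∀ x, W x) → (M → ℂ) → ∀ x, W x,
    (∀ r, IsBidifferential J (SmoothSecOn J F) (SmoothSecOn J F) (R r)) ∧
    (∀ U, IsOpen U → ∀ s f, FormalSmoothSecOn J F U s → FormalSmoothFunOn J U f →
      FormalEqOn U (bullet s f) (formalBilin R s f)) ∧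
    (∀ U, IsOpen U → ∀ s f, SmoothSecOn J F U s → SmoothFunOn J U f →
      ∀ x ∈ U, R 0 s f x = f x • s x)
  module_law : ∀ U, IsOpen U → ∀ s f g, FormalSmoothSecOn J F U s → FormalSmoothFunOn J U f →
    FormalSmoothFunOn J U g → FormalEqOn U (bullet s (star f g)) (bullet (bullet s f) g)

end General

/-! ## Frames and matrices -/

/-- Matrix product of matrices of formal functions with respect to `star`. -/
def matStar {M k l m : Type*} [Fintype l]
    (star : Formal (M → ℂ) → Formal (M → ℂ) → Formal (M → ℂ))
    (A : Matrix k l (Formal (M → ℂ))) (B : Matrix l m (Formal (M → ℂ))) :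
    Matrix k m (Formal (M → ℂ)) :=
  fun i j => ∑ r, star (A i r) (B r j)

/-- A matrix acting on a column of formal functions with respect to `star`. -/
def matVecStar {M k l : Type*} [Fintype l]
    (star : Formal (M → ℂ) → Formal (M → ℂ) → Formal (M → ℂ))
    (A : Matrix k l (Formal (M → ℂ))) (t : l → Formal (M → ℂ)) : k → Formal (M → ℂ) :=
  fun i => ∑ r, star (A i r) (t r)

/-- The unit matrix of formal functions. -/
def matUnit (M k : Type*) [DecidableEq k] : Matrix k k (Formal (M → ℂ)) :=
  fun i j => if i = j then Formal.const 1 else 0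

/-- The matrix of formal functions, of order zero, given by a matrix of functions. -/
def matConst {M k l : Type*} (A : Matrix k l (M → ℂ)) : Matrix k l (Formal (M → ℂ)) :=
  fun i j => Formal.const (A i j)

open scoped Classical in
/-- The coordinates of `v` in the basis `b` (zero if `b` is not a basis). -/
def basisCoord {k : ℕ} {X : Type*} [AddCommMonoid X] [Module ℂ X] (b : Fin k → X) (v : X)
    (i : Fin k) : ℂ :=
  if h : ∃ B : Module.Basis (Fin k) ℂ X, ⇑B = b then h.choose.repr v i else 0

/-- The coefficient functions `s_α` of a formal section `s = e_α s_α` in the frame `e`. -/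
def frameCoord {M : Type*} {W : M → Type*} [∀ x, AddCommMonoid (W x)] [∀ x, Module ℂ (W x)]
    {k : ℕ} (e : Fin k → ∀ x, W x) (s : Formal (∀ x, W x)) (i : Fin k) : Formal (M → ℂ) :=
  fun N x => basisCoord (fun j => e j x) (s N x) i

/-- The formal section `e t = ∑ e_i t_i`. -/
def frameComb {M : Type*} {W : M → Type*} [∀ x, AddCommMonoid (W x)] [∀ x, Module ℂ (W x)]
    {k : ℕ} (e : Fin k → ∀ x, W x) (t : Fin k → Formal (M → ℂ)) : Formal (∀ x, W x) :=
  fun N x => ∑ i, t i N x • e i x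

/-- The formal section `e • t = ∑ e_i • t_i`. -/
def frameBullet {M : Type*} {W : M → Type*} [∀ x, AddCommMonoid (W x)] [∀ x, Module ℂ (W x)]
    {k : ℕ} (bullet : Formal (∀ x, W x) → Formal (M → ℂ) → Formal (∀ x, W x))
    (e : Fin k → ∀ x, W x) (t : Fin k → Formal (M → ℂ)) : Formal (∀ x, W x) :=
  ∑ i, bullet (Formal.const (e i)) (t i)

/-- The transition matrix `ψ ∘ ψ'⁻¹` from the frame `e'` to the frame `e`: its `j`-th column
consists of the coordinates of `e'_j` in the frame `e`. -/
def transitionMatrix {M : Type*} {W : M → Type*} [∀ x, AddCommMonoid (W x)]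
    [∀ x, Module ℂ (W x)] {k : ℕ} (e e' : Fin k → ∀ x, W x) : Matrix (Fin k) (Fin k) (M → ℂ) :=
  fun i j x => basisCoord (fun l => e l x) (e' j x) i

/-! ## The cotangent bundle -/

/-- The cotangent space `T_q^*Q`. -/
abbrev CotangentSpace (n : ℕ) {Q : Type*} [TopologicalSpace Q]
    [ChartedSpace (EuclideanSpace ℝ (Fin n)) Q] (q : Q) : Type :=
  TangentSpace (𝓡 n) q →L[ℝ] ℝ

/-- The total space `T^*Q`, with its manifold structure from the bundle `Hom(TQ, ℝ)`. -/
abbrev Cotangent (n : ℕ) (Q : Type*) [TopologicalSpace Q]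
    [ChartedSpace (EuclideanSpace ℝ (Fin n)) Q] : Type _ :=
  TotalSpace (EuclideanSpace ℝ (Fin n) →L[ℝ] ℝ) (fun q : Q => CotangentSpace n q)

/-- The model with corners of `T^*Q`. -/
abbrev cotModel (n : ℕ) := (𝓡 n).prod 𝓘(ℝ, EuclideanSpace ℝ (Fin n) →L[ℝ] ℝ)

section Cot

variable {n : ℕ} {Q : Type*} [TopologicalSpace Q] [ChartedSpace (EuclideanSpace ℝ (Fin n)) Q]

/-- The coordinate covector field `dx^i` of the chart `e`. -/
def chartCovector (e : OpenPartialHomeomorph Q (EuclideanSpace ℝ (Fin n))) (i : Fin n) (q : Q) :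
    CotangentSpace n q :=
  (EuclideanSpace.proj i : EuclideanSpace ℝ (Fin n) →L[ℝ] ℝ).comp
    (mfderiv (𝓡 n) 𝓘(ℝ, EuclideanSpace ℝ (Fin n)) e q)

/-- The coordinate vector field `∂_i` of the chart `e`. -/
def chartVector (e : OpenPartialHomeomorph Q (EuclideanSpace ℝ (Fin n))) (i : Fin n) (q : Q) :
    TangentSpace (𝓡 n) q :=
  (mfderiv (𝓡 n) 𝓘(ℝ, EuclideanSpace ℝ (Fin n)) e q).inverse
    (EuclideanSpace.single i (1 : ℝ))

/-- The point of `T^*Q` with bundle coordinates `(x, p)` in the chart `e`. -/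
def cotPoint (e : OpenPartialHomeomorph Q (EuclideanSpace ℝ (Fin n)))
    (x : EuclideanSpace ℝ (Fin n)) (p : Fin n → ℝ) : Cotangent n Q :=
  ⟨e.symm x, ∑ i, p i • chartCovector e i (e.symm x)⟩

/-- The momentum coordinates `p_l` of a covector in the chart `e`. -/
def momentum (e : OpenPartialHomeomorph Q (EuclideanSpace ℝ (Fin n))) (ζ : Cotangent n Q)
    (l : Fin n) : ℝ :=
  ζ.2 (chartVector e l ζ.1)

/-- Fiber differentiation `𝖥(γ)` along a one-form `γ`:
`(𝖥(γ) f)(ζ) = d/dt f(ζ + t γ(q))` at `t = 0`. -/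
def fiberDeriv (γ : ∀ q : Q, CotangentSpace n q) (f : Cotangent n Q → ℂ) : Cotangent n Q → ℂ :=
  fun ζ => deriv (fun t : ℝ => f ⟨ζ.1, ζ.2 + t • γ ζ.1⟩) 0

/-- `∂/∂x^i` on functions on `Q`, in the chart `e`. -/
def partialX (e : OpenPartialHomeomorph Q (EuclideanSpace ℝ (Fin n))) (i : Fin n) {Y : Type*}
    [NormedAddCommGroup Y] [NormedSpace ℝ Y] (u : Q → Y) : Q → Y :=
  fun q => deriv (fun t : ℝ => u (e.symm (e q + t • EuclideanSpace.single i (1 : ℝ)))) 0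

/-- `∂/∂q^i` on functions on `T^*Q`, in the bundle chart of `e`. -/
def partialQ (e : OpenPartialHomeomorph Q (EuclideanSpace ℝ (Fin n))) (i : Fin n)
    (f : Cotangent n Q → ℂ) : Cotangent n Q → ℂ :=
  fun ζ => deriv (fun t : ℝ =>
    f (cotPoint e (e ζ.1 + t • EuclideanSpace.single i (1 : ℝ)) (momentum e ζ))) 0

/-- `∂/∂p_i` on functions on `T^*Q`, in the bundle chart of `e`; this is `𝖥(dx^i)`. -/
def partialP (e : OpenPartialHomeomorph Q (EuclideanSpace ℝ (Fin n))) (i : Fin n)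
    (f : Cotangent n Q → ℂ) : Cotangent n Q → ℂ :=
  fiberDeriv (chartCovector e i) f

/-- The canonical Poisson bracket of `T^*Q`. -/
def cotPoisson (f g : Cotangent n Q → ℂ) : Cotangent n Q → ℂ := fun ζ =>
  let e := chartAt (EuclideanSpace ℝ (Fin n)) ζ.1
  ∑ i, (partialQ e i f ζ * partialP e i g ζ - partialP e i f ζ * partialQ e i g ζ)

/-- `𝖥(dx^{I_1}) ⋯ 𝖥(dx^{I_r})` for a multiindex `I`. -/
def iterPartialP (e : OpenPartialHomeomorph Q (EuclideanSpace ℝ (Fin n))) :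
    (r : ℕ) → (Fin r → Fin n) → (Cotangent n Q → ℂ) → Cotangent n Q → ℂ
  | 0, _, f => f
  | r + 1, I, f => partialP e (I 0) (iterPartialP e r (fun m => I m.succ) f)

/-- `f` is polynomial in the momenta. -/
def PolynomialInMomenta (f : Cotangent n Q → ℂ) : Prop :=
  ∃ d : ℕ, ∀ (q : Q) (ζ γ : CotangentSpace n q), ∃ P : Polynomial ℂ,
    P.natDegree ≤ d ∧ ∀ t : ℝ, f ⟨q, ζ + t • γ⟩ = P.eval (t : ℂ)

/-- The pull-back `π^*u` of a function on `Q`. -/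
def pullbackFun (u : Q → ℂ) : Cotangent n Q → ℂ := fun ζ => u ζ.1

/-- A positive smooth volume density on `Q`: a positive function on frames which is multiplied
by `|det A|` under a linear map `A`, depending smoothly on the point. -/
structure VolumeDensity (n : ℕ) (Q : Type*) [TopologicalSpace Q]
    [ChartedSpace (EuclideanSpace ℝ (Fin n)) Q] where
  toFun : ∀ q : Q, (Fin n → TangentSpace (𝓡 n) q) → ℝ
  map_comp : ∀ (q : Q) (A : TangentSpace (𝓡 n) q →ₗ[ℝ] TangentSpace (𝓡 n) q)
    (v : Fin n → TangentSpace (𝓡 n) q), toFun q (fun i => A (v i)) = |LinearMap.det A| * toFun q v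
  pos : ∀ (q : Q) (v : Fin n → TangentSpace (𝓡 n) q), LinearIndependent ℝ v → 0 < toFun q v
  smooth : ∀ e ∈ atlas (EuclideanSpace ℝ (Fin n)) Q,
    ContMDiffOn (𝓡 n) 𝓘(ℝ, ℝ) ∞ (fun q => toFun q (fun i => chartVector e i q)) e.source

variable [IsManifold (𝓡 n) ∞ Q]

section Connection

variable (nabla : CovariantDerivative (𝓡 n) (EuclideanSpace ℝ (Fin n))
  (TangentSpace (𝓡 n) : Q → Type _))

/-- The Christoffel symbols `Γ^l_{jk} = dx^l(∇_{∂_j} ∂_k)` of `∇` in the chart `e`. -/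
def christoffel (e : OpenPartialHomeomorph Q (EuclideanSpace ℝ (Fin n))) (l j k : Fin n) (q : Q) :
    ℝ :=
  chartCovector e l q (nabla (chartVector e k) q (chartVector e j q))

/-- The components of the iterated covariant derivative `∇^r u` in the chart `e`,
`(∇T)_{i I} = ∂_i T_I - ∑_m ∑_l Γ^l_{i I_m} T_{I_1 … l … I_r}`. The symmetrized covariant
derivative `𝖣^r u ∈ Γ^∞(⋁^r T^*Q)` is its symmetrization, so that
`𝖣^r u = ∑_I (∇^r u)_I dx^{I_1} ∨ ⋯ ∨ dx^{I_r}`. -/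
def iterCov (e : OpenPartialHomeomorph Q (EuclideanSpace ℝ (Fin n))) (u : Q → ℂ) :
    (r : ℕ) → (Fin r → Fin n) → Q → ℂ
  | 0, _ => u
  | r + 1, I => fun q =>
      partialX e (I 0) (iterCov e u r (fun m => I m.succ)) q -
        ∑ m : Fin r, ∑ l : Fin n, (christoffel nabla e l (I 0) (I m.succ) q : ℂ) *
          iterCov e u r (Function.update (fun m' => I m'.succ) m l) q

/-- `𝖥(𝖣^r u) f` at the point `ζ`. -/
def fiberSymD (r : ℕ) (u : Q → ℂ) (f : Cotangent n Q → ℂ) : Cotangent n Q → ℂ := fun ζ =>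
  let e := chartAt (EuclideanSpace ℝ (Fin n)) ζ.1
  ∑ I : Fin r → Fin n, iterCov nabla e u r I ζ.1 * iterPartialP e r I f ζ

/-- The standard-ordered representation `ϱ_S(f) u = ι^* 𝖥(exp(-iλ𝖣) u) f`. -/
def stdRep (f : Formal (Cotangent n Q → ℂ)) (u : Formal (Q → ℂ)) : Formal (Q → ℂ) :=
  formalBilin
    (fun r a v q => ((-Complex.I) ^ r / (r.factorial : ℂ)) * fiberSymD nabla r v a ⟨q, 0⟩) f u

/-- `star` is the standard-ordered star product of `∇`: a star product on `T^*Q` with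
`ϱ_S(f ⋆ g) = ϱ_S(f) ϱ_S(g)`, of standard-order type `π^*u ⋆ f = (π^*u) f`, whose cochains map
functions polynomial in the momenta to such functions. (The representation determines only Taylor
coefficients along the zero section; as symbols polynomial in the momenta are determined by these,
and bidifferential operators by their values on such symbols, the conditions determine `⋆` on
smooth functions.) -/
structure IsStandardOrdered
    (star : Formal (Cotangent n Q → ℂ) → Formal (Cotangent n Q → ℂ) →
      Formal (Cotangent n Q → ℂ)) : Prop where
  isStarProduct : IsStarProduct (cotModel n) cotPoisson star
  rep : ∀ f g u, FormalSmoothFunOn (cotModel n) Set.univ f → FormalSmoothFunOn (cotModel n) Set.univ g →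
    FormalSmoothFunOn (𝓡 n) Set.univ u →
    stdRep nabla (star f g) u = stdRep nabla f (stdRep nabla g u)
  pull_star : ∀ O : Set Q, IsOpen O → ∀ U : Set (Cotangent n Q), IsOpen U →
    (∀ ζ ∈ U, ζ.1 ∈ O) → ∀ u f, SmoothFunOn (𝓡 n) O u → FormalSmoothFunOn (cotModel n) U f →
    FormalEqOn U (star (Formal.const (pullbackFun u)) f) (fun N ζ => pullbackFun u ζ * f N ζ)
  polynomial : ∀ f g, SmoothFunOn (cotModel n) Set.univ f → SmoothFunOn (cotModel n) Set.univ g →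
    PolynomialInMomenta f → PolynomialInMomenta g →
    ∀ r, PolynomialInMomenta (star (Formal.const f) (Formal.const g) r)

/-- The standard-ordered star product `⋆_S`. -/
def starS : Formal (Cotangent n Q → ℂ) → Formal (Cotangent n Q → ℂ) →
    Formal (Cotangent n Q → ℂ) :=
  Classical.epsilon (IsStandardOrdered nabla)

/-- The operator
`Δ = ∑ ∂²/∂p_k∂q^k + ∑ p_l Γ^l_{jk} ∂²/∂p_j∂p_k + ∑ Γ^j_{jk} ∂/∂p_k`. -/
def laplacian (f : Cotangent n Q → ℂ) : Cotangent n Q → ℂ := fun ζ =>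
  let e := chartAt (EuclideanSpace ℝ (Fin n)) ζ.1
  ∑ k, partialP e k (partialQ e k f) ζ +
    ∑ k, ∑ l, ∑ j, ((momentum e ζ l * christoffel nabla e l j k ζ.1 : ℝ) : ℂ) *
      partialP e j (partialP e k f) ζ +
    ∑ k, ∑ j, (christoffel nabla e j j k ζ.1 : ℂ) * partialP e k f ζ

variable (mu : VolumeDensity n Q)

/-- The one-form `α` with `∇_X μ = α(X) μ`: if `μ = ρ |dx^1 ∧ ⋯ ∧ dx^n|` locally, then
`α_i = ∂_i ρ / ρ - ∑_j Γ^j_{ij}`. -/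
def densityForm (q : Q) : CotangentSpace n q :=
  let e := chartAt (EuclideanSpace ℝ (Fin n)) q
  let ρ : Q → ℝ := fun q' => mu.toFun q' (fun i => chartVector e i q')
  ∑ i, (partialX e i ρ q / ρ q - ∑ j, christoffel nabla e j i j q) • chartCovector e i q

/-- `N_κ = exp(-iκλ(Δ + 𝖥(α)))`; its inverse is `N_{-κ}`. -/
def opN (κ : ℝ) : Formal (Cotangent n Q → ℂ) → Formal (Cotangent n Q → ℂ) :=
  formalExp (-Complex.I * κ) (fun f => laplacian nabla f + fiberDeriv (densityForm nabla mu) f)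

/-- `N_κ⁻¹ = exp(iκλ(Δ + 𝖥(α)))`. -/
def opNInv (κ : ℝ) : Formal (Cotangent n Q → ℂ) → Formal (Cotangent n Q → ℂ) :=
  formalExp (Complex.I * κ) (fun f => laplacian nabla f + fiberDeriv (densityForm nabla mu) f)

/-- The `κ`-ordered star product `f ⋆_κ g = N_κ⁻¹(N_κ f ⋆_S N_κ g)`. -/
def starK (κ : ℝ) (f g : Formal (Cotangent n Q → ℂ)) : Formal (Cotangent n Q → ℂ) :=
  opNInv nabla mu κ (starS nabla (opN nabla mu κ f) (opN nabla mu κ g))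

end Connection

/-- The bundle projection `T^*Q → Q`, as a continuous map. -/
def cotProj (n : ℕ) (Q : Type*) [TopologicalSpace Q]
    [ChartedSpace (EuclideanSpace ℝ (Fin n)) Q] [IsManifold (𝓡 n) ∞ Q] : C(Cotangent n Q, Q) :=
  ⟨TotalSpace.proj, FiberBundle.continuous_proj _ _⟩

/-- `T^*O`, as an open subset of `T^*Q`. -/
def cotOver (O : Set Q) : Set (Cotangent n Q) := cotProj n Q ⁻¹' O

/-- The frame `e = π^*ε` of `π^*V` induced by a frame `ε` of `V`. -/
def pullFrame {V : Q → Type*} {k : ℕ} (ε : Fin k → ∀ q, V q) :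
    Fin k → ∀ ζ : Cotangent n Q, ((cotProj n Q : Cotangent n Q → Q) *ᵖ V) ζ :=
  fun i ζ => ε i ζ.1

/-- The pull-back `π^*A` of a matrix of functions on `Q`. -/
def pullMatrix {k : ℕ} (A : Matrix (Fin k) (Fin k) (Q → ℂ)) :
    Matrix (Fin k) (Fin k) (Cotangent n Q → ℂ) :=
  fun i j => pullbackFun (A i j)

/-- The transition matrix `π^*φ` of `π^*V` from the frame `π^*ε'` to `π^*ε`, where `φ` is that of
`V` from `ε'` to `ε`, as a matrix of formal functions. -/
def pullTransition {V : Q → Type*} [∀ q, AddCommMonoid (V q)] [∀ q, Module ℂ (V q)] {k : ℕ}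
    (ε ε' : Fin k → ∀ q, V q) : Matrix (Fin k) (Fin k) (Formal (Cotangent n Q → ℂ)) :=
  matConst (pullMatrix (transitionMatrix ε ε'))

section Kappa

variable (nabla : CovariantDerivative (𝓡 n) (EuclideanSpace ℝ (Fin n))
  (TangentSpace (𝓡 n) : Q → Type _)) (mu : VolumeDensity n Q) (κ : ℝ)
  {V : Q → Type*} [∀ q, AddCommMonoid (V q)] [∀ q, Module ℂ (V q)]
  (F : Type*) [NormedAddCommGroup F] [NormedSpace ℂ F] [∀ q, TopologicalSpace (V q)]
  [TopologicalSpace (TotalSpace F V)] [FiberBundle F V] {k : ℕ} {ι : Type*}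

/-- Smoothness over `U ⊆ T^*Q` of a formal section of `π^*V`. -/
abbrev FormalSmoothPullSecOn (U : Set (Cotangent n Q))
    (s : Formal (∀ ζ, ((cotProj n Q : Cotangent n Q → Q) *ᵖ V) ζ)) : Prop :=
  FormalSmoothSecOn (cotModel n) F U s

/-- `bullet` is given over every `T^*O_α` by the local formula
`s • f = e_α (s_α ⋆_S N_κ f)`, where `e_α = π^*ε_α` and `s = e_α s_α`. -/
def IsGivenLocally (O : ι → Set Q) (ε : ι → Fin k → ∀ q, V q)
    (bullet : Formal (∀ ζ, ((cotProj n Q : Cotangent n Q → Q) *ᵖ V) ζ) →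
      Formal (Cotangent n Q → ℂ) → Formal (∀ ζ, ((cotProj n Q : Cotangent n Q → Q) *ᵖ V) ζ)) :
    Prop :=
  ∀ α, ∀ U : Set (Cotangent n Q), IsOpen U → ∀ s f, FormalSmoothPullSecOn F U s →
    FormalSmoothFunOn (cotModel n) U f →
    FormalEqOn (U ∩ cotOver (O α)) (bullet s f)
      (frameComb (pullFrame (ε α))
        (fun i => starS nabla (frameCoord (pullFrame (ε α)) s i) (opN nabla mu κ f)))

end Kappa

/-- `Φ` is the quantum transition matrix over `U` from the frame `e'` to the frame `e`, with
respect to `bullet` and `star`: the coefficients `t`, `t'` of the same section, that is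
`e • t = e' • t'`, are related by `t = Φ ⋆ t'`. -/
def IsQuantumTransitionMatrix
    (star : Formal (Cotangent n Q → ℂ) → Formal (Cotangent n Q → ℂ) →
      Formal (Cotangent n Q → ℂ)) {W : Cotangent n Q → Type*} [∀ ζ, AddCommMonoid (W ζ)]
    [∀ ζ, Module ℂ (W ζ)] {k : ℕ}
    (bullet : Formal (∀ ζ, W ζ) → Formal (Cotangent n Q → ℂ) → Formal (∀ ζ, W ζ))
    (e e' : Fin k → ∀ ζ, W ζ) (U : Set (Cotangent n Q))
    (Φ : Matrix (Fin k) (Fin k) (Formal (Cotangent n Q → ℂ))) : Prop :=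
  ∀ t t' : Fin k → Formal (Cotangent n Q → ℂ),
    (∀ i, FormalSmoothFunOn (cotModel n) U (t i)) →
    (∀ i, FormalSmoothFunOn (cotModel n) U (t' i)) →
    FormalEqOn U (frameBullet bullet e t) (frameBullet bullet e' t') →
    ∀ i, FormalEqOn U (t i) (matVecStar star Φ t' i)

end Cot

end

noncomputable section

set_option linter.unusedSectionVars false
set_option linter.unusedSimpArgs false
set_option linter.unusedVariables false

local notation "𝔼(" n ")" => EuclideanSpace ℝ (Fin n)

section

section OperatorCalculus

variable {E : Type*} [NormedAddCommGroup E] [NormedSpace ℝ E]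
  {H : Type*} [TopologicalSpace H] (J : ModelWithCorners ℝ E H)
  {M : Type*} [TopologicalSpace M] [ChartedSpace H M]

namespace SmoothFunOn

variable {J} {U U' : Set M} {f g : M → ℂ}

theorem mono (h : SmoothFunOn J U f) (hU : U' ⊆ U) : SmoothFunOn J U' f :=
  ContMDiffOn.mono h hU

theorem congr (h : SmoothFunOn J U f) (hfg : Set.EqOn g f U) : SmoothFunOn J U g :=
  ContMDiffOn.congr h hfg

theorem add (hf : SmoothFunOn J U f) (hg : SmoothFunOn J U g) : SmoothFunOn J U (f + g) :=
  ContMDiffOn.add hf hg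

theorem mul (hf : SmoothFunOn J U f) (hg : SmoothFunOn J U g) :
    SmoothFunOn J U (fun x => f x * g x) :=
  (contDiff_mul (𝕜 := ℝ) (𝔸 := ℂ) (n := ∞)).contMDiff.comp_contMDiffOn
    (ContMDiffOn.prodMk_space hf hg)

theorem const (c : ℂ) : SmoothFunOn J U (fun _ => c) := contMDiffOn_const

theorem zero : SmoothFunOn J U (0 : M → ℂ) := contMDiffOn_const

theorem smul (c : ℂ) (hf : SmoothFunOn J U f) : SmoothFunOn J U (c • f) :=
  (const c).mul hf

theorem neg (hf : SmoothFunOn J U f) : SmoothFunOn J U (-f) := by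
  simpa using hf.smul (-1)

theorem sub (hf : SmoothFunOn J U f) (hg : SmoothFunOn J U g) : SmoothFunOn J U (f - g) := by
  simpa [sub_eq_add_neg] using hf.add hg.neg

theorem sum {ι : Type*} {s : Finset ι} {f : ι → M → ℂ} (h : ∀ i ∈ s, SmoothFunOn J U (f i)) :
    SmoothFunOn J U (∑ i ∈ s, f i) := by
  classical
  induction s using Finset.induction_on with
  | empty => simpa using zero
  | insert a s ha ih =>
    rw [Finset.sum_insert ha]
    exact (h a (Finset.mem_insert_self _ _)).add
      (ih fun i hi => h i (Finset.mem_insert_of_mem hi))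

/-- Smoothness is local. -/
theorem of_local (h : ∀ x ∈ U, ∃ U', IsOpen U' ∧ x ∈ U' ∧ SmoothFunOn J (U ∩ U') f) :
    SmoothFunOn J U f :=
  contMDiffOn_of_locally_contMDiffOn h

end SmoothFunOn

/-- A local linear operator on the smooth functions on `U`. -/
structure LinOn (U : Set M) (P : (M → ℂ) → M → ℂ) : Prop where
  smooth : ∀ f, SmoothFunOn J U f → SmoothFunOn J U (P f)
  congr : ∀ f g, SmoothFunOn J U f → SmoothFunOn J U g → Set.EqOn f g U →
    Set.EqOn (P f) (P g) U
  add : ∀ f g, SmoothFunOn J U f → SmoothFunOn J U g → Set.EqOn (P (f + g)) (P f + P g) U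
  smul : ∀ (c : ℂ) f, SmoothFunOn J U f → Set.EqOn (P (c • f)) (c • P f) U

namespace LinOn

variable {J} {U : Set M} {P Q : (M → ℂ) → M → ℂ}

theorem id : LinOn J U (fun f => f) :=
  ⟨fun _ h => h, fun _ _ _ _ h => h, fun _ _ _ _ _ _ => rfl, fun _ _ _ _ _ => rfl⟩

theorem zero : LinOn J U (fun _ => 0) :=
  ⟨fun _ _ => SmoothFunOn.zero, fun _ _ _ _ _ _ _ => rfl, fun _ _ _ _ _ _ => by simp,
    fun _ _ _ _ _ => by simp⟩

theorem comp (hP : LinOn J U P) (hQ : LinOn J U Q) : LinOn J U (fun f => P (Q f)) where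
  smooth f hf := hP.smooth _ (hQ.smooth _ hf)
  congr f g hf hg h := hP.congr _ _ (hQ.smooth _ hf) (hQ.smooth _ hg) (hQ.congr _ _ hf hg h)
  add f g hf hg := (hP.congr _ _ (hQ.smooth _ (hf.add hg)) ((hQ.smooth _ hf).add (hQ.smooth _ hg))
    (hQ.add f g hf hg)).trans (hP.add _ _ (hQ.smooth _ hf) (hQ.smooth _ hg))
  smul c f hf := (hP.congr _ _ (hQ.smooth _ (hf.smul c)) ((hQ.smooth _ hf).smul c)
    (hQ.smul c f hf)).trans (hP.smul c _ (hQ.smooth _ hf))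

theorem map_add (hP : LinOn J U P) (hQ : LinOn J U Q) : LinOn J U (fun f => P f + Q f) where
  smooth f hf := (hP.smooth f hf).add (hQ.smooth f hf)
  congr f g hf hg h x hx := by
    simp only [Pi.add_apply, hP.congr f g hf hg h hx, hQ.congr f g hf hg h hx]
  add f g hf hg x hx := by
    have h1 := hP.add f g hf hg hx
    have h2 := hQ.add f g hf hg hx
    simp only [Pi.add_apply] at *
    rw [h1, h2]; ring
  smul c f hf x hx := by
    have h1 := hP.smul c f hf hx
    have h2 := hQ.smul c f hf hx
    simp only [Pi.add_apply, Pi.smul_apply, smul_eq_mul] at *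
    rw [h1, h2]; ring

theorem mul_left {a : M → ℂ} (ha : SmoothFunOn J U a) (hP : LinOn J U P) :
    LinOn J U (fun f x => a x * P f x) where
  smooth f hf := ha.mul (hP.smooth f hf)
  congr f g hf hg h x hx := by simp only [hP.congr f g hf hg h hx]
  add f g hf hg x hx := by
    have h1 := hP.add f g hf hg hx
    simp only [Pi.add_apply] at *
    rw [h1]; ring
  smul c f hf x hx := by
    have h1 := hP.smul c f hf hx
    simp only [Pi.smul_apply, smul_eq_mul] at *
    rw [h1]; ring

theorem of_eqOn (hP : LinOn J U P) (h : ∀ f, SmoothFunOn J U f → Set.EqOn (Q f) (P f) U) :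
    LinOn J U Q where
  smooth f hf := (hP.smooth f hf).congr (h f hf)
  congr f g hf hg hfg := (h f hf).trans ((hP.congr f g hf hg hfg).trans (h g hg).symm)
  add f g hf hg := (h _ (hf.add hg)).trans ((hP.add f g hf hg).trans fun x hx => by
    simp [h f hf hx, h g hg hx])
  smul c f hf := (h _ (hf.smul c)).trans ((hP.smul c f hf).trans fun x hx => by
    simp [h f hf hx])

end LinOn

/-- The commutator of an operator with the multiplication by `a`. -/
def mulComm {X Y : M → Type*} [∀ x, AddCommMonoid (X x)] [∀ x, Module ℂ (X x)]
    [∀ x, AddCommMonoid (Y x)] [∀ x, Module ℂ (Y x)] (a : M → ℂ)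
    (P : (∀ x, X x) → ∀ x, Y x) : (∀ x, X x) → ∀ x, Y x :=
  fun s x => P (fun y => a y • s y) x + (-a x) • P s x

theorem LinOn.mulComm {J : ModelWithCorners ℝ E H} {U : Set M} {P : (M → ℂ) → M → ℂ}
    {a : M → ℂ} (ha : SmoothFunOn J U a) (hP : LinOn J U P) :
    LinOn J U (mulComm (X := fun _ => ℂ) (Y := fun _ => ℂ) a P) :=
  (hP.comp (LinOn.id.mul_left ha)).map_add (hP.mul_left (a := fun x => -a x) ha.neg)

/-- Order at most `N` on the smooth functions on `U`. -/
abbrev FunOrderLE (U : Set M) (N : ℕ) (P : (M → ℂ) → M → ℂ) : Prop :=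
  OrderLE (X := fun _ => ℂ) (Y := fun _ => ℂ) U {a | SmoothFunOn J U a} {f | SmoothFunOn J U f} N P

section General

variable {X Y : M → Type*} [∀ x, AddCommMonoid (X x)] [∀ x, Module ℂ (X x)]
    [∀ x, AddCommMonoid (Y x)] [∀ x, Module ℂ (Y x)]

theorem OrderLE.of_cover {U : Set M} {A : Set (M → ℂ)} {S : Set (∀ x, X x)} {N : ℕ}
    {P : (∀ x, X x) → ∀ x, Y x}
    (h : ∀ x ∈ U, ∃ (U' : Set M) (A' : Set (M → ℂ)) (S' : Set (∀ x, X x)), x ∈ U' ∧ A ⊆ A' ∧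
      S ⊆ S' ∧ OrderLE U' A' S' N P) : OrderLE U A S N P := by
  induction N generalizing P with
  | zero =>
    intro a ha s hs x hx
    obtain ⟨U', A', S', hx', hA, hS, h'⟩ := h x hx
    exact h' a (hA ha) s (hS hs) x hx'
  | succ N ih =>
    intro a ha
    refine ih fun x hx => ?_
    obtain ⟨U', A', S', hx', hA, hS, h'⟩ := h x hx
    exact ⟨U', A', S', hx', hA, hS, h' a (hA ha)⟩

theorem OrderLE.of_eqOn {U : Set M} {A : Set (M → ℂ)} {S : Set (∀ x, X x)} {N : ℕ}
    {P Q : (∀ x, X x) → ∀ x, Y x} (hS : ∀ a ∈ A, ∀ s ∈ S, (fun y => a y • s y) ∈ S)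
    (h : ∀ s ∈ S, ∀ x ∈ U, Q s x = P s x) (hP : OrderLE U A S N P) : OrderLE U A S N Q := by
  induction N generalizing P Q with
  | zero =>
    intro a ha s hs x hx
    rw [h _ (hS a ha s hs) x hx, h _ hs x hx, hP a ha s hs x hx]
  | succ N ih =>
    intro a ha
    refine ih (fun s hs x hx => ?_) (hP a ha)
    rw [h _ (hS a ha s hs) x hx, h _ hs x hx]

end General

namespace FunOrderLE

variable {J} {U : Set M} {N N' : ℕ} {P Q : (M → ℂ) → M → ℂ}

theorem of_eqOn (hP : FunOrderLE J U N P)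
    (h : ∀ f, SmoothFunOn J U f → Set.EqOn (Q f) (P f) U) : FunOrderLE J U N Q :=
  OrderLE.of_eqOn (X := fun _ => ℂ) (Y := fun _ => ℂ)
    (fun _ ha _ hs => SmoothFunOn.mul ha hs) (fun s hs x hx => h s hs hx) hP

theorem of_zero (h : ∀ f, SmoothFunOn J U f → Set.EqOn (Q f) 0 U) : FunOrderLE J U N Q := by
  induction N generalizing Q with
  | zero =>
    intro a ha s hs x hx
    have h1 := h (fun y => a y * s y) (SmoothFunOn.mul ha hs) hx
    have h2 := h s hs hx
    simp only [smul_eq_mul] at *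
    rw [h1, h2]; simp
  | succ N ih =>
    intro a ha
    refine ih fun f hf x hx => ?_
    have h1 := h (fun y => a y * f y) (SmoothFunOn.mul ha hf) hx
    have h2 := h f hf hx
    simp only [smul_eq_mul] at *
    rw [h1, h2]; simp

theorem succ (hP : FunOrderLE J U N P) : FunOrderLE J U (N + 1) P := by
  induction N generalizing P with
  | zero =>
    intro a ha
    refine of_zero fun f hf x hx => ?_
    have := hP a ha f hf x hx
    simp only [smul_eq_mul, Pi.zero_apply] at *
    rw [this]; ring
  | succ N ih => exact fun a ha => ih (hP a ha)

theorem mono (hP : FunOrderLE J U N P) (h : N ≤ N') : FunOrderLE J U N' P := by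
  induction h with
  | refl => exact hP
  | step _ ih => exact ih.succ

theorem add (hP : FunOrderLE J U N P) (hQ : FunOrderLE J U N Q) :
    FunOrderLE J U N (fun f => P f + Q f) := by
  induction N generalizing P Q with
  | zero =>
    intro a ha s hs x hx
    have h1 := hP a ha s hs x hx
    have h2 := hQ a ha s hs x hx
    simp only [smul_eq_mul, Pi.add_apply] at *
    rw [h1, h2]; ring
  | succ N ih =>
    intro a ha
    refine (ih (hP a ha) (hQ a ha)).of_eqOn fun f hf x hx => ?_
    simp only [smul_eq_mul, Pi.add_apply]; ring

theorem mul_left (b : M → ℂ) (hP : FunOrderLE J U N P) :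
    FunOrderLE J U N (fun f x => b x * P f x) := by
  induction N generalizing P with
  | zero =>
    intro a ha s hs x hx
    have h1 := hP a ha s hs x hx
    simp only [smul_eq_mul] at *
    rw [h1]; ring
  | succ N ih =>
    intro a ha
    refine (ih (hP a ha)).of_eqOn fun f hf x hx => ?_
    simp only [smul_eq_mul]; ring

theorem comp (hP : FunOrderLE J U N P) (hQ : FunOrderLE J U N' Q) (lP : LinOn J U P)
    (lQ : LinOn J U Q) : FunOrderLE J U (N + N') (fun f => P (Q f)) := by
  induction hk : N + N' generalizing N N' P Q with
  | zero =>
    obtain ⟨rfl, rfl⟩ : N = 0 ∧ N' = 0 := by omega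
    intro a ha s hs x hx
    have h1 : Set.EqOn (Q (fun y => a y • s y)) (fun y => a y • Q s y) U :=
      fun y hy => hQ a ha s hs y hy
    have hs' : SmoothFunOn J U (fun y => a y • s y) := SmoothFunOn.mul ha hs
    have hs'' : SmoothFunOn J U (fun y => a y • Q s y) := SmoothFunOn.mul ha (lQ.smooth s hs)
    exact (lP.congr _ _ (lQ.smooth _ hs') hs'' h1 hx).trans (hP a ha _ (lQ.smooth s hs) x hx)
  | succ k ih =>
    intro a ha
    have lQ' := lQ.mulComm ha
    have lP' := lP.mulComm ha
    have key : ∀ f, SmoothFunOn J U f → Set.EqOn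
        (mulComm (X := fun _ => ℂ) (Y := fun _ => ℂ) a (fun f => P (Q f)) f)
        (P (mulComm (X := fun _ => ℂ) (Y := fun _ => ℂ) a Q f) +
          mulComm (X := fun _ => ℂ) (Y := fun _ => ℂ) a P (Q f)) U := by
      intro f hf x hx
      have haf : SmoothFunOn J U (fun y => a y * f y) := SmoothFunOn.mul ha hf
      have hQf := lQ.smooth f hf
      have haQ : SmoothFunOn J U (fun y => a y * Q f y) := SmoothFunOn.mul ha hQf
      have e1 : mulComm (X := fun _ => ℂ) (Y := fun _ => ℂ) a Q f =
          Q (fun y => a y * f y) + (-1 : ℂ) • (fun y => a y * Q f y) := by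
        funext y; simp [mulComm]
      rw [e1]
      have h1 := lP.add _ _ (lQ.smooth _ haf) (haQ.smul (-1)) hx
      have h2 := lP.smul (-1) _ haQ hx
      simp only [Pi.add_apply] at h1 ⊢
      rw [h1, h2]
      simp only [mulComm, Pi.smul_apply, smul_eq_mul]
      ring
    refine FunOrderLE.of_eqOn (P := fun f => P (mulComm (X := fun _ => ℂ) (Y := fun _ => ℂ) a Q f) +
          mulComm (X := fun _ => ℂ) (Y := fun _ => ℂ) a P (Q f)) (FunOrderLE.add ?_ ?_) key
    · cases N' with
      | zero =>
        refine of_zero fun f hf x hx => ?_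
        have hz : Set.EqOn (mulComm (X := fun _ => ℂ) (Y := fun _ => ℂ) a Q f)
            ((0 : ℂ) • f) U := fun y hy => by
          have := hQ a ha f hf y hy
          simp only [mulComm, smul_eq_mul, Pi.smul_apply] at *
          rw [this]; ring
        rw [lP.congr _ _ (lQ'.smooth f hf) (hf.smul 0) hz hx, lP.smul 0 f hf hx]
        simp
      | succ N' => exact ih hP (hQ a ha) lP lQ' (by omega)
    · cases N with
      | zero =>
        refine of_zero fun f hf x hx => ?_
        have := hP a ha (Q f) (lQ.smooth f hf) x hx
        simp only [mulComm, smul_eq_mul, Pi.zero_apply] at *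
        rw [this]; ring
      | succ N => exact ih (hP a ha) hQ lP' lQ (by omega)

end FunOrderLE

/-- A linear differential operator on the open subsets of `U₀`. -/
def IsDiffOpOn (U₀ : Set M) (P : (M → ℂ) → M → ℂ) : Prop :=
  (∀ U, IsOpen U → U ⊆ U₀ → LinOn J U P) ∧
    ∃ N, ∀ U, IsOpen U → U ⊆ U₀ → FunOrderLE J U N P

namespace IsDiffOpOn

variable {J} {U₀ : Set M} {P Q : (M → ℂ) → M → ℂ}

theorem linOn (hP : IsDiffOpOn J U₀ P) {U : Set M} (hU : IsOpen U) (hU₀ : U ⊆ U₀) :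
    LinOn J U P := hP.1 U hU hU₀

theorem id : IsDiffOpOn J U₀ (fun f => f) :=
  ⟨fun _ _ _ => LinOn.id, 0, fun _ _ _ _ _ _ _ _ _ => rfl⟩

theorem zero : IsDiffOpOn J U₀ (fun _ => 0) :=
  ⟨fun _ _ _ => LinOn.zero, 0, fun _ _ _ => FunOrderLE.of_zero fun _ _ _ _ => rfl⟩

theorem comp (hP : IsDiffOpOn J U₀ P) (hQ : IsDiffOpOn J U₀ Q) :
    IsDiffOpOn J U₀ (fun f => P (Q f)) := by
  obtain ⟨N, hN⟩ := hP.2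
  obtain ⟨N', hN'⟩ := hQ.2
  exact ⟨fun U hU h => (hP.1 U hU h).comp (hQ.1 U hU h), N + N', fun U hU h =>
    (hN U hU h).comp (hN' U hU h) (hP.1 U hU h) (hQ.1 U hU h)⟩

theorem add (hP : IsDiffOpOn J U₀ P) (hQ : IsDiffOpOn J U₀ Q) :
    IsDiffOpOn J U₀ (fun f => P f + Q f) := by
  obtain ⟨N, hN⟩ := hP.2
  obtain ⟨N', hN'⟩ := hQ.2
  exact ⟨fun U hU h => (hP.1 U hU h).map_add (hQ.1 U hU h), max N N', fun U hU h =>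
    ((hN U hU h).mono (le_max_left _ _)).add ((hN' U hU h).mono (le_max_right _ _))⟩

theorem mul_left {a : M → ℂ} (ha : SmoothFunOn J U₀ a) (hP : IsDiffOpOn J U₀ P) :
    IsDiffOpOn J U₀ (fun f x => a x * P f x) := by
  obtain ⟨N, hN⟩ := hP.2
  exact ⟨fun U hU h => (hP.1 U hU h).mul_left (ha.mono h), N, fun U hU h =>
    (hN U hU h).mul_left a⟩

theorem const_smul (c : ℂ) (hP : IsDiffOpOn J U₀ P) : IsDiffOpOn J U₀ (fun f => c • P f) :=
  hP.mul_left (SmoothFunOn.const c)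

theorem sum {ι : Type*} {s : Finset ι} {P : ι → (M → ℂ) → M → ℂ}
    (h : ∀ i ∈ s, IsDiffOpOn J U₀ (P i)) : IsDiffOpOn J U₀ (fun f => ∑ i ∈ s, P i f) := by
  classical
  induction s using Finset.induction_on with
  | empty => simpa using zero
  | insert a s ha ih =>
    simp only [Finset.sum_insert ha]
    exact (h a (Finset.mem_insert_self _ _)).add
      (ih fun i hi => h i (Finset.mem_insert_of_mem hi))

theorem iterate (hP : IsDiffOpOn J U₀ P) (r : ℕ) : IsDiffOpOn J U₀ (P^[r]) := by
  induction r with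
  | zero => exact id
  | succ r ih => exact ih.comp hP

theorem of_eqOn (hP : IsDiffOpOn J U₀ P)
    (h : ∀ U, IsOpen U → U ⊆ U₀ → ∀ f, SmoothFunOn J U f → Set.EqOn (Q f) (P f) U) :
    IsDiffOpOn J U₀ Q := by
  obtain ⟨N, hN⟩ := hP.2
  exact ⟨fun U hU h' => (hP.1 U hU h').of_eqOn (h U hU h'), N, fun U hU h' =>
    (hN U hU h').of_eqOn (h U hU h')⟩

end IsDiffOpOn

/-- A bidifferential operator on the open subsets of `U₀`. -/
structure IsBidiffOn (U₀ : Set M) (B : (M → ℂ) → (M → ℂ) → M → ℂ) : Prop where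
  left : ∀ U, IsOpen U → U ⊆ U₀ → ∀ g, SmoothFunOn J U g → LinOn J U (fun f => B f g)
  right : ∀ U, IsOpen U → U ⊆ U₀ → ∀ f, SmoothFunOn J U f → LinOn J U (fun g => B f g)
  order : ∃ N, ∀ U, IsOpen U → U ⊆ U₀ →
    (∀ g, SmoothFunOn J U g → FunOrderLE J U N (fun f => B f g)) ∧
    (∀ f, SmoothFunOn J U f → FunOrderLE J U N (fun g => B f g))

namespace IsBidiffOn

variable {J} {U₀ : Set M} {B C : (M → ℂ) → (M → ℂ) → M → ℂ} {P Q : (M → ℂ) → M → ℂ}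

theorem smooth (hB : IsBidiffOn J U₀ B) {U : Set M} (hU : IsOpen U) (hU₀ : U ⊆ U₀)
    {f g : M → ℂ} (hf : SmoothFunOn J U f) (hg : SmoothFunOn J U g) : SmoothFunOn J U (B f g) :=
  (hB.left U hU hU₀ g hg).smooth f hf

theorem congr (hB : IsBidiffOn J U₀ B) {U : Set M} (hU : IsOpen U) (hU₀ : U ⊆ U₀)
    {f f' g g' : M → ℂ} (hf : SmoothFunOn J U f) (hf' : SmoothFunOn J U f')
    (hg : SmoothFunOn J U g) (hg' : SmoothFunOn J U g') (h : Set.EqOn f f' U)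
    (h' : Set.EqOn g g' U) : Set.EqOn (B f g) (B f' g') U :=
  ((hB.left U hU hU₀ g hg).congr f f' hf hf' h).trans
    ((hB.right U hU hU₀ f' hf').congr g g' hg hg' h')

theorem mul : IsBidiffOn J U₀ (fun f g x => f x * g x) where
  left U hU h g hg := ⟨fun f hf => SmoothFunOn.mul hf hg, fun f f' _ _ h x hx => by simp [h hx],
    fun f f' _ _ x _ => by simp [add_mul], fun c f _ x _ => by simp [mul_assoc]⟩
  right U hU h g hg := ⟨fun f hf => SmoothFunOn.mul hg hf, fun f f' _ _ h x hx => by simp [h hx],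
    fun f f' _ _ x _ => by simp [mul_add], fun c f _ x _ => by simp; ring⟩
  order := ⟨0, fun U hU h => ⟨fun g hg a ha s hs x hx => by simp; ring,
    fun g hg a ha s hs x hx => by simp; ring⟩⟩

theorem of_eqOn (hB : IsBidiffOn J U₀ B)
    (h : ∀ U, IsOpen U → U ⊆ U₀ → ∀ f g, SmoothFunOn J U f → SmoothFunOn J U g →
      Set.EqOn (C f g) (B f g) U) : IsBidiffOn J U₀ C where
  left U hU h' g hg := (hB.left U hU h' g hg).of_eqOn fun f hf => h U hU h' f g hf hg
  right U hU h' f hf := (hB.right U hU h' f hf).of_eqOn fun g hg => h U hU h' f g hf hg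
  order := by
    obtain ⟨N, hN⟩ := hB.order
    exact ⟨N, fun U hU h' => ⟨fun g hg => ((hN U hU h').1 g hg).of_eqOn fun f hf =>
      h U hU h' f g hf hg, fun f hf => ((hN U hU h').2 f hf).of_eqOn fun g hg =>
      h U hU h' f g hf hg⟩⟩

theorem zero : IsBidiffOn J U₀ (fun _ _ => 0) where
  left _ _ _ _ _ := LinOn.zero
  right _ _ _ _ _ := LinOn.zero
  order := ⟨0, fun _ _ _ => ⟨fun _ _ => FunOrderLE.of_zero fun _ _ _ _ => rfl,
    fun _ _ => FunOrderLE.of_zero fun _ _ _ _ => rfl⟩⟩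

theorem add (hB : IsBidiffOn J U₀ B) (hC : IsBidiffOn J U₀ C) :
    IsBidiffOn J U₀ (fun f g => B f g + C f g) where
  left U hU h g hg := (hB.left U hU h g hg).map_add (hC.left U hU h g hg)
  right U hU h g hg := (hB.right U hU h g hg).map_add (hC.right U hU h g hg)
  order := by
    obtain ⟨N, hN⟩ := hB.order
    obtain ⟨N', hN'⟩ := hC.order
    exact ⟨max N N', fun U hU h => ⟨fun g hg =>
      (((hN U hU h).1 g hg).mono (le_max_left _ _)).add
        (((hN' U hU h).1 g hg).mono (le_max_right _ _)), fun g hg =>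
      (((hN U hU h).2 g hg).mono (le_max_left _ _)).add
        (((hN' U hU h).2 g hg).mono (le_max_right _ _))⟩⟩

theorem sum {ι : Type*} {s : Finset ι} {B : ι → (M → ℂ) → (M → ℂ) → M → ℂ}
    (h : ∀ i ∈ s, IsBidiffOn J U₀ (B i)) : IsBidiffOn J U₀ (fun f g => ∑ i ∈ s, B i f g) := by
  classical
  induction s using Finset.induction_on with
  | empty => simpa using zero
  | insert a s ha ih =>
    simp only [Finset.sum_insert ha]
    exact (h a (Finset.mem_insert_self _ _)).add
      (ih fun i hi => h i (Finset.mem_insert_of_mem hi))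

theorem comp_left (hB : IsBidiffOn J U₀ B) (hP : IsDiffOpOn J U₀ P) :
    IsBidiffOn J U₀ (fun f g => B (P f) g) where
  left U hU h g hg := (hB.left U hU h g hg).comp (hP.1 U hU h)
  right U hU h f hf := hB.right U hU h (P f) ((hP.1 U hU h).smooth f hf)
  order := by
    obtain ⟨N, hN⟩ := hB.order
    obtain ⟨N', hN'⟩ := hP.2
    exact ⟨N + N', fun U hU h => ⟨fun g hg => ((hN U hU h).1 g hg).comp (hN' U hU h)
      (hB.left U hU h g hg) (hP.1 U hU h), fun f hf =>
      ((hN U hU h).2 (P f) ((hP.1 U hU h).smooth f hf)).mono (Nat.le_add_right _ _)⟩⟩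

theorem comp_right (hB : IsBidiffOn J U₀ B) (hP : IsDiffOpOn J U₀ P) :
    IsBidiffOn J U₀ (fun f g => B f (P g)) where
  right U hU h g hg := (hB.right U hU h g hg).comp (hP.1 U hU h)
  left U hU h f hf := hB.left U hU h (P f) ((hP.1 U hU h).smooth f hf)
  order := by
    obtain ⟨N, hN⟩ := hB.order
    obtain ⟨N', hN'⟩ := hP.2
    exact ⟨N + N', fun U hU h => ⟨fun f hf =>
      ((hN U hU h).1 (P f) ((hP.1 U hU h).smooth f hf)).mono (Nat.le_add_right _ _),
      fun g hg => ((hN U hU h).2 g hg).comp (hN' U hU h)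
      (hB.right U hU h g hg) (hP.1 U hU h)⟩⟩

theorem postcomp (hB : IsBidiffOn J U₀ B) (hP : IsDiffOpOn J U₀ P) :
    IsBidiffOn J U₀ (fun f g => P (B f g)) where
  left U hU h g hg := (hP.1 U hU h).comp (hB.left U hU h g hg)
  right U hU h g hg := (hP.1 U hU h).comp (hB.right U hU h g hg)
  order := by
    obtain ⟨N, hN⟩ := hB.order
    obtain ⟨N', hN'⟩ := hP.2
    exact ⟨N' + N, fun U hU h => ⟨fun g hg => (hN' U hU h).comp ((hN U hU h).1 g hg)
      (hP.1 U hU h) (hB.left U hU h g hg), fun g hg =>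
      (hN' U hU h).comp ((hN U hU h).2 g hg) (hP.1 U hU h) (hB.right U hU h g hg)⟩⟩

theorem isBidifferential (hB : IsBidiffOn J Set.univ B) :
    IsBidifferential J (X := fun _ => ℂ) (Y := fun _ => ℂ) (SmoothFunOn J) (SmoothFunOn J) B where
  smooth U hU f g hf hg := hB.smooth hU (Set.subset_univ _) hf hg
  isLocal U hU f f' g g' hf hf' hg hg' h h' x hx :=
    hB.congr hU (Set.subset_univ _) hf hf' hg hg' (fun x hx => h' x hx) h hx
  add_left U hU f f' g hf hf' hg x hx := (hB.left U hU (Set.subset_univ _) g hg).add f f' hf hf' hx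
  smul_left U hU c f g hf hg x hx := (hB.left U hU (Set.subset_univ _) g hg).smul c f hf hx
  add_right U hU f g g' hf hg hg' x hx :=
    (hB.right U hU (Set.subset_univ _) f hf).add g g' hg hg' hx
  smul_right U hU c f g hf hg x hx := (hB.right U hU (Set.subset_univ _) f hf).smul c g hg hx
  finite_order := by
    obtain ⟨N, hN⟩ := hB.order
    exact ⟨N, fun U hU => hN U hU (Set.subset_univ _)⟩

theorem of_isBidifferential
    (hB : IsBidifferential J (X := fun _ => ℂ) (Y := fun _ => ℂ) (SmoothFunOn J)
      (SmoothFunOn J) B) : IsBidiffOn J Set.univ B where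
  left U hU _ g hg := ⟨fun f hf => hB.smooth U hU f g hf hg, fun f f' hf hf' h x hx =>
    hB.isLocal U hU f f' g g hf hf' hg hg (fun _ _ => rfl) h x hx,
    fun f f' hf hf' x hx => hB.add_left U hU f f' g hf hf' hg x hx,
    fun c f hf x hx => hB.smul_left U hU c f g hf hg x hx⟩
  right U hU _ f hf := ⟨fun g hg => hB.smooth U hU f g hf hg, fun g g' hg hg' h x hx =>
    hB.isLocal U hU f f g g' hf hf hg hg' h (fun _ _ => rfl) x hx,
    fun g g' hg hg' x hx => hB.add_right U hU f g g' hf hg hg' x hx,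
    fun c g hg x hx => hB.smul_right U hU c f g hf hg x hx⟩
  order := by
    obtain ⟨N, hN⟩ := hB.finite_order
    exact ⟨N, fun U hU _ => hN U hU⟩

end IsBidiffOn

end OperatorCalculus

end

section

section FormalAlgebra

open Finset HasAntidiagonal

/-- The `ℂ[[λ]]`-linear map `∑ λ^r S_r`. -/
def formalOp {X Y : Type*} [AddCommMonoid Y] (S : ℕ → X → Y) (f : Formal X) : Formal Y :=
  fun N => ∑ m ∈ HasAntidiagonal.antidiagonal N, S m.1 (f m.2)

/-- The trilinear analogue of `formalBilin`. -/
def formalTrilin {X Y Z W : Type*} [AddCommMonoid W] (D : ℕ → X → Y → Z → W) (f : Formal X)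
    (g : Formal Y) (h : Formal Z) : Formal W :=
  fun N => ∑ m ∈ HasAntidiagonal.antidiagonal N, ∑ m' ∈ HasAntidiagonal.antidiagonal m.2,
    ∑ m'' ∈ HasAntidiagonal.antidiagonal m'.2, D m.1 (f m'.1) (g m''.1) (h m''.2)

variable {W X Y Z X' : Type*} [AddCommGroup W] [AddCommGroup X] [AddCommGroup Y] [AddCommGroup Z]
  [AddCommGroup X'] [Module ℂ W] [Module ℂ X] [Module ℂ Y] [Module ℂ Z] [Module ℂ X']

theorem formalOp_formalOp (S : ℕ → Y →ₗ[ℂ] Z) (T : ℕ → X → Y) (f : Formal X) :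
    formalOp (fun r => S r) (formalOp T f) =
      formalOp (fun t x => ∑ m ∈ HasAntidiagonal.antidiagonal t, S m.1 (T m.2 x)) f := by
  funext N
  simp only [formalOp, map_sum, sum_sigma']
  refine sum_nbij'
    (fun ⟨(a, b), (c, d)⟩ => ⟨(a + c, d), (a, c)⟩)
    (fun ⟨(a, b), (c, d)⟩ => ⟨(c, d + b), (d, b)⟩) ?_ ?_ ?_ ?_ fun _ _ => rfl
  all_goals
    rintro ⟨⟨a, b⟩, ⟨c, d⟩⟩ h
    simp only [mem_sigma, HasAntidiagonal.mem_antidiagonal, and_true, true_and, Sigma.mk.injEq,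
      Prod.mk.injEq, heq_eq_eq] at h ⊢
    omega

theorem formalBilin_formalOp_left (B : ℕ → X →ₗ[ℂ] Y →ₗ[ℂ] Z) (S : ℕ → X' → X) (f : Formal X')
    (g : Formal Y) :
    formalBilin (fun r x y => B r x y) (formalOp S f) g =
      formalBilin (fun t x y => ∑ m ∈ HasAntidiagonal.antidiagonal t, B m.1 (S m.2 x) y) f g := by
  funext N
  simp only [formalBilin, formalOp, map_sum, LinearMap.sum_apply, sum_sigma']
  refine sum_nbij'
    (fun ⟨(a, b), (c, d), (e, k)⟩ => ⟨(a + e, k + d), (k, d), (a, e)⟩)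
    (fun ⟨(a, b), (c, d), (e, k)⟩ => ⟨(e, k + c + d), (k + c, d), (k, c)⟩) ?_ ?_ ?_ ?_ fun _ _ => rfl
  all_goals
    rintro ⟨⟨a, b⟩, ⟨c, d⟩, ⟨e, k⟩⟩ h
    simp only [mem_sigma, HasAntidiagonal.mem_antidiagonal, and_true, true_and, Sigma.mk.injEq,
      Prod.mk.injEq, heq_eq_eq] at h ⊢
    omega

theorem formalBilin_formalOp_right (B : ℕ → X →ₗ[ℂ] Y →ₗ[ℂ] Z) (S : ℕ → X' → Y) (f : Formal X)
    (g : Formal X') :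
    formalBilin (fun r x y => B r x y) f (formalOp S g) =
      formalBilin (fun t x y => ∑ m ∈ HasAntidiagonal.antidiagonal t, B m.1 x (S m.2 y)) f g := by
  funext N
  simp only [formalBilin, formalOp, map_sum, sum_sigma']
  refine sum_nbij'
    (fun ⟨(a, b), (c, d), (e, k)⟩ => ⟨(a + e, c + k), (c, k), (a, e)⟩)
    (fun ⟨(a, b), (c, d), (e, k)⟩ => ⟨(e, c + (k + d)), (c, k + d), (k, d)⟩) ?_ ?_ ?_ ?_ fun _ _ => rfl
  all_goals
    rintro ⟨⟨a, b⟩, ⟨c, d⟩, ⟨e, k⟩⟩ h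
    simp only [mem_sigma, HasAntidiagonal.mem_antidiagonal, and_true, true_and, Sigma.mk.injEq,
      Prod.mk.injEq, heq_eq_eq] at h ⊢
    omega

theorem formalBilin_formalBilin_left (B : ℕ → W →ₗ[ℂ] Z →ₗ[ℂ] X') (C : ℕ → X → Y → W)
    (f : Formal X) (g : Formal Y) (h : Formal Z) :
    formalBilin (fun r x y => B r x y) (formalBilin C f g) h =
      formalTrilin (fun t x y z => ∑ m ∈ HasAntidiagonal.antidiagonal t, B m.1 (C m.2 x y) z)
        f g h := by
  funext N
  simp only [formalBilin, formalTrilin, map_sum, LinearMap.sum_apply, sum_sigma']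
  refine sum_nbij'
    (fun ⟨(a, b), (c, d), (e, k), (i, j)⟩ => ⟨(a + e, k + d), (i, j + d), (j, d), (a, e)⟩)
    (fun ⟨(a, b), (c, d), (e, k), (i, j)⟩ => ⟨(i, j + c + e + k), (j + c + e, k), (j, c + e), (c, e)⟩) ?_ ?_ ?_ ?_ fun _ _ => rfl
  all_goals
    rintro ⟨⟨a, b⟩, ⟨c, d⟩, ⟨e, k⟩, ⟨i, j⟩⟩ h
    simp only [mem_sigma, HasAntidiagonal.mem_antidiagonal, and_true, true_and, Sigma.mk.injEq,
      Prod.mk.injEq, heq_eq_eq] at h ⊢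
    omega

theorem formalBilin_formalBilin_right (B : ℕ → X →ₗ[ℂ] W →ₗ[ℂ] X') (C : ℕ → Y → Z → W)
    (f : Formal X) (g : Formal Y) (h : Formal Z) :
    formalBilin (fun r x y => B r x y) f (formalBilin C g h) =
      formalTrilin (fun t x y z => ∑ m ∈ HasAntidiagonal.antidiagonal t, B m.1 x (C m.2 y z))
        f g h := by
  funext N
  simp only [formalBilin, formalTrilin, map_sum, sum_sigma']
  refine sum_nbij'
    (fun ⟨(a, b), (c, d), (e, k), (i, j)⟩ => ⟨(a + e, c + k), (c, k), (i, j), (a, e)⟩)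
    (fun ⟨(a, b), (c, d), (e, k), (i, j)⟩ => ⟨(i, c + (j + d)), (c, j + d), (j, d), (e, k)⟩) ?_ ?_ ?_ ?_ fun _ _ => rfl
  all_goals
    rintro ⟨⟨a, b⟩, ⟨c, d⟩, ⟨e, k⟩, ⟨i, j⟩⟩ h
    simp only [mem_sigma, HasAntidiagonal.mem_antidiagonal, and_true, true_and, Sigma.mk.injEq,
      Prod.mk.injEq, heq_eq_eq] at h ⊢
    omega

end FormalAlgebra

end

section

open Finset in
/-- The commuting derivations and the momenta of a cotangent chart, as structure on the algebra `A`
of functions on (a part of) phase space over the algebra `B` of functions on the base. -/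
structure PhaseAlgebra (n : ℕ) (A B : Type*) [CommRing A] [Algebra ℂ A] [CommRing B]
    [Algebra ℂ B] where
  dq : Fin n → A →ₗ[ℂ] A
  dp : Fin n → A →ₗ[ℂ] A
  dx : Fin n → B →ₗ[ℂ] B
  p : Fin n → A
  pull : B →ₐ[ℂ] A
  dq_mul : ∀ i f g, dq i (f * g) = dq i f * g + f * dq i g
  dp_mul : ∀ i f g, dp i (f * g) = dp i f * g + f * dp i g
  dx_mul : ∀ i u v, dx i (u * v) = dx i u * v + u * dx i v
  dq_comm : ∀ i j f, dq i (dq j f) = dq j (dq i f)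
  dp_comm : ∀ i j f, dp i (dp j f) = dp j (dp i f)
  dp_dq : ∀ i j f, dp i (dq j f) = dq j (dp i f)
  dp_p : ∀ i j, dp i (p j) = if i = j then 1 else 0
  dq_p : ∀ i j, dq i (p j) = 0
  dp_pull : ∀ i u, dp i (pull u) = 0
  dq_pull : ∀ i u, dq i (pull u) = pull (dx i u)

namespace PhaseAlgebra

open Finset

variable {n : ℕ} {A B : Type*} [CommRing A] [Algebra ℂ A] [CommRing B] [Algebra ℂ B]
  (Φ : PhaseAlgebra n A B)

/-! ### The flat product -/

/-- `∑_I ∂_p^I f ∂_q^I g`. -/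
def flatB : ℕ → A →ₗ[ℂ] A →ₗ[ℂ] A
  | 0 => LinearMap.mul ℂ A
  | r + 1 => ∑ i, (flatB r).compl₁₂ (Φ.dp i) (Φ.dq i)

theorem flatB_zero (f g : A) : Φ.flatB 0 f g = f * g := rfl

theorem flatB_succ (r : ℕ) (f g : A) :
    Φ.flatB (r + 1) f g = ∑ i, Φ.flatB r (Φ.dp i f) (Φ.dq i g) := by
  simp [flatB, LinearMap.sum_apply]

section Assoc

open TensorProduct

/-- `∑ ∂_p ⊗ ∂_q`. -/
def poissonTensor : A ⊗[ℂ] A →ₗ[ℂ] A ⊗[ℂ] A := ∑ i, TensorProduct.map (Φ.dp i) (Φ.dq i)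

theorem flatB_eq (r : ℕ) (f g : A) :
    Φ.flatB r f g = LinearMap.mul' ℂ A ((Φ.poissonTensor ^ r) (f ⊗ₜ g)) := by
  induction r generalizing f g with
  | zero => simp [flatB]
  | succ r ih =>
    rw [flatB_succ, pow_succ, Module.End.mul_apply]
    simp only [ih, poissonTensor, LinearMap.sum_apply, TensorProduct.map_tmul, map_sum]

/-- `∂_p ⊗ ∂_q ⊗ 1`. -/
def poisson12 : Module.End ℂ (A ⊗[ℂ] (A ⊗[ℂ] A)) :=
  ∑ i, TensorProduct.map (Φ.dp i) (TensorProduct.map (Φ.dq i) LinearMap.id)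

/-- `∂_p ⊗ 1 ⊗ ∂_q`. -/
def poisson13 : Module.End ℂ (A ⊗[ℂ] (A ⊗[ℂ] A)) :=
  ∑ i, TensorProduct.map (Φ.dp i) (TensorProduct.map LinearMap.id (Φ.dq i))

/-- `1 ⊗ ∂_p ⊗ ∂_q`. -/
def poisson23 : Module.End ℂ (A ⊗[ℂ] (A ⊗[ℂ] A)) :=
  TensorProduct.map LinearMap.id Φ.poissonTensor

theorem commute_poisson12_13 : Commute Φ.poisson12 Φ.poisson13 := by
  unfold poisson12 poisson13
  refine Commute.sum_left _ _ _ fun i _ => Commute.sum_right _ _ _ fun j _ => ?_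
  refine TensorProduct.ext_threefold' fun x y z => ?_
  simp [Φ.dp_comm i j x]

theorem commute_poisson12_23 : Commute Φ.poisson12 Φ.poisson23 := by
  unfold poisson12
  refine Commute.sum_left _ _ _ fun i _ => ?_
  refine TensorProduct.ext_threefold' fun x y z => ?_
  simp [poisson23, poissonTensor, TensorProduct.tmul_sum, Φ.dp_dq]

theorem commute_poisson13_23 : Commute Φ.poisson13 Φ.poisson23 := by
  unfold poisson13
  refine Commute.sum_left _ _ _ fun i _ => ?_
  refine TensorProduct.ext_threefold' fun x y z => ?_
  simp only [poisson23, poissonTensor, Module.End.mul_apply, TensorProduct.map_tmul,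
    LinearMap.id_coe, id_eq, LinearMap.sum_apply, TensorProduct.tmul_sum, map_sum]
  exact Finset.sum_congr rfl fun j _ => by rw [Φ.dq_comm i j z]

/-- `1 ⊗ m`. -/
def mulRight : A ⊗[ℂ] (A ⊗[ℂ] A) →ₗ[ℂ] A ⊗[ℂ] A :=
  TensorProduct.map LinearMap.id (LinearMap.mul' ℂ A)

/-- `m ⊗ 1`. -/
def mulLeft : A ⊗[ℂ] (A ⊗[ℂ] A) →ₗ[ℂ] A ⊗[ℂ] A :=
  TensorProduct.map (LinearMap.mul' ℂ A) LinearMap.id ∘ₗ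
    (TensorProduct.assoc ℂ A A A).symm.toLinearMap

theorem poissonTensor_mulRight (t : A ⊗[ℂ] (A ⊗[ℂ] A)) :
    Φ.poissonTensor (mulRight t) = mulRight ((Φ.poisson12 + Φ.poisson13) t) := by
  have : Φ.poissonTensor ∘ₗ mulRight = mulRight ∘ₗ (Φ.poisson12 + Φ.poisson13) := by
    refine TensorProduct.ext_threefold' fun x y z => ?_
    simp [poissonTensor, mulRight, poisson12, poisson13, Φ.dq_mul, TensorProduct.tmul_add,
      Finset.sum_add_distrib]
  exact LinearMap.congr_fun this t

theorem poissonTensor_mulLeft (t : A ⊗[ℂ] (A ⊗[ℂ] A)) :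
    Φ.poissonTensor (mulLeft t) = mulLeft ((Φ.poisson13 + Φ.poisson23) t) := by
  have : Φ.poissonTensor ∘ₗ mulLeft = mulLeft ∘ₗ (Φ.poisson13 + Φ.poisson23) := by
    refine TensorProduct.ext_threefold' fun x y z => ?_
    simp [poissonTensor, mulLeft, poisson23, poisson13, Φ.dp_mul, TensorProduct.add_tmul,
      Finset.sum_add_distrib, TensorProduct.tmul_sum]
  exact LinearMap.congr_fun this t

theorem poissonTensor_pow_mulRight (a : ℕ) (t : A ⊗[ℂ] (A ⊗[ℂ] A)) :
    (Φ.poissonTensor ^ a) (mulRight t) = mulRight (((Φ.poisson12 + Φ.poisson13) ^ a) t) := by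
  induction a with
  | zero => rfl
  | succ a ih =>
    rw [pow_succ', pow_succ', Module.End.mul_apply, ih, poissonTensor_mulRight,
      Module.End.mul_apply]

theorem poissonTensor_pow_mulLeft (a : ℕ) (t : A ⊗[ℂ] (A ⊗[ℂ] A)) :
    (Φ.poissonTensor ^ a) (mulLeft t) = mulLeft (((Φ.poisson13 + Φ.poisson23) ^ a) t) := by
  induction a with
  | zero => rfl
  | succ a ih =>
    rw [pow_succ', pow_succ', Module.End.mul_apply, ih, poissonTensor_mulLeft,
      Module.End.mul_apply]

theorem mul'_mulRight (t : A ⊗[ℂ] (A ⊗[ℂ] A)) :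
    LinearMap.mul' ℂ A (mulRight t) = LinearMap.mul' ℂ A (mulLeft t) := by
  have : LinearMap.mul' ℂ A ∘ₗ mulRight = LinearMap.mul' ℂ A ∘ₗ mulLeft := by
    refine TensorProduct.ext_threefold' fun x y z => ?_
    simp [mulRight, mulLeft, mul_assoc]
  exact LinearMap.congr_fun this t

theorem flatB_flatB_right (a b : ℕ) (f g h : A) : Φ.flatB a f (Φ.flatB b g h) =
    LinearMap.mul' ℂ A (mulLeft (((Φ.poisson12 + Φ.poisson13) ^ a * Φ.poisson23 ^ b)
      (f ⊗ₜ (g ⊗ₜ h)))) := by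
  have h1 : (Φ.poisson23 ^ b) (f ⊗ₜ (g ⊗ₜ h)) = f ⊗ₜ ((Φ.poissonTensor ^ b) (g ⊗ₜ h)) := by
    induction b with
    | zero => rfl
    | succ b ih => rw [pow_succ', Module.End.mul_apply, ih, pow_succ', Module.End.mul_apply]; rfl
  rw [flatB_eq, flatB_eq, Module.End.mul_apply, h1, ← mul'_mulRight,
    ← poissonTensor_pow_mulRight]
  rfl

theorem flatB_flatB_left (a b : ℕ) (f g h : A) : Φ.flatB a (Φ.flatB b f g) h =
    LinearMap.mul' ℂ A (mulLeft (((Φ.poisson13 + Φ.poisson23) ^ a * Φ.poisson12 ^ b)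
      (f ⊗ₜ (g ⊗ₜ h)))) := by
  have h1 : ∀ s : A ⊗[ℂ] A, (TensorProduct.assoc ℂ A A A).symm
      (Φ.poisson12 (TensorProduct.assoc ℂ A A A (s ⊗ₜ h))) = (Φ.poissonTensor s) ⊗ₜ h := by
    intro s
    induction s with
    | zero => simp
    | tmul x y => simp [poisson12, poissonTensor, TensorProduct.sum_tmul]
    | add x y hx hy => simp only [TensorProduct.add_tmul, map_add, hx, hy]
  have h2 : (Φ.poisson12 ^ b) (f ⊗ₜ (g ⊗ₜ h)) =
      TensorProduct.assoc ℂ A A A (((Φ.poissonTensor ^ b) (f ⊗ₜ g)) ⊗ₜ h) := by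
    induction b with
    | zero => simp
    | succ b ih =>
      rw [pow_succ', Module.End.mul_apply, ih, pow_succ', Module.End.mul_apply, ← h1]
      simp
  rw [flatB_eq, flatB_eq, Module.End.mul_apply, h2, ← poissonTensor_pow_mulLeft]
  simp [mulLeft]

theorem sum_divided_pow {R : Type*} [Semiring R] [Algebra ℂ R] {x y : R} (h : Commute x y) (N : ℕ) :
    ∑ m ∈ HasAntidiagonal.antidiagonal N,
      ((m.1.factorial : ℂ)⁻¹ * (m.2.factorial : ℂ)⁻¹) • (x ^ m.1 * y ^ m.2) =
      (N.factorial : ℂ)⁻¹ • (x + y) ^ N := by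
  rw [h.add_pow', Finset.smul_sum]
  refine sum_congr rfl fun m hm => ?_
  have hN : m.1 + m.2 = N := by simpa using hm
  rw [← Nat.cast_smul_eq_nsmul ℂ, smul_smul]
  congr 1
  have h1 := Nat.choose_mul_factorial_mul_factorial (n := N) (k := m.1) (by omega)
  have h2 : N - m.1 = m.2 := by omega
  rw [h2] at h1
  have : (m.1.factorial : ℂ) ≠ 0 := by exact_mod_cast m.1.factorial_ne_zero
  have : (m.2.factorial : ℂ) ≠ 0 := by exact_mod_cast m.2.factorial_ne_zero
  rw [← h1]
  push_cast
  have : ((N.choose m.1 : ℕ) : ℂ) ≠ 0 := by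
    exact_mod_cast (Nat.choose_pos (n := N) (k := m.1) (by omega)).ne'
  field_simp

/-- The cochains of the flat product with parameter `c`. -/
def flatC (c : ℂ) (r : ℕ) : A →ₗ[ℂ] A →ₗ[ℂ] A := (c ^ r / (r.factorial : ℂ)) • Φ.flatB r

theorem flatC_apply (c : ℂ) (r : ℕ) (f g : A) :
    Φ.flatC c r f g = (c ^ r / (r.factorial : ℂ)) • Φ.flatB r f g := rfl

theorem flatC_assoc (c : ℂ) (N : ℕ) (f g h : A) :
    ∑ m ∈ HasAntidiagonal.antidiagonal N, Φ.flatC c m.1 (Φ.flatC c m.2 f g) h =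
      ∑ m ∈ HasAntidiagonal.antidiagonal N, Φ.flatC c m.1 f (Φ.flatC c m.2 g h) := by
  have e1 : ∀ m ∈ HasAntidiagonal.antidiagonal N, Φ.flatC c m.1 (Φ.flatC c m.2 f g) h =
      c ^ N • LinearMap.mul' ℂ A (mulLeft ((((m.1.factorial : ℂ)⁻¹ * (m.2.factorial : ℂ)⁻¹) •
        ((Φ.poisson13 + Φ.poisson23) ^ m.1 * Φ.poisson12 ^ m.2)) (f ⊗ₜ (g ⊗ₜ h)))) := by
    intro m hm
    have hN : m.1 + m.2 = N := by simpa using hm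
    simp only [flatC_apply, map_smul, LinearMap.smul_apply, flatB_flatB_left, smul_smul]
    rw [← hN, pow_add]
    congr 1
    field_simp
  have e2 : ∀ m ∈ HasAntidiagonal.antidiagonal N, Φ.flatC c m.1 f (Φ.flatC c m.2 g h) =
      c ^ N • LinearMap.mul' ℂ A (mulLeft ((((m.1.factorial : ℂ)⁻¹ * (m.2.factorial : ℂ)⁻¹) •
        ((Φ.poisson12 + Φ.poisson13) ^ m.1 * Φ.poisson23 ^ m.2)) (f ⊗ₜ (g ⊗ₜ h)))) := by
    intro m hm
    have hN : m.1 + m.2 = N := by simpa using hm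
    simp only [flatC_apply, map_smul, LinearMap.smul_apply, flatB_flatB_right, smul_smul]
    rw [← hN, pow_add]
    congr 1
    field_simp
  rw [sum_congr rfl e1, sum_congr rfl e2]
  simp only [← smul_sum, ← map_sum, ← LinearMap.sum_apply]
  rw [sum_divided_pow (Φ.commute_poisson12_13.symm.add_left Φ.commute_poisson12_23.symm),
    sum_divided_pow (Φ.commute_poisson12_23.add_left Φ.commute_poisson13_23)]
  congr 6
  abel

end Assoc

end PhaseAlgebra

end

section

namespace PhaseAlgebra

open Finset

variable {n : ℕ} {A B : Type*} [CommRing A] [Algebra ℂ A] [CommRing B] [Algebra ℂ B]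
  (Φ : PhaseAlgebra n A B)

/-! ### The symbol transform -/

/-- Multiplication by a momentum. -/
abbrev mulP (l : Fin n) : Module.End ℂ A := LinearMap.mulLeft ℂ (Φ.p l)

/-- Multiplication by a function on the base. -/
abbrev mulPull (u : B) : Module.End ℂ A := LinearMap.mulLeft ℂ (Φ.pull u)

/-- The preceding term of a sequence. -/
def prevTerm {X : Type*} [Zero X] (T : ℕ → X) : ℕ → X
  | 0 => 0
  | d + 1 => T d

/-- `∑_l Γ^l_{ik} ∂_{p_i} ∂_{p_k}`. -/
def gammaDD (G : Fin n → Fin n → Fin n → B) (l : Fin n) : Module.End ℂ A :=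
  ∑ i, ∑ k, Φ.mulPull (G l i k) * Φ.dp i * Φ.dp k

/-- The recursion defining the transform from the symbols of a connection to flat symbols, split
into the parts `T j d` which have order `d` in `∂_p` and lower the degree in the momenta by `j`. -/
structure IsSymbolFamily (G : Fin n → Fin n → Fin n → B) (T : ℕ → ℕ → Module.End ℂ A) : Prop where
  zero_zero : T 0 0 = 1
  zero_succ : ∀ d, T 0 (d + 1) = 0
  succ_zero : ∀ j, T (j + 1) 0 = 0
  succ_succ : ∀ j d : ℕ, ((d : ℂ) + 1) • T (j + 1) (d + 1) =
    ∑ i, (Φ.dq i * T j d * Φ.dp i - T j d * Φ.dq i * Φ.dp i) -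
      ∑ l, (T j d * Φ.mulP l - Φ.mulP l * T j d + Φ.mulP l * prevTerm (T j) d) * Φ.gammaDD G l

theorem dp_mulP (i l : Fin n) :
    Φ.dp i * Φ.mulP l = Φ.mulP l * Φ.dp i + if i = l then 1 else 0 := by
  ext f
  by_cases h : i = l <;> simp [Φ.dp_mul, Φ.dp_p, h, add_comm]

theorem dq_mulP (i l : Fin n) : Φ.dq i * Φ.mulP l = Φ.mulP l * Φ.dq i := by
  ext f
  simp [Φ.dq_mul, Φ.dq_p]

theorem mulP_mulP (i l : Fin n) : Φ.mulP i * Φ.mulP l = Φ.mulP l * Φ.mulP i := by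
  ext f
  simp [mul_left_comm]

theorem dp_mul_dp (i l : Fin n) : Φ.dp i * Φ.dp l = Φ.dp l * Φ.dp i :=
  LinearMap.ext fun f => Φ.dp_comm i l f

theorem dp_mul_dq (i l : Fin n) : Φ.dp i * Φ.dq l = Φ.dq l * Φ.dp i :=
  LinearMap.ext fun f => Φ.dp_dq i l f

theorem dp_gammaDD (G : Fin n → Fin n → Fin n → B) (i l : Fin n) :
    Φ.dp i * Φ.gammaDD G l = Φ.gammaDD G l * Φ.dp i := by
  ext f
  simp [gammaDD, LinearMap.sum_apply, Φ.dp_mul, Φ.dp_pull, Φ.dp_comm i]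

/-- `∑ p_i [X, ∂_{p_i}]`. -/
def eulerComm (X : Module.End ℂ A) : Module.End ℂ A :=
  ∑ i, Φ.mulP i * (X * Φ.dp i - Φ.dp i * X)

theorem eulerComm_add (X Y : Module.End ℂ A) :
    Φ.eulerComm (X + Y) = Φ.eulerComm X + Φ.eulerComm Y := by
  simp only [eulerComm, ← sum_add_distrib]
  exact sum_congr rfl fun i _ => by (simp only [mul_add, add_mul, mul_sub, sub_mul, mul_assoc, one_mul, mul_one, mul_zero, zero_mul]; abel)

theorem eulerComm_zero : Φ.eulerComm 0 = 0 := by simp [eulerComm]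

theorem eulerComm_sub (X Y : Module.End ℂ A) :
    Φ.eulerComm (X - Y) = Φ.eulerComm X - Φ.eulerComm Y := by
  simp only [eulerComm, ← sum_sub_distrib]
  exact sum_congr rfl fun i _ => by (simp only [mul_add, add_mul, mul_sub, sub_mul, mul_assoc, one_mul, mul_one, mul_zero, zero_mul]; abel)

theorem eulerComm_sum {ι : Type*} (s : Finset ι) (X : ι → Module.End ℂ A) :
    Φ.eulerComm (∑ i ∈ s, X i) = ∑ i ∈ s, Φ.eulerComm (X i) := by
  classical
  induction s using Finset.induction_on with
  | empty => simp [eulerComm_zero]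
  | insert a s ha ih => rw [sum_insert ha, sum_insert ha, eulerComm_add, ih]

theorem eulerComm_smul (c : ℂ) (X : Module.End ℂ A) :
    Φ.eulerComm (c • X) = c • Φ.eulerComm X := by
  simp only [eulerComm, smul_sum]
  refine sum_congr rfl fun i _ => ?_
  ext f
  simp [mul_sub, smul_sub]

theorem eulerComm_mul_right {X Y : Module.End ℂ A} (h : ∀ i, Φ.dp i * Y = Y * Φ.dp i) :
    Φ.eulerComm (X * Y) = Φ.eulerComm X * Y := by
  simp only [eulerComm, sum_mul]
  refine sum_congr rfl fun i _ => ?_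
  rw [mul_assoc X Y, ← h i]
  simp only [mul_sub, sub_mul, mul_assoc]

theorem eulerComm_dq_mul (k : Fin n) (X : Module.End ℂ A) :
    Φ.eulerComm (Φ.dq k * X) = Φ.dq k * Φ.eulerComm X := by
  simp only [eulerComm, mul_sum]
  refine sum_congr rfl fun i _ => ?_
  rw [← mul_assoc (Φ.dp i), dp_mul_dq, ← mul_assoc (Φ.dq k), dq_mulP]
  simp only [mul_sub, sub_mul, mul_assoc]

theorem eulerComm_mul_mulP (l : Fin n) (X : Module.End ℂ A) :
    Φ.eulerComm (X * Φ.mulP l) = Φ.eulerComm X * Φ.mulP l - Φ.mulP l * X := by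
  have h : ∀ i, Φ.mulP i * (X * Φ.mulP l * Φ.dp i - Φ.dp i * (X * Φ.mulP l)) =
      Φ.mulP i * (X * Φ.dp i - Φ.dp i * X) * Φ.mulP l -
        (if i = l then Φ.mulP l * X else 0) := by
    intro i
    have := Φ.dp_mulP i l
    have h2 : Φ.mulP l * Φ.dp i = Φ.dp i * Φ.mulP l - if i = l then 1 else 0 := by
      rw [this]; abel
    rw [mul_assoc X, h2]
    split_ifs with hil
    · subst hil; (simp only [mul_add, add_mul, mul_sub, sub_mul, mul_assoc, one_mul, mul_one, mul_zero, zero_mul]; abel)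
    · (simp only [mul_add, add_mul, mul_sub, sub_mul, mul_assoc, one_mul, mul_one, mul_zero, zero_mul]; abel)
  simp only [eulerComm, h, sum_sub_distrib, sum_mul]
  simp

theorem eulerComm_mulP_mul (l : Fin n) (X : Module.End ℂ A) :
    Φ.eulerComm (Φ.mulP l * X) = Φ.mulP l * Φ.eulerComm X - Φ.mulP l * X := by
  have h : ∀ i, Φ.mulP i * (Φ.mulP l * X * Φ.dp i - Φ.dp i * (Φ.mulP l * X)) =
      Φ.mulP l * (Φ.mulP i * (X * Φ.dp i - Φ.dp i * X)) -
        (if i = l then Φ.mulP l * X else 0) := by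
    intro i
    rw [← mul_assoc (Φ.dp i), Φ.dp_mulP i l, ← mul_assoc (Φ.mulP l), ← Φ.mulP_mulP i l]
    split_ifs with hil
    · subst hil; (simp only [mul_add, add_mul, mul_sub, sub_mul, mul_assoc, one_mul, mul_one, mul_zero, zero_mul]; abel)
    · (simp only [mul_add, add_mul, mul_sub, sub_mul, mul_assoc, one_mul, mul_one, mul_zero, zero_mul]; abel)
  simp only [eulerComm, h, sum_sub_distrib, mul_sum]
  simp

namespace IsSymbolFamily

variable {Φ} {G : Fin n → Fin n → Fin n → B} {T : ℕ → ℕ → Module.End ℂ A}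
  (hT : Φ.IsSymbolFamily G T)

include hT

theorem eulerComm_eq (j d : ℕ) : Φ.eulerComm (T j d) = ((j : ℂ) - d) • T j d := by
  induction j generalizing d with
  | zero =>
    cases d with
    | zero => simp [hT.zero_zero, eulerComm]
    | succ d => simp [hT.zero_succ, eulerComm]
  | succ j ih =>
    cases d with
    | zero => simp [hT.succ_zero, eulerComm]
    | succ d =>
      have hd : ((d : ℂ) + 1) ≠ 0 := by exact_mod_cast Nat.succ_ne_zero d
      have hprev : Φ.eulerComm (prevTerm (T j) d) = ((j : ℂ) - d + 1) • prevTerm (T j) d := by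
        cases d with
        | zero => simp [prevTerm, eulerComm]
        | succ d =>
          rw [prevTerm, ih]
          congr 1
          push_cast; ring
      have key : Φ.eulerComm (((d : ℂ) + 1) • T (j + 1) (d + 1)) =
          ((j : ℂ) - d) • (((d : ℂ) + 1) • T (j + 1) (d + 1)) := by
        rw [hT.succ_succ, eulerComm_sub, eulerComm_sum, eulerComm_sum, smul_sub, smul_sum, smul_sum]
        congr 1
        · refine sum_congr rfl fun i _ => ?_
          rw [eulerComm_sub, mul_assoc, eulerComm_dq_mul, mul_assoc (T j d),
            Φ.eulerComm_mul_right fun k => Φ.dp_mul_dp k i,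
            Φ.eulerComm_mul_right (Y := Φ.dq i * Φ.dp i), ih]
          · simp only [smul_sub, mul_smul_comm, smul_mul_assoc]
          · intro k
            rw [← mul_assoc, dp_mul_dq, mul_assoc, dp_mul_dp, mul_assoc]
        · refine sum_congr rfl fun l _ => ?_
          rw [Φ.eulerComm_mul_right fun k => Φ.dp_gammaDD G k l, eulerComm_add, eulerComm_sub,
            eulerComm_mul_mulP, eulerComm_mulP_mul, eulerComm_mulP_mul, ih, hprev,
            ← smul_mul_assoc]
          congr 1
          have e1 : ((j : ℂ) - d + 1) • prevTerm (T j) d =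
            ((j : ℂ) - d) • prevTerm (T j) d + prevTerm (T j) d := by
            rw [add_smul, one_smul]
          rw [e1]
          simp only [mul_smul_comm, smul_mul_assoc, smul_add, smul_sub, mul_add]
          abel
      rw [eulerComm_smul, smul_comm] at key
      have := smul_right_injective _ hd key
      rw [this]
      congr 1
      push_cast; ring

theorem eq_zero_of_lt {j d : ℕ} (h : 2 * j < d) : T j d = 0 := by
  induction j generalizing d with
  | zero =>
    obtain ⟨d, rfl⟩ : ∃ d', d = d' + 1 := ⟨d - 1, by omega⟩
    exact hT.zero_succ d
  | succ j ih =>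
    obtain ⟨d, rfl⟩ : ∃ d', d = d' + 2 := ⟨d - 2, by omega⟩
    have hd : (((d + 1 : ℕ) : ℂ) + 1) ≠ 0 := by exact_mod_cast Nat.succ_ne_zero (d + 1)
    have := hT.succ_succ j (d + 1)
    rw [ih (by omega : 2 * j < d + 1), prevTerm, ih (by omega : 2 * j < d)] at this
    simp only [mul_zero, zero_mul, sub_zero, add_zero, sum_const_zero] at this
    exact (smul_eq_zero.1 this).resolve_left hd

theorem apply_mulPull (j d : ℕ) (u : B) (f : A) : T j d (Φ.pull u * f) = Φ.pull u * T j d f := by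
  induction j generalizing d u f with
  | zero =>
    cases d with
    | zero => simp [hT.zero_zero]
    | succ d => simp [hT.zero_succ]
  | succ j ih =>
    cases d with
    | zero => simp [hT.succ_zero]
    | succ d =>
      have hd : ((d : ℂ) + 1) ≠ 0 := by exact_mod_cast Nat.succ_ne_zero d
      refine smul_right_injective _ hd ?_
      have hprev : ∀ u f, prevTerm (T j) d (Φ.pull u * f) = Φ.pull u * prevTerm (T j) d f := by
        intro u f
        cases d with
        | zero => simp [prevTerm]
        | succ d => exact ih d u f
      have e : ∀ f, ((d : ℂ) + 1) • T (j + 1) (d + 1) f = _ := fun f =>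
        LinearMap.congr_fun (hT.succ_succ j d) f
      have hg : ∀ l, Φ.gammaDD G l (Φ.pull u * f) = Φ.pull u * Φ.gammaDD G l f := by
        intro l
        simp [gammaDD, Φ.dp_mul, Φ.dp_pull, mul_sum, LinearMap.sum_apply, mul_left_comm]
      simp only
      rw [e, ← mul_smul_comm, e]
      simp only [LinearMap.sub_apply, LinearMap.sum_apply, Module.End.mul_apply, Φ.dp_mul,
        Φ.dp_pull, zero_mul, zero_add, ih, hg, LinearMap.add_apply, LinearMap.mulLeft_apply,
        Φ.dq_mul, Φ.dq_pull, map_add, hprev, mul_sub, mul_sum, mul_left_comm (Φ.p _) (Φ.pull _), mul_add]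
      congr 1
      refine sum_congr rfl fun i _ => ?_
      ring

theorem apply_pull (j d : ℕ) (u : B) : T (j + 1) d (Φ.pull u) = 0 := by
  cases d with
  | zero => simp [hT.succ_zero]
  | succ d =>
    have hd : ((d : ℂ) + 1) ≠ 0 := by exact_mod_cast Nat.succ_ne_zero d
    have e : ((d : ℂ) + 1) • T (j + 1) (d + 1) (Φ.pull u) = _ :=
      LinearMap.congr_fun (hT.succ_succ j d) (Φ.pull u)
    refine (smul_eq_zero.1 (e.trans ?_)).resolve_left hd
    simp [gammaDD, Φ.dp_pull, LinearMap.sum_apply]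

omit hT in
/-- The order `j` term of the symbol transform. -/
def total (T : ℕ → ℕ → Module.End ℂ A) (j : ℕ) : Module.End ℂ A :=
  ∑ d ∈ range (2 * j + 1), T j d

omit hT in
/-- The order `j` term of the symbol transform, weighted by the order in `∂_p`. -/
def weighted (T : ℕ → ℕ → Module.End ℂ A) (j : ℕ) : Module.End ℂ A :=
  ∑ d ∈ range (2 * j + 1), (d : ℂ) • T j d

theorem total_zero : total T 0 = 1 := by simp [total, hT.zero_zero]

theorem total_mulPull (j : ℕ) (u : B) (f : A) :
    total T j (Φ.pull u * f) = Φ.pull u * total T j f := by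
  simp [total, LinearMap.sum_apply, hT.apply_mulPull, mul_sum]

theorem total_pull (j : ℕ) (u : B) : total T (j + 1) (Φ.pull u) = 0 := by
  simp [total, LinearMap.sum_apply, hT.apply_pull]

theorem weighted_zero : weighted T 0 = 0 := by simp [weighted]

theorem weighted_succ (j : ℕ) : weighted T (j + 1) =
    ∑ i, (Φ.dq i * total T j * Φ.dp i - total T j * Φ.dq i * Φ.dp i) -
      ∑ l, total T j * Φ.mulP l * Φ.gammaDD G l := by
  have h1 : weighted T (j + 1) = ∑ d ∈ range (2 * j + 2), ((d : ℂ) + 1) • T (j + 1) (d + 1) := by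
    rw [weighted, show 2 * (j + 1) + 1 = (2 * j + 2) + 1 by ring, sum_range_succ']
    simp
  have h2 : ∑ d ∈ range (2 * j + 2), T j d = total T j := by
    rw [sum_range_succ, hT.eq_zero_of_lt (by omega), add_zero, total]
  have h3 : ∑ d ∈ range (2 * j + 2), prevTerm (T j) d = total T j := by
    rw [sum_range_succ']
    simp [prevTerm, total]
  rw [h1, sum_congr rfl fun d _ => hT.succ_succ j d, sum_sub_distrib]
  congr 1
  · rw [sum_comm]
    refine sum_congr rfl fun i _ => ?_
    rw [sum_sub_distrib, ← sum_mul, ← mul_sum, h2, ← sum_mul, ← sum_mul, h2]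
  · rw [sum_comm]
    refine sum_congr rfl fun l _ => ?_
    rw [← sum_mul, sum_add_distrib, sum_sub_distrib, ← sum_mul, ← mul_sum, ← mul_sum, h2, h3]
    congr 1
    abel

theorem eulerComm_total (j : ℕ) :
    Φ.eulerComm (total T j) = (j : ℂ) • total T j - weighted T j := by
  simp only [total, weighted, eulerComm_sum, hT.eulerComm_eq, smul_sum]
  rw [← sum_sub_distrib]
  exact sum_congr rfl fun d _ => LinearMap.ext fun f => sub_smul _ _ (T j d f)

end IsSymbolFamily

/-! ### Representations on the base -/

theorem flatB_mul_p (r : ℕ) (i : Fin n) (g h : A) : Φ.flatB (r + 1) (Φ.p i * g) h =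
    Φ.p i * Φ.flatB (r + 1) g h + ((r : ℂ) + 1) • Φ.flatB r g (Φ.dq i h) := by
  induction r generalizing g h with
  | zero =>
    simp only [flatB_succ, flatB_zero, Φ.dp_mul, Φ.dp_p, mul_sum, add_mul, sum_add_distrib]
    simp only [ite_mul, one_mul, zero_mul, sum_ite_eq', mem_univ, if_true, Nat.cast_zero,
      zero_add, one_smul]
    rw [add_comm]
    simp only [mul_assoc]
  | succ r ih =>
    rw [flatB_succ]
    have : ∀ k, Φ.flatB (r + 1) (Φ.dp k (Φ.p i * g)) (Φ.dq k h) =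
        (if k = i then Φ.flatB (r + 1) g (Φ.dq k h) else 0) +
          (Φ.p i * Φ.flatB (r + 1) (Φ.dp k g) (Φ.dq k h) +
            ((r : ℂ) + 1) • Φ.flatB r (Φ.dp k g) (Φ.dq k (Φ.dq i h))) := by
      intro k
      rw [Φ.dp_mul, Φ.dp_p, map_add, LinearMap.add_apply, ih, Φ.dq_comm i k]
      by_cases hk : k = i <;> simp [hk]
    simp only [this, sum_add_distrib, sum_ite_eq', mem_univ, if_true]
    rw [← mul_sum, ← smul_sum, ← flatB_succ, ← flatB_succ]
    push_cast
    rw [add_smul ((r : ℂ) + 1), one_smul]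
    abel

section Representation

variable {Φ} {ι : A →ₐ[ℂ] B} (hpull : ∀ u, ι (Φ.pull u) = u) (hp : ∀ i, ι (Φ.p i) = 0)
  (hdq : ∀ i f, ι (Φ.dq i f) = Φ.dx i (ι f))

include hdq in
theorem flatB_congr_right (r : ℕ) (f : A) {g h : A} (e : ι g = ι h) :
    ι (Φ.flatB r f g) = ι (Φ.flatB r f h) := by
  induction r generalizing f g h with
  | zero => simp [flatB_zero, e]
  | succ r ih =>
    simp only [flatB_succ, map_sum]
    exact sum_congr rfl fun i _ => ih _ (by rw [hdq, hdq, e])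

include hpull hdq in
theorem dx_flatB (i : Fin n) (r : ℕ) (f h : A) : Φ.dx i (ι (Φ.flatB r f h)) =
    ι (Φ.flatB r (Φ.dq i f) h) + ι (Φ.flatB r f (Φ.dq i h)) := by
  rw [← hdq, ← map_add]
  congr 1
  induction r generalizing f h with
  | zero => simp [flatB_zero, Φ.dq_mul]
  | succ r ih =>
    simp only [flatB_succ, map_sum, ih, Φ.dp_dq, Φ.dq_comm i, sum_add_distrib]

include hp in
theorem flatB_sum_mul_p (r : ℕ) (g : Fin n → A) (h : A) :
    ι (Φ.flatB (r + 1) (∑ i, Φ.p i * g i) h) =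
      ((r : ℂ) + 1) • ∑ i, ι (Φ.flatB r (g i) (Φ.dq i h)) := by
  simp only [map_sum, LinearMap.sum_apply, flatB_mul_p, map_add, map_mul, hp, zero_mul, zero_add,
    map_smul, smul_sum]

include hp in
theorem flatB_euler (r : ℕ) (g h : A) :
    ι (Φ.flatB r (∑ i, Φ.p i * Φ.dp i g) h) = (r : ℂ) • ι (Φ.flatB r g h) := by
  cases r with
  | zero => simp [flatB_zero, hp, sum_mul]
  | succ r =>
    rw [flatB_sum_mul_p hp, ← map_sum, ← flatB_succ]
    push_cast; rfl

/-- The symbol transform turns the symbols of a connection into flat symbols: if `a r f` are the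
differential operators applied to a fixed function `u` with symbols in the sense of the
connection, then they are those with the transformed flat symbols. -/
theorem IsSymbolFamily.flat_symbol {G : Fin n → Fin n → Fin n → B} {T : ℕ → ℕ → Module.End ℂ A}
    (hT : Φ.IsSymbolFamily G T) (hpull : ∀ u, ι (Φ.pull u) = u) (hp : ∀ i, ι (Φ.p i) = 0)
    (hdq : ∀ i f, ι (Φ.dq i f) = Φ.dx i (ι f)) (u : B) (a : ℕ → A →ₗ[ℂ] B)
    (h0 : ∀ f, a 0 f = u * ι f)
    (hsucc : ∀ r f, a (r + 1) f = ∑ i, Φ.dx i (a r (Φ.dp i f)) -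
      a r (∑ i, Φ.dq i (Φ.dp i f) + ∑ l, Φ.p l * Φ.gammaDD G l f)) (N : ℕ) (f : A) :
    (N.factorial : ℂ)⁻¹ • a N f = ∑ m ∈ HasAntidiagonal.antidiagonal N,
      (m.2.factorial : ℂ)⁻¹ • ι (Φ.flatB m.2 (IsSymbolFamily.total T m.1 f) (Φ.pull u)) := by
  induction N generalizing f with
  | zero => simp [h0, hT.total_zero, flatB_zero, hpull, mul_comm]
  | succ N ih =>
    set S := IsSymbolFamily.total T with hS
    set h := Φ.pull u with hh
    have hN : ((N : ℂ) + 1) ≠ 0 := by exact_mod_cast Nat.succ_ne_zero N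
    refine smul_right_injective _ hN ?_
    have weight : ∀ j r : ℕ, ((j : ℂ) + r) • ι (Φ.flatB r (S j f) h) =
        ι (Φ.flatB r (∑ i, Φ.p i * S j (Φ.dp i f)) h) +
          ι (Φ.flatB r (IsSymbolFamily.weighted T j f) h) := by
      intro j r
      have e := LinearMap.congr_fun (hT.eulerComm_total j) f
      simp only [eulerComm, LinearMap.sum_apply, Module.End.mul_apply, LinearMap.sub_apply,
        LinearMap.mulLeft_apply, LinearMap.smul_apply, mul_sub, sum_sub_distrib] at e
      rw [sub_eq_iff_eq_add] at e
      rw [hS, e, map_add, LinearMap.add_apply, map_add, flatB_euler hp, map_sub,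
        LinearMap.sub_apply, map_sub, map_smul, LinearMap.smul_apply, map_smul, add_smul]
      abel
    have lhs : ((N : ℂ) + 1) • (((N + 1).factorial : ℂ)⁻¹ • a (N + 1) f) =
        ∑ i, Φ.dx i ((N.factorial : ℂ)⁻¹ • a N (Φ.dp i f)) - (N.factorial : ℂ)⁻¹ •
          a N (∑ i, Φ.dq i (Φ.dp i f) + ∑ l, Φ.p l * Φ.gammaDD G l f) := by
      rw [hsucc, smul_smul, Nat.factorial_succ]
      push_cast
      rw [mul_inv, ← mul_assoc, mul_inv_cancel₀ hN, one_mul, smul_sub, smul_sum]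
      simp only [map_smul]
    simp only
    rw [lhs]
    simp only [ih]
    rw [smul_sum]
    have rhs : ∀ m ∈ HasAntidiagonal.antidiagonal (N + 1), ((N : ℂ) + 1) •
        ((m.2.factorial : ℂ)⁻¹ • ι (Φ.flatB m.2 (S m.1 f) h)) =
        (m.2.factorial : ℂ)⁻¹ • ι (Φ.flatB m.2 (∑ i, Φ.p i * S m.1 (Φ.dp i f)) h) +
        (m.2.factorial : ℂ)⁻¹ • ι (Φ.flatB m.2 (IsSymbolFamily.weighted T m.1 f) h) := by
      intro m hm
      have : m.1 + m.2 = N + 1 := by simpa using hm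
      rw [smul_comm, ← smul_add, ← weight]
      congr 2
      exact_mod_cast this.symm
    rw [sum_congr rfl rhs, sum_add_distrib]
    rw [Finset.Nat.sum_antidiagonal_succ' (f := fun m => (m.2.factorial : ℂ)⁻¹ •
      ι (Φ.flatB m.2 (∑ i, Φ.p i * S m.1 (Φ.dp i f)) h)),
      Finset.Nat.sum_antidiagonal_succ (f := fun m => (m.2.factorial : ℂ)⁻¹ •
      ι (Φ.flatB m.2 (IsSymbolFamily.weighted T m.1 f) h))]
    simp only [hT.weighted_zero, LinearMap.zero_apply, map_zero, smul_zero, zero_add]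
    have z : ι (Φ.flatB 0 (∑ i, Φ.p i * S (N + 1) (Φ.dp i f)) h) = 0 := by
      simp [flatB_zero, hp, sum_mul]
    rw [z, smul_zero, zero_add]
    simp only [map_sum, map_smul, dx_flatB hpull hdq, smul_add, sum_add_distrib]
    have c1 : ∀ F : Fin n → ℕ × ℕ → B, ∑ i, ∑ m ∈ HasAntidiagonal.antidiagonal N, F i m =
        ∑ m ∈ HasAntidiagonal.antidiagonal N, ∑ i, F i m := fun F => sum_comm
    simp only [c1]
    have c2 : ∀ (s : Finset (ℕ × ℕ)) (F₁ F₂ F₃ F₄ F₅ : ℕ × ℕ → B),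
        (∀ m ∈ s, F₁ m + F₂ m - F₃ m = F₄ m + F₅ m) →
        ∑ m ∈ s, F₁ m + ∑ m ∈ s, F₂ m - ∑ m ∈ s, F₃ m = ∑ m ∈ s, F₄ m + ∑ m ∈ s, F₅ m := by
      intro s F₁ F₂ F₃ F₄ F₅ hF
      rw [← sum_add_distrib, ← sum_add_distrib, ← sum_sub_distrib]
      exact sum_congr rfl hF
    refine c2 _ _ _ _ _ _ fun m hm => ?_
    have fac : (((m.2 + 1).factorial : ℂ))⁻¹ * ((m.2 : ℂ) + 1) = (m.2.factorial : ℂ)⁻¹ := by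
      have : ((m.2 : ℂ) + 1) ≠ 0 := by exact_mod_cast Nat.succ_ne_zero m.2
      rw [Nat.factorial_succ]
      push_cast
      field_simp
    rw [← map_sum (Φ.flatB (m.2 + 1)), flatB_sum_mul_p hp, smul_smul, fac, hT.weighted_succ]
    simp only [LinearMap.sub_apply, LinearMap.sum_apply, Module.End.mul_apply, map_sub, map_sum,
      map_add, LinearMap.add_apply, smul_sub, smul_sum, smul_add, LinearMap.mulLeft_apply,
      sum_sub_distrib, ← hS]
    simp only [← Φ.dp_dq]
    abel

end Representation

end PhaseAlgebra

end

section

theorem ite_one_zero_mul {R : Type*} [Semiring R] (P : Prop) [Decidable P] (x : R) :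
    (if P then 1 else 0) * x = if P then x else 0 := by
  split_ifs <;> simp

namespace PhaseAlgebra

open Finset

variable {n : ℕ} {A B : Type*} [CommRing A] [Algebra ℂ A] [CommRing B] [Algebra ℂ B]
  (Φ : PhaseAlgebra n A B)

/-! ### Iterated covariant derivatives -/

/-- `∂_{p_{I_1}} ⋯ ∂_{p_{I_r}}`. -/
def iterDp : (r : ℕ) → (Fin r → Fin n) → A →ₗ[ℂ] A
  | 0, _ => LinearMap.id
  | r + 1, I => Φ.dp (I 0) ∘ₗ iterDp r (fun m => I m.succ)

theorem iterDp_succ (r : ℕ) (I : Fin (r + 1) → Fin n) (f : A) :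
    Φ.iterDp (r + 1) I f = Φ.dp (I 0) (Φ.iterDp r (fun m => I m.succ) f) := rfl

theorem iterDp_dp (r : ℕ) (I : Fin r → Fin n) (i : Fin n) (f : A) :
    Φ.iterDp r I (Φ.dp i f) = Φ.dp i (Φ.iterDp r I f) := by
  induction r generalizing f with
  | zero => rfl
  | succ r ih => simp only [iterDp, LinearMap.comp_apply, ih, Φ.dp_comm i]

theorem iterDp_dq (r : ℕ) (I : Fin r → Fin n) (i : Fin n) (f : A) :
    Φ.iterDp r I (Φ.dq i f) = Φ.dq i (Φ.iterDp r I f) := by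
  induction r generalizing f with
  | zero => rfl
  | succ r ih => simp only [iterDp, LinearMap.comp_apply, ih, Φ.dp_dq]

theorem iterDp_pull_mul (r : ℕ) (I : Fin r → Fin n) (u : B) (f : A) :
    Φ.iterDp r I (Φ.pull u * f) = Φ.pull u * Φ.iterDp r I f := by
  induction r generalizing f with
  | zero => rfl
  | succ r ih =>
    simp only [iterDp, LinearMap.comp_apply, ih, Φ.dp_mul, Φ.dp_pull, zero_mul, zero_add]

theorem iterDp_succAbove (r : ℕ) (I : Fin (r + 1) → Fin n) (m : Fin (r + 1)) (f : A) :
    Φ.iterDp (r + 1) I f = Φ.iterDp r (fun k => I (m.succAbove k)) (Φ.dp (I m) f) := by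
  induction r with
  | zero =>
    have : m = 0 := by ext; omega
    subst this; rfl
  | succ r ih =>
    refine Fin.cases ?_ (fun m => ?_) m
    · rw [iterDp_dp]; rfl
    · rw [iterDp_succ, ih _ m, iterDp_succ]
      simp [Fin.succ_succAbove_zero, Fin.succ_succAbove_succ]

theorem iterDp_mul_p (r : ℕ) (I : Fin (r + 1) → Fin n) (l : Fin n) (g : A) :
    Φ.iterDp (r + 1) I (Φ.p l * g) = Φ.p l * Φ.iterDp (r + 1) I g +
      ∑ m, if I m = l then Φ.iterDp r (fun k => I (m.succAbove k)) g else 0 := by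
  induction r with
  | zero =>
    have h : ∀ f, Φ.iterDp (0 + 1) I f = Φ.dp (I 0) f := fun f => rfl
    rw [h, h, Φ.dp_mul, Φ.dp_p, Fin.sum_univ_succ]
    by_cases hI : I 0 = l <;> simp [hI, iterDp, add_comm]
  | succ r ih =>
    have h : ∀ f, Φ.iterDp (r + 1 + 1) I f = Φ.dp (I 0) (Φ.iterDp (r + 1) (fun k => I k.succ) f) :=
      fun f => rfl
    rw [h, ih, map_add, Φ.dp_mul, ← h, Φ.dp_p]
    have e : Φ.dp (I 0) (∑ m : Fin (r + 1), if I m.succ = l then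
        Φ.iterDp r (fun k => I (m.succAbove k).succ) g else 0) =
        ∑ m : Fin (r + 1), if I m.succ = l then
          Φ.iterDp (r + 1) (fun k => I (m.succ.succAbove k)) g else 0 := by
      rw [map_sum]
      refine sum_congr rfl fun m _ => ?_
      split_ifs
      · rw [iterDp_succ]
        simp [Fin.succ_succAbove_zero, Fin.succ_succAbove_succ]
      · simp
    rw [e, Fin.sum_univ_succ (n := r + 1)]
    by_cases hI : I 0 = l
    · simp [hI]; ring
    · simp [hI]

/-- The components of the iterated covariant derivatives of a function on the base. -/
structure IsIterCov (G : Fin n → Fin n → Fin n → B) (u : B)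
    (cov : (r : ℕ) → (Fin r → Fin n) → B) : Prop where
  zero : ∀ I, cov 0 I = u
  succ : ∀ r I, cov (r + 1) I = Φ.dx (I 0) (cov r fun m => I m.succ) -
    ∑ m : Fin r, ∑ l, G l (I 0) (I m.succ) * cov r (Function.update (fun k => I k.succ) m l)

/-- `f ↦ ∑_I (∇^r u)_I ι^* ∂_p^I f`. -/
def covSum (ι : A →ₐ[ℂ] B) (cov : (r : ℕ) → (Fin r → Fin n) → B) (r : ℕ) : A →ₗ[ℂ] B :=
  ∑ I, LinearMap.mulLeft ℂ (cov r I) ∘ₗ ι.toLinearMap ∘ₗ Φ.iterDp r I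

theorem covSum_apply (ι : A →ₐ[ℂ] B) (cov : (r : ℕ) → (Fin r → Fin n) → B) (r : ℕ) (f : A) :
    Φ.covSum ι cov r f = ∑ I, cov r I * ι (Φ.iterDp r I f) := by
  simp [covSum, LinearMap.sum_apply]

theorem covSum_pull_mul {ι : A →ₐ[ℂ] B} (hpull : ∀ u, ι (Φ.pull u) = u)
    (cov : (r : ℕ) → (Fin r → Fin n) → B) (r : ℕ) (u : B) (f : A) :
    Φ.covSum ι cov r (Φ.pull u * f) = u * Φ.covSum ι cov r f := by
  simp only [covSum_apply, iterDp_pull_mul, map_mul, hpull, mul_sum, mul_left_comm]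

variable {Φ}

theorem IsIterCov.covSum_zero {G : Fin n → Fin n → Fin n → B} {u : B}
    {cov : (r : ℕ) → (Fin r → Fin n) → B} (h : Φ.IsIterCov G u cov) (ι : A →ₐ[ℂ] B) (f : A) :
    Φ.covSum ι cov 0 f = u * ι f := by
  rw [covSum_apply]
  simp [h.zero, iterDp]

theorem IsIterCov.covSum_succ {G : Fin n → Fin n → Fin n → B} {u : B}
    {cov : (r : ℕ) → (Fin r → Fin n) → B} (h : Φ.IsIterCov G u cov) {ι : A →ₐ[ℂ] B}
    (hpull : ∀ u, ι (Φ.pull u) = u) (hp : ∀ i, ι (Φ.p i) = 0)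
    (hdq : ∀ i f, ι (Φ.dq i f) = Φ.dx i (ι f)) (r : ℕ) (f : A) :
    Φ.covSum ι cov (r + 1) f = ∑ i, Φ.dx i (Φ.covSum ι cov r (Φ.dp i f)) -
      Φ.covSum ι cov r (∑ i, Φ.dq i (Φ.dp i f) + ∑ l, Φ.p l * Φ.gammaDD G l f) := by
  have e1 : Φ.covSum ι cov (r + 1) f = ∑ i, ∑ I : Fin r → Fin n,
      (Φ.dx i (cov r I) * ι (Φ.iterDp r I (Φ.dp i f)) -
        ∑ m : Fin r, ∑ l, G l i (I m) * cov r (Function.update I m l) *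
          ι (Φ.iterDp r I (Φ.dp i f))) := by
    rw [covSum_apply, ← (Fin.consEquiv fun _ => Fin n).sum_comp, Fintype.sum_prod_type]
    refine sum_congr rfl fun i _ => sum_congr rfl fun I _ => ?_
    rw [h.succ, sub_mul, sum_mul]
    simp only [sum_mul, iterDp, LinearMap.comp_apply, iterDp_dp, Fin.consEquiv_apply, Fin.cons_zero,
      Fin.cons_succ]
  have e2 : ∀ i, Φ.dx i (Φ.covSum ι cov r (Φ.dp i f)) = ∑ I : Fin r → Fin n,
      Φ.dx i (cov r I) * ι (Φ.iterDp r I (Φ.dp i f)) + Φ.covSum ι cov r (Φ.dq i (Φ.dp i f)) := by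
    intro i
    rw [covSum_apply, covSum_apply, map_sum, ← sum_add_distrib]
    refine sum_congr rfl fun I _ => ?_
    rw [Φ.dx_mul, ← hdq, iterDp_dq]
  have e3 : ∑ i, ∑ I : Fin r → Fin n, ∑ m : Fin r, ∑ l,
      G l i (I m) * cov r (Function.update I m l) * ι (Φ.iterDp r I (Φ.dp i f)) =
      Φ.covSum ι cov r (∑ l, Φ.p l * Φ.gammaDD G l f) := by
    cases r with
    | zero => simp [covSum_apply, iterDp, map_sum, hp]
    | succ r =>
      have l1 : ∀ i, ∑ I : Fin (r + 1) → Fin n, ∑ m : Fin (r + 1), ∑ l,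
          G l i (I m) * cov (r + 1) (Function.update I m l) * ι (Φ.iterDp (r + 1) I (Φ.dp i f)) =
          ∑ m : Fin (r + 1), ∑ k, ∑ I : Fin r → Fin n, ∑ l, G l i k * cov (r + 1) (m.insertNth l I) *
            ι (Φ.iterDp r I (Φ.dp i (Φ.dp k f))) := by
        intro i
        rw [sum_comm]
        refine sum_congr rfl fun m _ => ?_
        rw [← (Fin.insertNthEquiv (fun _ => Fin n) m).sum_comp, Fintype.sum_prod_type]
        refine sum_congr rfl fun k _ => sum_congr rfl fun I _ => sum_congr rfl fun l _ => ?_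
        have e : (Fin.insertNthEquiv (fun _ => Fin n) m) (k, I) = m.insertNth k I := rfl
        rw [e, Fin.insertNth_apply_same, Fin.update_insertNth]
        rw [Φ.iterDp_succAbove r _ m]
        simp only [Fin.insertNth_apply_same, Fin.insertNth_apply_succAbove]
        rw [Φ.dp_comm k i]
      have l2 : ∀ (I : Fin (r + 1) → Fin n) (l : Fin n) (g : A),
          ι (Φ.iterDp (r + 1) I (Φ.p l * g)) =
            ∑ m, if I m = l then ι (Φ.iterDp r (fun k => I (m.succAbove k)) g) else 0 := by
        intro I l g
        rw [iterDp_mul_p, map_add, map_mul, hp, zero_mul, zero_add, map_sum]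
        exact sum_congr rfl fun m _ => by split_ifs <;> simp
      have l3 : ∀ g : Fin n → A, Φ.covSum ι cov (r + 1) (∑ l, Φ.p l * g l) =
          ∑ m : Fin (r + 1), ∑ l, ∑ I : Fin r → Fin n, cov (r + 1) (m.insertNth l I) *
            ι (Φ.iterDp r I (g l)) := by
        intro g
        rw [covSum_apply]
        simp only [map_sum, l2, mul_sum]
        rw [sum_congr rfl fun I _ => sum_comm, sum_comm]
        refine sum_congr rfl fun m _ => ?_
        rw [← (Fin.insertNthEquiv (fun _ => Fin n) m).sum_comp, Fintype.sum_prod_type]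
        refine sum_congr rfl fun k _ => sum_congr rfl fun I _ => ?_
        have e : (Fin.insertNthEquiv (fun _ => Fin n) m) (k, I) = m.insertNth k I := rfl
        simp [e]
      rw [l3, sum_congr rfl fun i _ => l1 i, sum_comm]
      refine sum_congr rfl fun m _ => ?_
      simp only [gammaDD, LinearMap.sum_apply, map_sum, mul_sum, Module.End.mul_apply,
        LinearMap.mulLeft_apply, iterDp_pull_mul, map_mul, hpull]
      calc _ = ∑ i, ∑ k, ∑ l, ∑ I : Fin r → Fin n, cov (r + 1) (m.insertNth l I) *
            (G l i k * ι (Φ.iterDp r I (Φ.dp i (Φ.dp k f)))) := by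
              refine sum_congr rfl fun i _ => sum_congr rfl fun k _ => ?_
              rw [sum_comm]
              exact sum_congr rfl fun l _ => sum_congr rfl fun I _ => by ring
        _ = ∑ i, ∑ l, ∑ I : Fin r → Fin n, ∑ k, cov (r + 1) (m.insertNth l I) *
            (G l i k * ι (Φ.iterDp r I (Φ.dp i (Φ.dp k f)))) := by
              refine sum_congr rfl fun i _ => ?_
              rw [sum_comm]
              exact sum_congr rfl fun l _ => sum_comm
        _ = _ := by
              rw [sum_comm]
              exact sum_congr rfl fun l _ => sum_comm
  rw [e1]
  simp only [sum_sub_distrib, e3, e2, sum_add_distrib, map_add, map_sum]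
  abel

/-! ### Change of charts -/

variable (Φ) in
/-- The Laplacian of a connection on phase space. -/
def lap (G : Fin n → Fin n → Fin n → B) (f : A) : A :=
  ∑ k, Φ.dp k (Φ.dq k f) + ∑ k, ∑ l, ∑ j, Φ.p l * Φ.pull (G l j k) * Φ.dp j (Φ.dp k f) +
    ∑ k, ∑ j, Φ.pull (G j j k) * Φ.dp k f

theorem lap_eq (G : Fin n → Fin n → Fin n → B) (f : A) :
    Φ.lap G f = ∑ i, Φ.dq i (Φ.dp i f) + ∑ l, Φ.p l * Φ.gammaDD G l f +
      ∑ k, ∑ j, Φ.pull (G j j k) * Φ.dp k f := by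
  unfold lap
  congr 2
  · exact sum_congr rfl fun k _ => Φ.dp_dq k k f
  · simp only [gammaDD, LinearMap.sum_apply, mul_sum, Module.End.mul_apply, LinearMap.mulLeft_apply]
    rw [sum_comm]
    refine sum_congr rfl fun l _ => ?_
    rw [sum_comm]
    exact sum_congr rfl fun i _ => sum_congr rfl fun k _ => mul_assoc _ _ _

/-- The transformation of coordinates, with Jacobian `K = ∂x'/∂x` and its inverse `J`. -/
structure ChartChange (Φ Φ' : PhaseAlgebra n A B) (G G' : Fin n → Fin n → Fin n → B)
    (K J : Fin n → Fin n → B) : Prop where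
  pull_eq : ∀ u, Φ'.pull u = Φ.pull u
  K_J : ∀ l m, ∑ j, K l j * J j m = if l = m then 1 else 0
  J_K : ∀ l m, ∑ j, J l j * K j m = if l = m then 1 else 0
  p_eq : ∀ j, Φ.p j = ∑ l, Φ'.p l * Φ.pull (K l j)
  dp_eq : ∀ k f, Φ'.dp k f = ∑ j, Φ.pull (K k j) * Φ.dp j f
  dx_eq : ∀ k u, Φ'.dx k u = ∑ j, J j k * Φ.dx j u
  dq_eq : ∀ k f, Φ'.dq k f = ∑ j, Φ.pull (J j k) * Φ.dq j f +
    ∑ l, ∑ j, Φ'.p l * Φ.pull (Φ'.dx k (K l j)) * Φ.dp j f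
  christoffel_eq : ∀ l a b, ∑ j, ∑ k, G' l j k * K j a * K k b =
    ∑ m, K l m * G m a b - Φ.dx a (K l b)

namespace ChartChange

variable {Φ Φ' : PhaseAlgebra n A B} {G G' : Fin n → Fin n → Fin n → B} {K J : Fin n → Fin n → B}
  (h : ChartChange Φ Φ' G G' K J)

include h

theorem dx_eq' (j : Fin n) (u : B) : Φ.dx j u = ∑ k, K k j * Φ'.dx k u := by
  simp only [h.dx_eq, mul_sum]
  rw [sum_comm]
  have : ∀ m, ∑ k, K k j * (J m k * Φ.dx m u) = if m = j then Φ.dx m u else 0 := by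
    intro m
    rw [← ite_one_zero_mul, ← h.J_K m j, sum_mul]
    exact sum_congr rfl fun k _ => by ring
  simp [this]

theorem trace_eq (b : Fin n) : ∑ k, (∑ j, G' j j k) * K k b =
    ∑ a, G a a b - ∑ l, Φ'.dx l (K l b) := by
  have h1 : ∑ k, (∑ j, G' j j k) * K k b =
      ∑ l, ∑ a, J a l * ∑ j, ∑ k, G' l j k * K j a * K k b := by
    have : ∀ l, ∑ a, J a l * ∑ j, ∑ k, G' l j k * K j a * K k b =
        ∑ j, (∑ a, K j a * J a l) * ∑ k, G' l j k * K k b := by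
      intro l
      simp only [mul_sum, sum_mul]
      rw [sum_comm]
      refine sum_congr rfl fun j _ => ?_
      rw [sum_comm]
      exact sum_congr rfl fun k _ => sum_congr rfl fun a _ => by ring
    simp only [this, h.K_J, ite_mul, one_mul, zero_mul, sum_ite_eq', mem_univ, if_true, sum_mul]
    exact sum_comm
  rw [h1]
  simp only [h.christoffel_eq, mul_sub, sum_sub_distrib, h.dx_eq]
  congr 1
  simp only [mul_sum]
  have h2 : ∀ m a, ∑ l, J a l * (K l m * G m a b) = if a = m then G m a b else 0 := by
    intro m a
    rw [← ite_one_zero_mul, ← h.J_K a m, sum_mul]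
    exact sum_congr rfl fun k _ => by ring
  rw [sum_comm]
  refine sum_congr rfl fun a _ => ?_
  rw [sum_comm]
  simp [h2]

theorem lap_eq (f : A) : Φ'.lap G' f = Φ.lap G f := by
  set X := ∑ a, ∑ b, ∑ l, Φ'.p l * Φ.pull (Φ.dx a (K l b)) * Φ.dp a (Φ.dp b f) with hX
  set Y := ∑ l, ∑ j, Φ.pull (Φ'.dx l (K l j)) * Φ.dp j f with hY
  have t1 : ∑ k, Φ'.dp k (Φ'.dq k f) = ∑ k, Φ.dp k (Φ.dq k f) + Y + X := by
    have s1 : ∀ k, Φ'.dp k (Φ'.dq k f) = ∑ j, Φ.pull (J j k) * Φ'.dp k (Φ.dq j f) +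
        ∑ j, Φ.pull (Φ'.dx k (K k j)) * Φ.dp j f +
        ∑ l, ∑ j, Φ'.p l * Φ.pull (Φ'.dx k (K l j)) * Φ'.dp k (Φ.dp j f) := by
      intro k
      rw [h.dq_eq, map_add, map_sum, map_sum, add_assoc]
      congr 1
      · refine sum_congr rfl fun j _ => ?_
        rw [Φ'.dp_mul, ← h.pull_eq, Φ'.dp_pull, zero_mul, zero_add]
      · simp only [map_sum, Φ'.dp_mul, Φ'.dp_p, ← h.pull_eq, Φ'.dp_pull, mul_zero, add_zero,
          sum_add_distrib]
        congr 1
        rw [sum_eq_single k]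
        · simp
        · intro l _ hl; simp [Ne.symm hl]
        · simp
    have s2 : ∑ k, ∑ j, Φ.pull (J j k) * Φ'.dp k (Φ.dq j f) = ∑ k, Φ.dp k (Φ.dq k f) := by
      simp only [h.dp_eq, mul_sum]
      rw [sum_comm]
      refine sum_congr rfl fun j _ => ?_
      rw [sum_comm]
      have : ∀ m, ∑ k, Φ.pull (J j k) * (Φ.pull (K k m) * Φ.dp m (Φ.dq j f)) =
          if j = m then Φ.dp m (Φ.dq j f) else 0 := by
        intro m
        rw [← ite_one_zero_mul]
        have := congrArg Φ.pull (h.J_K j m)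
        rw [map_sum] at this
        have e : Φ.pull (if j = m then 1 else 0) = if j = m then 1 else 0 := by
          split_ifs <;> simp
        rw [e] at this
        rw [← this, sum_mul]
        exact sum_congr rfl fun k _ => by rw [map_mul]; ring
      simp [this]
    have s3 : ∑ k, ∑ l, ∑ j, Φ'.p l * Φ.pull (Φ'.dx k (K l j)) * Φ'.dp k (Φ.dp j f) = X := by
      rw [hX]
      have : ∀ l j, ∑ k, Φ'.p l * Φ.pull (Φ'.dx k (K l j)) * Φ'.dp k (Φ.dp j f) =
          ∑ a, Φ'.p l * Φ.pull (Φ.dx a (K l j)) * Φ.dp a (Φ.dp j f) := by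
        intro l j
        simp only [h.dp_eq, h.dx_eq' _ (K l j), map_sum, mul_sum, sum_mul, map_mul]
        rw [sum_comm]
        exact sum_congr rfl fun k _ => sum_congr rfl fun a _ => by ring
      calc _ = ∑ l, ∑ j, ∑ k, Φ'.p l * Φ.pull (Φ'.dx k (K l j)) * Φ'.dp k (Φ.dp j f) := by
            rw [sum_comm]
            exact sum_congr rfl fun l _ => sum_comm
        _ = ∑ l, ∑ j, ∑ a, Φ'.p l * Φ.pull (Φ.dx a (K l j)) * Φ.dp a (Φ.dp j f) :=
            sum_congr rfl fun l _ => sum_congr rfl fun j _ => this l j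
        _ = _ := by
            rw [sum_congr rfl fun l _ => sum_comm, sum_comm]
            exact sum_congr rfl fun a _ => sum_comm
    simp only [s1, sum_add_distrib]
    rw [s2, s3]
  have t2 : ∑ k, ∑ l, ∑ j, Φ'.p l * Φ'.pull (G' l j k) * Φ'.dp j (Φ'.dp k f) =
      ∑ k, ∑ l, ∑ j, Φ.p l * Φ.pull (G l j k) * Φ.dp j (Φ.dp k f) - X := by
    have s1 : ∀ j k, Φ'.dp j (Φ'.dp k f) =
        ∑ a, ∑ b, Φ.pull (K j a * K k b) * Φ.dp a (Φ.dp b f) := by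
      intro j k
      rw [h.dp_eq k f, map_sum]
      simp only [Φ'.dp_mul, ← h.pull_eq, Φ'.dp_pull, zero_mul, zero_add]
      simp only [h.pull_eq, h.dp_eq, mul_sum, map_mul]
      rw [sum_comm]
      exact sum_congr rfl fun k _ => sum_congr rfl fun a _ => by ring
    have s2 : ∀ l, ∑ k, ∑ j, Φ'.p l * Φ'.pull (G' l j k) * Φ'.dp j (Φ'.dp k f) =
        ∑ a, ∑ b, Φ'.p l * Φ.pull (∑ j, ∑ k, G' l j k * K j a * K k b) * Φ.dp a (Φ.dp b f) := by
      intro l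
      simp only [s1, h.pull_eq, mul_sum, map_sum, sum_mul]
      calc _ = ∑ k, ∑ a, ∑ b, ∑ j, Φ'.p l * Φ.pull (G' l j k) *
              (Φ.pull (K j a * K k b) * Φ.dp a (Φ.dp b f)) := by
            refine sum_congr rfl fun k _ => ?_
            rw [sum_comm]
            exact sum_congr rfl fun a _ => sum_comm
        _ = ∑ a, ∑ b, ∑ k, ∑ j, Φ'.p l * Φ.pull (G' l j k) *
              (Φ.pull (K j a * K k b) * Φ.dp a (Φ.dp b f)) := by
            rw [sum_comm]
            exact sum_congr rfl fun a _ => sum_comm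
        _ = _ := by
            refine sum_congr rfl fun a _ => sum_congr rfl fun b _ => ?_
            rw [sum_comm]
            exact sum_congr rfl fun j _ => sum_congr rfl fun k _ => by
              simp only [map_mul]; ring
    have s3 : ∀ a b, ∑ l, Φ'.p l * Φ.pull (∑ m, K l m * G m a b) = ∑ m, Φ.p m * Φ.pull (G m a b) := by
      intro a b
      simp only [h.p_eq, map_sum, mul_sum, sum_mul, map_mul]
      rw [sum_comm]
      exact sum_congr rfl fun m _ => sum_congr rfl fun l _ => by ring
    calc _ = ∑ l, ∑ a, ∑ b, Φ'.p l * Φ.pull (∑ j, ∑ k, G' l j k * K j a * K k b) *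
            Φ.dp a (Φ.dp b f) := by
          rw [sum_comm]
          exact sum_congr rfl fun l _ => s2 l
      _ = ∑ a, ∑ b, ∑ l, Φ'.p l * Φ.pull (∑ j, ∑ k, G' l j k * K j a * K k b) *
            Φ.dp a (Φ.dp b f) := by
          rw [sum_comm]
          exact sum_congr rfl fun a _ => sum_comm
      _ = ∑ a, ∑ b, (∑ m, Φ.p m * Φ.pull (G m a b)) * Φ.dp a (Φ.dp b f) - X := by
          rw [hX, ← sum_sub_distrib]
          refine sum_congr rfl fun a _ => ?_
          rw [← sum_sub_distrib]
          refine sum_congr rfl fun b _ => ?_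
          rw [← s3, sum_mul, ← sum_sub_distrib]
          refine sum_congr rfl fun l _ => ?_
          rw [h.christoffel_eq, map_sub]
          ring
      _ = _ := by
          congr 1
          rw [sum_comm]
          refine sum_congr rfl fun b _ => ?_
          simp only [sum_mul]
          rw [sum_comm]
  have t3 : ∑ k, ∑ j, Φ'.pull (G' j j k) * Φ'.dp k f =
      ∑ k, ∑ j, Φ.pull (G j j k) * Φ.dp k f - Y := by
    have s1 : ∑ k, ∑ j, Φ'.pull (G' j j k) * Φ'.dp k f =
        ∑ b, Φ.pull (∑ k, (∑ j, G' j j k) * K k b) * Φ.dp b f := by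
      simp only [h.pull_eq, h.dp_eq, map_sum, sum_mul, mul_sum, map_mul]
      calc _ = ∑ k, ∑ b, ∑ j, Φ.pull (G' j j k) * (Φ.pull (K k b) * Φ.dp b f) :=
            sum_congr rfl fun k _ => sum_comm
        _ = _ := by
            rw [sum_comm]
            exact sum_congr rfl fun k _ => sum_congr rfl fun b _ =>
              sum_congr rfl fun j _ => by ring
    rw [s1]
    simp only [h.trace_eq, map_sub, sub_mul, sum_sub_distrib]
    simp only [map_sum, sum_mul]
    rw [hY]
    congr 1
    exact sum_comm
  unfold lap
  rw [t1, t2, t3]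
  abel

/-- The operators with given symbol in the sense of a connection do not depend on the chart. -/
theorem symbol_eq {ι : A →ₐ[ℂ] B} {a a' : ℕ → A →ₗ[ℂ] B} (h0 : ∀ f, a' 0 f = a 0 f)
    (hpull : ∀ r u f, a r (Φ.pull u * f) = u * a r f)
    (hpull' : ∀ r u f, a' r (Φ'.pull u * f) = u * a' r f)
    (hsucc : ∀ r f, a (r + 1) f = ∑ i, Φ.dx i (a r (Φ.dp i f)) -
      a r (∑ i, Φ.dq i (Φ.dp i f) + ∑ l, Φ.p l * Φ.gammaDD G l f))
    (hsucc' : ∀ r f, a' (r + 1) f = ∑ i, Φ'.dx i (a' r (Φ'.dp i f)) -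
      a' r (∑ i, Φ'.dq i (Φ'.dp i f) + ∑ l, Φ'.p l * Φ'.gammaDD G' l f)) (r : ℕ) (f : A) :
    a' r f = a r f := by
  induction r generalizing f with
  | zero => exact h0 f
  | succ r ih =>
    have e : ∀ f, a (r + 1) f = ∑ i, Φ.dx i (a r (Φ.dp i f)) +
        ∑ i, (∑ j, G j j i) * a r (Φ.dp i f) - a r (Φ.lap G f) := by
      intro f
      rw [hsucc, PhaseAlgebra.lap_eq, map_add (a r) _ (∑ k, ∑ j, Φ.pull (G j j k) * Φ.dp k f)]
      have : a r (∑ k, ∑ j, Φ.pull (G j j k) * Φ.dp k f) =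
          ∑ i, (∑ j, G j j i) * a r (Φ.dp i f) := by
        simp only [map_sum (a r), hpull, sum_mul]
      rw [this]
      abel
    have e' : ∀ f, a' (r + 1) f = ∑ i, Φ'.dx i (a' r (Φ'.dp i f)) +
        ∑ i, (∑ j, G' j j i) * a' r (Φ'.dp i f) - a' r (Φ'.lap G' f) := by
      intro f
      rw [hsucc', PhaseAlgebra.lap_eq, map_add (a' r) _ (∑ k, ∑ j, Φ'.pull (G' j j k) * Φ'.dp k f)]
      have : a' r (∑ k, ∑ j, Φ'.pull (G' j j k) * Φ'.dp k f) =
          ∑ i, (∑ j, G' j j i) * a' r (Φ'.dp i f) := by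
        simp only [map_sum (a' r), hpull', sum_mul]
      rw [this]
      abel
    rw [e, e', h.lap_eq, ih]
    congr 1
    simp only [ih, h.dp_eq, map_sum, hpull, Φ'.dx_mul, sum_add_distrib, mul_sum]
    have s1 : ∑ i, ∑ j, K i j * Φ'.dx i (a r (Φ.dp j f)) = ∑ j, Φ.dx j (a r (Φ.dp j f)) := by
      rw [sum_comm]
      exact sum_congr rfl fun j _ => (h.dx_eq' j _).symm
    have s2 : ∑ i, ∑ b, (∑ j, G' j j i) * (K i b * a r (Φ.dp b f)) =
        ∑ b, (∑ j, G j j b) * a r (Φ.dp b f) - ∑ i, ∑ b, Φ'.dx i (K i b) * a r (Φ.dp b f) := by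
      rw [sum_comm, sum_comm (f := fun i b => Φ'.dx i (K i b) * a r (Φ.dp b f)),
        ← sum_sub_distrib]
      refine sum_congr rfl fun b _ => ?_
      rw [← sum_mul, ← sub_mul, ← h.trace_eq, sum_mul]
      exact sum_congr rfl fun i _ => by ring
    rw [s1, s2]
    abel

end ChartChange

end PhaseAlgebra

end

section

section Conjugation

open Finset HasAntidiagonal

theorem formalOp_const {X Y : Type*} [Zero X] [AddCommMonoid Y] {S : ℕ → X → Y}
    (hS : ∀ r, S r 0 = 0) (x : X) : formalOp S (Formal.const x) = fun N => S N x := by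
  funext N
  rw [formalOp, sum_eq_single (N, 0)]
  · rfl
  · intro m hm hm'
    rw [HasAntidiagonal.mem_antidiagonal] at hm
    rw [Formal.const, if_neg fun h => hm' (Prod.ext (by simp; omega) h), hS]
  · intro h; simp at h

theorem formalBilin_const_right {X Y Z : Type*} [Zero Y] [AddCommMonoid Z] {B : ℕ → X → Y → Z}
    (hB : ∀ r x, B r x 0 = 0) (f : Formal X) (y : Y) :
    formalBilin B f (Formal.const y) = formalOp (fun r x => B r x y) f := by
  funext N
  refine sum_congr rfl fun m _ => ?_
  rw [sum_eq_single (m.2, 0)]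
  · rfl
  · intro m' hm hm'
    rw [HasAntidiagonal.mem_antidiagonal] at hm
    rw [Formal.const, if_neg fun h => hm' (Prod.ext (by simp; omega) h), hB]
  · intro h; simp at h

theorem formalBilin_const_left {X Y Z : Type*} [Zero X] [AddCommMonoid Z] {B : ℕ → X → Y → Z}
    (hB : ∀ r y, B r 0 y = 0) (x : X) (g : Formal Y) :
    formalBilin B (Formal.const x) g = formalOp (fun r y => B r x y) g := by
  funext N
  refine sum_congr rfl fun m _ => ?_
  rw [sum_eq_single (0, m.2)]
  · rfl
  · intro m' hm hm'
    rw [HasAntidiagonal.mem_antidiagonal] at hm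
    rw [Formal.const, if_neg fun h => hm' (Prod.ext h (by simp; omega)), hB]
  · intro h; simp at h

theorem formalBilin_const_const {X Y Z : Type*} [Zero X] [Zero Y] [AddCommMonoid Z]
    {B : ℕ → X → Y → Z} (hB : ∀ r x, B r x 0 = 0) (hB' : ∀ r y, B r 0 y = 0) (x : X) (y : Y) :
    formalBilin B (Formal.const x) (Formal.const y) = fun N => B N x y := by
  rw [formalBilin_const_right hB, formalOp_const fun r => hB' r y]

/-- The cochains of the product `R(C(S f, S g))`. -/
def conjCochain {X : Type*} [AddCommMonoid X] (R : ℕ → X → X) (C : ℕ → X → X → X) (S : ℕ → X → X)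
    (t : ℕ) (f g : X) : X :=
  ∑ m ∈ HasAntidiagonal.antidiagonal t, ∑ m' ∈ HasAntidiagonal.antidiagonal m.2,
    ∑ m'' ∈ HasAntidiagonal.antidiagonal m'.2, R m.1 (C m'.1 (S m''.1 f) (S m''.2 g))

variable {A : Type*} [AddCommGroup A] [Module ℂ A]

theorem formalOp_formalBilin_formalOp (R : ℕ → A →ₗ[ℂ] A) (C : ℕ → A →ₗ[ℂ] A →ₗ[ℂ] A)
    (S : ℕ → A →ₗ[ℂ] A) (f g : Formal A) :
    formalOp (fun r => R r) (formalBilin (fun r x y => C r x y) (formalOp (fun r => S r) f)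
      (formalOp (fun r => S r) g)) =
      formalBilin (conjCochain (fun r => R r) (fun r x y => C r x y) (fun r => S r)) f g := by
  funext N
  simp only [formalOp, formalBilin, conjCochain, map_sum, LinearMap.sum_apply, sum_sigma']
  refine sum_nbij'
    (fun ⟨(a, b), (c, d), (e, h), x, y⟩ => ⟨(a + (c + (y.1 + x.1)), y.2 + x.2), (y.2, x.2),
      (a, c + (y.1 + x.1)), (c, y.1 + x.1), (y.1, x.1)⟩)
    (fun ⟨(t, w), (j, l), (a, x), (c, y), (i, k)⟩ => ⟨(a, x + w), (c, y + w), (i + j, k + l),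
      (k, l), (i, j)⟩) ?_ ?_ ?_ ?_ fun _ _ => rfl
  all_goals
    rintro ⟨⟨a, b⟩, ⟨c, d⟩, ⟨e, h⟩, ⟨i, j⟩, ⟨k, l⟩⟩ H
    simp only [mem_sigma, HasAntidiagonal.mem_antidiagonal, and_true, true_and, Sigma.mk.injEq,
      Prod.mk.injEq, heq_eq_eq] at H ⊢
    omega

/-- `∑ λ^r R_r` is the inverse of `∑ λ^r S_r`, and both begin with the identity. -/
structure IsInvSeries (S R : ℕ → Module.End ℂ A) : Prop where
  left_zero : S 0 = 1
  right_zero : R 0 = 1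
  succ : ∀ N, ∑ m ∈ HasAntidiagonal.antidiagonal (N + 1), S m.1 * R m.2 = 0

theorem formalOp_injective {S : ℕ → Module.End ℂ A} (hS : S 0 = 1) :
    Function.Injective (formalOp fun r => (S r : A → A)) := by
  intro f g h
  have key : ∀ N, ∀ k ≤ N, f k = g k := by
    intro N
    induction N with
    | zero =>
      intro k hk
      obtain rfl : k = 0 := by omega
      have := congrFun h 0
      simpa [formalOp, hS] using this
    | succ N ih =>
      intro k hk
      rcases Nat.lt_or_ge k (N + 1) with hk' | hk'
      · exact ih k (by omega)
      · obtain rfl : k = N + 1 := by omega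
        have := congrFun h (N + 1)
        simp only [formalOp] at this
        rw [Nat.sum_antidiagonal_succ, Nat.sum_antidiagonal_succ] at this
        have e : ∑ p ∈ HasAntidiagonal.antidiagonal N, S (p.1 + 1) (f p.2) =
            ∑ p ∈ HasAntidiagonal.antidiagonal N, S (p.1 + 1) (g p.2) := by
          refine sum_congr rfl fun p hp => ?_
          rw [HasAntidiagonal.mem_antidiagonal] at hp
          rw [ih p.2 (by omega)]
        rw [e] at this
        simpa [hS] using this
  exact funext fun N => key N N le_rfl

theorem IsInvSeries.formalOp_right {S R : ℕ → Module.End ℂ A} (h : IsInvSeries S R)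
    (f : Formal A) : formalOp (fun r => S r) (formalOp (fun r => R r) f) = f := by
  rw [formalOp_formalOp]
  funext N
  have : ∀ t x, ∑ m ∈ HasAntidiagonal.antidiagonal t, S m.1 (R m.2 x) =
      (∑ m ∈ HasAntidiagonal.antidiagonal t, S m.1 * R m.2) x := fun t x => by
    simp [LinearMap.sum_apply]
  simp only [formalOp, this]
  rcases N with _ | N
  · simp [h.left_zero, h.right_zero]
  · rw [Nat.sum_antidiagonal_succ]
    simp [h.succ, h.left_zero, h.right_zero]

theorem IsInvSeries.formalOp_left {S R : ℕ → Module.End ℂ A} (h : IsInvSeries S R)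
    (f : Formal A) : formalOp (fun r => R r) (formalOp (fun r => S r) f) = f :=
  formalOp_injective h.left_zero (h.formalOp_right _)

end Conjugation

namespace PhaseAlgebra

open Finset

variable {n : ℕ} {A B : Type*} [CommRing A] [Algebra ℂ A] [CommRing B] [Algebra ℂ B]
  (Φ : PhaseAlgebra n A B)

/-! ### Functions polynomial in the momenta -/

/-- All the products of `d` momentum derivatives vanish on `f`. -/
def IsNil : ℕ → A → Prop
  | 0, f => f = 0
  | d + 1, f => ∀ i, IsNil d (Φ.dp i f)

variable {Φ}

theorem IsNil.zero (d : ℕ) : Φ.IsNil d 0 := by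
  induction d with
  | zero => rfl
  | succ d ih => intro i; rwa [map_zero]

theorem IsNil.succ {d : ℕ} {f : A} (h : Φ.IsNil d f) : Φ.IsNil (d + 1) f := by
  induction d generalizing f with
  | zero => intro i; rw [show f = 0 from h, map_zero]; exact IsNil.zero 0
  | succ d ih => exact fun i => ih (h i)

theorem IsNil.mono {d d' : ℕ} {f : A} (h : Φ.IsNil d f) (hd : d ≤ d') : Φ.IsNil d' f := by
  induction hd with
  | refl => exact h
  | step _ ih => exact ih.succ

theorem IsNil.add {d : ℕ} {f g : A} (hf : Φ.IsNil d f) (hg : Φ.IsNil d g) :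
    Φ.IsNil d (f + g) := by
  induction d generalizing f g with
  | zero => rw [show f = 0 from hf, show g = 0 from hg, add_zero]; exact IsNil.zero 0
  | succ d ih => intro i; rw [map_add]; exact ih (hf i) (hg i)

theorem IsNil.smul {d : ℕ} {f : A} (c : ℂ) (hf : Φ.IsNil d f) : Φ.IsNil d (c • f) := by
  induction d generalizing f with
  | zero => rw [show f = 0 from hf, smul_zero]; exact IsNil.zero 0
  | succ d ih => intro i; rw [map_smul]; exact ih (hf i)

theorem IsNil.sub {d : ℕ} {f g : A} (hf : Φ.IsNil d f) (hg : Φ.IsNil d g) :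
    Φ.IsNil d (f - g) := by
  simpa [sub_eq_add_neg] using hf.add (hg.smul (-1))

theorem IsNil.sum {ι : Type*} {s : Finset ι} {d : ℕ} {f : ι → A}
    (h : ∀ i ∈ s, Φ.IsNil d (f i)) : Φ.IsNil d (∑ i ∈ s, f i) := by
  classical
  induction s using Finset.induction_on with
  | empty => simpa using IsNil.zero d
  | insert a s ha ih =>
    rw [sum_insert ha]
    exact (h a (mem_insert_self _ _)).add (ih fun i hi => h i (mem_insert_of_mem hi))

theorem IsNil.dp {d : ℕ} {f : A} (hf : Φ.IsNil d f) (j : Fin n) : Φ.IsNil d (Φ.dp j f) := by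
  induction d generalizing f with
  | zero => rw [show f = 0 from hf, map_zero]; exact IsNil.zero 0
  | succ d ih => intro i; rw [Φ.dp_comm]; exact ih (hf i)

theorem IsNil.dq {d : ℕ} {f : A} (hf : Φ.IsNil d f) (j : Fin n) : Φ.IsNil d (Φ.dq j f) := by
  induction d generalizing f with
  | zero => rw [show f = 0 from hf, map_zero]; exact IsNil.zero 0
  | succ d ih => intro i; rw [Φ.dp_dq]; exact ih (hf i)

theorem IsNil.pull (u : B) : Φ.IsNil 1 (Φ.pull u) := fun i => Φ.dp_pull i u

theorem IsNil.mulPull {d : ℕ} {f : A} (hf : Φ.IsNil d f) (u : B) :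
    Φ.IsNil d (Φ.pull u * f) := by
  induction d generalizing f with
  | zero => rw [show f = 0 from hf, mul_zero]; exact IsNil.zero 0
  | succ d ih => intro i; rw [Φ.dp_mul, Φ.dp_pull, zero_mul, zero_add]; exact ih (hf i)

theorem IsNil.mul {d d' : ℕ} {f g : A} (hf : Φ.IsNil d f) (hg : Φ.IsNil d' g) :
    Φ.IsNil (d + d') (f * g) := by
  induction h : d + d' generalizing d d' f g with
  | zero =>
    obtain ⟨rfl, rfl⟩ : d = 0 ∧ d' = 0 := by omega
    rw [show f = 0 from hf, zero_mul]; exact IsNil.zero 0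
  | succ k ih =>
    intro i
    rw [Φ.dp_mul]
    refine IsNil.add ?_ ?_
    · rcases d with _ | d
      · rw [show f = 0 from hf, map_zero, zero_mul]; exact IsNil.zero k
      · exact ih (hf i) hg (by omega)
    · rcases d' with _ | d'
      · rw [show g = 0 from hg, map_zero, mul_zero]; exact IsNil.zero k
      · exact ih hf (hg i) (by omega)

theorem IsNil.mulP {d : ℕ} {f : A} (hf : Φ.IsNil d f) (l : Fin n) :
    Φ.IsNil (d + 1) (Φ.p l * f) := by
  induction d generalizing f with
  | zero => rw [show f = 0 from hf, mul_zero]; exact IsNil.zero 1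
  | succ d ih =>
    intro i
    rw [Φ.dp_mul, Φ.dp_p]
    refine IsNil.add ?_ (ih (hf i))
    split_ifs
    · rwa [one_mul]
    · rw [zero_mul]; exact IsNil.zero _

theorem IsNil.of_dp_pow {k : Fin n → ℕ} {f : A} (h : ∀ i, ((Φ.dp i) ^ (k i)) f = 0) :
    Φ.IsNil (∑ i, k i + 1) f := by
  induction hm : ∑ i, k i generalizing k f with
  | zero =>
    intro i
    have : k i = 0 := by
      have := (sum_eq_zero_iff.1 hm) i (mem_univ i)
      exact this
    have h' := h i
    rw [this, pow_zero] at h'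
    rw [show f = 0 from h', map_zero]; exact IsNil.zero 0
  | succ m ih =>
    intro i
    rcases hk : k i with _ | a
    · have h' := h i
      rw [hk, pow_zero] at h'
      rw [show f = 0 from h', map_zero]; exact IsNil.zero _
    · refine ih (k := Function.update k i a) (fun j => ?_) ?_
      · by_cases hj : j = i
        · subst hj
          have h' := h j
          rw [hk, pow_succ] at h'
          simpa using h'
        · rw [Function.update_of_ne hj]
          have hc : Commute (Φ.dp j ^ k j) (Φ.dp i) :=
            Commute.pow_left (LinearMap.ext fun g => Φ.dp_comm j i g) _
          have := congrArg (fun X : Module.End ℂ A => X f) hc.eq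
          simp only [Module.End.mul_apply] at this
          rw [this, h j, map_zero]
      · rw [sum_update_of_mem (mem_univ i)]
        have := add_sum_erase univ k (mem_univ i)
        rw [← sdiff_singleton_eq_erase] at this
        omega

/-- `P` maps polynomials of degree `< d` to polynomials of degree `< d + m`. -/
def Lifts (Φ : PhaseAlgebra n A B) (m : ℕ) (P : Module.End ℂ A) : Prop :=
  ∀ d f, Φ.IsNil d f → Φ.IsNil (d + m) (P f)

theorem Lifts.mul {m m' : ℕ} {P P' : Module.End ℂ A} (h : Φ.Lifts m P) (h' : Φ.Lifts m' P') :
    Φ.Lifts (m + m') (P * P') := fun d f hf => by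
  have := h _ _ (h' d f hf)
  rwa [add_assoc, add_comm m'] at this

theorem Lifts.mono {m m' : ℕ} {P : Module.End ℂ A} (h : Φ.Lifts m P) (hm : m ≤ m') :
    Φ.Lifts m' P := fun d f hf => (h d f hf).mono (by omega)

theorem Lifts.add {m : ℕ} {P P' : Module.End ℂ A} (h : Φ.Lifts m P) (h' : Φ.Lifts m P') :
    Φ.Lifts m (P + P') := fun d f hf => (h d f hf).add (h' d f hf)

theorem Lifts.sub {m : ℕ} {P P' : Module.End ℂ A} (h : Φ.Lifts m P) (h' : Φ.Lifts m P') :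
    Φ.Lifts m (P - P') := fun d f hf => (h d f hf).sub (h' d f hf)

theorem Lifts.smul {m : ℕ} {P : Module.End ℂ A} (c : ℂ) (h : Φ.Lifts m P) : Φ.Lifts m (c • P) :=
  fun d f hf => (h d f hf).smul c

theorem Lifts.zero {m : ℕ} : Φ.Lifts m 0 := fun _ _ _ => IsNil.zero _

theorem Lifts.one {m : ℕ} : Φ.Lifts m 1 := fun _ _ h => h.mono (by omega)

theorem Lifts.sum {ι : Type*} {s : Finset ι} {m : ℕ} {P : ι → Module.End ℂ A}
    (h : ∀ i ∈ s, Φ.Lifts m (P i)) : Φ.Lifts m (∑ i ∈ s, P i) := fun d f hf => by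
  rw [LinearMap.sum_apply]; exact IsNil.sum fun i hi => h i hi d f hf

theorem Lifts.dp (i : Fin n) : Φ.Lifts 0 (Φ.dp i) := fun _ _ h => h.dp i

theorem Lifts.dq (i : Fin n) : Φ.Lifts 0 (Φ.dq i) := fun _ _ h => h.dq i

theorem Lifts.mulPull (u : B) : Φ.Lifts 0 (Φ.mulPull u) := fun _ _ h => h.mulPull u

theorem Lifts.mulP (l : Fin n) : Φ.Lifts 1 (Φ.mulP l) := fun _ _ h => h.mulP l

theorem Lifts.gammaDD (G : Fin n → Fin n → Fin n → B) (l : Fin n) : Φ.Lifts 0 (Φ.gammaDD G l) :=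
  Lifts.sum fun i _ => Lifts.sum fun k _ =>
    ((Lifts.mulPull _).mul (Lifts.dp i)).mul (Lifts.dp k)

theorem IsSymbolFamily.lifts {G : Fin n → Fin n → Fin n → B} {T : ℕ → ℕ → Module.End ℂ A}
    (hT : Φ.IsSymbolFamily G T) (j d : ℕ) : Φ.Lifts j (T j d) := by
  induction j generalizing d with
  | zero =>
    cases d with
    | zero => rw [hT.zero_zero]; exact Lifts.one
    | succ d => rw [hT.zero_succ]; exact Lifts.zero
  | succ j ih =>
    cases d with
    | zero => rw [hT.succ_zero]; exact Lifts.zero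
    | succ d =>
      have hd : (d : ℂ) + 1 ≠ 0 := by exact_mod_cast Nat.succ_ne_zero d
      rw [← inv_smul_smul₀ hd (T (j + 1) (d + 1)), hT.succ_succ]
      have hprev : Φ.Lifts j (prevTerm (T j) d) := by
        cases d with
        | zero => exact Lifts.zero
        | succ d => exact ih d
      refine Lifts.smul _ (Lifts.sub (Lifts.sum fun i _ => Lifts.sub ?_ ?_) (Lifts.sum fun l _ => ?_))
      · exact (((Lifts.dq i).mul (ih d)).mul (Lifts.dp i)).mono (by omega)
      · exact (((ih d).mul (Lifts.dq i)).mul (Lifts.dp i)).mono (by omega)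
      · refine (Lifts.mul (m := j + 1) (Lifts.add (Lifts.sub ?_ ?_) ?_) (Lifts.gammaDD G l)).mono (by omega)
        · exact (ih d).mul (Lifts.mulP l)
        · exact ((Lifts.mulP l).mul (ih d)).mono (by omega)
        · exact ((Lifts.mulP l).mul hprev).mono (by omega)

theorem IsNil.flatB {d d' : ℕ} {f g : A} (hf : Φ.IsNil d f) (hg : Φ.IsNil d' g) (r : ℕ) :
    Φ.IsNil (d + d') (Φ.flatB r f g) := by
  induction r generalizing f g with
  | zero => exact hf.mul hg
  | succ r ih => rw [flatB_succ]; exact IsNil.sum fun i _ => ih (hf.dp i) (hg.dq i)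

theorem Lifts.of_invSeries {S R : ℕ → Module.End ℂ A} (h : IsInvSeries S R)
    (hS : ∀ j, Φ.Lifts j (S j)) (j : ℕ) : Φ.Lifts j (R j) := by
  induction j using Nat.strong_induction_on with
  | _ j ih =>
    cases j with
    | zero => rw [h.right_zero]; exact Lifts.one
    | succ j =>
      have h1 := h.succ j
      rw [Finset.Nat.sum_antidiagonal_succ] at h1
      simp only [h.left_zero, one_mul] at h1
      rw [eq_neg_of_add_eq_zero_left h1, ← neg_one_smul ℂ]
      refine Lifts.smul _ (Lifts.sum fun m hm => ?_)
      rw [Finset.HasAntidiagonal.mem_antidiagonal] at hm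
      exact ((hS _).mul (ih m.2 (by omega))).mono (by omega)

end PhaseAlgebra

end

section

namespace PhaseAlgebra

open Finset

variable {n : ℕ} {A B : Type*} [CommRing A] [Algebra ℂ A] [CommRing B] [Algebra ℂ B]
  (Φ : PhaseAlgebra n A B)

/-! ### Sections with constant momenta and fibre Taylor polynomials -/

/-- `σ` is the restriction to the section with constant momenta `c`. -/
structure IsSection (c : Fin n → ℂ) (σ : A →ₐ[ℂ] B) : Prop where
  pull : ∀ u, σ (Φ.pull u) = u
  p : ∀ i, σ (Φ.p i) = algebraMap ℂ B (c i)
  dq : ∀ i f, σ (Φ.dq i f) = Φ.dx i (σ f)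

/-- The momentum derivatives of order at most `M` of `f` vanish on the section `σ`. -/
def IsFlat (σ : A →ₐ[ℂ] B) : ℕ → A → Prop
  | 0, f => σ f = 0
  | M + 1, f => σ f = 0 ∧ ∀ i, IsFlat σ M (Φ.dp i f)

variable {Φ} {σ : A →ₐ[ℂ] B} {c : Fin n → ℂ}

theorem IsFlat.apply {M : ℕ} {f : A} (h : Φ.IsFlat σ M f) : σ f = 0 := by
  cases M with
  | zero => exact h
  | succ M => exact h.1

theorem IsFlat.of_succ {M : ℕ} {f : A} (h : Φ.IsFlat σ (M + 1) f) : Φ.IsFlat σ M f := by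
  induction M generalizing f with
  | zero => exact h.1
  | succ M ih => exact ⟨h.1, fun i => ih (h.2 i)⟩

theorem IsFlat.mono {M M' : ℕ} {f : A} (h : Φ.IsFlat σ M' f) (hM : M ≤ M') : Φ.IsFlat σ M f := by
  induction hM with
  | refl => exact h
  | step _ ih => exact ih h.of_succ

theorem IsFlat.add {M : ℕ} {f g : A} (hf : Φ.IsFlat σ M f) (hg : Φ.IsFlat σ M g) :
    Φ.IsFlat σ M (f + g) := by
  induction M generalizing f g with
  | zero => change σ (f + g) = 0; rw [map_add, hf.apply, hg.apply, add_zero]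
  | succ M ih =>
    exact ⟨by rw [map_add, hf.apply, hg.apply, add_zero],
      fun i => by rw [map_add]; exact ih (hf.2 i) (hg.2 i)⟩

theorem IsFlat.mul_left {M : ℕ} {f : A} (a : A) (hf : Φ.IsFlat σ M f) :
    Φ.IsFlat σ M (a * f) := by
  induction M generalizing f a with
  | zero => change σ (a * f) = 0; rw [map_mul, hf.apply, mul_zero]
  | succ M ih =>
    exact ⟨by rw [map_mul, hf.apply, mul_zero],
      fun i => by rw [Φ.dp_mul]; exact (ih _ hf.of_succ).add (ih _ (hf.2 i))⟩

theorem IsFlat.smul {M : ℕ} {f : A} (a : ℂ) (hf : Φ.IsFlat σ M f) : Φ.IsFlat σ M (a • f) := by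
  rw [Algebra.smul_def]; exact hf.mul_left _

theorem IsFlat.dp {M : ℕ} {f : A} (hf : Φ.IsFlat σ (M + 1) f) (i : Fin n) :
    Φ.IsFlat σ M (Φ.dp i f) := hf.2 i

theorem IsFlat.dq (hσ : Φ.IsSection c σ) {M : ℕ} {f : A} (hf : Φ.IsFlat σ M f) (j : Fin n) :
    Φ.IsFlat σ M (Φ.dq j f) := by
  induction M generalizing f with
  | zero => change σ (Φ.dq j f) = 0; rw [hσ.dq, hf.apply, map_zero]
  | succ M ih =>
    exact ⟨by rw [hσ.dq, hf.apply, map_zero], fun i => by rw [Φ.dp_dq]; exact ih (hf.2 i)⟩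

variable (Φ σ) in
/-- The operators under which flatness along `σ` decreases by a bounded order. -/
def flatBdd : Subalgebra ℂ (Module.End ℂ A) where
  carrier := {P | ∃ k, ∀ M f, Φ.IsFlat σ (M + k) f → Φ.IsFlat σ M (P f)}
  mul_mem' := by
    rintro P P' ⟨k, h⟩ ⟨k', h'⟩
    refine ⟨k + k', fun M f hf => ?_⟩
    rw [← add_assoc] at hf
    exact h _ _ (h' _ _ hf)
  add_mem' := by
    rintro P P' ⟨k, h⟩ ⟨k', h'⟩
    exact ⟨k + k', fun M f hf =>
      (h _ _ (hf.mono (by omega))).add (h' _ _ (hf.mono (by omega)))⟩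
  algebraMap_mem' r := ⟨0, fun M f hf => by
    rw [Module.algebraMap_end_apply]; exact hf.smul r⟩

theorem dp_mem_flatBdd (i : Fin n) : Φ.dp i ∈ Φ.flatBdd σ := ⟨1, fun _ _ h => h.dp i⟩

theorem dq_mem_flatBdd (hσ : Φ.IsSection c σ) (i : Fin n) : Φ.dq i ∈ Φ.flatBdd σ :=
  ⟨0, fun _ _ h => h.dq hσ i⟩

theorem mulLeft_mem_flatBdd (a : A) : LinearMap.mulLeft ℂ a ∈ Φ.flatBdd σ :=
  ⟨0, fun _ _ h => h.mul_left a⟩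

theorem gammaDD_mem {𝒮 : Subalgebra ℂ (Module.End ℂ A)} (hdp : ∀ i, Φ.dp i ∈ 𝒮)
    (hpull : ∀ u, Φ.mulPull u ∈ 𝒮) (G : Fin n → Fin n → Fin n → B) (l : Fin n) :
    Φ.gammaDD G l ∈ 𝒮 :=
  sum_mem fun i _ => sum_mem fun k _ => mul_mem (mul_mem (hpull _) (hdp i)) (hdp k)

theorem IsSymbolFamily.mem {𝒮 : Subalgebra ℂ (Module.End ℂ A)} (hdq : ∀ i, Φ.dq i ∈ 𝒮)
    (hdp : ∀ i, Φ.dp i ∈ 𝒮) (hp : ∀ i, Φ.mulP i ∈ 𝒮) (hpull : ∀ u, Φ.mulPull u ∈ 𝒮)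
    {G : Fin n → Fin n → Fin n → B} {T : ℕ → ℕ → Module.End ℂ A}
    (hT : Φ.IsSymbolFamily G T) (j d : ℕ) : T j d ∈ 𝒮 := by
  induction j generalizing d with
  | zero =>
    cases d with
    | zero => rw [hT.zero_zero]; exact one_mem _
    | succ d => rw [hT.zero_succ]; exact zero_mem _
  | succ j ih =>
    cases d with
    | zero => rw [hT.succ_zero]; exact zero_mem _
    | succ d =>
      have hd : (d : ℂ) + 1 ≠ 0 := by exact_mod_cast Nat.succ_ne_zero d
      rw [← inv_smul_smul₀ hd (T (j + 1) (d + 1)), hT.succ_succ]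
      have hprev : prevTerm (T j) d ∈ 𝒮 := by
        cases d with
        | zero => exact zero_mem _
        | succ d => exact ih d
      refine 𝒮.smul_mem (sub_mem (sum_mem fun i _ => sub_mem ?_ ?_) (sum_mem fun l _ => ?_)) _
      · exact mul_mem (mul_mem (hdq i) (ih d)) (hdp i)
      · exact mul_mem (mul_mem (ih d) (hdq i)) (hdp i)
      · exact mul_mem (add_mem (sub_mem (mul_mem (ih d) (hp l)) (mul_mem (hp l) (ih d)))
          (mul_mem (hp l) hprev)) (gammaDD_mem hdp hpull G l)

theorem _root_.IsInvSeries.mem {𝒮 : Subalgebra ℂ (Module.End ℂ A)} {S R : ℕ → Module.End ℂ A}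
    (h : IsInvSeries S R) (hS : ∀ j, S j ∈ 𝒮) (j : ℕ) : R j ∈ 𝒮 := by
  induction j using Nat.strong_induction_on with
  | _ j ih =>
    cases j with
    | zero => rw [h.right_zero]; exact one_mem _
    | succ j =>
      have h1 := h.succ j
      rw [Finset.Nat.sum_antidiagonal_succ] at h1
      simp only [h.left_zero, one_mul] at h1
      rw [eq_neg_of_add_eq_zero_left h1]
      refine neg_mem (sum_mem fun m hm => ?_)
      rw [Finset.HasAntidiagonal.mem_antidiagonal] at hm
      exact mul_mem (hS _) (ih m.2 (by omega))

variable (Φ σ) in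
/-- Bilinear operators under which flatness along `σ` decreases by a bounded order. -/
def FlatBdd₂ (D : A → A → A) : Prop :=
  ∃ k, ∀ M f g, (Φ.IsFlat σ (M + k) f ∨ Φ.IsFlat σ (M + k) g) → Φ.IsFlat σ M (D f g)

theorem FlatBdd₂.mul : Φ.FlatBdd₂ σ (fun f g => f * g) :=
  ⟨0, fun _ f g h => h.elim (fun h => show Φ.IsFlat σ _ (f * g) by
    rw [mul_comm]; exact h.mul_left g) fun h => h.mul_left f⟩

theorem FlatBdd₂.zero : Φ.FlatBdd₂ σ (fun _ _ => 0) :=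
  ⟨0, fun M f g h => by
    have : ∀ a : A, Φ.IsFlat σ M ((0 : A) * a) → Φ.IsFlat σ M 0 := fun a h => by rwa [zero_mul] at h
    rcases h with h | h
    · exact this f (h.mul_left 0)
    · exact this g (h.mul_left 0)⟩

theorem FlatBdd₂.add {D D' : A → A → A} (h : Φ.FlatBdd₂ σ D) (h' : Φ.FlatBdd₂ σ D') :
    Φ.FlatBdd₂ σ (fun f g => D f g + D' f g) := by
  obtain ⟨k, hk⟩ := h
  obtain ⟨k', hk'⟩ := h'
  exact ⟨k + k', fun M f g h =>
    (hk M f g (h.imp (fun h => h.mono (by omega)) fun h => h.mono (by omega))).add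
      (hk' M f g (h.imp (fun h => h.mono (by omega)) fun h => h.mono (by omega)))⟩

theorem FlatBdd₂.smul {D : A → A → A} (c : ℂ) (h : Φ.FlatBdd₂ σ D) :
    Φ.FlatBdd₂ σ (fun f g => c • D f g) := by
  obtain ⟨k, hk⟩ := h
  exact ⟨k, fun M f g h => (hk M f g h).smul c⟩

theorem FlatBdd₂.sum {ι : Type*} {s : Finset ι} {D : ι → A → A → A}
    (h : ∀ i ∈ s, Φ.FlatBdd₂ σ (D i)) : Φ.FlatBdd₂ σ (fun f g => ∑ i ∈ s, D i f g) := by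
  classical
  induction s using Finset.induction_on with
  | empty => simpa using FlatBdd₂.zero
  | insert a s ha ih =>
    simp only [sum_insert ha]
    exact (h a (mem_insert_self _ _)).add (ih fun i hi => h i (mem_insert_of_mem hi))

theorem FlatBdd₂.comp {D : A → A → A} (h : Φ.FlatBdd₂ σ D) {P Q : Module.End ℂ A}
    (hP : P ∈ Φ.flatBdd σ) (hQ : Q ∈ Φ.flatBdd σ) : Φ.FlatBdd₂ σ (fun f g => D (P f) (Q g)) := by
  obtain ⟨k, hk⟩ := h
  obtain ⟨a, ha⟩ := hP
  obtain ⟨b, hb⟩ := hQ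
  exact ⟨k + a + b, fun M f g h => hk M _ _ (h.imp (fun h => ha _ _ (h.mono (by omega)))
    fun h => hb _ _ (h.mono (by omega)))⟩

theorem FlatBdd₂.postcomp {D : A → A → A} (h : Φ.FlatBdd₂ σ D) {P : Module.End ℂ A}
    (hP : P ∈ Φ.flatBdd σ) : Φ.FlatBdd₂ σ (fun f g => P (D f g)) := by
  obtain ⟨k, hk⟩ := h
  obtain ⟨a, ha⟩ := hP
  exact ⟨a + k, fun M f g h => ha _ _ (hk _ _ _ (by rwa [add_assoc]))⟩

theorem FlatBdd₂.flatC {Ψ : PhaseAlgebra n A B} (hdq : ∀ i, Ψ.dq i ∈ Φ.flatBdd σ)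
    (hdp : ∀ i, Ψ.dp i ∈ Φ.flatBdd σ) (c : ℂ) (r : ℕ) :
    Φ.FlatBdd₂ σ (fun f g => Ψ.flatC c r f g) := by
  have : Φ.FlatBdd₂ σ (fun f g => Ψ.flatB r f g) := by
    induction r with
    | zero => exact FlatBdd₂.mul
    | succ r ih =>
      simp only [flatB_succ]
      exact FlatBdd₂.sum fun i _ => ih.comp (hdp i) (hdq i)
  exact this.smul _

theorem FlatBdd₂.conjCochain {S R : ℕ → Module.End ℂ A} {C : ℕ → A →ₗ[ℂ] A →ₗ[ℂ] A}
    (hS : ∀ j, S j ∈ Φ.flatBdd σ) (hR : ∀ j, R j ∈ Φ.flatBdd σ)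
    (hC : ∀ r, Φ.FlatBdd₂ σ (fun f g => C r f g)) (N : ℕ) :
    Φ.FlatBdd₂ σ (_root_.conjCochain (fun r => R r) (fun r x y => C r x y) (fun r => S r) N) :=
  FlatBdd₂.sum fun _ _ => FlatBdd₂.sum fun _ _ => FlatBdd₂.sum fun _ _ =>
    ((hC _).comp (hS _) (hS _)).postcomp (hR _)

variable (Φ σ c) in
/-- The homogeneous part of degree `r`, multiplied by `r!`, of the Taylor series of a function
along the section `σ`. -/
def taylorTerm : ℕ → A →ₗ[ℂ] A
  | 0 => Φ.pull.toLinearMap ∘ₗ σ.toLinearMap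
  | r + 1 => ∑ i, LinearMap.mulLeft ℂ (Φ.p i - algebraMap ℂ A (c i)) ∘ₗ taylorTerm r ∘ₗ Φ.dp i

variable (Φ σ c) in
theorem taylorTerm_succ (r : ℕ) (f : A) : Φ.taylorTerm σ c (r + 1) f =
    ∑ i, (Φ.p i - algebraMap ℂ A (c i)) * Φ.taylorTerm σ c r (Φ.dp i f) := by
  simp [taylorTerm, LinearMap.sum_apply]

theorem dp_algebraMap (i : Fin n) (a : ℂ) : Φ.dp i (algebraMap ℂ A a) = 0 := by
  rw [← Φ.pull.commutes, Φ.dp_pull]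

theorem dp_taylorTerm (r : ℕ) (j : Fin n) (f : A) : Φ.dp j (Φ.taylorTerm σ c (r + 1) f) =
    ((r : ℂ) + 1) • Φ.taylorTerm σ c r (Φ.dp j f) := by
  induction r generalizing f with
  | zero =>
    rw [taylorTerm_succ, map_sum]
    simp [Φ.dp_mul, Φ.dp_p, dp_algebraMap, taylorTerm, Φ.dp_pull]
  | succ r ih =>
    rw [taylorTerm_succ, map_sum]
    simp only [Φ.dp_mul, map_sub, Φ.dp_p, dp_algebraMap, sub_zero, ih, sum_add_distrib,
      ite_one_zero_mul]
    rw [Fintype.sum_ite_eq, taylorTerm_succ]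
    simp only [mul_smul_comm, ← smul_sum, Φ.dp_comm _ j]
    push_cast
    module

theorem IsNil.taylorTerm (r : ℕ) (f : A) : Φ.IsNil (r + 1) (Φ.taylorTerm σ c r f) := by
  induction r generalizing f with
  | zero => exact IsNil.pull _
  | succ r ih =>
    intro j
    rw [dp_taylorTerm]
    exact (ih _).smul _

variable (Φ σ c) in
/-- The fibre Taylor polynomial of degree `M` along the section `σ`. -/
def taylor (M : ℕ) (f : A) : A :=
  ∑ r ∈ range (M + 1), (r.factorial : ℂ)⁻¹ • Φ.taylorTerm σ c r f

theorem IsNil.taylor (M : ℕ) (f : A) : Φ.IsNil (M + 1) (Φ.taylor σ c M f) :=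
  IsNil.sum fun r hr => ((IsNil.taylorTerm r f).smul _).mono (by simpa using hr)

theorem IsSection.isFlat_sub_taylor (hσ : Φ.IsSection c σ) (M : ℕ) (f : A) :
    Φ.IsFlat σ M (f - Φ.taylor σ c M f) := by
  have h0 : ∀ M f, σ (f - Φ.taylor σ c M f) = 0 := by
    intro M f
    rw [PhaseAlgebra.taylor, sum_range_succ']
    simp [PhaseAlgebra.taylorTerm_succ, PhaseAlgebra.taylorTerm, hσ.pull, hσ.p]
  induction M generalizing f with
  | zero => exact h0 0 f
  | succ M ih =>
    refine ⟨h0 _ _, fun i => ?_⟩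
    have h1 : Φ.dp i (Φ.taylor σ c (M + 1) f) = Φ.taylor σ c M (Φ.dp i f) := by
      rw [PhaseAlgebra.taylor, sum_range_succ', map_add, map_sum, PhaseAlgebra.taylor]
      have : Φ.dp i ((Nat.factorial 0 : ℂ)⁻¹ • Φ.taylorTerm σ c 0 f) = 0 := by
        simp [PhaseAlgebra.taylorTerm, Φ.dp_pull]
      rw [this, add_zero]
      refine sum_congr rfl fun r _ => ?_
      rw [map_smul, dp_taylorTerm, smul_smul]
      congr 1
      have h1 : (r.factorial : ℂ) ≠ 0 := by exact_mod_cast r.factorial_ne_zero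
      have h2 : (r : ℂ) + 1 ≠ 0 := by exact_mod_cast Nat.succ_ne_zero r
      rw [Nat.factorial_succ]
      push_cast
      field_simp
    rw [map_sub, h1]
    exact ih _

/-- A bilinear operator with bounded loss of flatness which vanishes on functions polynomial in
the momenta vanishes on the section. -/
theorem FlatBdd₂.eq_zero (hσ : Φ.IsSection c σ) {D : A → A → A} (hD : Φ.FlatBdd₂ σ D)
    (hl : ∀ f f' g, D (f - f') g = D f g - D f' g) (hr : ∀ f g g', D f (g - g') = D f g - D f g')
    (h0 : ∀ f g d d', Φ.IsNil d f → Φ.IsNil d' g → D f g = 0) (f g : A) : σ (D f g) = 0 := by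
  obtain ⟨k, hk⟩ := hD
  have h1 := (hk 0 _ g (Or.inl ((hσ.isFlat_sub_taylor k f).mono (by omega)))).apply
  have h2 := (hk 0 (Φ.taylor σ c k f) _
    (Or.inr ((hσ.isFlat_sub_taylor k g).mono (by omega)))).apply
  rw [hl, map_sub, sub_eq_zero] at h1
  rw [hr, h0 _ _ _ _ (IsNil.taylor k f) (IsNil.taylor k g), sub_zero] at h2
  rw [h1, h2]

/-! ### The representation of a flat symbol -/

variable (Φ) in
/-- The coefficients of `ι(S f ⋆ π^*u)`, with the flat product. -/
def repC (ι : A →ₐ[ℂ] B) (S : ℕ → Module.End ℂ A) (N : ℕ) (f : A) (u : B) : B :=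
  ∑ m ∈ HasAntidiagonal.antidiagonal N, ι (Φ.flatC (-Complex.I) m.1 (S m.2 f) (Φ.pull u))

theorem formalBilin_repC (ι : A →ₐ[ℂ] B) (S : ℕ → Module.End ℂ A) (f : Formal A) (u : Formal B)
    (N : ℕ) : formalBilin (Φ.repC ι S) f u N =
      ι (formalBilin (fun r x y => Φ.flatC (-Complex.I) r x y) (formalOp (fun r => S r) f)
        (fun r => Φ.pull (u r)) N) := by
  have := formalBilin_formalOp_left (Φ.flatC (-Complex.I)) (fun r => S r) f (fun r => Φ.pull (u r))
  rw [this]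
  simp only [formalBilin, map_sum]
  rfl

variable (Φ) in
theorem flatC_formal_assoc (a : ℂ) (f g h : Formal A) :
    formalBilin (fun r x y => Φ.flatC a r x y) (formalBilin (fun r x y => Φ.flatC a r x y) f g) h =
      formalBilin (fun r x y => Φ.flatC a r x y) f
        (formalBilin (fun r x y => Φ.flatC a r x y) g h) := by
  rw [formalBilin_formalBilin_left, formalBilin_formalBilin_right]
  simp only [flatC_assoc]

theorem repC_hom {ι : A →ₐ[ℂ] B} (hι : Φ.IsSection 0 ι) {S R : ℕ → Module.End ℂ A}
    (hR : IsInvSeries S R) (f g : Formal A) (u : Formal B) :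
    formalBilin (Φ.repC ι S) (formalBilin (conjCochain (fun r => R r)
      (fun r x y => Φ.flatC (-Complex.I) r x y) (fun r => S r)) f g) u =
      formalBilin (Φ.repC ι S) f (formalBilin (Φ.repC ι S) g u) := by
  funext N
  have key : ∀ f X Y : Formal A, (∀ k, ι (X k) = ι (Y k)) →
      ι (formalBilin (fun r x y => Φ.flatC (-Complex.I) r x y) f X N) =
        ι (formalBilin (fun r x y => Φ.flatC (-Complex.I) r x y) f Y N) := by
    intro f X Y h
    simp only [formalBilin, map_sum]
    refine sum_congr rfl fun m _ => sum_congr rfl fun m' _ => ?_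
    rw [flatC_apply, flatC_apply, map_smul, map_smul, flatB_congr_right hι.dq m.1 _ (h _)]
  rw [formalBilin_repC, ← formalOp_formalBilin_formalOp, hR.formalOp_right, flatC_formal_assoc,
    formalBilin_repC]
  exact key _ _ _ fun k => by rw [hι.pull, formalBilin_repC]

theorem IsSymbolFamily.repC_eq {G : Fin n → Fin n → Fin n → B} {T : ℕ → ℕ → Module.End ℂ A}
    (hT : Φ.IsSymbolFamily G T) {ι : A →ₐ[ℂ] B} (hι : Φ.IsSection 0 ι) {u : B}
    {cov : (r : ℕ) → (Fin r → Fin n) → B} (hcov : Φ.IsIterCov G u cov) (N : ℕ) (f : A) :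
    Φ.repC ι (fun j => (-Complex.I) ^ j • total T j) N f u =
      ((-Complex.I) ^ N / (N.factorial : ℂ)) • Φ.covSum ι cov N f := by
  have hp : ∀ i, ι (Φ.p i) = 0 := fun i => by rw [hι.p]; simp
  have h := hT.flat_symbol hι.pull hp hι.dq u (Φ.covSum ι cov) (hcov.covSum_zero ι)
    (hcov.covSum_succ hι.pull hp hι.dq) N f
  rw [div_eq_mul_inv, mul_smul, h, smul_sum, repC, ← Nat.sum_antidiagonal_swap]
  refine sum_congr rfl fun m hm => ?_
  rw [HasAntidiagonal.mem_antidiagonal] at hm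
  simp only [Prod.fst_swap, Prod.snd_swap, flatC_apply, map_smul, LinearMap.smul_apply, smul_smul]
  congr 1
  rw [← hm, pow_add]
  ring

/-! ### Recovering a function from its representation -/

variable (Φ) in
/-- Iterated momentum derivative along a list of indices. -/
def listDp : List (Fin n) → A → A
  | [], f => f
  | j :: L, f => listDp L (Φ.dp j f)

/-- Product of coordinates along a list of indices. -/
def listProd (y : Fin n → B) : List (Fin n) → B
  | [] => 1
  | j :: L => y j * listProd y L

theorem flatB_mul_coord {y : B} {j : Fin n} (hy : ∀ i, Φ.dx i y = if i = j then 1 else 0) (r : ℕ)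
    (f : A) (u : B) : Φ.flatB (r + 1) f (Φ.pull (y * u)) =
      Φ.pull y * Φ.flatB (r + 1) f (Φ.pull u) + ((r : ℂ) + 1) • Φ.flatB r (Φ.dp j f) (Φ.pull u) := by
  have key : ∀ i, Φ.dq i (Φ.pull (y * u)) =
      (if i = j then Φ.pull u else 0) + Φ.pull (y * Φ.dx i u) := by
    intro i
    rw [Φ.dq_pull, Φ.dx_mul, hy, map_add]
    split_ifs <;> simp
  have hs : ∀ r f, ∑ i, Φ.flatB r (Φ.dp i f) (if i = j then Φ.pull u else 0) =
      Φ.flatB r (Φ.dp j f) (Φ.pull u) := by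
    intro r f
    rw [sum_eq_single j]
    · simp
    · intro i _ hi; simp [hi]
    · simp
  induction r generalizing f u with
  | zero =>
    rw [flatB_succ]
    simp only [key, map_add, sum_add_distrib, hs]
    rw [flatB_succ, mul_sum, Nat.cast_zero, zero_add, one_smul, add_comm]
    congr 1
    refine sum_congr rfl fun i _ => ?_
    rw [flatB_zero, flatB_zero, Φ.dq_pull, map_mul]
    ring
  | succ r ih =>
    rw [flatB_succ]
    simp only [key, map_add, sum_add_distrib, hs]
    have h1 : ∀ i, Φ.flatB (r + 1) (Φ.dp i f) (Φ.pull (y * Φ.dx i u)) =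
        Φ.pull y * Φ.flatB (r + 1) (Φ.dp i f) (Φ.dq i (Φ.pull u)) +
          ((r : ℂ) + 1) • Φ.flatB r (Φ.dp i (Φ.dp j f)) (Φ.dq i (Φ.pull u)) := by
      intro i
      rw [ih (f := Φ.dp i f) (u := Φ.dx i u) (key := ?_) (hs := ?_), Φ.dq_pull, Φ.dp_comm i j]
      · intro i'
        rw [Φ.dq_pull, Φ.dx_mul, hy, map_add]
        split_ifs <;> simp
      · intro r f
        rw [sum_eq_single j]
        · simp
        · intro i _ hi; simp [hi]
        · simp
    simp only [h1, sum_add_distrib, ← mul_sum, ← smul_sum, ← flatB_succ]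
    push_cast
    module

section Recover

variable {ι : A →ₐ[ℂ] B} (hι : Φ.IsSection 0 ι) {X : Type*} {ev : X → B →ₐ[ℂ] ℂ}
  {y : X → Fin n → B} (hev : ∀ x i, ev x (y x i) = 0)
  (hy : ∀ x i j, Φ.dx i (y x j) = if i = j then 1 else 0)

include hι hev hy

theorem flatB_listProd (x : X) (L : List (Fin n)) (r : ℕ) (hr : r ≤ L.length) (f : A) :
    ev x (ι (Φ.flatB r f (Φ.pull (listProd (y x) L)))) =
      if r = L.length then (r.factorial : ℂ) * ev x (ι (Φ.listDp L f)) else 0 := by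
  induction L generalizing r f with
  | nil =>
    obtain rfl : r = 0 := by simpa using hr
    simp [listProd, flatB_zero, listDp]
  | cons j L ih =>
    cases r with
    | zero =>
      simp [flatB_zero, listProd, hι.pull, hev]
    | succ r =>
      rw [listProd, flatB_mul_coord (fun i => hy x i j), map_add, map_add, map_mul, map_mul,
        hι.pull, hev, zero_mul, zero_add, map_smul, map_smul,
        ih r (by simpa using hr)]
      simp only [List.length_cons, Nat.add_right_cancel_iff, Nat.factorial_succ, listDp]
      split_ifs
      · push_cast; simp [mul_assoc]
      · simp

theorem eq_zero_of_repC (hsep : ∀ u, (∀ x, ev x u = 0) → u = 0)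
    (hconst : ∀ f, (∀ i, Φ.dp i f = 0) → ι f = 0 → f = 0) {S : ℕ → Module.End ℂ A}
    (hS : S 0 = 1) {D : ℕ → A} (hD : ∀ N, ∃ d, Φ.IsNil d (D N))
    (h : ∀ N u, ∑ m ∈ HasAntidiagonal.antidiagonal N, Φ.repC ι S m.1 (D m.2) u = 0) (N : ℕ) :
    D N = 0 := by
  have hnil : ∀ d f, Φ.IsNil d f → (∀ L, ι (Φ.listDp L f) = 0) → f = 0 := by
    intro d
    induction d with
    | zero => exact fun f hf _ => hf
    | succ d ih =>
      intro f hf hL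
      exact hconst f (fun i => ih _ (hf i) fun L => hL (i :: L)) (hL [])
  induction N using Nat.strong_induction_on with
  | _ N ih =>
    obtain ⟨d, hd⟩ := hD N
    refine hnil d _ hd fun L => hsep _ fun x => ?_
    have h1 := congrArg (ev x) (h (L.length + N) (listProd (y x) L))
    rw [map_sum, map_zero, sum_eq_single (L.length, N)] at h1
    · simp only [repC, map_sum] at h1
      rw [sum_eq_single (L.length, 0)] at h1
      · rw [flatC_apply, map_smul, map_smul, flatB_listProd hι hev hy x L _ le_rfl, if_pos rfl, hS,
          smul_eq_mul] at h1
        simpa [Nat.factorial_ne_zero, Complex.I_ne_zero] using h1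
      · intro m hm hm'
        rw [HasAntidiagonal.mem_antidiagonal] at hm
        have : m.1 ≠ L.length := fun h => hm' (Prod.ext h (by simp; omega))
        rw [flatC_apply, map_smul, map_smul, flatB_listProd hι hev hy x L _ (by omega),
          if_neg this, smul_zero]
      · intro h; simp at h
    · intro m hm hm'
      rw [HasAntidiagonal.mem_antidiagonal] at hm
      rcases Nat.lt_or_ge m.2 N with h2 | h2
      · rw [ih _ h2]; simp [repC]
      · have h3 : m.1 ≠ L.length := fun h => hm' (Prod.ext h (by simp; omega))
        simp only [repC, map_sum]
        refine sum_eq_zero fun m' hm'' => ?_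
        rw [HasAntidiagonal.mem_antidiagonal] at hm''
        rw [flatC_apply, map_smul, map_smul, flatB_listProd hι hev hy x L _ (by omega),
          if_neg (by omega), smul_zero]
    · intro h; simp at h

end Recover

/-! ### Independence of the chart -/

variable (Φ) in
theorem IsSymbolFamily.total_lifts {G : Fin n → Fin n → Fin n → B}
    {T : ℕ → ℕ → Module.End ℂ A} (hT : Φ.IsSymbolFamily G T) (j : ℕ) :
    Φ.Lifts j ((-Complex.I) ^ j • total T j) :=
  Lifts.smul _ (Lifts.sum fun d _ => hT.lifts j d)

theorem IsNil.conjCochain {S R : ℕ → Module.End ℂ A} (hS : ∀ j, Φ.Lifts j (S j))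
    (hR : ∀ j, Φ.Lifts j (R j)) (a : ℂ) {d d' : ℕ} {f g : A} (hf : Φ.IsNil d f)
    (hg : Φ.IsNil d' g) (N : ℕ) :
    Φ.IsNil (d + d' + 2 * N) (_root_.conjCochain (fun r => R r) (fun r x y => Φ.flatC a r x y)
      (fun r => S r) N f g) := by
  refine IsNil.sum fun m hm => IsNil.sum fun m' hm' => IsNil.sum fun m'' hm'' => ?_
  rw [HasAntidiagonal.mem_antidiagonal] at hm hm' hm''
  refine (hR m.1 _ _ (IsNil.smul _ (((hS m''.1 _ _ hf).flatB (hS m''.2 _ _ hg) m'.1)))).mono ?_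
  omega

theorem conjCochain_sub_left (S R : ℕ → Module.End ℂ A) (C : ℕ → A →ₗ[ℂ] A →ₗ[ℂ] A) (N : ℕ)
    (f f' g : A) : conjCochain (fun r => R r) (fun r x y => C r x y) (fun r => S r) N (f - f') g =
      conjCochain (fun r => R r) (fun r x y => C r x y) (fun r => S r) N f g -
        conjCochain (fun r => R r) (fun r x y => C r x y) (fun r => S r) N f' g := by
  simp [conjCochain, sum_sub_distrib]

theorem conjCochain_sub_right (S R : ℕ → Module.End ℂ A) (C : ℕ → A →ₗ[ℂ] A →ₗ[ℂ] A) (N : ℕ)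
    (f g g' : A) : conjCochain (fun r => R r) (fun r x y => C r x y) (fun r => S r) N f (g - g') =
      conjCochain (fun r => R r) (fun r x y => C r x y) (fun r => S r) N f g -
        conjCochain (fun r => R r) (fun r x y => C r x y) (fun r => S r) N f g' := by
  simp [conjCochain, sum_sub_distrib]

namespace ChartChange

variable {Φ' : PhaseAlgebra n A B} {G G' : Fin n → Fin n → Fin n → B} {K J : Fin n → Fin n → B}
  (h : ChartChange Φ Φ' G G' K J)

include h

theorem dp_eq' (l : Fin n) (f : A) : Φ.dp l f = ∑ k, Φ'.pull (J l k) * Φ'.dp k f := by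
  simp only [h.dp_eq, mul_sum, h.pull_eq]
  rw [sum_comm]
  have : ∀ m, ∑ k, Φ.pull (J l k) * (Φ.pull (K k m) * Φ.dp m f) =
      if l = m then Φ.dp m f else 0 := by
    intro m
    have h1 := congrArg Φ.pull (h.J_K l m)
    rw [map_sum] at h1
    calc _ = (∑ k, Φ.pull (J l k * K k m)) * Φ.dp m f := by
          rw [sum_mul]; exact sum_congr rfl fun k _ => by rw [map_mul, mul_assoc]
      _ = _ := by rw [h1]; split_ifs <;> simp
  simp [this]

theorem isNil {d : ℕ} {f : A} (hf : Φ.IsNil d f) : Φ'.IsNil d f := by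
  induction d generalizing f with
  | zero => exact hf
  | succ d ih =>
    intro i
    rw [h.dp_eq]
    exact ih (IsNil.sum fun j _ => (hf j).mulPull _)

theorem isNil' {d : ℕ} {f : A} (hf : Φ'.IsNil d f) : Φ.IsNil d f := by
  induction d generalizing f with
  | zero => exact hf
  | succ d ih =>
    intro i
    rw [h.dp_eq']
    exact ih (IsNil.sum fun j _ => (hf j).mulPull _)

theorem conjCochain_eq {T T' : ℕ → ℕ → Module.End ℂ A} (hT : Φ.IsSymbolFamily G T)
    (hT' : Φ'.IsSymbolFamily G' T') {R R' : ℕ → Module.End ℂ A}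
    (hR : IsInvSeries (fun j => (-Complex.I) ^ j • IsSymbolFamily.total T j) R)
    (hR' : IsInvSeries (fun j => (-Complex.I) ^ j • IsSymbolFamily.total T' j) R')
    {ι : A →ₐ[ℂ] B} (hι : Φ.IsSection 0 ι) (hι' : Φ'.IsSection 0 ι)
    (hrep : ∀ N f u, Φ'.repC ι (fun j => (-Complex.I) ^ j • IsSymbolFamily.total T' j) N f u =
      Φ.repC ι (fun j => (-Complex.I) ^ j • IsSymbolFamily.total T j) N f u)
    {X : Type*} {ev : X → B →ₐ[ℂ] ℂ} {y : X → Fin n → B} (hev : ∀ x i, ev x (y x i) = 0)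
    (hy : ∀ x i j, Φ.dx i (y x j) = if i = j then 1 else 0)
    (hsep : ∀ u, (∀ x, ev x u = 0) → u = 0)
    (hconst : ∀ f, (∀ i, Φ.dp i f = 0) → ι f = 0 → f = 0)
    (hsec : ∀ f, (∀ c σ, Φ.IsSection c σ → σ f = 0) → f = 0) (N : ℕ) (f g : A) :
    conjCochain (fun r => R' r) (fun r x y => Φ'.flatC (-Complex.I) r x y)
      (fun j => ((-Complex.I) ^ j • IsSymbolFamily.total T' j : Module.End ℂ A)) N f g =
    conjCochain (fun r => R r) (fun r x y => Φ.flatC (-Complex.I) r x y)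
      (fun j => ((-Complex.I) ^ j • IsSymbolFamily.total T j : Module.End ℂ A)) N f g := by
  set S := fun j => ((-Complex.I) ^ j • IsSymbolFamily.total T j : Module.End ℂ A) with hS
  set S' := fun j => ((-Complex.I) ^ j • IsSymbolFamily.total T' j : Module.End ℂ A) with hS'
  rw [← sub_eq_zero]
  have lS : ∀ j, Φ.Lifts j (S j) := hT.total_lifts
  have lS' : ∀ j, Φ'.Lifts j (S' j) := hT'.total_lifts
  refine hsec _ fun c σ hσ => ?_
  have mdq : ∀ i, Φ'.dq i ∈ Φ.flatBdd σ := fun i => by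
    have : Φ'.dq i = ∑ j, LinearMap.mulLeft ℂ (Φ.pull (J j i)) * Φ.dq j +
        ∑ l, ∑ j, LinearMap.mulLeft ℂ (Φ'.p l * Φ.pull (Φ'.dx i (K l j))) * Φ.dp j := by
      ext f
      simp [h.dq_eq, LinearMap.sum_apply, mul_assoc]
    rw [this]
    exact add_mem (sum_mem fun j _ => mul_mem (mulLeft_mem_flatBdd _) (dq_mem_flatBdd hσ j))
      (sum_mem fun l _ => sum_mem fun j _ => mul_mem (mulLeft_mem_flatBdd _) (dp_mem_flatBdd j))
  have mdp : ∀ i, Φ'.dp i ∈ Φ.flatBdd σ := fun i => by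
    have : Φ'.dp i = ∑ j, LinearMap.mulLeft ℂ (Φ.pull (K i j)) * Φ.dp j := by
      ext f
      simp [h.dp_eq, LinearMap.sum_apply]
    rw [this]
    exact sum_mem fun j _ => mul_mem (mulLeft_mem_flatBdd _) (dp_mem_flatBdd j)
  have mS : ∀ j, S j ∈ Φ.flatBdd σ := fun j => Subalgebra.smul_mem _ (sum_mem fun d _ =>
    hT.mem (dq_mem_flatBdd hσ) dp_mem_flatBdd (fun _ => mulLeft_mem_flatBdd _)
      (fun _ => mulLeft_mem_flatBdd _) j d) _
  have mS' : ∀ j, S' j ∈ Φ.flatBdd σ := fun j => Subalgebra.smul_mem _ (sum_mem fun d _ =>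
    hT'.mem mdq mdp (fun _ => mulLeft_mem_flatBdd _) (fun _ => mulLeft_mem_flatBdd _) j d) _
  have b1 := FlatBdd₂.conjCochain mS (hR.mem mS)
    (FlatBdd₂.flatC (dq_mem_flatBdd hσ) dp_mem_flatBdd (-Complex.I)) N
  have b2 := FlatBdd₂.conjCochain mS' (hR'.mem mS') (FlatBdd₂.flatC mdq mdp (-Complex.I)) N
  have b3 := (b2.add (b1.smul (-1)))
  simp only [neg_one_smul, ← sub_eq_add_neg] at b3
  refine b3.eq_zero hσ ?_ ?_ ?_ f g
  · intro f f' g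
    rw [conjCochain_sub_left, conjCochain_sub_left]; abel
  · intro f f' g
    rw [conjCochain_sub_right, conjCochain_sub_right]; abel
  · intro f g d d' hf hg
    refine eq_zero_of_repC hι hev hy hsep hconst (S := S)
      (D := fun N => conjCochain (fun r => R' r) (fun r x y => Φ'.flatC (-Complex.I) r x y)
        (fun j => S' j) N f g - conjCochain (fun r => R r)
          (fun r x y => Φ.flatC (-Complex.I) r x y) (fun j => S j) N f g) hR.left_zero ?_ ?_ N
    · intro N
      exact ⟨_, (h.isNil' (IsNil.conjCochain lS' (Lifts.of_invSeries hR' lS') _ (h.isNil hf)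
        (h.isNil hg) N)).sub (IsNil.conjCochain lS (Lifts.of_invSeries hR lS) _ hf hg N)⟩
    · intro N u
      have e1 := congrFun (repC_hom hι hR (Formal.const f) (Formal.const g) (Formal.const u)) N
      have e2 := congrFun (repC_hom hι' hR' (Formal.const f) (Formal.const g) (Formal.const u)) N
      have e3 : Φ'.repC ι S' = Φ.repC ι S := by
        funext N f u; exact hrep N f u
      have z : ∀ r x, Φ.repC ι S r x 0 = 0 := fun r x => by simp [repC]
      rw [e3, ← e1, formalBilin_const_right z, formalBilin_const_right z,
        formalBilin_const_const, formalBilin_const_const] at e2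
      · simp only [formalOp] at e2
        rw [← sub_eq_zero, ← sum_sub_distrib] at e2
        rw [← e2]
        refine sum_congr rfl fun m _ => ?_
        simp [repC, sum_sub_distrib]
      all_goals intros; simp [conjCochain]

end ChartChange

end PhaseAlgebra

end

section

section Transfer

open Finset HasAntidiagonal

variable {E : Type*} [NormedAddCommGroup E] [NormedSpace ℝ E]
  {H : Type*} [TopologicalSpace H] (J : ModelWithCorners ℝ E H)
  {M : Type*} [TopologicalSpace M] [ChartedSpace H M]

/-! ### The algebra of smooth functions on a set -/

/-- The algebra of smooth functions on `U`. -/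
def Sm (U : Set M) : Subalgebra ℂ (U → ℂ) where
  carrier := {a | ∃ f : M → ℂ, SmoothFunOn J U f ∧ ∀ x : U, a x = f x}
  mul_mem' := by
    rintro a b ⟨f, hf, h⟩ ⟨g, hg, h'⟩
    exact ⟨_, hf.mul hg, fun x => by simp [h, h']⟩
  add_mem' := by
    rintro a b ⟨f, hf, h⟩ ⟨g, hg, h'⟩
    exact ⟨_, hf.add hg, fun x => by simp [h, h']⟩
  algebraMap_mem' c := ⟨fun _ => c, SmoothFunOn.const c, fun x => rfl⟩

variable {J} {U : Set M}

instance : CommRing (Sm J U) := inferInstance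

instance : Algebra ℂ (Sm J U) := inferInstance

/-- The element `a` of the algebra of smooth functions on `U` is the restriction of `f`. -/
structure Represents (a : Sm J U) (f : M → ℂ) : Prop where
  smooth : SmoothFunOn J U f
  eq : ∀ x : U, (a : U → ℂ) x = f x

/-- The restriction of `f` to `U`. -/
def SmoothFunOn.toSm {f : M → ℂ} (hf : SmoothFunOn J U f) : Sm J U := ⟨fun x => f x, f, hf, fun _ => rfl⟩

theorem SmoothFunOn.represents {f : M → ℂ} (hf : SmoothFunOn J U f) : Represents hf.toSm f :=
  ⟨hf, fun _ => rfl⟩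

theorem exists_represents (a : Sm J U) : ∃ f, Represents a f := by
  obtain ⟨f, hf, h⟩ := a.2
  exact ⟨f, hf, h⟩

/-- A function on the manifold representing `a`. -/
def Sm.out (a : Sm J U) : M → ℂ := (exists_represents a).choose

theorem represents_out (a : Sm J U) : Represents a (Sm.out a) := (exists_represents a).choose_spec

namespace Represents

variable {a b : Sm J U} {f g : M → ℂ}

theorem ext (ha : Represents a f) (hb : Represents b g) (h : Set.EqOn f g U) : a = b :=
  Subtype.ext (funext fun x => by rw [ha.eq, hb.eq, h x.2])

theorem eqOn (ha : Represents a f) (hb : Represents a g) : Set.EqOn f g U := fun x hx => by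
  rw [← ha.eq ⟨x, hx⟩, hb.eq]

theorem congr (ha : Represents a f) (h : Set.EqOn g f U) : Represents a g :=
  ⟨ha.smooth.congr h, fun x => by rw [ha.eq, h x.2]⟩

theorem add (ha : Represents a f) (hb : Represents b g) : Represents (a + b) (f + g) :=
  ⟨ha.smooth.add hb.smooth, fun x => by simp [ha.eq, hb.eq]⟩

theorem sub (ha : Represents a f) (hb : Represents b g) : Represents (a - b) (f - g) :=
  ⟨ha.smooth.sub hb.smooth, fun x => by simp [ha.eq, hb.eq]⟩

theorem mul (ha : Represents a f) (hb : Represents b g) :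
    Represents (a * b) (fun x => f x * g x) :=
  ⟨ha.smooth.mul hb.smooth, fun x => by simp [ha.eq, hb.eq]⟩

theorem smul (c : ℂ) (ha : Represents a f) : Represents (c • a) (c • f) :=
  ⟨ha.smooth.smul c, fun x => by simp [ha.eq]⟩

theorem zero : Represents (0 : Sm J U) 0 := ⟨SmoothFunOn.zero, fun _ => rfl⟩

theorem sum {ι : Type*} {s : Finset ι} {a : ι → Sm J U} {f : ι → M → ℂ}
    (h : ∀ i ∈ s, Represents (a i) (f i)) : Represents (∑ i ∈ s, a i) (∑ i ∈ s, f i) := by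
  classical
  induction s using Finset.induction_on with
  | empty => simpa using zero
  | insert i s hi ih =>
    rw [sum_insert hi, sum_insert hi]
    exact (h i (mem_insert_self _ _)).add (ih fun i hi => h i (mem_insert_of_mem hi))

end Represents

variable {P : (M → ℂ) → M → ℂ}

/-- The linear map on the smooth functions on `U` given by a local linear operator. -/
def LinOn.toEnd (h : LinOn J U P) : Module.End ℂ (Sm J U) where
  toFun a := (h.smooth _ (represents_out a).smooth).toSm
  map_add' a b := by
    refine Subtype.ext (funext fun x => ?_)
    have ha := (represents_out a)
    have hb := (represents_out b)
    have := h.congr _ _ (represents_out (a + b)).smooth (ha.add hb).smooth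
      ((represents_out (a + b)).eqOn (ha.add hb)) x.2
    exact this.trans (h.add _ _ ha.smooth hb.smooth x.2)
  map_smul' c a := by
    refine Subtype.ext (funext fun x => ?_)
    have ha := (represents_out a)
    have := h.congr _ _ (represents_out (c • a)).smooth (ha.smul c).smooth
      ((represents_out (c • a)).eqOn (ha.smul c)) x.2
    exact this.trans (h.smul _ _ ha.smooth x.2)

theorem Represents.toEnd (h : LinOn J U P) {a : Sm J U} {f : M → ℂ} (ha : Represents a f) :
    Represents (h.toEnd a) (P f) :=
  (h.smooth _ (represents_out a).smooth).represents.congr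
    (h.congr _ _ ha.smooth (represents_out a).smooth (ha.eqOn (represents_out a)))

section Bil

variable {U₀ : Set M} {B : (M → ℂ) → (M → ℂ) → M → ℂ}

/-- The bilinear map on the smooth functions on `U` given by a bidifferential operator. -/
def IsBidiffOn.toBil (h : IsBidiffOn J U₀ B) (hU : IsOpen U) (hU₀ : U ⊆ U₀) :
    Sm J U →ₗ[ℂ] Sm J U →ₗ[ℂ] Sm J U :=
  LinearMap.mk₂ ℂ (fun a b => (h.right U hU hU₀ _ (represents_out a).smooth).toEnd b)
    (fun a a' b => by
      have ha := (represents_out a)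
      have ha' := (represents_out a')
      have hb := (represents_out b)
      refine (hb.toEnd _).ext ((hb.toEnd _).add (hb.toEnd _)) ?_
      exact (h.congr hU hU₀ (represents_out (a + a')).smooth (ha.add ha').smooth hb.smooth hb.smooth
        ((represents_out (a + a')).eqOn (ha.add ha')) fun _ _ => rfl).trans
          ((h.left U hU hU₀ _ hb.smooth).add _ _ ha.smooth ha'.smooth))
    (fun c a b => by
      have ha := (represents_out a)
      have hb := (represents_out b)
      refine (hb.toEnd _).ext ((hb.toEnd _).smul c) ?_
      exact (h.congr hU hU₀ (represents_out (c • a)).smooth (ha.smul c).smooth hb.smooth hb.smooth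
        ((represents_out (c • a)).eqOn (ha.smul c)) fun _ _ => rfl).trans
          ((h.left U hU hU₀ _ hb.smooth).smul _ _ ha.smooth))
    (fun a b b' => map_add _ _ _) (fun c a b => map_smul _ _ _)

theorem Represents.toBil (h : IsBidiffOn J U₀ B) (hU : IsOpen U) (hU₀ : U ⊆ U₀) {a b : Sm J U}
    {f g : M → ℂ} (ha : Represents a f) (hb : Represents b g) :
    Represents (h.toBil hU hU₀ a b) (B f g) :=
  (hb.toEnd (h.right U hU hU₀ _ (represents_out a).smooth)).congr
    (h.congr hU hU₀ ha.smooth (represents_out a).smooth hb.smooth hb.smooth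
      (ha.eqOn (represents_out a)) fun _ _ => rfl)

end Bil

theorem Represents.formalOp {S : ℕ → Sm J U → Sm J U} {S' : ℕ → (M → ℂ) → M → ℂ}
    (h : ∀ r a f, Represents a f → Represents (S r a) (S' r f)) {a : Formal (Sm J U)}
    {f : Formal (M → ℂ)} (ha : ∀ N, Represents (a N) (f N)) (N : ℕ) :
    Represents (formalOp S a N) (formalOp S' f N) :=
  Represents.sum fun _ _ => h _ _ _ (ha _)

theorem Represents.formalBilin {C : ℕ → Sm J U → Sm J U → Sm J U}
    {C' : ℕ → (M → ℂ) → (M → ℂ) → M → ℂ}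
    (h : ∀ r a f b g, Represents a f → Represents b g → Represents (C r a b) (C' r f g))
    {a b : Formal (Sm J U)} {f g : Formal (M → ℂ)} (ha : ∀ N, Represents (a N) (f N))
    (hb : ∀ N, Represents (b N) (g N)) (N : ℕ) :
    Represents (formalBilin C a b N) (formalBilin C' f g N) :=
  Represents.sum fun _ _ => Represents.sum fun _ _ => h _ _ _ _ _ (ha _) (hb _)

theorem Represents.conjCochain {R : ℕ → Sm J U → Sm J U} {R' : ℕ → (M → ℂ) → M → ℂ}
    {C : ℕ → Sm J U → Sm J U → Sm J U} {C' : ℕ → (M → ℂ) → (M → ℂ) → M → ℂ}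
    {S : ℕ → Sm J U → Sm J U} {S' : ℕ → (M → ℂ) → M → ℂ}
    (hR : ∀ r a f, Represents a f → Represents (R r a) (R' r f))
    (hC : ∀ r a f b g, Represents a f → Represents b g → Represents (C r a b) (C' r f g))
    (hS : ∀ r a f, Represents a f → Represents (S r a) (S' r f)) (N : ℕ)
    {a b : Sm J U} {f g : M → ℂ} (ha : Represents a f) (hb : Represents b g) :
    Represents (conjCochain R C S N a b) (conjCochain R' C' S' N f g) :=
  Represents.sum fun _ _ => Represents.sum fun _ _ => Represents.sum fun _ _ =>
    hR _ _ _ (hC _ _ _ _ _ (hS _ _ _ ha) (hS _ _ _ hb))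

/-! ### Conjugation of products -/

section Conj

variable {U₀ : Set M} {R S : ℕ → (M → ℂ) → M → ℂ} {C : ℕ → (M → ℂ) → (M → ℂ) → M → ℂ}

theorem IsBidiffOn.conjCochain (hR : ∀ r, IsDiffOpOn J U₀ (R r)) (hC : ∀ r, IsBidiffOn J U₀ (C r))
    (hS : ∀ r, IsDiffOpOn J U₀ (S r)) (N : ℕ) : IsBidiffOn J U₀ (conjCochain R C S N) := by
  have : IsBidiffOn J U₀ (fun f g => ∑ m ∈ HasAntidiagonal.antidiagonal N,
      ∑ m' ∈ HasAntidiagonal.antidiagonal m.2, ∑ m'' ∈ HasAntidiagonal.antidiagonal m'.2,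
        R m.1 (C m'.1 (S m''.1 f) (S m''.2 g))) :=
    IsBidiffOn.sum fun m _ => IsBidiffOn.sum fun m' _ => IsBidiffOn.sum fun m'' _ =>
      (((hC _).comp_left (hS _)).comp_right (hS _)).postcomp (hR _)
  exact this

end Conj

/-! ### Inverse series -/

/-- The inverse of the series `∑ λ^r S_r`, which begins with the identity. -/
def invSeries {X : Type*} [AddCommGroup X] (S : ℕ → X → X) : ℕ → X → X
  | 0, f => f
  | N + 1, f => -∑ a : Fin (N + 1), S (N - a + 1) (invSeries S a f)
  decreasing_by exact a.2

theorem IsDiffOpOn.neg {U₀ : Set M} {P : (M → ℂ) → M → ℂ} (h : IsDiffOpOn J U₀ P) :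
    IsDiffOpOn J U₀ (fun f => -P f) := by
  have := h.const_smul (-1)
  simpa using this

theorem IsDiffOpOn.invSeries {U₀ : Set M} {S : ℕ → (M → ℂ) → M → ℂ}
    (h : ∀ r, IsDiffOpOn J U₀ (S r)) (N : ℕ) : IsDiffOpOn J U₀ (invSeries S N) := by
  induction N using Nat.strong_induction_on with
  | _ N ih =>
    cases N with
    | zero =>
      have : _root_.invSeries S 0 = fun f => f := by funext f; rw [_root_.invSeries]
      rw [this]; exact IsDiffOpOn.id
    | succ N =>
      have : _root_.invSeries S (N + 1) =
          fun f => -∑ a : Fin (N + 1), S (N - a + 1) (_root_.invSeries S a f) := by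
        funext f; rw [_root_.invSeries]
      rw [this]
      exact (IsDiffOpOn.sum fun (a : Fin (N + 1)) _ => (h _).comp (ih a a.2)).neg

theorem isInvSeries_toEnd {S : ℕ → (M → ℂ) → M → ℂ} {S' R' : ℕ → Module.End ℂ (Sm J U)}
    (h0 : S' 0 = 1) (hS : ∀ r a f, Represents a f → Represents (S' r a) (S r f))
    (hR : ∀ r a f, Represents a f → Represents (R' r a) (invSeries S r f)) :
    IsInvSeries S' R' where
  left_zero := h0
  right_zero := by
    ext1 a
    have ha := (represents_out a)
    have := hR 0 _ _ ha
    rw [invSeries] at this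
    exact this.ext ha fun _ _ => rfl
  succ N := by
    ext1 a
    have ha := (represents_out a)
    rw [Nat.sum_antidiagonal_succ, h0, LinearMap.add_apply, one_mul]
    have h1 := hR (N + 1) _ _ ha
    rw [invSeries] at h1
    have h2 : Represents ((∑ p ∈ HasAntidiagonal.antidiagonal N, S' (p.1 + 1) * R' p.2) a)
        (∑ p ∈ HasAntidiagonal.antidiagonal N, S (p.1 + 1) (invSeries S p.2 (Sm.out a))) := by
      rw [LinearMap.sum_apply]
      exact Represents.sum fun p _ => hS _ _ _ (hR _ _ _ ha)
    refine (h1.add h2).ext Represents.zero ?_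
    rw [← Nat.sum_antidiagonal_swap, Nat.sum_antidiagonal_eq_sum_range_succ_mk, Finset.sum_range]
    simp [Set.EqOn]

end Transfer

section LocalStar

open Finset HasAntidiagonal
open PhaseAlgebra (prevTerm)

variable {E : Type*} [NormedAddCommGroup E] [NormedSpace ℝ E]
  {H : Type*} [TopologicalSpace H] {J : ModelWithCorners ℝ E H}
  {M : Type*} [TopologicalSpace M] [ChartedSpace H M]

/-- The operators of `IsSymbolFamily` on functions on a manifold. -/
def symOp {n : ℕ} (dq dp : Fin n → (M → ℂ) → M → ℂ) (p : Fin n → M → ℂ)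
    (Γ : Fin n → Fin n → Fin n → M → ℂ) : ℕ → ℕ → (M → ℂ) → M → ℂ
  | 0 => fun d f => if d = 0 then f else 0
  | j + 1 => fun d => match d with
    | 0 => fun _ => 0
    | d + 1 => fun f => ((d : ℂ) + 1)⁻¹ •
      (∑ i, (dq i (symOp dq dp p Γ j d (dp i f)) - symOp dq dp p Γ j d (dq i (dp i f))) -
        ∑ l, ((symOp dq dp p Γ j d fun x => p l x * (∑ i, ∑ k, fun x => Γ l i k x * dp i (dp k f) x) x) -
          (fun x => p l x * symOp dq dp p Γ j d (∑ i, ∑ k, fun x => Γ l i k x * dp i (dp k f) x) x) +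
          fun x => p l x * prevTerm (symOp dq dp p Γ j) d
            (∑ i, ∑ k, fun x => Γ l i k x * dp i (dp k f) x) x))

/-- The operators `S_j` of the transform of symbols. -/
def symS {n : ℕ} (dq dp : Fin n → (M → ℂ) → M → ℂ) (p : Fin n → M → ℂ)
    (Γ : Fin n → Fin n → Fin n → M → ℂ) (j : ℕ) (f : M → ℂ) : M → ℂ :=
  (-Complex.I) ^ j • ∑ d ∈ range (2 * j + 1), symOp dq dp p Γ j d f

/-- The flat cochains. -/
def flatFun {n : ℕ} (dq dp : Fin n → (M → ℂ) → M → ℂ) : ℕ → (M → ℂ) → (M → ℂ) → M → ℂ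
  | 0 => fun f g x => f x * g x
  | r + 1 => fun f g => ∑ i, flatFun dq dp r (dp i f) (dq i g)

/-- The cochains of the standard-ordered star product in a chart. -/
def localCochain {n : ℕ} (dq dp : Fin n → (M → ℂ) → M → ℂ) (p : Fin n → M → ℂ)
    (Γ : Fin n → Fin n → Fin n → M → ℂ) : ℕ → (M → ℂ) → (M → ℂ) → M → ℂ :=
  conjCochain (invSeries (symS dq dp p Γ))
    (fun r f g => ((-Complex.I) ^ r / (r.factorial : ℂ)) • flatFun dq dp r f g) (symS dq dp p Γ)

variable {n : ℕ} {U₀ : Set M} {dq dp : Fin n → (M → ℂ) → M → ℂ} {p : Fin n → M → ℂ}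
    {Γ : Fin n → Fin n → Fin n → M → ℂ}

theorem IsDiffOpOn.sub {P Q : (M → ℂ) → M → ℂ} (hP : IsDiffOpOn J U₀ P) (hQ : IsDiffOpOn J U₀ Q) :
    IsDiffOpOn J U₀ (fun f => P f - Q f) := by
  simpa only [sub_eq_add_neg] using hP.add hQ.neg

section DiffOp

variable (hdq : ∀ i, IsDiffOpOn J U₀ (dq i)) (hdp : ∀ i, IsDiffOpOn J U₀ (dp i))
  (hp : ∀ l, SmoothFunOn J U₀ (p l)) (hΓ : ∀ l i k, SmoothFunOn J U₀ (Γ l i k))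

include hdq hdp hp hΓ

theorem isDiffOpOn_symOp (j d : ℕ) : IsDiffOpOn J U₀ (symOp dq dp p Γ j d) := by
  induction j generalizing d with
  | zero =>
    by_cases h : d = 0
    · have : symOp dq dp p Γ 0 d = fun f => f := by funext f; exact if_pos h
      rw [this]; exact IsDiffOpOn.id
    · have : symOp dq dp p Γ 0 d = fun f => 0 := by funext f; exact if_neg h
      rw [this]; exact IsDiffOpOn.zero
  | succ j ih =>
    cases d with
    | zero => exact IsDiffOpOn.zero
    | succ d =>
      have hg : ∀ l, IsDiffOpOn J U₀
          (fun f => ∑ i, ∑ k, fun x => Γ l i k x * dp i (dp k f) x) := fun l =>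
        IsDiffOpOn.sum fun i _ => IsDiffOpOn.sum fun k _ => ((hdp i).comp (hdp k)).mul_left (hΓ l i k)
      have hprev : IsDiffOpOn J U₀ (prevTerm (symOp dq dp p Γ j) d) := by
        cases d with
        | zero => exact IsDiffOpOn.zero
        | succ d => exact ih d
      refine IsDiffOpOn.const_smul _ (IsDiffOpOn.sub (IsDiffOpOn.sum fun i _ => IsDiffOpOn.sub ?_ ?_)
        (IsDiffOpOn.sum fun l _ => IsDiffOpOn.add (IsDiffOpOn.sub ?_ ?_) ?_))
      · exact (hdq i).comp ((ih d).comp (hdp i))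
      · exact (ih d).comp ((hdq i).comp (hdp i))
      · exact (ih d).comp ((hg l).mul_left (hp l))
      · exact ((ih d).comp (hg l)).mul_left (hp l)
      · exact (hprev.comp (hg l)).mul_left (hp l)

theorem isDiffOpOn_symS (j : ℕ) : IsDiffOpOn J U₀ (symS dq dp p Γ j) :=
  IsDiffOpOn.const_smul _ (IsDiffOpOn.sum fun d _ => isDiffOpOn_symOp hdq hdp hp hΓ j d)

omit hp hΓ in
theorem isBidiffOn_flatFun (r : ℕ) : IsBidiffOn J U₀ (flatFun dq dp r) := by
  induction r with
  | zero => exact IsBidiffOn.mul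
  | succ r ih => exact IsBidiffOn.sum fun i _ => (ih.comp_left (hdp i)).comp_right (hdq i)

theorem isBidiffOn_localCochain (N : ℕ) : IsBidiffOn J U₀ (localCochain dq dp p Γ N) :=
  IsBidiffOn.conjCochain (IsDiffOpOn.invSeries (isDiffOpOn_symS hdq hdp hp hΓ))
    (fun r => (isBidiffOn_flatFun hdq hdp r).postcomp (IsDiffOpOn.id.const_smul _))
    (isDiffOpOn_symS hdq hdp hp hΓ) N

end DiffOp

/-- The phase space algebra `Φ` on the smooth functions on `U` has the given operators and
momenta. -/
structure PhaseAlgebra.IsGivenBy {U : Set M} {B : Type*} [CommRing B] [Algebra ℂ B]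
    (Φ : PhaseAlgebra n (Sm J U) B) (G : Fin n → Fin n → Fin n → B)
    (dq dp : Fin n → (M → ℂ) → M → ℂ) (p : Fin n → M → ℂ)
    (Γ : Fin n → Fin n → Fin n → M → ℂ) : Prop where
  dq : ∀ i a f, Represents a f → Represents (Φ.dq i a) (dq i f)
  dp : ∀ i a f, Represents a f → Represents (Φ.dp i a) (dp i f)
  p : ∀ i, Represents (Φ.p i) (p i)
  pull : ∀ l i k, Represents (Φ.pull (G l i k)) (Γ l i k)

namespace PhaseAlgebra.IsGivenBy

variable {U : Set M} {B : Type*} [CommRing B] [Algebra ℂ B] {Φ : PhaseAlgebra n (Sm J U) B}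
  {G : Fin n → Fin n → Fin n → B} (h : Φ.IsGivenBy G dq dp p Γ)

include h

theorem gammaDD (l : Fin n) {a : Sm J U} {f : M → ℂ} (ha : Represents a f) :
    Represents (Φ.gammaDD G l a) (∑ i, ∑ k, fun x => Γ l i k x * dp i (dp k f) x) := by
  simp only [PhaseAlgebra.gammaDD, LinearMap.sum_apply]
  exact Represents.sum fun i _ => Represents.sum fun k _ =>
    (h.pull l i k).mul (h.dp _ _ _ (h.dp _ _ _ ha))

theorem isSymbolFamily {T : ℕ → ℕ → Module.End ℂ (Sm J U)}
    (hT : ∀ j d a f, Represents a f → Represents (T j d a) (symOp dq dp p Γ j d f)) :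
    Φ.IsSymbolFamily G T where
  zero_zero := by
    ext1 a
    exact (hT 0 0 _ _ (represents_out a)).ext (represents_out a) fun _ _ => rfl
  zero_succ d := by
    ext1 a
    exact (hT 0 (d + 1) _ _ (represents_out a)).ext Represents.zero fun _ _ => rfl
  succ_zero j := by
    ext1 a
    exact (hT (j + 1) 0 _ _ (represents_out a)).ext Represents.zero fun _ _ => rfl
  succ_succ j d := by
    ext1 a
    have ha := (represents_out a)
    have hd : (d : ℂ) + 1 ≠ 0 := by exact_mod_cast Nat.succ_ne_zero d
    have hg := fun l => h.gammaDD l ha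
    have hprev : ∀ b g, Represents b g →
        Represents (prevTerm (T j) d b) (prevTerm (symOp dq dp p Γ j) d g) := by
      intro b g hb
      cases d with
      | zero => exact Represents.zero
      | succ d => exact hT j d b g hb
    refine ((hT (j + 1) (d + 1) _ _ ha).smul ((d : ℂ) + 1)).ext
      (g := ((d : ℂ) + 1) • symOp dq dp p Γ (j + 1) (d + 1) (Sm.out a)) ?_ fun _ _ => rfl
    rw [show symOp dq dp p Γ (j + 1) (d + 1) (Sm.out a) = ((d : ℂ) + 1)⁻¹ • _ from rfl,
      smul_inv_smul₀ hd]
    simp only [LinearMap.sub_apply, LinearMap.sum_apply]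
    exact Represents.sub (Represents.sum fun i _ =>
      Represents.sub (h.dq i _ _ (hT j d _ _ (h.dp i _ _ ha)))
        (hT j d _ _ (h.dq i _ _ (h.dp i _ _ ha)))) (Represents.sum fun l _ =>
      Represents.add (Represents.sub (hT j d _ _ ((h.p l).mul (hg l)))
        ((h.p l).mul (hT j d _ _ (hg l)))) ((h.p l).mul (hprev _ _ (hg l))))

omit h in
theorem represents_symS {T : ℕ → ℕ → Module.End ℂ (Sm J U)}
    (hT : ∀ j d a f, Represents a f → Represents (T j d a) (symOp dq dp p Γ j d f)) (j : ℕ)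
    {a : Sm J U} {f : M → ℂ} (ha : Represents a f) :
    Represents (((-Complex.I) ^ j • IsSymbolFamily.total T j : Module.End ℂ (Sm J U)) a)
      (symS dq dp p Γ j f) := by
  simp only [LinearMap.smul_apply, IsSymbolFamily.total, LinearMap.sum_apply]
  exact (Represents.sum fun d _ => hT j d a f ha).smul _

theorem flatC (r : ℕ) {a b : Sm J U} {f g : M → ℂ} (ha : Represents a f) (hb : Represents b g) :
    Represents (Φ.flatC (-Complex.I) r a b)
      (((-Complex.I) ^ r / (r.factorial : ℂ)) • flatFun dq dp r f g) := by
  refine Represents.smul _ ?_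
  induction r generalizing a b f g with
  | zero => exact ha.mul hb
  | succ r ih =>
    rw [flatB_succ]
    exact Represents.sum fun i _ => ih (h.dp _ _ _ ha) (h.dq _ _ _ hb)

end PhaseAlgebra.IsGivenBy

end LocalStar

end

section

section Coordinates

variable {E : Type*} [NormedAddCommGroup E] [NormedSpace ℝ E]
  {H : Type*} [TopologicalSpace H] {J : ModelWithCorners ℝ E H}
  {M : Type*} [TopologicalSpace M] [ChartedSpace H M]
  {E' : Type*} [NormedAddCommGroup E'] [NormedSpace ℝ E']
  {H' : Type*} [TopologicalSpace H'] {J' : ModelWithCorners ℝ E' H'}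
  {M' : Type*} [TopologicalSpace M'] [ChartedSpace H' M']
  {V : Type*} [NormedAddCommGroup V] [NormedSpace ℝ V]

theorem SmoothFunOn.comp_contMDiffOn {O : Set M'} {U : Set M} {u : M' → ℂ} {φ : M → M'}
    (hu : SmoothFunOn J' O u) (hφ : ContMDiffOn J J' ∞ φ U) (h : Set.MapsTo φ U O) :
    SmoothFunOn J U (fun x => u (φ x)) :=
  ContMDiffOn.comp (g := u) hu hφ h

/-- Pullback of smooth functions along a smooth map. -/
def Sm.comap {O : Set M'} {U : Set M} {φ : M → M'} (hφ : ContMDiffOn J J' ∞ φ U)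
    (h : Set.MapsTo φ U O) : Sm J' O →ₐ[ℂ] Sm J U where
  toFun a := ⟨fun x => (a : O → ℂ) ⟨φ x, h x.2⟩, by
    obtain ⟨u, hu, e⟩ := a.2
    exact ⟨_, hu.comp_contMDiffOn hφ h, fun x => e _⟩⟩
  map_one' := rfl
  map_zero' := rfl
  map_mul' _ _ := rfl
  map_add' _ _ := rfl
  commutes' _ := rfl

theorem Represents.comap {O : Set M'} {U : Set M} {φ : M → M'} (hφ : ContMDiffOn J J' ∞ φ U)
    (h : Set.MapsTo φ U O) {a : Sm J' O} {u : M' → ℂ} (ha : Represents a u) :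
    Represents (Sm.comap hφ h a) (fun x => u (φ x)) :=
  ⟨ha.smooth.comp_contMDiffOn hφ h, fun x => ha.eq _⟩

/-- Evaluation at a point. -/
def Sm.eval {U : Set M} (x : U) : Sm J U →ₐ[ℂ] ℂ :=
  (Pi.evalAlgHom ℂ (fun _ : U => ℂ) x).comp (Subalgebra.val _)

/-- `Θ` is a smooth coordinate system on `U₀`, with image `W` and inverse `Ψ`. -/
structure IsCoord (J : ModelWithCorners ℝ E H) (U₀ : Set M) (W : Set V) (Θ : M → V) (Ψ : V → M) :
    Prop where
  isOpen : IsOpen U₀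
  isOpen_target : IsOpen W
  mapsTo : Set.MapsTo Θ U₀ W
  left_inv : ∀ x ∈ U₀, Ψ (Θ x) = x
  right_inv : ∀ z ∈ W, Θ (Ψ z) = z
  contMDiffOn : ContMDiffOn J 𝓘(ℝ, V) ∞ Θ U₀
  contMDiffOn_symm : ContMDiffOn 𝓘(ℝ, V) J ∞ Ψ W

/-- The derivative of a function in the direction `v`, in the coordinates `Θ`. -/
def coordDeriv (Θ : M → V) (Ψ : V → M) (v : V) (f : M → ℂ) : M → ℂ :=
  fun x => fderiv ℝ (fun z => f (Ψ z)) (Θ x) v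

namespace IsCoord

variable {U₀ U : Set M} {W : Set V} {Θ : M → V} {Ψ : V → M} (h : IsCoord J U₀ W Θ Ψ)
  {f g : M → ℂ}

include h

theorem isOpen_preimage (hU : IsOpen U) : IsOpen (W ∩ Ψ ⁻¹' U) :=
  h.contMDiffOn_symm.continuousOn.isOpen_inter_preimage h.isOpen_target hU

theorem mem_preimage (hU₀ : U ⊆ U₀) {x : M} (hx : x ∈ U) : Θ x ∈ W ∩ Ψ ⁻¹' U :=
  ⟨h.mapsTo (hU₀ hx), by rw [Set.mem_preimage, h.left_inv x (hU₀ hx)]; exact hx⟩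

theorem contDiffOn (hf : SmoothFunOn J U f) :
    ContDiffOn ℝ ∞ (fun z => f (Ψ z)) (W ∩ Ψ ⁻¹' U) :=
  contMDiffOn_iff_contDiffOn.1 <| ContMDiffOn.comp (g := f) hf
    (h.contMDiffOn_symm.mono Set.inter_subset_left) fun _ hz => hz.2

theorem contDiffAt (hU : IsOpen U) (hU₀ : U ⊆ U₀) (hf : SmoothFunOn J U f) {x : M} (hx : x ∈ U) :
    ContDiffAt ℝ ∞ (fun z => f (Ψ z)) (Θ x) :=
  (h.contDiffOn hf).contDiffAt ((h.isOpen_preimage hU).mem_nhds (h.mem_preimage hU₀ hx))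

theorem differentiableAt (hU : IsOpen U) (hU₀ : U ⊆ U₀) (hf : SmoothFunOn J U f) {x : M}
    (hx : x ∈ U) : DifferentiableAt ℝ (fun z => f (Ψ z)) (Θ x) :=
  (h.contDiffAt hU hU₀ hf hx).differentiableAt (by simp)

theorem smoothFunOn_of_contDiffOn {F : V → ℂ} (hU₀ : U ⊆ U₀)
    (hF : ContDiffOn ℝ ∞ F (W ∩ Ψ ⁻¹' U)) : SmoothFunOn J U (fun x => F (Θ x)) :=
  ContMDiffOn.comp (g := F) (contMDiffOn_iff_contDiffOn.2 hF) (h.contMDiffOn.mono hU₀)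
    fun _ hx => h.mem_preimage hU₀ hx

theorem coordDeriv_mul (hU : IsOpen U) (hU₀ : U ⊆ U₀) (hf : SmoothFunOn J U f)
    (hg : SmoothFunOn J U g) (v : V) {x : M} (hx : x ∈ U) :
    coordDeriv Θ Ψ v (fun x => f x * g x) x =
      coordDeriv Θ Ψ v f x * g x + f x * coordDeriv Θ Ψ v g x := by
  unfold coordDeriv
  rw [fderiv_fun_mul (h.differentiableAt hU hU₀ hf hx) (h.differentiableAt hU hU₀ hg hx)]
  simp [h.left_inv x (hU₀ hx)]
  ring

theorem linOn (hU : IsOpen U) (hU₀ : U ⊆ U₀) (v : V) : LinOn J U (coordDeriv Θ Ψ v) where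
  smooth f hf := by
    have h1 : ContDiffOn ℝ ∞ (fun z => fderiv ℝ (fun z => f (Ψ z)) z v) (W ∩ Ψ ⁻¹' U) :=
      ((h.contDiffOn hf).fderiv_of_isOpen (h.isOpen_preimage hU) (by simp)).clm_apply
        contDiffOn_const
    exact h.smoothFunOn_of_contDiffOn hU₀ h1
  congr f g hf hg hfg x hx := by
    unfold coordDeriv
    rw [Filter.EventuallyEq.fderiv_eq]
    filter_upwards [(h.isOpen_preimage hU).mem_nhds (h.mem_preimage hU₀ hx)] with z hz
    exact hfg hz.2
  add f g hf hg x hx := by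
    have := fderiv_fun_add (h.differentiableAt hU hU₀ hf hx) (h.differentiableAt hU hU₀ hg hx)
    simp only [coordDeriv, Pi.add_apply]
    rw [this]; rfl
  smul c f hf x hx := by
    have := fderiv_fun_const_smul (h.differentiableAt hU hU₀ hf hx) c
    simp only [coordDeriv, Pi.smul_apply]
    rw [this]; rfl

theorem isDiffOpOn (v : V) : IsDiffOpOn J U₀ (coordDeriv Θ Ψ v) := by
  refine ⟨fun U hU hU₀ => h.linOn hU hU₀ v, 1, fun U hU hU₀ a ha => ?_⟩
  intro b hb s hs x hx
  have hbs : SmoothFunOn J U (fun x => b x * s x) := SmoothFunOn.mul hb hs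
  have e1 := h.coordDeriv_mul hU hU₀ ha hbs v hx
  have e2 := h.coordDeriv_mul hU hU₀ ha hs v hx
  simp only [smul_eq_mul] at *
  rw [e1, e2]
  ring

theorem coordDeriv_comm (hU : IsOpen U) (hU₀ : U ⊆ U₀) (hf : SmoothFunOn J U f) (v w : V) {x : M}
    (hx : x ∈ U) :
    coordDeriv Θ Ψ v (coordDeriv Θ Ψ w f) x = coordDeriv Θ Ψ w (coordDeriv Θ Ψ v f) x := by
  have key : ∀ v w, coordDeriv Θ Ψ v (coordDeriv Θ Ψ w f) x =
      fderiv ℝ (fderiv ℝ (fun z => f (Ψ z))) (Θ x) v w := by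
    intro v w
    have h1 : (fun z => coordDeriv Θ Ψ w f (Ψ z)) =ᶠ[𝓝 (Θ x)]
        fun z => fderiv ℝ (fun z => f (Ψ z)) z w := by
      filter_upwards [h.isOpen_target.mem_nhds (h.mapsTo (hU₀ hx))] with z hz
      rw [coordDeriv, h.right_inv z hz]
    rw [coordDeriv, h1.fderiv_eq]
    have h2 : DifferentiableAt ℝ (fderiv ℝ (fun z => f (Ψ z))) (Θ x) :=
      ((h.contDiffAt hU hU₀ hf hx).fderiv_right (m := 1) (by norm_cast)).differentiableAt (by simp)
    rw [fderiv_clm_apply h2 (differentiableAt_const w)]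
    simp
  rw [key, key]
  exact ((h.contDiffAt hU hU₀ hf hx).isSymmSndFDerivAt
    (by rw [minSmoothness_of_isRCLikeNormedField]; exact WithTop.coe_le_coe.2 le_top)).eq v w

theorem coordDeriv_clm (ℓ : V →L[ℝ] ℂ) (v : V) {x : M} (hx : x ∈ U₀) :
    coordDeriv Θ Ψ v (fun x => ℓ (Θ x)) x = ℓ v := by
  have h1 : (fun z => ℓ (Θ (Ψ z))) =ᶠ[𝓝 (Θ x)] ℓ := by
    filter_upwards [h.isOpen_target.mem_nhds (h.mapsTo hx)] with z hz
    rw [h.right_inv z hz]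
  rw [coordDeriv, h1.fderiv_eq, ContinuousLinearMap.fderiv]

theorem coordDeriv_sum_smul {ι : Type*} (s : Finset ι) (a : ι → ℝ) (v : ι → V) (x : M) :
    coordDeriv Θ Ψ (∑ i ∈ s, a i • v i) f x = ∑ i ∈ s, (a i : ℂ) * coordDeriv Θ Ψ (v i) f x := by
  simp [coordDeriv, map_sum]

/-- The derivative along a curve given in coordinates. -/
theorem deriv_line (hU : IsOpen U) (hU₀ : U ⊆ U₀) (hf : SmoothFunOn J U f) {x : M} (hx : x ∈ U)
    (v : V) : deriv (fun t : ℝ => f (Ψ (Θ x + t • v))) 0 = coordDeriv Θ Ψ v f x := by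
  have h1 : HasDerivAt (fun t : ℝ => Θ x + t • v) v 0 := by
    simpa using ((hasDerivAt_id (0 : ℝ)).smul_const v).const_add (Θ x)
  have h2 : HasFDerivAt (fun z => f (Ψ z)) (fderiv ℝ (fun z => f (Ψ z)) (Θ x)) (Θ x + (0 : ℝ) • v) := by
    rw [zero_smul, add_zero]; exact (h.differentiableAt hU hU₀ hf hx).hasFDerivAt
  exact (h2.comp_hasDerivAt (0 : ℝ) h1).deriv

end IsCoord

end Coordinates

end

local instance isManifold_one {n : ℕ} {Q : Type*} [TopologicalSpace Q]
    [ChartedSpace 𝔼(n) Q] [IsManifold (𝓡 n) ∞ Q] :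
    IsManifold (𝓡 n) 1 Q := IsManifold.of_le (n := ∞) (by norm_cast)

local instance topologicalSpaceTangentBundle {n : ℕ} {Q : Type*} [TopologicalSpace Q]
    [ChartedSpace 𝔼(n) Q] [IsManifold (𝓡 n) ∞ Q] :
    TopologicalSpace (TangentBundle (𝓡 n) Q) := inferInstance

local instance topologicalSpaceCotangent {n : ℕ} {Q : Type*} [TopologicalSpace Q]
    [ChartedSpace 𝔼(n) Q] [IsManifold (𝓡 n) ∞ Q] :
    TopologicalSpace (Cotangent n Q) := inferInstance

section

section CotangentCoordinates

variable {n : ℕ} {Q : Type*} [TopologicalSpace Q] [ChartedSpace 𝔼(n) Q]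
  [IsManifold (𝓡 n) ∞ Q] {e : OpenPartialHomeomorph Q 𝔼(n)}

theorem exists_mfderiv_equiv (he : e ∈ atlas 𝔼(n) Q) {q : Q}
    (hq : q ∈ e.source) : ∃ L : TangentSpace (𝓡 n) q ≃L[ℝ] 𝔼(n),
      (L : TangentSpace (𝓡 n) q →L[ℝ] 𝔼(n)) =
        mfderiv (𝓡 n) 𝓘(ℝ, 𝔼(n)) e q := by
  have : IsManifold (𝓡 n) 1 Q := IsManifold.of_le (n := ∞) (by norm_cast)
  exact ⟨(mdifferentiable_of_mem_atlas (I := 𝓡 n) he).mfderiv hq, rfl⟩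

theorem chartCovector_chartVector (he : e ∈ atlas 𝔼(n) Q) {q : Q}
    (hq : q ∈ e.source) (i j : Fin n) :
    chartCovector e i q (chartVector e j q) = if i = j then 1 else 0 := by
  obtain ⟨L, hL⟩ := exists_mfderiv_equiv he hq
  have h1 : chartVector e j q = L.symm (EuclideanSpace.single j (1 : ℝ)) := by
    rw [chartVector, ← hL]
    exact congrArg (fun T => T (EuclideanSpace.single j (1 : ℝ)))
      (ContinuousLinearMap.inverse_equiv L)
  rw [h1, chartCovector, ← hL]
  change (L (L.symm (EuclideanSpace.single j (1 : ℝ)))) i = _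
  rw [L.apply_symm_apply]
  simp [Pi.single_apply]

theorem sum_chartCovector_smul_chartVector (he : e ∈ atlas 𝔼(n) Q) {q : Q}
    (hq : q ∈ e.source) (v : TangentSpace (𝓡 n) q) :
    ∑ i, chartCovector e i q v • chartVector e i q = v := by
  obtain ⟨L, hL⟩ := exists_mfderiv_equiv he hq
  have h1 : ∀ j, chartVector e j q = L.symm (EuclideanSpace.single j (1 : ℝ)) := by
    intro j
    rw [chartVector, ← hL]
    exact congrArg (fun T => T (EuclideanSpace.single j (1 : ℝ)))
      (ContinuousLinearMap.inverse_equiv L)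
  have h2 : ∀ j, chartCovector e j q v = (L v) j := by
    intro j
    rw [chartCovector, ← hL]; rfl
  simp only [h1, h2]
  apply L.injective
  rw [map_sum]
  simp only [map_smul, L.apply_symm_apply]
  ext j
  simp [Pi.single_apply]

theorem sum_smul_chartCovector (he : e ∈ atlas 𝔼(n) Q) {q : Q}
    (hq : q ∈ e.source) (ζ : CotangentSpace n q) :
    ∑ i, ζ (chartVector e i q) • chartCovector e i q = ζ := by
  ext v
  conv_rhs => rw [← sum_chartCovector_smul_chartVector he hq v]
  simp [sum_apply, map_sum, mul_comm]

theorem contMDiffOn_atlasChart (he : e ∈ atlas 𝔼(n) Q) :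
    ContMDiffOn (𝓡 n) 𝓘(ℝ, 𝔼(n)) ∞ e e.source :=
  contMDiffOn_of_mem_maximalAtlas (IsManifold.subset_maximalAtlas he)

theorem contMDiffOn_atlasChart_symm (he : e ∈ atlas 𝔼(n) Q) :
    ContMDiffOn 𝓘(ℝ, 𝔼(n)) (𝓡 n) ∞ e.symm e.target :=
  contMDiffOn_symm_of_mem_maximalAtlas (IsManifold.subset_maximalAtlas he)

theorem contMDiffOn_chartVector (he : e ∈ atlas 𝔼(n) Q) (i : Fin n) :
    ContMDiffOn (𝓡 n) (𝓡 n).tangent ∞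
      (fun q => (⟨q, chartVector e i q⟩ : TangentBundle (𝓡 n) Q)) e.source := by
  intro q hq
  have h1 : ContMDiffAt (𝓡 n) 𝓘(ℝ, 𝔼(n)) ∞ e q :=
    (contMDiffOn_atlasChart he).contMDiffAt (e.open_source.mem_nhds hq)
  have h2 : ContMDiffAt 𝓘(ℝ, 𝔼(n)) (𝓘(ℝ, 𝔼(n))).tangent ∞
      (fun x => (⟨x, EuclideanSpace.single i (1 : ℝ)⟩ :
        TangentBundle 𝓘(ℝ, 𝔼(n)) 𝔼(n))) (e q) := by
    rw [contMDiffAt_totalSpace]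
    refine ⟨contMDiffAt_id, ?_⟩
    simp only [trivializationAt_model_space_apply]
    exact contMDiffAt_const
  obtain ⟨L, hL⟩ := exists_mfderiv_equiv he hq
  have h3 := ContMDiffAt.mpullback_vectorField_preimage (m := ∞) (n := ∞) h2 h1
    ⟨L, hL⟩ (by norm_cast)
  exact h3.contMDiffWithinAt

theorem contMDiffOn_chartCovector (he : e ∈ atlas 𝔼(n) Q) (i : Fin n) :
    ContMDiffOn (𝓡 n) (cotModel n) ∞
      (fun q => (⟨q, chartCovector e i q⟩ : Cotangent n Q)) e.source := by
  intro q hq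
  refine ContMDiffAt.contMDiffWithinAt ?_
  have h1 : ContMDiffAt (𝓡 n) 𝓘(ℝ, 𝔼(n)) ∞ e q :=
    (contMDiffOn_atlasChart he).contMDiffAt (e.open_source.mem_nhds hq)
  rw [contMDiffAt_hom_bundle]
  refine ⟨contMDiffAt_id, ?_⟩
  have h2 := h1.mfderiv_const (m := ∞) (by norm_cast)
  have h3 := (contMDiffAt_const (c := (EuclideanSpace.proj i : 𝔼(n) →L[ℝ] ℝ))
    (I := 𝓡 n) (x := q) (n := ∞)).clm_comp h2
  refine h3.congr_of_eventuallyEq (Filter.Eventually.of_forall fun x => ?_)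
  simp only [inTangentCoordinates, ContinuousLinearMap.inCoordinates, chartCovector]
  rw [TangentBundle.continuousLinearMapAt_model_space]
  erw [Bundle.Trivial.continuousLinearMapAt_trivialization]
  rfl

theorem isOpen_cotOver {O : Set Q} (hO : IsOpen O) : IsOpen (cotOver O : Set (Cotangent n Q)) :=
  hO.preimage (cotProj n Q).continuous

theorem contMDiff_cotProj : ContMDiff (cotModel n) (𝓡 n) ∞
    (fun ζ : Cotangent n Q => ζ.1) :=
  contMDiff_proj (fun q : Q => CotangentSpace n q)

theorem contMDiffOn_apply_vector {O : Set Q} {X : ∀ q : Q, TangentSpace (𝓡 n) q}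
    (hX : ContMDiffOn (𝓡 n) (𝓡 n).tangent ∞ (fun q => (⟨q, X q⟩ : TangentBundle (𝓡 n) Q)) O) :
    ContMDiffOn (cotModel n) 𝓘(ℝ, ℝ) ∞ (fun ζ : Cotangent n Q => ζ.2 (X ζ.1)) (cotOver O) := by
  have h1 : ContMDiffOn (cotModel n) (cotModel n) ∞
      (fun ζ : Cotangent n Q => (⟨ζ.1, ζ.2⟩ : Cotangent n Q)) (cotOver O) := contMDiffOn_id
  have h2 : ContMDiffOn (cotModel n) (𝓡 n).tangent ∞
      (fun ζ : Cotangent n Q => (⟨ζ.1, X ζ.1⟩ : TangentBundle (𝓡 n) Q)) (cotOver O) :=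
    hX.comp contMDiff_cotProj.contMDiffOn fun ζ hζ => hζ
  have h3 := ContMDiffOn.clm_bundle_apply (F₂ := ℝ) (E₂ := fun _ : Q => ℝ) h1 h2
  intro ζ hζ
  have h4 := h3 ζ hζ
  rw [contMDiffWithinAt_totalSpace] at h4
  exact h4.2

theorem contMDiffOn_momentum (he : e ∈ atlas 𝔼(n) Q) (l : Fin n) :
    ContMDiffOn (cotModel n) 𝓘(ℝ, ℝ) ∞ (fun ζ : Cotangent n Q => momentum e ζ l)
      (cotOver e.source) :=
  contMDiffOn_apply_vector (contMDiffOn_chartVector he l)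

theorem contMDiffAt_sum_smul {N : Type*} {E' : Type*} [NormedAddCommGroup E'] [NormedSpace ℝ E']
    {H' : Type*} [TopologicalSpace H'] {J' : ModelWithCorners ℝ E' H'} [TopologicalSpace N]
    [ChartedSpace H' N] {b : N → Q} {x : N} {c : Fin n → N → ℝ}
    {γ : Fin n → ∀ q : Q, CotangentSpace n q} (hb : ContMDiffAt J' (𝓡 n) ∞ b x)
    (hc : ∀ i, ContMDiffAt J' 𝓘(ℝ, ℝ) ∞ (c i) x)
    (hγ : ∀ i, ContMDiffAt (𝓡 n) (cotModel n) ∞ (fun q => (⟨q, γ i q⟩ : Cotangent n Q)) (b x)) :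
    ContMDiffAt J' (cotModel n) ∞
      (fun z => (⟨b z, ∑ i, c i z • γ i (b z)⟩ : Cotangent n Q)) x := by
  rw [contMDiffAt_hom_bundle]
  refine ⟨hb, ?_⟩
  have h1 : ∀ i, ContMDiffAt J' 𝓘(ℝ, 𝔼(n) →L[ℝ] ℝ) ∞ (fun z =>
      c i z • ContinuousLinearMap.inCoordinates 𝔼(n) (TangentSpace (𝓡 n)) ℝ
        (fun _ : Q => ℝ) (b x) (b z) (b x) (b z) (γ i (b z))) x := by
    intro i
    have := (contMDiffAt_hom_bundle _).1 (hγ i)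
    exact (hc i).smul (this.2.comp x hb)
  have h2 := ContMDiffAt.sum (t := Finset.univ) fun i _ => h1 i
  refine h2.congr_of_eventuallyEq (Filter.Eventually.of_forall fun z => ?_)
  ext v
  simp [ContinuousLinearMap.inCoordinates, sum_apply]

theorem isCoord_chart (he : e ∈ atlas 𝔼(n) Q) :
    IsCoord (𝓡 n) e.source e.target e e.symm where
  isOpen := e.open_source
  isOpen_target := e.open_target
  mapsTo := e.mapsTo
  left_inv _ h := e.left_inv h
  right_inv _ h := e.right_inv h
  contMDiffOn := contMDiffOn_atlasChart he
  contMDiffOn_symm := contMDiffOn_atlasChart_symm he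

theorem momentum_mk (he : e ∈ atlas 𝔼(n) Q) {q : Q} (hq : q ∈ e.source)
    (p : Fin n → ℝ) :
    momentum e (⟨q, ∑ i, p i • chartCovector e i q⟩ : Cotangent n Q) = p := by
  funext l
  simp [momentum, sum_apply, chartCovector_chartVector he hq]

theorem cotPoint_momentum (he : e ∈ atlas 𝔼(n) Q) {ζ : Cotangent n Q}
    (hζ : ζ.1 ∈ e.source) : cotPoint e (e ζ.1) (momentum e ζ) = ζ := by
  obtain ⟨q, ζ⟩ := ζ
  have h1 : e.symm (e q) = q := e.left_inv hζ
  simp only [cotPoint]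
  rw [h1]
  congr 1
  exact sum_smul_chartCovector he hζ ζ

theorem momentum_cotPoint (he : e ∈ atlas 𝔼(n) Q)
    {x : 𝔼(n)} (hx : x ∈ e.target) (p : Fin n → ℝ) :
    momentum e (cotPoint e x p : Cotangent n Q) = p :=
  momentum_mk he (e.map_target hx) p

theorem isCoord_cot (he : e ∈ atlas 𝔼(n) Q) :
    IsCoord (cotModel n) (cotOver e.source) (e.target ×ˢ (Set.univ : Set (Fin n → ℝ)))
      (fun ζ : Cotangent n Q => (e ζ.1, momentum e ζ)) (fun z => cotPoint e z.1 z.2) where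
  isOpen := isOpen_cotOver e.open_source
  isOpen_target := e.open_target.prod isOpen_univ
  mapsTo ζ hζ := ⟨e.map_source hζ, trivial⟩
  left_inv ζ hζ := cotPoint_momentum he hζ
  right_inv z hz := Prod.ext (e.right_inv hz.1) (momentum_cotPoint he hz.1 z.2)
  contMDiffOn := by
    refine ContMDiffOn.prodMk_space ?_ ?_
    · exact (contMDiffOn_atlasChart he).comp contMDiff_cotProj.contMDiffOn fun ζ hζ => hζ
    · exact contMDiffOn_pi_space.2 fun l => contMDiffOn_momentum he l
  contMDiffOn_symm := by
    rintro z hz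
    refine ContMDiffAt.contMDiffWithinAt ?_
    refine contMDiffAt_sum_smul (b := fun z : 𝔼(n) × (Fin n → ℝ) => e.symm z.1)
      (c := fun i z => z.2 i) ?_ (fun i => ?_) (fun i => ?_)
    · exact ((contMDiffOn_atlasChart_symm he).contMDiffAt (e.open_target.mem_nhds hz.1)).comp z
        contDiffAt_fst.contMDiffAt
    · exact ((contDiff_apply ℝ ℝ i).comp contDiff_snd).contDiffAt.contMDiffAt
    · exact (contMDiffOn_chartCovector he i).contMDiffAt
        (e.open_source.mem_nhds (e.map_target hz.1))

end CotangentCoordinates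
end

section

section ChartPhase

variable {n : ℕ} {Q : Type*} [TopologicalSpace Q] [ChartedSpace 𝔼(n) Q]
  [IsManifold (𝓡 n) ∞ Q] {e : OpenPartialHomeomorph Q 𝔼(n)}

/-- The bundle coordinates on the cotangent bundle. -/
abbrev cotCoord (e : OpenPartialHomeomorph Q 𝔼(n)) :
    Cotangent n Q → 𝔼(n) × (Fin n → ℝ) :=
  fun ζ => (e ζ.1, momentum e ζ)

/-- The inverse of the bundle coordinates. -/
abbrev cotCoordSymm (e : OpenPartialHomeomorph Q 𝔼(n)) :
    𝔼(n) × (Fin n → ℝ) → Cotangent n Q :=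
  fun z => cotPoint e z.1 z.2

variable (he : e ∈ atlas 𝔼(n) Q)

include he

theorem cotPoint_add (ζ : Cotangent n Q) (hζ : ζ.1 ∈ e.source) (γ : CotangentSpace n ζ.1) (t : ℝ) :
    cotPoint e (e ζ.1) (momentum e ζ + t • fun i => γ (chartVector e i ζ.1)) =
      (⟨ζ.1, ζ.2 + t • γ⟩ : Cotangent n Q) := by
  have h := cotPoint_momentum he (ζ := (⟨ζ.1, ζ.2 + t • γ⟩ : Cotangent n Q)) hζ
  rw [← h]
  rfl

section

variable {U : Set (Cotangent n Q)} (hU : IsOpen U) (hUe : U ⊆ cotOver e.source)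
  {f : Cotangent n Q → ℂ} (hf : SmoothFunOn (cotModel n) U f)

include hU hUe hf

theorem fiberDeriv_eqOn (γ : ∀ q : Q, CotangentSpace n q) {ζ : Cotangent n Q} (hζ : ζ ∈ U) :
    fiberDeriv γ f ζ = coordDeriv (cotCoord e) (cotCoordSymm e)
      (0, fun i => γ ζ.1 (chartVector e i ζ.1)) f ζ := by
  rw [← (isCoord_cot he).deriv_line hU hUe hf hζ, fiberDeriv]
  congr 1
  funext t
  simp only [← cotPoint_add he ζ (hUe hζ), Prod.fst_add, Prod.snd_add, Prod.smul_mk, smul_zero,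
    add_zero]

theorem partialP_eqOn (i : Fin n) : Set.EqOn (partialP e i f)
    (coordDeriv (cotCoord e) (cotCoordSymm e) (0, Pi.single i 1) f) U := by
  intro ζ hζ
  rw [partialP, fiberDeriv_eqOn he hU hUe hf _ hζ]
  congr 2
  funext j
  rw [chartCovector_chartVector he (q := ζ.1) (hUe hζ), Pi.single_apply]
  simp [eq_comm]

theorem partialQ_eqOn (i : Fin n) : Set.EqOn (partialQ e i f)
    (coordDeriv (cotCoord e) (cotCoordSymm e) (EuclideanSpace.single i 1, 0) f) U := by
  intro ζ hζ
  rw [← (isCoord_cot he).deriv_line hU hUe hf hζ, partialQ]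
  simp

theorem fiberDeriv_eq_sum (γ : ∀ q : Q, CotangentSpace n q) {ζ : Cotangent n Q} (hζ : ζ ∈ U) :
    fiberDeriv γ f ζ = ∑ i, (γ ζ.1 (chartVector e i ζ.1) : ℂ) * partialP e i f ζ := by
  rw [fiberDeriv_eqOn he hU hUe hf _ hζ]
  have : ((0, fun i => γ ζ.1 (chartVector e i ζ.1)) : 𝔼(n) × (Fin n → ℝ)) =
      ∑ i, γ ζ.1 (chartVector e i ζ.1) • ((0, Pi.single i 1) :
        𝔼(n) × (Fin n → ℝ)) := by
    refine Prod.ext ?_ ?_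
    · simp [Prod.fst_sum]
    · funext j
      simp [Prod.snd_sum, Finset.sum_apply, Pi.single_apply]
  rw [this, (isCoord_cot he).coordDeriv_sum_smul]
  exact Finset.sum_congr rfl fun i _ => by rw [partialP_eqOn he hU hUe hf i hζ]

end

theorem isDiffOpOn_partialP (i : Fin n) :
    IsDiffOpOn (cotModel n) (cotOver e.source) (partialP e i) :=
  ((isCoord_cot he).isDiffOpOn _).of_eqOn fun _ hU hUe _ hf => partialP_eqOn he hU hUe hf i

theorem isDiffOpOn_partialQ (i : Fin n) :
    IsDiffOpOn (cotModel n) (cotOver e.source) (partialQ e i) :=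
  ((isCoord_cot he).isDiffOpOn _).of_eqOn fun _ hU hUe _ hf => partialQ_eqOn he hU hUe hf i

theorem partialX_eqOn {O : Set Q} (hO : IsOpen O) (hOe : O ⊆ e.source) {u : Q → ℂ}
    (hu : SmoothFunOn (𝓡 n) O u) (i : Fin n) : Set.EqOn (partialX e i u)
      (coordDeriv e e.symm (EuclideanSpace.single i 1) u) O := fun q hq =>
  (isCoord_chart he).deriv_line hO hOe hu hq _

theorem smoothFunOn_momentum (l : Fin n) :
    SmoothFunOn (cotModel n) (cotOver e.source) (fun ζ => (momentum e ζ l : ℂ)) :=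
  Complex.ofRealCLM.contDiff.contMDiff.comp_contMDiffOn (contMDiffOn_momentum he l)

omit he in
theorem SmoothFunOn.pullbackFun {O : Set Q} {U : Set (Cotangent n Q)} (hUO : U ⊆ cotOver O)
    {u : Q → ℂ} (hu : SmoothFunOn (𝓡 n) O u) : SmoothFunOn (cotModel n) U (pullbackFun u) :=
  hu.comp_contMDiffOn contMDiff_cotProj.contMDiffOn hUO

theorem coordDeriv_pullbackFun {O : Set Q} (hO : IsOpen O) (hOe : O ⊆ e.source) {u : Q → ℂ}
    (hu : SmoothFunOn (𝓡 n) O u) (v : 𝔼(n) × (Fin n → ℝ)) {ζ : Cotangent n Q}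
    (hζ : ζ.1 ∈ O) : coordDeriv (cotCoord e) (cotCoordSymm e) v (pullbackFun u) ζ =
      coordDeriv e e.symm v.1 u ζ.1 := by
  have h1 := (isCoord_chart he).differentiableAt hO hOe hu hζ
  have h2 : HasFDerivAt (fun z : 𝔼(n) × (Fin n → ℝ) => u (e.symm z.1))
      ((fderiv ℝ (fun x => u (e.symm x)) (e ζ.1)).comp
        (ContinuousLinearMap.fst ℝ _ _)) (cotCoord e ζ) :=
    HasFDerivAt.comp (cotCoord e ζ) (g := fun x => u (e.symm x)) h1.hasFDerivAt hasFDerivAt_fst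
  rw [coordDeriv]
  exact congrArg (fun T => T v) h2.fderiv

section Phase

variable {U : Set (Cotangent n Q)} (hU : IsOpen U) {O : Set Q} (hO : IsOpen O)
  (hOe : O ⊆ e.source) (hUO : U ⊆ cotOver O)

omit he in
theorem IsCoord.toEnd_mul {E : Type*} [NormedAddCommGroup E] [NormedSpace ℝ E]
    {H : Type*} [TopologicalSpace H] {J : ModelWithCorners ℝ E H}
    {M : Type*} [TopologicalSpace M] [ChartedSpace H M] {V : Type*} [NormedAddCommGroup V]
    [NormedSpace ℝ V] {U₀ U : Set M} {W : Set V} {Θ : M → V} {Ψ : V → M} (h : IsCoord J U₀ W Θ Ψ)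
    (hU : IsOpen U) (hU₀ : U ⊆ U₀) (v : V) (a b : Sm J U) :
    (h.linOn hU hU₀ v).toEnd (a * b) = (h.linOn hU hU₀ v).toEnd a * b +
      a * (h.linOn hU hU₀ v).toEnd b := by
  have ha := represents_out a
  have hb := represents_out b
  exact ((ha.mul hb).toEnd _).ext (((ha.toEnd _).mul hb).add (ha.mul (hb.toEnd _)))
    fun x hx => h.coordDeriv_mul hU hU₀ ha.smooth hb.smooth v hx

omit he in
theorem IsCoord.toEnd_comm {E : Type*} [NormedAddCommGroup E] [NormedSpace ℝ E]
    {H : Type*} [TopologicalSpace H] {J : ModelWithCorners ℝ E H}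
    {M : Type*} [TopologicalSpace M] [ChartedSpace H M] {V : Type*} [NormedAddCommGroup V]
    [NormedSpace ℝ V] {U₀ U : Set M} {W : Set V} {Θ : M → V} {Ψ : V → M} (h : IsCoord J U₀ W Θ Ψ)
    (hU : IsOpen U) (hU₀ : U ⊆ U₀) (v w : V) (a : Sm J U) :
    (h.linOn hU hU₀ v).toEnd ((h.linOn hU hU₀ w).toEnd a) =
      (h.linOn hU hU₀ w).toEnd ((h.linOn hU hU₀ v).toEnd a) := by
  have ha := represents_out a
  exact ((ha.toEnd _).toEnd _).ext ((ha.toEnd _).toEnd _)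
    fun x hx => h.coordDeriv_comm hU hU₀ ha.smooth v w hx

/-- The phase space algebra of a cotangent chart. -/
def chartPhase : PhaseAlgebra n (Sm (cotModel n) U) (Sm (𝓡 n) O) where
  dq i := ((isCoord_cot he).linOn hU (hUO.trans fun _ h => hOe h)
    (EuclideanSpace.single i 1, 0)).toEnd
  dp i := ((isCoord_cot he).linOn hU (hUO.trans fun _ h => hOe h) (0, Pi.single i 1)).toEnd
  dx i := ((isCoord_chart he).linOn hO hOe (EuclideanSpace.single i 1)).toEnd
  p l := ((smoothFunOn_momentum he l).mono (hUO.trans fun _ h => hOe h)).toSm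
  pull := Sm.comap contMDiff_cotProj.contMDiffOn hUO
  dq_mul i := (isCoord_cot he).toEnd_mul hU (hUO.trans fun _ h => hOe h) _
  dp_mul i := (isCoord_cot he).toEnd_mul hU (hUO.trans fun _ h => hOe h) _
  dx_mul i := (isCoord_chart he).toEnd_mul hO hOe _
  dq_comm i j := (isCoord_cot he).toEnd_comm hU (hUO.trans fun _ h => hOe h) _ _
  dp_comm i j := (isCoord_cot he).toEnd_comm hU (hUO.trans fun _ h => hOe h) _ _
  dp_dq i j := (isCoord_cot he).toEnd_comm hU (hUO.trans fun _ h => hOe h) _ _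
  dp_p i j := by
    have h1 := (((smoothFunOn_momentum he j).mono (hUO.trans fun _ h => hOe h)).represents).toEnd
      ((isCoord_cot he).linOn hU (hUO.trans fun _ h => hOe h) (0, Pi.single i 1))
    refine Subtype.ext (funext fun ζ => (h1.eq ζ).trans ?_)
    refine ((isCoord_cot he).coordDeriv_clm (Complex.ofRealCLM.comp
      ((ContinuousLinearMap.proj j).comp (ContinuousLinearMap.snd ℝ _ _))) _ (hOe (hUO ζ.2))).trans ?_
    by_cases h : i = j
    · simp [h]
    · simp [h, Pi.single_apply, Ne.symm h]
  dq_p i j := by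
    have h1 := (((smoothFunOn_momentum he j).mono (hUO.trans fun _ h => hOe h)).represents).toEnd
      ((isCoord_cot he).linOn hU (hUO.trans fun _ h => hOe h) (EuclideanSpace.single i 1, 0))
    refine Subtype.ext (funext fun ζ => (h1.eq ζ).trans ?_)
    refine ((isCoord_cot he).coordDeriv_clm (Complex.ofRealCLM.comp
      ((ContinuousLinearMap.proj j).comp (ContinuousLinearMap.snd ℝ _ _))) _ (hOe (hUO ζ.2))).trans ?_
    simp
  dp_pull i u := by
    have hu := represents_out u
    refine ((hu.comap contMDiff_cotProj.contMDiffOn hUO).toEnd _).ext Represents.zero fun ζ hζ => ?_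
    refine (coordDeriv_pullbackFun he hO hOe hu.smooth _ (hUO hζ)).trans ?_
    simp [coordDeriv]
  dq_pull i u := by
    have hu := represents_out u
    exact ((hu.comap contMDiff_cotProj.contMDiffOn hUO).toEnd _).ext
      ((hu.toEnd _).comap contMDiff_cotProj.contMDiffOn hUO) fun ζ hζ =>
        coordDeriv_pullbackFun he hO hOe hu.smooth _ (hUO hζ)

theorem represents_dq {a : Sm (cotModel n) U} {f : Cotangent n Q → ℂ} (ha : Represents a f)
    (i : Fin n) : Represents ((chartPhase he hU hO hOe hUO).dq i a) (partialQ e i f) :=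
  (ha.toEnd ((isCoord_cot he).linOn hU (hUO.trans fun _ h => hOe h) _)).congr (partialQ_eqOn he hU (hUO.trans fun _ h => hOe h) ha.smooth i)

theorem represents_dp {a : Sm (cotModel n) U} {f : Cotangent n Q → ℂ} (ha : Represents a f)
    (i : Fin n) : Represents ((chartPhase he hU hO hOe hUO).dp i a) (partialP e i f) :=
  (ha.toEnd ((isCoord_cot he).linOn hU (hUO.trans fun _ h => hOe h) _)).congr (partialP_eqOn he hU (hUO.trans fun _ h => hOe h) ha.smooth i)

theorem represents_dx {a : Sm (𝓡 n) O} {u : Q → ℂ} (ha : Represents a u)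
    (i : Fin n) : Represents ((chartPhase he hU hO hOe hUO).dx i a) (partialX e i u) :=
  (ha.toEnd ((isCoord_chart he).linOn hO hOe _)).congr (partialX_eqOn he hO hOe ha.smooth i)

theorem represents_p (l : Fin n) : Represents ((chartPhase he hU hO hOe hUO).p l)
    (fun ζ => (momentum e ζ l : ℂ)) :=
  SmoothFunOn.represents ((smoothFunOn_momentum he l).mono (hUO.trans fun _ h => hOe h))

theorem represents_pull {a : Sm (𝓡 n) O} {u : Q → ℂ} (ha : Represents a u) :
    Represents ((chartPhase he hU hO hOe hUO).pull a) (pullbackFun u) :=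
  ha.comap contMDiff_cotProj.contMDiffOn hUO

end Phase

/-! ### Sections and evaluations -/

section Sections

variable {O : Set Q} (hO : IsOpen O) (hOe : O ⊆ e.source)

theorem contMDiffOn_constSection (hOe : O ⊆ e.source) (c : Fin n → ℝ) :
    ContMDiffOn (𝓡 n) (cotModel n) ∞
      (fun q => (⟨q, ∑ i, c i • chartCovector e i q⟩ : Cotangent n Q)) O := fun q hq =>
  (contMDiffAt_sum_smul (c := fun i _ => c i) contMDiffAt_id (fun i => contMDiffAt_const)
    fun i => (contMDiffOn_chartCovector he i).contMDiffAt
      (e.open_source.mem_nhds (hOe hq))).contMDiffWithinAt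

theorem isSection_comap {s : Q → Cotangent n Q} (hs : ContMDiffOn (𝓡 n) (cotModel n) ∞ s O)
    (hs' : Set.MapsTo s O (cotOver O)) {c : Fin n → ℝ}
    (h : ∀ q ∈ O, s q = ⟨q, ∑ i, c i • chartCovector e i q⟩) :
    (chartPhase he (isOpen_cotOver hO) hO hOe subset_rfl).IsSection (fun i => (c i : ℂ))
      (Sm.comap hs hs') where
  pull u := by
    refine Subtype.ext (funext fun q => ?_)
    have h1 : (⟨(s q).1, hs' q.2⟩ : O) = q := Subtype.ext (congrArg TotalSpace.proj (h q q.2))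
    exact congrArg u.1 h1
  p i := by
    refine Subtype.ext (funext fun q => ?_)
    change ((momentum e (s q) i : ℝ) : ℂ) = _
    rw [h q q.2, momentum_mk he (hOe q.2)]
    rfl
  dq i a := by
    have ha := represents_out a
    have h1 := ha.comap hs hs'
    refine ((ha.toEnd ((isCoord_cot he).linOn (isOpen_cotOver hO) (fun _ h => hOe h)
      (EuclideanSpace.single i 1, 0))).comap hs hs').ext
      (h1.toEnd ((isCoord_chart he).linOn hO hOe (EuclideanSpace.single i 1))) fun q hq => ?_
    have e1 : cotCoord e (s q) = (e q, c) := by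
      rw [h q hq, cotCoord, momentum_mk he (hOe hq)]
    have e2 : (fun x => Sm.out a (s (e.symm x))) =ᶠ[𝓝 (e q)]
        fun x => Sm.out a (cotCoordSymm e (x, c)) := by
      filter_upwards [((isCoord_chart he).isOpen_preimage hO).mem_nhds
        ((isCoord_chart he).mem_preimage hOe hq)] with x hx
      rw [h _ hx.2]
      rfl
    have hsq : s q ∈ cotOver O := hs' hq
    have h2 := (isCoord_cot he).differentiableAt (isOpen_cotOver hO) (fun _ h => hOe h)
      ha.smooth hsq
    have h3 : HasFDerivAt (fun x => Sm.out a (cotCoordSymm e (x, c)))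
        ((fderiv ℝ (fun z => Sm.out a (cotCoordSymm e z)) (e q, c)).comp
          (ContinuousLinearMap.inl ℝ 𝔼(n) (Fin n → ℝ))) (e q) := by
      refine HasFDerivAt.comp (e q) (g := fun z => Sm.out a (cotCoordSymm e z)) ?_
        (hasFDerivAt_prodMk_left (e q) c)
      rw [← e1]
      exact h2.hasFDerivAt
    change coordDeriv (cotCoord e) (cotCoordSymm e) _ _ (s q) = coordDeriv _ _ _ _ q
    rw [coordDeriv, coordDeriv, e2.fderiv_eq, h3.fderiv, e1]
    rfl

theorem eq_zero_of_isSection (a : Sm (cotModel n) (cotOver O))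
    (h : ∀ c σ, (chartPhase he (isOpen_cotOver hO) hO hOe subset_rfl).IsSection c σ → σ a = 0) :
    a = 0 := by
  refine Subtype.ext (funext fun ζ => ?_)
  have h1 := h _ _ (isSection_comap he hO hOe (contMDiffOn_constSection he hOe (momentum e ζ.1))
    (fun q hq => hq) fun q hq => rfl)
  have h2 := congrArg (fun b : Sm (𝓡 n) O => b.1 ⟨ζ.1.1, ζ.2⟩) h1
  refine Eq.trans ?_ h2
  refine congrArg a.1 (Subtype.ext ?_)
  obtain ⟨⟨q, ζ⟩, hζ⟩ := ζ
  change (⟨q, ζ⟩ : Cotangent n Q) = ⟨q, _⟩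
  congr 1
  exact (sum_smul_chartCovector he (hOe hζ) ζ).symm

omit he in
theorem contMDiff_cotZero :
    ContMDiff (𝓡 n) (cotModel n) ∞ (fun q : Q => (⟨q, 0⟩ : Cotangent n Q)) :=
  Bundle.contMDiff_zeroSection ℝ (fun q : Q => CotangentSpace n q)

omit he in
/-- Restriction to the zero section. -/
def Sm.zeroSection (O : Set Q) : Sm (cotModel n) (cotOver O : Set (Cotangent n Q)) →ₐ[ℂ] Sm (𝓡 n) O :=
  Sm.comap (φ := fun q => (⟨q, 0⟩ : Cotangent n Q)) contMDiff_cotZero.contMDiffOn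
    fun q hq => hq

theorem isSection_zeroSection :
    (chartPhase he (isOpen_cotOver hO) hO hOe subset_rfl).IsSection 0 (Sm.zeroSection O) := by
  have := isSection_comap he hO hOe (c := fun _ => 0)
    (s := fun q => (⟨q, 0⟩ : Cotangent n Q)) contMDiff_cotZero.contMDiffOn (fun q hq => hq)
    (fun q hq => by simp)
  have h0 : (fun i : Fin n => ((0 : ℝ) : ℂ)) = 0 := funext fun _ => Complex.ofReal_zero
  rw [h0] at this
  exact this

theorem eq_zero_of_dp (a : Sm (cotModel n) (cotOver O))
    (h : ∀ i, (chartPhase he (isOpen_cotOver hO) hO hOe subset_rfl).dp i a = 0)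
    (h0 : Sm.zeroSection O a = 0) : a = 0 := by
  have ha := represents_out a
  refine Subtype.ext (funext fun ζ => ?_)
  rw [ha.eq]
  have hmem : ∀ p : Fin n → ℝ, cotPoint e (e ζ.1.1) p ∈ (cotOver O : Set (Cotangent n Q)) := by
    intro p
    change e.symm (e ζ.1.1) ∈ O
    rw [e.left_inv (show ζ.1.1 ∈ e.source from hOe ζ.2)]
    exact ζ.2
  have hc : ∀ p, cotCoord e (cotPoint e (e ζ.1.1) p : Cotangent n Q) = (e ζ.1.1, p) := fun p =>
    (isCoord_cot he).right_inv (e ζ.1.1, p) ⟨e.map_source (hOe ζ.2), trivial⟩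
  have hd : ∀ p, HasFDerivAt (fun p => Sm.out a (cotPoint e (e ζ.1.1) p))
      ((fderiv ℝ (fun z => Sm.out a (cotCoordSymm e z)) (e ζ.1.1, p)).comp
        (ContinuousLinearMap.inr ℝ 𝔼(n) (Fin n → ℝ))) p := by
    intro p
    have hr : HasFDerivAt (fun p' : Fin n → ℝ => (e ζ.1.1, p'))
        (ContinuousLinearMap.inr ℝ 𝔼(n) (Fin n → ℝ)) p :=
      hasFDerivAt_prodMk_right (e ζ.1.1) p
    refine HasFDerivAt.comp p (g := fun z => Sm.out a (cotCoordSymm e z)) ?_ hr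
    have : DifferentiableAt ℝ (fun z => Sm.out a (cotCoordSymm e z))
        (cotCoord e (cotPoint e (e ζ.1.1) p : Cotangent n Q)) :=
      (isCoord_cot he).differentiableAt (isOpen_cotOver hO) (fun _ h => hOe h) ha.smooth (hmem p)
    rw [hc p] at this
    exact this.hasFDerivAt
  have hz : ∀ p, fderiv ℝ (fun p => Sm.out a (cotPoint e (e ζ.1.1) p)) p = 0 := by
    intro p
    rw [(hd p).fderiv]
    refine ContinuousLinearMap.coe_injective (LinearMap.pi_ext' fun i => LinearMap.ext_ring ?_)
    have h1 := (ha.toEnd ((isCoord_cot he).linOn (isOpen_cotOver hO) (fun _ h => hOe h)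
      (0, Pi.single i 1))).eq ⟨_, hmem p⟩
    have h2 := congrArg (fun b : Sm (cotModel n) (cotOver O) =>
      b.1 ⟨_, hmem p⟩) (h i)
    have h3 : fderiv ℝ (fun z => Sm.out a (cotCoordSymm e z))
        (cotCoord e (cotPoint e (e ζ.1.1) p : Cotangent n Q)) (0, Pi.single i 1) = 0 := h1.symm.trans h2
    rw [hc p] at h3
    simpa using h3
  have hconst := is_const_of_fderiv_eq_zero (fun p => (hd p).differentiableAt) hz
    (momentum e ζ.1) 0
  rw [cotPoint_momentum he (hOe ζ.2)] at hconst
  rw [hconst]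
  have h2 := congrArg (fun b : Sm (𝓡 n) O => b.1 ⟨ζ.1.1, ζ.2⟩) h0
  have h3 := (ha.comap (φ := fun q => (⟨q, 0⟩ : Cotangent n Q))
    contMDiff_cotZero.contMDiffOn fun q (hq : q ∈ O) => hq).eq ⟨ζ.1.1, ζ.2⟩
  refine Eq.trans ?_ (h3.symm.trans h2)
  have h4 : (cotPoint e (e ζ.1.1) 0 : Cotangent n Q) = ⟨ζ.1.1, 0⟩ := by
    have := cotPoint_momentum he (ζ := (⟨ζ.1.1, 0⟩ : Cotangent n Q)) (hOe ζ.2)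
    rw [← this]
    congr 1
  rw [h4]

/-- The coordinate functions vanishing at a point. -/
def chartCoord (x : O) (i : Fin n) : Sm (𝓡 n) O :=
  SmoothFunOn.toSm (U := O) (f := fun q => ((e q i - e x i : ℝ) : ℂ)) (by
    have h1 : ContMDiffOn (𝓡 n) 𝓘(ℝ, ℝ) ∞ (fun q => e q i) O :=
      (EuclideanSpace.proj (𝕜 := ℝ) i).contDiff.contMDiff.comp_contMDiffOn
        ((contMDiffOn_atlasChart he).mono hOe)
    exact Complex.ofRealCLM.contDiff.contMDiff.comp_contMDiffOn (h1.sub contMDiffOn_const))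

theorem dx_chartCoord {U : Set (Cotangent n Q)} (hU : IsOpen U) (hUO : U ⊆ cotOver O) (x : O)
    (i j : Fin n) : (chartPhase he hU hO hOe hUO).dx i (chartCoord he hOe x j) =
      if i = j then 1 else 0 := by
  refine Subtype.ext (funext fun q => ?_)
  have h1 := ((SmoothFunOn.represents _ : Represents (chartCoord he hOe x j) _).toEnd
    ((isCoord_chart he).linOn hO hOe (EuclideanSpace.single i 1))).eq q
  refine h1.trans ?_
  have h2 : (fun z => ((e (e.symm z) j - e x j : ℝ) : ℂ)) =ᶠ[𝓝 (e q)]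
      fun z => (Complex.ofRealCLM.comp (EuclideanSpace.proj (𝕜 := ℝ) j)) z - (e x j : ℂ) := by
    filter_upwards [e.open_target.mem_nhds (e.map_source (hOe q.2))] with z hz
    rw [e.right_inv hz]
    simp
  rw [coordDeriv, h2.fderiv_eq, fderiv_sub_const, ContinuousLinearMap.fderiv]
  by_cases h : i = j
  · simp [h]
  · simp [h, Pi.single_apply, Ne.symm h]

end Sections

end ChartPhase

end

section

section Christoffel

variable {n : ℕ} {Q : Type*} [TopologicalSpace Q] [ChartedSpace 𝔼(n) Q]
  [IsManifold (𝓡 n) ∞ Q] {e e' : OpenPartialHomeomorph Q 𝔼(n)}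
  {nabla : CovariantDerivative (𝓡 n) 𝔼(n) (TangentSpace (𝓡 n) : Q → Type _)}

theorem mfderiv_chartVector (he : e ∈ atlas 𝔼(n) Q) {q : Q}
    (hq : q ∈ e.source) (i : Fin n) :
    mfderiv (𝓡 n) 𝓘(ℝ, 𝔼(n)) e q (chartVector e i q) =
      EuclideanSpace.single i (1 : ℝ) := by
  obtain ⟨L, hL⟩ := exists_mfderiv_equiv he hq
  rw [chartVector, ← hL]
  have := congrArg (fun T => L (T (EuclideanSpace.single i (1 : ℝ))))
    (ContinuousLinearMap.inverse_equiv L)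
  exact this.trans (L.apply_symm_apply _)

theorem mdifferentiableAt_chartVector (he : e ∈ atlas 𝔼(n) Q) {q : Q}
    (hq : q ∈ e.source) (i : Fin n) :
    MDifferentiableAt (𝓡 n) (𝓡 n).tangent
      (fun q => (⟨q, chartVector e i q⟩ : TangentBundle (𝓡 n) Q)) q :=
  ((contMDiffOn_chartVector he i).contMDiffAt (e.open_source.mem_nhds hq)).mdifferentiableAt
    (by simp)

/-- Evaluation of a covector field on a vector field. -/
theorem contMDiffOn_covector_apply {O : Set Q} {γ : ∀ q : Q, CotangentSpace n q}
    {X : ∀ q : Q, TangentSpace (𝓡 n) q}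
    (hγ : ContMDiffOn (𝓡 n) (cotModel n) ∞ (fun q => (⟨q, γ q⟩ : Cotangent n Q)) O)
    (hX : ContMDiffOn (𝓡 n) (𝓡 n).tangent ∞ (fun q => (⟨q, X q⟩ : TangentBundle (𝓡 n) Q)) O) :
    ContMDiffOn (𝓡 n) 𝓘(ℝ, ℝ) ∞ (fun q => γ q (X q)) O :=
  (contMDiffOn_apply_vector hX).comp hγ fun q hq => hq

theorem contMDiffOn_christoffel [T2Space Q]
    (hsmooth : CovariantDerivative.ContMDiffCovariantDerivative nabla ∞)
    (he : e ∈ atlas 𝔼(n) Q) (l j k : Fin n) :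
    ContMDiffOn (𝓡 n) 𝓘(ℝ, ℝ) ∞ (christoffel nabla e l j k) e.source := by
  intro q hq
  obtain ⟨ψ, -, hψ⟩ := (SmoothBumpFunction.nhds_basis_tsupport (I := 𝓡 n) q).mem_iff.1
    (e.open_source.mem_nhds hq)
  have hX : ContMDiff (𝓡 n) (𝓡 n).tangent ∞
      (fun q => (⟨q, ((ψ : Q → ℝ) • chartVector e k) q⟩ : TangentBundle (𝓡 n) Q)) :=
    ContMDiffOn.smul_section_of_tsupport ψ.contMDiff.contMDiffOn e.open_source hψ
      (contMDiffOn_chartVector he k)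
  have h1 := hsmooth.contMDiff.contMDiff hX.contMDiffOn
  have h2 := (ContMDiffOn.clm_bundle_apply (F₂ := 𝔼(n))
    (E₂ := (TangentSpace (𝓡 n) : Q → Type _)) (h1.mono (Set.subset_univ e.source))
    (contMDiffOn_chartVector he j))
  have h3 := contMDiffOn_covector_apply (contMDiffOn_chartCovector he l) h2
  refine ((h3.contMDiffAt (e.open_source.mem_nhds hq)).congr_of_eventuallyEq ?_).contMDiffWithinAt
  have h4 := ψ.eventuallyEq_one
  filter_upwards [h4.eventually_nhds, e.open_source.mem_nhds hq] with q' h5 h6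
  rw [christoffel]
  congr 2
  refine nabla.isCovariantDerivativeOn.congr_of_eventuallyEq (s := Set.univ)
    (mdifferentiableAt_chartVector he h6 k) (hX.contMDiffAt.mdifferentiableAt (by simp))
    Filter.univ_mem ?_
  filter_upwards [h5] with x hx
  simp [hx]

theorem IsCovariantDerivativeOn.sum_smul {cov : (∀ q : Q, TangentSpace (𝓡 n) q) →
      ∀ q : Q, TangentSpace (𝓡 n) q →L[ℝ] TangentSpace (𝓡 n) q}
    (hcov : IsCovariantDerivativeOn 𝔼(n) cov Set.univ) {ι : Type*}
    (s : Finset ι) {g : ι → Q → ℝ} {X : ι → ∀ q : Q, TangentSpace (𝓡 n) q} {q : Q}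
    (hg : ∀ i, MDifferentiableAt (𝓡 n) 𝓘(ℝ, ℝ) (g i) q)
    (hX : ∀ i, MDifferentiableAt (𝓡 n) (𝓡 n).tangent
      (fun q => (⟨q, X i q⟩ : TangentBundle (𝓡 n) Q)) q) :
    cov (∑ i ∈ s, g i • X i) q =
      ∑ i ∈ s, (g i q • cov (X i) q + (mvfderiv (𝓡 n) (g i) q).smulRight (X i q)) := by
  classical
  have hd : ∀ i, MDifferentiableAt (𝓡 n) (𝓡 n).tangent
      (fun q => (⟨q, (g i • X i) q⟩ : TangentBundle (𝓡 n) Q)) q := fun i => (hg i).smul_section (hX i)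
  have hs : ∀ s : Finset ι, MDifferentiableAt (𝓡 n) (𝓡 n).tangent
      (fun q => (⟨q, (∑ i ∈ s, g i • X i) q⟩ : TangentBundle (𝓡 n) Q)) q := by
    intro s
    have := MDifferentiableAt.sum_section (s := s) fun i _ => hd i
    simpa using this
  induction s using Finset.induction_on with
  | empty => simpa using hcov.zero
  | insert i s hi ih =>
    rw [Finset.sum_insert hi, Finset.sum_insert hi, hcov.add (hd i) (hs s), ih,
      hcov.leibniz (hX i) (hg i)]

variable (he : e ∈ atlas 𝔼(n) Q)
  (he' : e' ∈ atlas 𝔼(n) Q)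

/-- The Jacobian `∂x'^l/∂x^j` of a change of charts. -/
def chartJacobian (e' e : OpenPartialHomeomorph Q 𝔼(n)) (l j : Fin n) (q : Q) :
    ℝ := chartCovector e' l q (chartVector e j q)

include he he'

theorem contMDiffOn_chartJacobian (l j : Fin n) :
    ContMDiffOn (𝓡 n) 𝓘(ℝ, ℝ) ∞ (chartJacobian e' e l j) (e.source ∩ e'.source) :=
  contMDiffOn_covector_apply ((contMDiffOn_chartCovector he' l).mono Set.inter_subset_right)
    ((contMDiffOn_chartVector he j).mono Set.inter_subset_left)

theorem smoothFunOn_chartJacobian (l j : Fin n) :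
    SmoothFunOn (𝓡 n) (e.source ∩ e'.source) (fun q => (chartJacobian e' e l j q : ℂ)) :=
  Complex.ofRealCLM.contDiff.contMDiff.comp_contMDiffOn (contMDiffOn_chartJacobian he he' l j)

omit he in
theorem chartJacobian_mul (e'' : OpenPartialHomeomorph Q 𝔼(n)) (l m : Fin n)
    {q : Q} (hq : q ∈ e'.source) (e₀ : OpenPartialHomeomorph Q 𝔼(n)) :
    ∑ j, chartJacobian e'' e' l j q * chartJacobian e' e₀ j m q = chartJacobian e'' e₀ l m q := by
  simp only [chartJacobian]
  conv_rhs => rw [← sum_chartCovector_smul_chartVector he' hq (chartVector e₀ m q)]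
  simp [map_sum, mul_comm]

omit he in
theorem chartJacobian_self (l m : Fin n) {q : Q} (hq : q ∈ e'.source) :
    chartJacobian e' e' l m q = if l = m then 1 else 0 := chartCovector_chartVector he' hq l m

theorem christoffel_change (l a b : Fin n) {q : Q} (hq : q ∈ e.source) (hq' : q ∈ e'.source) :
    ∑ j, ∑ k, christoffel nabla e' l j k q * chartJacobian e' e j a q * chartJacobian e' e k b q =
      ∑ m, chartJacobian e' e l m q * christoffel nabla e m a b q -
        mvfderiv (𝓡 n) (chartJacobian e' e l b) q (chartVector e a q) := by
  have hm : (e.source ∩ e'.source) ∈ 𝓝 q := (e.open_source.inter e'.open_source).mem_nhds ⟨hq, hq'⟩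
  have hg : ∀ k, MDifferentiableAt (𝓡 n) 𝓘(ℝ, ℝ) (chartJacobian e' e k b) q := fun k =>
    ((contMDiffOn_chartJacobian he he' k b).contMDiffAt hm).mdifferentiableAt (by simp)
  have hX := fun k => mdifferentiableAt_chartVector he' hq' k
  have hexp : ∀ᶠ x in 𝓝 q, chartVector e b x =
      (∑ k, chartJacobian e' e k b • chartVector e' k) x := by
    filter_upwards [e'.open_source.mem_nhds hq'] with x hx
    rw [Finset.sum_apply]
    exact (sum_chartCovector_smul_chartVector he' hx (chartVector e b x)).symm
  have h1 : nabla (chartVector e b) q = nabla (∑ k, chartJacobian e' e k b • chartVector e' k) q := by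
    refine nabla.isCovariantDerivativeOn.congr_of_eventuallyEq (s := Set.univ)
      (mdifferentiableAt_chartVector he hq b) ?_ Filter.univ_mem hexp
    exact (mdifferentiableAt_chartVector he hq b).congr_of_eventuallyEq
      (hexp.mono fun x hx => congrArg (TotalSpace.mk x) hx.symm)
  have h2 := nabla.isCovariantDerivativeOn.sum_smul Finset.univ hg hX
  have h3 : ∑ m, chartJacobian e' e l m q * christoffel nabla e m a b q =
      chartCovector e' l q (nabla (chartVector e b) q (chartVector e a q)) := by
    conv_rhs => rw [← sum_chartCovector_smul_chartVector he hq
      (nabla (chartVector e b) q (chartVector e a q))]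
    simp [map_sum, mul_comm, christoffel, chartJacobian]
  have h4 : ∀ k, ∑ j, christoffel nabla e' l j k q * chartJacobian e' e j a q =
      chartCovector e' l q (nabla (chartVector e' k) q (chartVector e a q)) := by
    intro k
    conv_rhs => rw [← sum_chartCovector_smul_chartVector he' hq' (chartVector e a q)]
    simp [map_sum, mul_comm, christoffel, chartJacobian]
  rw [h3, h1, h2, Finset.sum_comm]
  simp only [← Finset.sum_mul, h4]
  simp only [sum_apply, _root_.add_apply, _root_.smul_apply,
    ContinuousLinearMap.smulRight_apply, map_sum, map_add, map_smul, smul_eq_mul,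
    Finset.sum_add_distrib, chartCovector_chartVector he' hq', mul_ite, mul_one, mul_zero,
    Finset.sum_ite_eq, Finset.mem_univ, if_true]
  rw [add_sub_cancel_right]
  exact Finset.sum_congr rfl fun k _ => mul_comm _ _

omit he' in
theorem partialX_eq_mvfderiv {O : Set Q} (hO : IsOpen O) (hOe : O ⊆ e.source) {u : Q → ℂ}
    (hu : SmoothFunOn (𝓡 n) O u) (i : Fin n) {q : Q} (hq : q ∈ O) :
    partialX e i u q = mvfderiv (𝓡 n) u q (chartVector e i q) := by
  rw [partialX_eqOn he hO hOe hu i hq, coordDeriv]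
  have h1 := ((isCoord_chart he).differentiableAt hO hOe hu hq).hasFDerivAt.hasMFDerivAt
  have h2 : MDifferentiableAt (𝓡 n) 𝓘(ℝ, 𝔼(n)) e q :=
    ((contMDiffOn_atlasChart he).contMDiffAt (e.open_source.mem_nhds (hOe hq))).mdifferentiableAt
      (by simp)
  have h3 := (h1.comp q h2.hasMFDerivAt).congr_of_eventuallyEq (f₁ := u) (by
    filter_upwards [e.open_source.mem_nhds (hOe hq)] with x hx
    simp [e.left_inv hx])
  rw [mvfderiv, h3.mfderiv]
  have := mfderiv_chartVector he (hOe hq) i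
  change _ = fderiv ℝ (fun x => u (e.symm x)) (e q)
    (mfderiv (𝓡 n) 𝓘(ℝ, 𝔼(n)) e q (chartVector e i q))
  rw [this]

theorem partialX_change {O : Set Q} (hO : IsOpen O) (hOe : O ⊆ e.source) (hOe' : O ⊆ e'.source)
    {u : Q → ℂ} (hu : SmoothFunOn (𝓡 n) O u) (k : Fin n) {q : Q} (hq : q ∈ O) :
    partialX e' k u q = ∑ j, (chartJacobian e e' j k q : ℂ) * partialX e j u q := by
  rw [partialX_eq_mvfderiv he' hO hOe' hu k hq,
    ← sum_chartCovector_smul_chartVector he (hOe hq) (chartVector e' k q), map_sum]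
  refine Finset.sum_congr rfl fun j _ => ?_
  rw [partialX_eq_mvfderiv he hO hOe hu j hq, map_smul]
  rfl

omit he' in
theorem partialX_ofReal {O : Set Q} (hO : IsOpen O) (hOe : O ⊆ e.source) {u : Q → ℝ}
    (hu : ContMDiffOn (𝓡 n) 𝓘(ℝ, ℝ) ∞ u O) (i : Fin n) {q : Q} (hq : q ∈ O) :
    partialX e i (fun q => (u q : ℂ)) q = (mvfderiv (𝓡 n) u q (chartVector e i q) : ℂ) := by
  have hu' : SmoothFunOn (𝓡 n) O (fun q => (u q : ℂ)) :=
    Complex.ofRealCLM.contDiff.contMDiff.comp_contMDiffOn hu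
  rw [partialX_eq_mvfderiv he hO hOe hu' i hq]
  have h1 : MDifferentiableAt (𝓡 n) 𝓘(ℝ, ℝ) u q :=
    (hu.contMDiffAt (hO.mem_nhds hq)).mdifferentiableAt (by simp)
  have h2 := (Complex.ofRealCLM.hasFDerivAt (x := u q)).hasMFDerivAt.comp q h1.hasMFDerivAt
  have h3 : (fun q => (u q : ℂ)) = Complex.ofRealCLM ∘ u := rfl
  rw [mvfderiv, mvfderiv, h3, h2.mfderiv]
  rfl

theorem partialX_coord {O : Set Q} (hO : IsOpen O) (hOe : O ⊆ e.source) (hOe' : O ⊆ e'.source)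
    (j k : Fin n) {q : Q} (hq : q ∈ O) :
    partialX e' k (fun q => ((e q j : ℝ) : ℂ)) q = (chartJacobian e e' j k q : ℂ) := by
  have h0 : ContMDiffOn (𝓡 n) 𝓘(ℝ, ℝ) ∞ (fun q => e q j) O :=
    (EuclideanSpace.proj (𝕜 := ℝ) j).contDiff.contMDiff.comp_contMDiffOn
      ((contMDiffOn_atlasChart he).mono hOe)
  rw [partialX_ofReal he' hO hOe' h0 k hq]
  have h1 : MDifferentiableAt (𝓡 n) 𝓘(ℝ, 𝔼(n)) e q :=
    ((contMDiffOn_atlasChart he).contMDiffAt (e.open_source.mem_nhds (hOe hq))).mdifferentiableAt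
      (by simp)
  have h2 := ((EuclideanSpace.proj (𝕜 := ℝ) j).hasFDerivAt (x := e q)).hasMFDerivAt.comp q
    h1.hasMFDerivAt
  have h3 : (fun q => e q j) = (EuclideanSpace.proj (𝕜 := ℝ) j) ∘ e := rfl
  rw [mvfderiv, h3, h2.mfderiv]
  rfl

end Christoffel

end

section

/-- A smooth function on a part of a coordinate patch extends, near a given point, to the patch. -/
theorem IsCoord.exists_extension {E : Type*} [NormedAddCommGroup E] [NormedSpace ℝ E]
    {H : Type*} [TopologicalSpace H] {J : ModelWithCorners ℝ E H}
    {M : Type*} [TopologicalSpace M] [ChartedSpace H M] {V : Type*} [NormedAddCommGroup V]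
    [NormedSpace ℝ V] [HasContDiffBump V] {U₀ U : Set M} {W : Set V} {Θ : M → V} {Ψ : V → M}
    (h : IsCoord J U₀ W Θ Ψ) (hU : IsOpen U) (hU₀ : U ⊆ U₀) {f : M → ℂ} (hf : SmoothFunOn J U f)
    {x : M} (hx : x ∈ U) : ∃ f' : M → ℂ, SmoothFunOn J U₀ f' ∧ f' =ᶠ[𝓝 x] f := by
  have hD := h.isOpen_preimage hU
  obtain ⟨r, hr, hrD⟩ := Metric.isOpen_iff.1 hD _ (h.mem_preimage hU₀ hx)
  let b : ContDiffBump (Θ x) := ⟨r / 4, r / 2, by positivity, by linarith⟩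
  have hb : Metric.closedBall (Θ x) b.rOut ⊆ W ∩ Ψ ⁻¹' U :=
    (Metric.closedBall_subset_ball (show r / 2 < r by linarith)).trans hrD
  have hF : ContDiff ℝ ∞ (fun z => b z • f (Ψ z)) := by
    rw [contDiff_iff_contDiffAt]
    intro z
    by_cases hz : z ∈ Metric.closedBall (Θ x) b.rOut
    · exact b.contDiff.contDiffAt.smul ((h.contDiffOn hf).contDiffAt (hD.mem_nhds (hb hz)))
    · refine (contDiffAt_const (c := (0 : ℂ))).congr_of_eventuallyEq ?_
      filter_upwards [Metric.isClosed_closedBall.isOpen_compl.mem_nhds hz] with w hw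
      rw [b.zero_of_le_dist (le_of_lt (by simpa using hw)), zero_smul]
  refine ⟨fun y => b (Θ y) • f (Ψ (Θ y)),
    h.smoothFunOn_of_contDiffOn subset_rfl hF.contDiffOn, ?_⟩
  have hc : ContinuousAt Θ x :=
    (h.contMDiffOn.continuousOn.continuousAt (h.isOpen.mem_nhds (hU₀ hx)))
  filter_upwards [hU.mem_nhds hx, hc.preimage_mem_nhds (Metric.ball_mem_nhds _ b.rIn_pos)]
    with y hy hy'
  rw [b.one_of_mem_closedBall (Metric.ball_subset_closedBall hy'), one_smul,
    h.left_inv y (hU₀ hy)]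

section ChartStar

variable {n : ℕ} {Q : Type*} [TopologicalSpace Q] [ChartedSpace 𝔼(n) Q]
  [IsManifold (𝓡 n) ∞ Q] {e e' : OpenPartialHomeomorph Q 𝔼(n)}

section

variable (nabla : CovariantDerivative (𝓡 n) 𝔼(n)
    (TangentSpace (𝓡 n) : Q → Type _)) (e : OpenPartialHomeomorph Q 𝔼(n))

/-- The momenta, as complex functions. -/
abbrev cotMomentum (l : Fin n) (ζ : Cotangent n Q) : ℂ := (momentum e ζ l : ℂ)

/-- The Christoffel symbols, as functions on the cotangent bundle. -/
abbrev cotChristoffel (l j k : Fin n) : Cotangent n Q → ℂ :=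
  pullbackFun fun q => (christoffel nabla e l j k q : ℂ)

/-- The transform of symbols, in a chart. -/
abbrev chartS : ℕ → (Cotangent n Q → ℂ) → Cotangent n Q → ℂ :=
  symS (partialQ e) (partialP e) (cotMomentum e) (cotChristoffel nabla e)

/-- The cochains of the standard-ordered star product, in a chart. -/
abbrev chartCochain : ℕ → (Cotangent n Q → ℂ) → (Cotangent n Q → ℂ) → Cotangent n Q → ℂ :=
  localCochain (partialQ e) (partialP e) (cotMomentum e) (cotChristoffel nabla e)

/-- The operators `𝖥(𝖣^r u)` along the zero section, in a chart. -/
def chartSymD (r : ℕ) (u : Q → ℂ) (f : Cotangent n Q → ℂ) (q : Q) : ℂ :=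
  ∑ I : Fin r → Fin n, iterCov nabla e u r I q * iterPartialP e r I f ⟨q, 0⟩

end

variable {nabla : CovariantDerivative (𝓡 n) 𝔼(n)
    (TangentSpace (𝓡 n) : Q → Type _)} [T2Space Q]
  (hs : CovariantDerivative.ContMDiffCovariantDerivative nabla ∞)
  (he : e ∈ atlas 𝔼(n) Q)

include hs he

theorem smoothFunOn_christoffel (l j k : Fin n) :
    SmoothFunOn (𝓡 n) e.source (fun q => (christoffel nabla e l j k q : ℂ)) :=
  Complex.ofRealCLM.contDiff.contMDiff.comp_contMDiffOn (contMDiffOn_christoffel hs he l j k)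

theorem smoothFunOn_cotChristoffel (l j k : Fin n) :
    SmoothFunOn (cotModel n) (cotOver e.source) (cotChristoffel nabla e l j k) :=
  (smoothFunOn_christoffel hs he l j k).pullbackFun subset_rfl

theorem isDiffOpOn_chartOp (j d : ℕ) : IsDiffOpOn (cotModel n) (cotOver e.source)
    (symOp (partialQ e) (partialP e) (cotMomentum e) (cotChristoffel nabla e) j d) :=
  isDiffOpOn_symOp (isDiffOpOn_partialQ he) (isDiffOpOn_partialP he) (smoothFunOn_momentum he)
    (smoothFunOn_cotChristoffel hs he) j d

theorem isDiffOpOn_chartS (j : ℕ) : IsDiffOpOn (cotModel n) (cotOver e.source) (chartS nabla e j) :=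
  isDiffOpOn_symS (isDiffOpOn_partialQ he) (isDiffOpOn_partialP he) (smoothFunOn_momentum he)
    (smoothFunOn_cotChristoffel hs he) j

theorem isBidiffOn_chartCochain (N : ℕ) :
    IsBidiffOn (cotModel n) (cotOver e.source) (chartCochain nabla e N) :=
  isBidiffOn_localCochain (isDiffOpOn_partialQ he) (isDiffOpOn_partialP he)
    (smoothFunOn_momentum he) (smoothFunOn_cotChristoffel hs he) N

variable {U : Set (Cotangent n Q)} (hU : IsOpen U) {O : Set Q} (hO : IsOpen O)
  (hOe : O ⊆ e.source) (hUO : U ⊆ cotOver O)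

/-- The Christoffel symbols as smooth functions. -/
def chartG (l j k : Fin n) : Sm (𝓡 n) O :=
  ((smoothFunOn_christoffel hs he l j k).mono hOe).toSm

theorem represents_chartG (l j k : Fin n) :
    Represents (chartG hs he hOe l j k) (fun q => (christoffel nabla e l j k q : ℂ)) :=
  SmoothFunOn.represents ((smoothFunOn_christoffel hs he l j k).mono hOe)

theorem chartPhase_isGivenBy : (chartPhase he hU hO hOe hUO).IsGivenBy (chartG hs he hOe)
    (partialQ e) (partialP e) (cotMomentum e) (cotChristoffel nabla e) where
  dq i a f ha := represents_dq he hU hO hOe hUO ha i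
  dp i a f ha := represents_dp he hU hO hOe hUO ha i
  p l := represents_p he hU hO hOe hUO l
  pull l i k := represents_pull he hU hO hOe hUO (represents_chartG hs he hOe l i k)

omit hs he in
theorem cotOver_mono (hOe : O ⊆ e.source) (hUO : U ⊆ cotOver O) :
    U ⊆ (cotOver e.source : Set (Cotangent n Q)) := hUO.trans fun _ h => hOe h

/-- The operators of the symbol family of a chart. -/
def chartT (hUe : U ⊆ cotOver e.source) (j d : ℕ) : Module.End ℂ (Sm (cotModel n) U) :=
  ((isDiffOpOn_chartOp hs he j d).linOn hU hUe).toEnd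

/-- The inverse of the transform of symbols of a chart. -/
def chartR (hUe : U ⊆ cotOver e.source) (j : ℕ) : Module.End ℂ (Sm (cotModel n) U) :=
  ((IsDiffOpOn.invSeries (isDiffOpOn_chartS hs he) j).linOn hU hUe).toEnd

open PhaseAlgebra (IsSymbolFamily)

theorem isSymbolFamily_chartT : (chartPhase he hU hO hOe hUO).IsSymbolFamily (chartG hs he hOe)
    (chartT hs he hU (cotOver_mono hOe hUO)) :=
  (chartPhase_isGivenBy hs he hU hO hOe hUO).isSymbolFamily fun _ _ _ _ ha => ha.toEnd _

theorem represents_chartS (hUe : U ⊆ cotOver e.source) (j : ℕ) (a : Sm (cotModel n) U)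
    (f : Cotangent n Q → ℂ) (ha : Represents a f) : Represents
      (((-Complex.I) ^ j • IsSymbolFamily.total (chartT hs he hU hUe) j :
        Module.End ℂ (Sm (cotModel n) U)) a) (chartS nabla e j f) :=
  PhaseAlgebra.IsGivenBy.represents_symS (fun _ _ _ _ ha => ha.toEnd _) j ha

theorem represents_chartR (hUe : U ⊆ cotOver e.source) (j : ℕ) (a : Sm (cotModel n) U)
    (f : Cotangent n Q → ℂ) (ha : Represents a f) :
    Represents (chartR hs he hU hUe j a) (invSeries (chartS nabla e) j f) := ha.toEnd _

include hO in
theorem isInvSeries_chartR : IsInvSeries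
    (fun j => (-Complex.I) ^ j • IsSymbolFamily.total (chartT hs he hU (cotOver_mono hOe hUO)) j)
    (chartR hs he hU (cotOver_mono hOe hUO)) :=
  isInvSeries_toEnd (by
    rw [pow_zero, one_smul]
    exact (isSymbolFamily_chartT hs he hU hO hOe hUO).total_zero)
    (represents_chartS hs he hU _) (represents_chartR hs he hU _)

theorem represents_flatC (r : ℕ) (a : Sm (cotModel n) U) (f : Cotangent n Q → ℂ)
    (b : Sm (cotModel n) U) (g : Cotangent n Q → ℂ) (ha : Represents a f) (hb : Represents b g) :
    Represents ((chartPhase he hU hO hOe hUO).flatC (-Complex.I) r a b)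
      (((-Complex.I) ^ r / (r.factorial : ℂ)) • flatFun (partialQ e) (partialP e) r f g) :=
  (chartPhase_isGivenBy hs he hU hO hOe hUO).flatC r ha hb

theorem represents_chartCochain (N : ℕ) (a : Sm (cotModel n) U) (f : Cotangent n Q → ℂ)
    (b : Sm (cotModel n) U) (g : Cotangent n Q → ℂ) (ha : Represents a f) (hb : Represents b g) :
    Represents (conjCochain (fun r => chartR hs he hU (cotOver_mono hOe hUO) r)
      (fun r x y => (chartPhase he hU hO hOe hUO).flatC (-Complex.I) r x y)
      (fun j => ((-Complex.I) ^ j • IsSymbolFamily.total (chartT hs he hU (cotOver_mono hOe hUO)) j :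
        Module.End ℂ (Sm (cotModel n) U))) N a b)
      (chartCochain nabla e N f g) :=
  Represents.conjCochain (represents_chartR hs he hU _) (represents_flatC hs he hU hO hOe hUO)
    (represents_chartS hs he hU _) N ha hb

/-! ### The representation -/

omit hs in
theorem smoothFunOn_partialX {u : Q → ℂ} (hO : IsOpen O) (hOe : O ⊆ e.source)
    (hu : SmoothFunOn (𝓡 n) O u) (i : Fin n) : SmoothFunOn (𝓡 n) O (partialX e i u) :=
  (((isCoord_chart he).linOn hO hOe _).smooth u hu).congr (partialX_eqOn he hO hOe hu i)

theorem smoothFunOn_iterCov {u : Q → ℂ} (hO : IsOpen O) (hOe : O ⊆ e.source)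
    (hu : SmoothFunOn (𝓡 n) O u) (r : ℕ) (I : Fin r → Fin n) :
    SmoothFunOn (𝓡 n) O (iterCov nabla e u r I) := by
  induction r with
  | zero => exact hu
  | succ r ih =>
    have h1 : SmoothFunOn (𝓡 n) O (∑ m : Fin r, ∑ l : Fin n,
        fun q => (christoffel nabla e l (I 0) (I m.succ) q : ℂ) *
          iterCov nabla e u r (Function.update (fun m' => I m'.succ) m l) q) :=
      SmoothFunOn.sum fun m _ => SmoothFunOn.sum fun l _ =>
        ((smoothFunOn_christoffel hs he l _ _).mono hOe).mul (ih _)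
    refine ((smoothFunOn_partialX he hO hOe (ih fun m => I m.succ) (I 0)).sub h1).congr fun q hq => ?_
    simp [iterCov, Finset.sum_apply]

/-- The components of the iterated covariant derivatives, as smooth functions. -/
def chartCov {u : Q → ℂ} (hu : SmoothFunOn (𝓡 n) O u) (r : ℕ) (I : Fin r → Fin n) : Sm (𝓡 n) O :=
  (smoothFunOn_iterCov hs he hO hOe hu r I).toSm

theorem represents_chartCov {u : Q → ℂ} (hu : SmoothFunOn (𝓡 n) O u) (r : ℕ) (I : Fin r → Fin n) :
    Represents (chartCov hs he hO hOe hu r I) (iterCov nabla e u r I) :=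
  SmoothFunOn.represents (smoothFunOn_iterCov hs he hO hOe hu r I)

theorem isIterCov_chartCov {u : Q → ℂ} (hu : SmoothFunOn (𝓡 n) O u) :
    (chartPhase he hU hO hOe hUO).IsIterCov (chartG hs he hOe) hu.toSm
      (chartCov hs he hO hOe hu) where
  zero I := rfl
  succ r I := by
    refine (represents_chartCov hs he hO hOe hu (r + 1) I).ext
      ((represents_dx he hU hO hOe hUO (represents_chartCov hs he hO hOe hu r fun m => I m.succ)
        (I 0)).sub
        (Represents.sum fun m _ => Represents.sum fun l _ =>
          (represents_chartG hs he hOe l _ _).mul (represents_chartCov hs he hO hOe hu r _)))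
      fun q hq => ?_
    simp [iterCov, Finset.sum_apply]

theorem represents_iterDp (r : ℕ) (I : Fin r → Fin n) {a : Sm (cotModel n) U}
    {f : Cotangent n Q → ℂ} (ha : Represents a f) :
    Represents ((chartPhase he hU hO hOe hUO).iterDp r I a) (iterPartialP e r I f) := by
  induction r with
  | zero => exact ha
  | succ r ih => exact represents_dp he hU hO hOe hUO (ih _) (I 0)

theorem represents_covSum {u : Q → ℂ} (hu : SmoothFunOn (𝓡 n) O u) (r : ℕ)
    {a : Sm (cotModel n) (cotOver O)} {f : Cotangent n Q → ℂ} (ha : Represents a f) :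
    Represents ((chartPhase he (isOpen_cotOver hO) hO hOe subset_rfl).covSum (Sm.zeroSection O)
      (chartCov hs he hO hOe hu) r a) (chartSymD nabla e r u f) := by
  rw [PhaseAlgebra.covSum_apply]
  have : chartSymD nabla e r u f = ∑ I : Fin r → Fin n,
      fun q => iterCov nabla e u r I q * iterPartialP e r I f ⟨q, 0⟩ := by
    funext q; simp [chartSymD, Finset.sum_apply]
  rw [this]
  exact Represents.sum fun I _ => (represents_chartCov hs he hO hOe hu r I).mul
    ((represents_iterDp hs he (isOpen_cotOver hO) hO hOe subset_rfl r I ha).comap _ _)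

theorem repC_chart {u : Q → ℂ} (hu : SmoothFunOn (𝓡 n) O u) (N : ℕ)
    (a : Sm (cotModel n) (cotOver O)) :
    (chartPhase he (isOpen_cotOver hO) hO hOe subset_rfl).repC (Sm.zeroSection O)
      (fun j => (-Complex.I) ^ j • IsSymbolFamily.total
        (chartT hs he (isOpen_cotOver hO) (cotOver_mono hOe subset_rfl)) j) N a hu.toSm =
      ((-Complex.I) ^ N / (N.factorial : ℂ)) • (chartPhase he (isOpen_cotOver hO) hO hOe
        subset_rfl).covSum (Sm.zeroSection O) (chartCov hs he hO hOe hu) N a :=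
  (isSymbolFamily_chartT hs he (isOpen_cotOver hO) hO hOe subset_rfl).repC_eq
    (isSection_zeroSection he hO hOe) (isIterCov_chartCov hs he (isOpen_cotOver hO) hO hOe
      subset_rfl hu) N a

end ChartStar

end

section

section ChartChangeCot

variable {n : ℕ} {Q : Type*} [TopologicalSpace Q] [ChartedSpace 𝔼(n) Q]
  [IsManifold (𝓡 n) ∞ Q] {e e' : OpenPartialHomeomorph Q 𝔼(n)}
  (he : e ∈ atlas 𝔼(n) Q) (he' : e' ∈ atlas 𝔼(n) Q)

include he he'

theorem momentum_change {ζ : Cotangent n Q} (hζ : ζ.1 ∈ e'.source) (j : Fin n) :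
    momentum e ζ j = ∑ l, momentum e' ζ l * chartJacobian e' e l j ζ.1 := by
  conv_lhs => rw [momentum, ← sum_chartCovector_smul_chartVector he' hζ (chartVector e j ζ.1)]
  simp [map_sum, momentum, chartJacobian, mul_comm]

theorem partialP_change {U : Set (Cotangent n Q)} (hU : IsOpen U) (hUe : U ⊆ cotOver e.source)
    {f : Cotangent n Q → ℂ} (hf : SmoothFunOn (cotModel n) U f) (k : Fin n) {ζ : Cotangent n Q}
    (hζ : ζ ∈ U) : partialP e' k f ζ =
      ∑ j, (chartJacobian e' e k j ζ.1 : ℂ) * partialP e j f ζ :=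
  fiberDeriv_eq_sum he hU hUe hf _ hζ

/-- The chain rule for a change of bundle coordinates. -/
theorem coordDeriv_cot_change {U : Set (Cotangent n Q)} (hU : IsOpen U)
    (hUe : U ⊆ cotOver e.source) (hUe' : U ⊆ cotOver e'.source)
    {f : Cotangent n Q → ℂ} (hf : SmoothFunOn (cotModel n) U f)
    (v : 𝔼(n) × (Fin n → ℝ)) {ζ : Cotangent n Q} (hζ : ζ ∈ U) :
    coordDeriv (cotCoord e') (cotCoordSymm e') v f ζ =
      ∑ j, coordDeriv (cotCoord e') (cotCoordSymm e') v (fun ζ => ((e ζ.1 j : ℝ) : ℂ)) ζ *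
        partialQ e j f ζ +
      ∑ j, coordDeriv (cotCoord e') (cotCoordSymm e') v (cotMomentum e j) ζ * partialP e j f ζ := by
  set T : 𝔼(n) × (Fin n → ℝ) → 𝔼(n) × (Fin n → ℝ) :=
    fun z => cotCoord e (cotCoordSymm e' z : Cotangent n Q) with hT
  have hmem := (isCoord_cot he').mem_preimage hUe' hζ
  have hopen := (isCoord_cot he').isOpen_preimage hU
  have hTd : DifferentiableAt ℝ T (cotCoord e' ζ) := by
    have h1 : ContDiffOn ℝ ∞ T _ := contMDiffOn_iff_contDiffOn.1 <|
      ((isCoord_cot he).contMDiffOn.mono hUe).comp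
        ((isCoord_cot he').contMDiffOn_symm.mono Set.inter_subset_left) fun z hz => hz.2
    exact (h1.contDiffAt (hopen.mem_nhds hmem)).differentiableAt (by simp)
  have hTζ : T (cotCoord e' ζ) = cotCoord e ζ := by
    exact congrArg (cotCoord e) (cotPoint_momentum he' (hUe' hζ))
  have hF := (isCoord_cot he).differentiableAt hU hUe hf hζ
  have hcomp : HasFDerivAt (fun z => f (cotCoordSymm e (T z)))
      ((fderiv ℝ (fun z => f (cotCoordSymm e z)) (cotCoord e ζ)).comp
        (fderiv ℝ T (cotCoord e' ζ))) (cotCoord e' ζ) := by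
    refine HasFDerivAt.comp (cotCoord e' ζ) (g := fun z => f (cotCoordSymm e z)) ?_ hTd.hasFDerivAt
    rw [hTζ]
    exact hF.hasFDerivAt
  have heq : (fun z => f (cotCoordSymm e' z)) =ᶠ[𝓝 (cotCoord e' ζ)]
      fun z => f (cotCoordSymm e (T z)) := by
    filter_upwards [hopen.mem_nhds hmem] with z hz
    congr 1
    exact ((isCoord_cot he).left_inv _ (hUe hz.2)).symm
  set w := fderiv ℝ T (cotCoord e' ζ) v with hw
  have h1 : coordDeriv (cotCoord e') (cotCoordSymm e') v f ζ =
      coordDeriv (cotCoord e) (cotCoordSymm e) w f ζ := by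
    rw [coordDeriv, heq.fderiv_eq, hcomp.fderiv]
    rfl
  have h2 : ∀ j, coordDeriv (cotCoord e') (cotCoordSymm e') v
      (fun ζ => ((e ζ.1 j : ℝ) : ℂ)) ζ = (w.1 j : ℂ) := by
    intro j
    have := ((Complex.ofRealCLM.comp ((EuclideanSpace.proj (𝕜 := ℝ) j).comp
      (ContinuousLinearMap.fst ℝ 𝔼(n) (Fin n → ℝ)))).hasFDerivAt.comp
        (cotCoord e' ζ) hTd.hasFDerivAt).fderiv
    exact congrArg (fun L => L v) this
  have h3 : ∀ j, coordDeriv (cotCoord e') (cotCoordSymm e') v (cotMomentum e j) ζ =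
      (w.2 j : ℂ) := by
    intro j
    have := ((Complex.ofRealCLM.comp ((ContinuousLinearMap.proj j).comp
      (ContinuousLinearMap.snd ℝ 𝔼(n) (Fin n → ℝ)))).hasFDerivAt.comp
        (cotCoord e' ζ) hTd.hasFDerivAt).fderiv
    exact congrArg (fun L => L v) this
  have hwsum : w = ∑ j, w.1 j • ((EuclideanSpace.single j 1, 0) :
        𝔼(n) × (Fin n → ℝ)) +
      ∑ j, w.2 j • ((0, Pi.single j 1) : 𝔼(n) × (Fin n → ℝ)) := by
    refine Prod.ext ?_ ?_
    · ext i
      simp [Prod.fst_sum, Pi.single_apply]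
    · funext i
      simp [Prod.snd_sum, Finset.sum_apply, Pi.single_apply]
  rw [h1, hwsum, show ∀ a b, coordDeriv (cotCoord e) (cotCoordSymm e) (a + b) f ζ =
    coordDeriv (cotCoord e) (cotCoordSymm e) a f ζ + coordDeriv (cotCoord e) (cotCoordSymm e) b f ζ
    from fun a b => map_add _ _ _, (isCoord_cot he).coordDeriv_sum_smul,
    (isCoord_cot he).coordDeriv_sum_smul]
  simp only [h2, h3, partialP_eqOn he hU hUe hf _ hζ, partialQ_eqOn he hU hUe hf _ hζ]

theorem coordDeriv_momentum {U : Set (Cotangent n Q)} (hU : IsOpen U) {O : Set Q} (hO : IsOpen O)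
    (hOe : O ⊆ e.source) (hOe' : O ⊆ e'.source) (hUO : U ⊆ cotOver O) (j k : Fin n)
    {ζ : Cotangent n Q} (hζ : ζ ∈ U) :
    coordDeriv (cotCoord e') (cotCoordSymm e') (EuclideanSpace.single k 1, 0) (cotMomentum e j) ζ =
      ∑ l, (momentum e' ζ l : ℂ) *
        partialX e' k (fun q => (chartJacobian e' e l j q : ℂ)) ζ.1 := by
  set Φ' := chartPhase he' hU hO hOe' hUO
  have hK : ∀ l, SmoothFunOn (𝓡 n) O (fun q => (chartJacobian e' e l j q : ℂ)) := fun l =>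
    (smoothFunOn_chartJacobian he he' l j).mono fun q hq => ⟨hOe hq, hOe' hq⟩
  have hp := ((smoothFunOn_momentum he j).mono (hUO.trans fun _ h => hOe h)).represents
  have h1 : hp.smooth.toSm = ∑ l, Φ'.p l * Φ'.pull (hK l).toSm := by
    refine hp.ext (Represents.sum fun l _ => (represents_p he' hU hO hOe' hUO l).mul
      (represents_pull he' hU hO hOe' hUO (hK l).represents)) fun ζ hζ => ?_
    have := congrArg (fun x : ℝ => (x : ℂ)) (momentum_change he he' (hOe' (hUO hζ)) j)
    simpa [pullbackFun, Finset.sum_apply] using this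
  have h2 := represents_dq he' hU hO hOe' hUO hp k
  have h3 : Φ'.dq k hp.smooth.toSm = ∑ l, Φ'.p l * Φ'.pull (Φ'.dx k (hK l).toSm) := by
    rw [h1, map_sum]
    refine Finset.sum_congr rfl fun l _ => ?_
    rw [Φ'.dq_mul, Φ'.dq_p, Φ'.dq_pull, zero_mul, zero_add]
  have h4 : Represents (Φ'.dq k hp.smooth.toSm) (∑ l, fun ζ => (momentum e' ζ l : ℂ) *
      pullbackFun (partialX e' k (fun q => (chartJacobian e' e l j q : ℂ))) ζ) := by
    rw [h3]
    exact Represents.sum fun l _ => (represents_p he' hU hO hOe' hUO l).mul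
      (represents_pull he' hU hO hOe' hUO (represents_dx he' hU hO hOe' hUO (hK l).represents k))
  rw [← partialQ_eqOn he' hU (hUO.trans fun _ h => hOe' h) hp.smooth k hζ, h2.eqOn h4 hζ]
  simp [pullbackFun, Finset.sum_apply]

theorem partialQ_change {U : Set (Cotangent n Q)} (hU : IsOpen U) {O : Set Q} (hO : IsOpen O)
    (hOe : O ⊆ e.source) (hOe' : O ⊆ e'.source) (hUO : U ⊆ cotOver O)
    {f : Cotangent n Q → ℂ} (hf : SmoothFunOn (cotModel n) U f) (k : Fin n)
    {ζ : Cotangent n Q} (hζ : ζ ∈ U) : partialQ e' k f ζ =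
      ∑ j, (chartJacobian e e' j k ζ.1 : ℂ) * partialQ e j f ζ +
      ∑ l, ∑ j, (momentum e' ζ l : ℂ) * partialX e' k
        (fun q => (chartJacobian e' e l j q : ℂ)) ζ.1 * partialP e j f ζ := by
  have hUe := hUO.trans fun (x : Cotangent n Q) h => hOe h
  have hUe' := hUO.trans fun (x : Cotangent n Q) h => hOe' h
  rw [partialQ_eqOn he' hU hUe' hf k hζ, coordDeriv_cot_change he he' hU hUe hUe' hf _ hζ]
  have hcoord : ∀ j, SmoothFunOn (𝓡 n) O (fun q => ((e q j : ℝ) : ℂ)) := fun j =>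
    Complex.ofRealCLM.contDiff.contMDiff.comp_contMDiffOn
      ((EuclideanSpace.proj (𝕜 := ℝ) j).contDiff.contMDiff.comp_contMDiffOn
        ((contMDiffOn_atlasChart he).mono hOe))
  congr 1
  · refine Finset.sum_congr rfl fun j _ => ?_
    rw [← partialX_coord he he' hO hOe hOe' j k (q := ζ.1) (hUO hζ),
      partialX_eqOn he' hO hOe' (hcoord j) k (x := ζ.1) (hUO hζ)]
    congr 1
    exact coordDeriv_pullbackFun he' hO hOe' (hcoord j) _ (hUO hζ)
  · rw [Finset.sum_comm]
    refine Finset.sum_congr rfl fun j _ => ?_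
    rw [coordDeriv_momentum he he' hU hO hOe hOe' hUO j k hζ, Finset.sum_mul]

section

variable {nabla : CovariantDerivative (𝓡 n) 𝔼(n)
    (TangentSpace (𝓡 n) : Q → Type _)} [T2Space Q]
  (hs : CovariantDerivative.ContMDiffCovariantDerivative nabla ∞)
  {U : Set (Cotangent n Q)} (hU : IsOpen U) {O : Set Q} (hO : IsOpen O)
  (hOe : O ⊆ e.source) (hOe' : O ⊆ e'.source) (hUO : U ⊆ cotOver O)

/-- The Jacobian of a change of charts, as smooth functions. -/
def smJacobian (l j : Fin n) : Sm (𝓡 n) O :=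
  ((smoothFunOn_chartJacobian he he' l j).mono fun _ hq => ⟨hOe hq, hOe' hq⟩).toSm

theorem represents_smJacobian (l j : Fin n) : Represents (smJacobian he he' hOe hOe' l j)
    (fun q => (chartJacobian e' e l j q : ℂ)) :=
  SmoothFunOn.represents ((smoothFunOn_chartJacobian he he' l j).mono fun _ hq => ⟨hOe hq, hOe' hq⟩)

theorem sum_smJacobian (l m : Fin n) : ∑ j, smJacobian he he' hOe hOe' l j *
    smJacobian he' he hOe' hOe j m = if l = m then 1 else 0 := by
  have h1 := Represents.sum (s := Finset.univ) fun j _ =>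
    (represents_smJacobian he he' hOe hOe' l j).mul (represents_smJacobian he' he hOe' hOe j m)
  refine Subtype.ext (funext fun q => (h1.eq q).trans ?_)
  have h2 := chartJacobian_mul he e' l m (hOe q.2) e'
  rw [chartJacobian_self he' l m (hOe' q.2)] at h2
  have h3 := congrArg (fun x : ℝ => (x : ℂ)) h2
  push_cast at h3
  rw [Finset.sum_apply, h3]
  split_ifs <;> simp

include hs

theorem chartChange : (chartPhase he hU hO hOe hUO).ChartChange (chartPhase he' hU hO hOe' hUO)
    (chartG hs he hOe) (chartG hs he' hOe') (smJacobian he he' hOe hOe')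
    (smJacobian he' he hOe' hOe) where
  pull_eq u := rfl
  K_J l m := sum_smJacobian he he' hOe hOe' l m
  J_K l m := sum_smJacobian he' he hOe' hOe l m
  p_eq j := by
    refine (represents_p he hU hO hOe hUO j).ext (Represents.sum fun l _ =>
      (represents_p he' hU hO hOe' hUO l).mul (represents_pull he hU hO hOe hUO
        (represents_smJacobian he he' hOe hOe' l j))) fun ζ hζ => ?_
    have := congrArg (fun x : ℝ => (x : ℂ)) (momentum_change he he' (hOe' (hUO hζ)) j)
    simpa [pullbackFun, Finset.sum_apply] using this
  dp_eq k a := by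
    have ha := represents_out a
    refine (represents_dp he' hU hO hOe' hUO ha k).ext (Represents.sum fun j _ =>
      (represents_pull he hU hO hOe hUO (represents_smJacobian he he' hOe hOe' k j)).mul
        (represents_dp he hU hO hOe hUO ha j)) fun ζ hζ => ?_
    rw [partialP_change he he' hU (hUO.trans fun _ h => hOe h) ha.smooth k hζ]
    simp [pullbackFun, Finset.sum_apply]
  dx_eq k u := by
    have hu := represents_out u
    refine (represents_dx he' hU hO hOe' hUO hu k).ext (Represents.sum fun j _ =>
      (represents_smJacobian he' he hOe' hOe j k).mul (represents_dx he hU hO hOe hUO hu j))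
      fun q hq => ?_
    rw [partialX_change he he' hO hOe hOe' hu.smooth k hq]
    simp [Finset.sum_apply]
  dq_eq k a := by
    have ha := represents_out a
    refine (represents_dq he' hU hO hOe' hUO ha k).ext ((Represents.sum fun j _ =>
      (represents_pull he hU hO hOe hUO (represents_smJacobian he' he hOe' hOe j k)).mul
        (represents_dq he hU hO hOe hUO ha j)).add (Represents.sum fun l _ =>
          Represents.sum fun j _ => ((represents_p he' hU hO hOe' hUO l).mul
            (represents_pull he hU hO hOe hUO (represents_dx he' hU hO hOe' hUO
              (represents_smJacobian he he' hOe hOe' l j) k))).mul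
                (represents_dp he hU hO hOe hUO ha j))) fun ζ hζ => ?_
    rw [partialQ_change he he' hU hO hOe hOe' hUO ha.smooth k hζ]
    simp [pullbackFun, Finset.sum_apply]
  christoffel_eq l a b := by
    refine (Represents.sum fun j _ => Represents.sum fun k _ =>
      ((represents_chartG hs he' hOe' l j k).mul (represents_smJacobian he he' hOe hOe' j a)).mul
        (represents_smJacobian he he' hOe hOe' k b)).ext ((Represents.sum fun m _ =>
          (represents_smJacobian he he' hOe hOe' l m).mul (represents_chartG hs he hOe m a b)).sub
            (represents_dx he hU hO hOe hUO (represents_smJacobian he he' hOe hOe' l b) a))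
        fun q hq => ?_
    have h1 := christoffel_change (nabla := nabla) he he' l a b (hOe hq) (hOe' hq)
    have h2 := congrArg (fun x : ℝ => (x : ℂ)) h1
    push_cast at h2
    simp only [Finset.sum_apply, Pi.sub_apply]
    rw [h2, partialX_ofReal he hO hOe ((contMDiffOn_chartJacobian he he' l b).mono
      fun q hq => ⟨hOe hq, hOe' hq⟩) a hq]

include hO hOe hOe' in
theorem chartSymD_eqOn {u : Q → ℂ} (hu : SmoothFunOn (𝓡 n) O u) {f : Cotangent n Q → ℂ}
    (hf : SmoothFunOn (cotModel n) (cotOver O) f) (r : ℕ) :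
    Set.EqOn (chartSymD nabla e' r u f) (chartSymD nabla e r u f) O := by
  have hU := isOpen_cotOver (n := n) hO
  have hι := isSection_zeroSection he hO hOe
  have hι' := isSection_zeroSection he' hO hOe'
  have hc := isIterCov_chartCov hs he hU hO hOe subset_rfl hu
  have hc' := isIterCov_chartCov hs he' hU hO hOe' subset_rfl hu
  have h1 := (chartChange he he' hs hU hO hOe hOe' subset_rfl).symbol_eq
    (ι := Sm.zeroSection O)
    (fun f => (hc'.covSum_zero (Sm.zeroSection O) f).trans (hc.covSum_zero _ f).symm)
    (PhaseAlgebra.covSum_pull_mul _ hι.pull _) (PhaseAlgebra.covSum_pull_mul _ hι'.pull _)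
    (hc.covSum_succ hι.pull (fun i => by rw [hι.p]; simp) hι.dq)
    (hc'.covSum_succ hι'.pull (fun i => by rw [hι'.p]; simp) hι'.dq) r hf.toSm
  have h2 := represents_covSum hs he' hO hOe' hu r hf.represents
  rw [h1] at h2
  exact h2.eqOn (represents_covSum hs he hO hOe hu r hf.represents)

include hO hOe hOe' in
theorem chartCochain_eqOn_cotOver {f g : Cotangent n Q → ℂ}
    (hf : SmoothFunOn (cotModel n) (cotOver O) f) (hg : SmoothFunOn (cotModel n) (cotOver O) g)
    (N : ℕ) : Set.EqOn (chartCochain nabla e' N f g) (chartCochain nabla e N f g) (cotOver O) := by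
  have hU := isOpen_cotOver (n := n) hO
  have h1 := (chartChange he he' hs hU hO hOe hOe' subset_rfl).conjCochain_eq
    (isSymbolFamily_chartT hs he hU hO hOe subset_rfl)
    (isSymbolFamily_chartT hs he' hU hO hOe' subset_rfl)
    (isInvSeries_chartR hs he hU hO hOe subset_rfl)
    (isInvSeries_chartR hs he' hU hO hOe' subset_rfl)
    (isSection_zeroSection he hO hOe) (isSection_zeroSection he' hO hOe')
    (fun N a u => by
      have hu := represents_out u
      have ha := represents_out a
      rw [← show hu.smooth.toSm = u from hu.smooth.represents.ext hu fun _ _ => rfl, repC_chart hs he hO hOe, repC_chart hs he' hO hOe']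
      congr 1
      exact (represents_covSum hs he' hO hOe' hu.smooth N ha).ext
        (represents_covSum hs he hO hOe hu.smooth N ha)
        (chartSymD_eqOn he he' hs hO hOe hOe' hu.smooth ha.smooth N))
    (X := O) (ev := fun x => Sm.eval x) (y := fun x i => chartCoord he hOe x i)
    (fun x i => by
      change (((e x i - e x i : ℝ)) : ℂ) = 0
      simp)
    (fun x i j => dx_chartCoord he hO hOe hU subset_rfl x i j)
    (fun u hu => Subtype.ext (funext fun x => hu x))
    (fun a h h0 => eq_zero_of_dp he hO hOe a h h0)
    (eq_zero_of_isSection he hO hOe) N hf.toSm hg.toSm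
  have h2 := represents_chartCochain hs he' hU hO hOe' subset_rfl N _ _ _ _ hf.represents
    hg.represents
  rw [h1] at h2
  exact h2.eqOn (represents_chartCochain hs he hU hO hOe subset_rfl N _ _ _ _ hf.represents
    hg.represents)

end

end ChartChangeCot

section

variable {n : ℕ} {Q : Type*} [TopologicalSpace Q] [ChartedSpace 𝔼(n) Q]
  [IsManifold (𝓡 n) ∞ Q] {e e' : OpenPartialHomeomorph Q 𝔼(n)}
  (he : e ∈ atlas 𝔼(n) Q) (he' : e' ∈ atlas 𝔼(n) Q)
  {nabla : CovariantDerivative (𝓡 n) 𝔼(n)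
    (TangentSpace (𝓡 n) : Q → Type _)} [T2Space Q]
  (hs : CovariantDerivative.ContMDiffCovariantDerivative nabla ∞)

include he he' hs

theorem chartCochain_eqOn {U : Set (Cotangent n Q)} (hU : IsOpen U) (hUe : U ⊆ cotOver e.source)
    (hUe' : U ⊆ cotOver e'.source) {f g : Cotangent n Q → ℂ} (hf : SmoothFunOn (cotModel n) U f)
    (hg : SmoothFunOn (cotModel n) U g) (N : ℕ) :
    Set.EqOn (chartCochain nabla e' N f g) (chartCochain nabla e N f g) U := by
  intro ζ hζ
  obtain ⟨f', hf', hff⟩ := (isCoord_cot he).exists_extension hU hUe hf hζ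
  obtain ⟨g', hg', hgg⟩ := (isCoord_cot he).exists_extension hU hUe hg hζ
  obtain ⟨W, hW, hWo, hζW⟩ := eventually_nhds_iff.1 (hff.and hgg)
  have hO := e.open_source.inter e'.open_source
  have h1 := chartCochain_eqOn_cotOver he he' hs hO Set.inter_subset_left Set.inter_subset_right
    (hf'.mono fun ζ h => h.1) (hg'.mono fun ζ h => h.1) N (x := ζ) ⟨hUe hζ, hUe' hζ⟩
  have key : ∀ e ∈ atlas 𝔼(n) Q, U ⊆ cotOver e.source →
      chartCochain nabla e N f g ζ = chartCochain nabla e N f' g' ζ := fun e he hUe =>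
    (isBidiffOn_chartCochain hs he N).congr (hU.inter hWo) (Set.inter_subset_left.trans hUe)
      (hf.mono Set.inter_subset_left)
      ((hf.mono Set.inter_subset_left).congr fun x hx => (hW x hx.2).1)
      (hg.mono Set.inter_subset_left)
      ((hg.mono Set.inter_subset_left).congr fun x hx => (hW x hx.2).2)
      (fun x hx => (hW x hx.2).1.symm) (fun x hx => (hW x hx.2).2.symm) ⟨hζ, hζW⟩
  rw [key e' he' hUe', key e he hUe, h1]

end

end

section

section Orders

variable {E : Type*} [NormedAddCommGroup E] [NormedSpace ℝ E]
  {H : Type*} [TopologicalSpace H] (J : ModelWithCorners ℝ E H)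
  {M : Type*} [TopologicalSpace M] [ChartedSpace H M]

/-- `P` is a differential operator of order at most `N` on the open subsets of `U₀`. -/
def HasOrder (U₀ : Set M) (N : ℕ) (P : (M → ℂ) → M → ℂ) : Prop :=
  IsDiffOpOn J U₀ P ∧ ∀ U, IsOpen U → U ⊆ U₀ → FunOrderLE J U N P

/-- `B` is a bidifferential operator of order at most `N` on the open subsets of `U₀`. -/
def HasBiOrder (U₀ : Set M) (N : ℕ) (B : (M → ℂ) → (M → ℂ) → M → ℂ) : Prop :=
  IsBidiffOn J U₀ B ∧ ∀ U, IsOpen U → U ⊆ U₀ →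
    (∀ g, SmoothFunOn J U g → FunOrderLE J U N (fun f => B f g)) ∧
    (∀ f, SmoothFunOn J U f → FunOrderLE J U N (fun g => B f g))

variable {J} {U₀ : Set M} {N N' : ℕ} {P P' : (M → ℂ) → M → ℂ}
  {B B' : (M → ℂ) → (M → ℂ) → M → ℂ}

namespace HasOrder

theorem id : HasOrder J U₀ N (fun f => f) :=
  ⟨IsDiffOpOn.id, fun _ _ _ => FunOrderLE.mono (N := 0) (fun _ _ _ _ _ _ => rfl) N.zero_le⟩

theorem zero : HasOrder J U₀ N (fun _ => 0) :=
  ⟨IsDiffOpOn.zero, fun _ _ _ => FunOrderLE.of_zero fun _ _ _ _ => rfl⟩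

theorem mono (h : HasOrder J U₀ N P) (hN : N ≤ N') : HasOrder J U₀ N' P :=
  ⟨h.1, fun U hU hU₀ => (h.2 U hU hU₀).mono hN⟩

theorem comp (h : HasOrder J U₀ N P) (h' : HasOrder J U₀ N' P') :
    HasOrder J U₀ (N + N') (fun f => P (P' f)) :=
  ⟨h.1.comp h'.1, fun U hU hU₀ =>
    (h.2 U hU hU₀).comp (h'.2 U hU hU₀) (h.1.linOn hU hU₀) (h'.1.linOn hU hU₀)⟩

theorem add (h : HasOrder J U₀ N P) (h' : HasOrder J U₀ N P') :
    HasOrder J U₀ N (fun f => P f + P' f) :=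
  ⟨h.1.add h'.1, fun U hU hU₀ => (h.2 U hU hU₀).add (h'.2 U hU hU₀)⟩

theorem mul_left {a : M → ℂ} (ha : SmoothFunOn J U₀ a) (h : HasOrder J U₀ N P) :
    HasOrder J U₀ N (fun f x => a x * P f x) :=
  ⟨h.1.mul_left ha, fun U hU hU₀ => (h.2 U hU hU₀).mul_left a⟩

theorem const_smul (c : ℂ) (h : HasOrder J U₀ N P) : HasOrder J U₀ N (fun f => c • P f) :=
  h.mul_left (SmoothFunOn.const c)

theorem neg (h : HasOrder J U₀ N P) : HasOrder J U₀ N (fun f => -P f) := by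
  simpa using h.const_smul (-1)

theorem sub (h : HasOrder J U₀ N P) (h' : HasOrder J U₀ N P') :
    HasOrder J U₀ N (fun f => P f - P' f) := by
  simpa only [sub_eq_add_neg] using h.add h'.neg

theorem sum {ι : Type*} {s : Finset ι} {P : ι → (M → ℂ) → M → ℂ}
    (h : ∀ i ∈ s, HasOrder J U₀ N (P i)) : HasOrder J U₀ N (fun f => ∑ i ∈ s, P i f) := by
  classical
  induction s using Finset.induction_on with
  | empty => simpa using zero
  | insert a s ha ih =>
    simp only [Finset.sum_insert ha]
    exact (h a (Finset.mem_insert_self _ _)).add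
      (ih fun i hi => h i (Finset.mem_insert_of_mem hi))

end HasOrder

namespace HasBiOrder

theorem mul : HasBiOrder J U₀ N (fun f g x => f x * g x) :=
  ⟨IsBidiffOn.mul, fun U hU h => ⟨fun g hg => FunOrderLE.mono (N := 0)
    (fun a ha s hs x hx => by simp; ring) N.zero_le, fun g hg => FunOrderLE.mono (N := 0)
    (fun a ha s hs x hx => by simp; ring) N.zero_le⟩⟩

theorem zero : HasBiOrder J U₀ N (fun _ _ => 0) :=
  ⟨IsBidiffOn.zero, fun _ _ _ => ⟨fun _ _ => FunOrderLE.of_zero fun _ _ _ _ => rfl,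
    fun _ _ => FunOrderLE.of_zero fun _ _ _ _ => rfl⟩⟩

theorem mono (h : HasBiOrder J U₀ N B) (hN : N ≤ N') : HasBiOrder J U₀ N' B :=
  ⟨h.1, fun U hU hU₀ => ⟨fun g hg => ((h.2 U hU hU₀).1 g hg).mono hN,
    fun f hf => ((h.2 U hU hU₀).2 f hf).mono hN⟩⟩

theorem add (h : HasBiOrder J U₀ N B) (h' : HasBiOrder J U₀ N B') :
    HasBiOrder J U₀ N (fun f g => B f g + B' f g) :=
  ⟨h.1.add h'.1, fun U hU hU₀ =>
    ⟨fun g hg => ((h.2 U hU hU₀).1 g hg).add ((h'.2 U hU hU₀).1 g hg),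
      fun f hf => ((h.2 U hU hU₀).2 f hf).add ((h'.2 U hU hU₀).2 f hf)⟩⟩

theorem sum {ι : Type*} {s : Finset ι} {B : ι → (M → ℂ) → (M → ℂ) → M → ℂ}
    (h : ∀ i ∈ s, HasBiOrder J U₀ N (B i)) : HasBiOrder J U₀ N (fun f g => ∑ i ∈ s, B i f g) := by
  classical
  induction s using Finset.induction_on with
  | empty => simpa using zero
  | insert a s ha ih =>
    simp only [Finset.sum_insert ha]
    exact (h a (Finset.mem_insert_self _ _)).add
      (ih fun i hi => h i (Finset.mem_insert_of_mem hi))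

theorem comp (h : HasBiOrder J U₀ N B) {k : ℕ} (hP : HasOrder J U₀ k P) (hP' : HasOrder J U₀ k P') :
    HasBiOrder J U₀ (N + k) (fun f g => B (P f) (P' g)) := by
  refine ⟨(h.1.comp_left hP.1).comp_right hP'.1, fun U hU hU₀ => ⟨fun g hg => ?_, fun f hf => ?_⟩⟩
  · have hg' := (hP'.1.linOn hU hU₀).smooth g hg
    exact ((h.2 U hU hU₀).1 _ hg').comp (hP.2 U hU hU₀) (h.1.left U hU hU₀ _ hg')
      (hP.1.linOn hU hU₀)
  · have hf' := (hP.1.linOn hU hU₀).smooth f hf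
    exact ((h.2 U hU hU₀).2 _ hf').comp (hP'.2 U hU hU₀) (h.1.right U hU hU₀ _ hf')
      (hP'.1.linOn hU hU₀)

theorem postcomp (h : HasBiOrder J U₀ N B) (hP : HasOrder J U₀ N' P) :
    HasBiOrder J U₀ (N' + N) (fun f g => P (B f g)) :=
  ⟨h.1.postcomp hP.1, fun U hU hU₀ => ⟨fun g hg => (hP.2 U hU hU₀).comp ((h.2 U hU hU₀).1 g hg)
    (hP.1.linOn hU hU₀) (h.1.left U hU hU₀ g hg), fun f hf =>
      (hP.2 U hU hU₀).comp ((h.2 U hU hU₀).2 f hf) (hP.1.linOn hU hU₀) (h.1.right U hU hU₀ f hf)⟩⟩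

end HasBiOrder

theorem HasOrder.invSeries {S : ℕ → (M → ℂ) → M → ℂ} (h : ∀ r, HasOrder J U₀ (2 * r) (S r)) (N : ℕ) :
    HasOrder J U₀ (2 * N) (invSeries S N) := by
  induction N using Nat.strong_induction_on with
  | _ N ih =>
    cases N with
    | zero =>
      have : _root_.invSeries S 0 = fun f => f := by funext f; rw [_root_.invSeries]
      rw [this]; exact HasOrder.id
    | succ N =>
      have : _root_.invSeries S (N + 1) =
          fun f => -∑ a : Fin (N + 1), S (N - a + 1) (_root_.invSeries S a f) := by
        funext f; rw [_root_.invSeries]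
      rw [this]
      exact (HasOrder.sum fun (a : Fin (N + 1)) _ =>
        ((h _).comp (ih a a.2)).mono (by have := a.2; omega)).neg

variable {n : ℕ} {dq dp : Fin n → (M → ℂ) → M → ℂ} {p : Fin n → M → ℂ}
    {Γ : Fin n → Fin n → Fin n → M → ℂ}
    (hdq : ∀ i, HasOrder J U₀ 1 (dq i)) (hdp : ∀ i, HasOrder J U₀ 1 (dp i))
    (hp : ∀ l, SmoothFunOn J U₀ (p l)) (hΓ : ∀ l i k, SmoothFunOn J U₀ (Γ l i k))

include hdq hdp

theorem hasBiOrder_flatFun (r : ℕ) : HasBiOrder J U₀ r (flatFun dq dp r) := by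
  induction r with
  | zero => exact HasBiOrder.mul
  | succ r ih => exact HasBiOrder.sum fun i _ => ih.comp (hdp i) (hdq i)

include hp hΓ

theorem hasOrder_symOp (j d : ℕ) : HasOrder J U₀ (2 * j) (symOp dq dp p Γ j d) := by
  induction j generalizing d with
  | zero =>
    by_cases h : d = 0
    · have : symOp dq dp p Γ 0 d = fun f => f := by funext f; exact if_pos h
      rw [this]; exact HasOrder.id
    · have : symOp dq dp p Γ 0 d = fun f => 0 := by funext f; exact if_neg h
      rw [this]; exact HasOrder.zero
  | succ j ih =>
    cases d with
    | zero => exact HasOrder.zero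
    | succ d =>
      have hg : ∀ l, HasOrder J U₀ 2 (fun f => ∑ i, ∑ k, fun x => Γ l i k x * dp i (dp k f) x) :=
        fun l => HasOrder.sum fun i _ => HasOrder.sum fun k _ =>
          ((hdp i).comp (hdp k)).mul_left (hΓ l i k)
      have hprev : HasOrder J U₀ (2 * j) (PhaseAlgebra.prevTerm (symOp dq dp p Γ j) d) := by
        cases d with
        | zero => exact HasOrder.zero
        | succ d => exact ih d
      refine HasOrder.const_smul _ (HasOrder.sub (HasOrder.sum fun i _ => HasOrder.sub ?_ ?_)
        (HasOrder.sum fun l _ => HasOrder.add (HasOrder.sub ?_ ?_) ?_))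
      · exact ((hdq i).comp ((ih d).comp (hdp i))).mono (by omega)
      · exact (ih d).comp ((hdq i).comp (hdp i))
      · exact (ih d).comp ((hg l).mul_left (hp l))
      · exact ((ih d).comp (hg l)).mul_left (hp l)
      · exact (hprev.comp (hg l)).mul_left (hp l)

theorem hasBiOrder_localCochain (N : ℕ) : HasBiOrder J U₀ (2 * N) (localCochain dq dp p Γ N) := by
  have hS : ∀ j, HasOrder J U₀ (2 * j) (symS dq dp p Γ j) := fun j =>
    HasOrder.const_smul _ (HasOrder.sum fun d _ => hasOrder_symOp hdq hdp hp hΓ j d)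
  suffices h : HasBiOrder J U₀ (2 * N) (fun f g => ∑ m ∈ Finset.HasAntidiagonal.antidiagonal N,
      ∑ m' ∈ Finset.HasAntidiagonal.antidiagonal m.2,
        ∑ m'' ∈ Finset.HasAntidiagonal.antidiagonal m'.2,
          invSeries (symS dq dp p Γ) m.1 (((-Complex.I) ^ m'.1 / (m'.1.factorial : ℂ)) •
            flatFun dq dp m'.1 (symS dq dp p Γ m''.1 f) (symS dq dp p Γ m''.2 g))) from h
  refine HasBiOrder.sum fun m hm => HasBiOrder.sum fun m' hm' => HasBiOrder.sum fun m'' hm'' => ?_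
  rw [Finset.HasAntidiagonal.mem_antidiagonal] at hm hm' hm''
  have h1 : HasOrder J U₀ 0 (fun f => ((-Complex.I) ^ m'.1 / (m'.1.factorial : ℂ)) • f) :=
    HasOrder.id.const_smul _
  have h2 : HasBiOrder J U₀ (m'.1) (fun f g =>
      ((-Complex.I) ^ m'.1 / (m'.1.factorial : ℂ)) • flatFun dq dp m'.1 f g) :=
    ((hasBiOrder_flatFun hdq hdp m'.1).postcomp h1).mono (by omega)
  exact ((h2.comp ((hS m''.1).mono (N' := 2 * m'.2) (by omega)) ((hS m''.2).mono
    (by omega))).postcomp (HasOrder.invSeries hS m.1)).mono (by omega)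

omit hdq hdp hp hΓ in
theorem IsCoord.hasOrder_coordDeriv {V : Type*} [NormedAddCommGroup V] [NormedSpace ℝ V]
    {W : Set V} {Θ : M → V} {Ψ : V → M} (h : IsCoord J U₀ W Θ Ψ) (v : V) :
    HasOrder J U₀ 1 (coordDeriv Θ Ψ v) := by
  refine ⟨h.isDiffOpOn v, fun U hU hU₀ a ha b hb s hs x hx => ?_⟩
  have hbs : SmoothFunOn J U (fun x => b x * s x) := SmoothFunOn.mul hb hs
  have e1 := h.coordDeriv_mul hU hU₀ ha hbs v hx
  have e2 := h.coordDeriv_mul hU hU₀ ha hs v hx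
  simp only [smul_eq_mul] at *
  rw [e1, e2]
  ring

end Orders

section

variable {n : ℕ} {Q : Type*} [TopologicalSpace Q] [ChartedSpace 𝔼(n) Q]
  [IsManifold (𝓡 n) ∞ Q] {e : OpenPartialHomeomorph Q 𝔼(n)}
  (he : e ∈ atlas 𝔼(n) Q)

include he

theorem hasOrder_partialP (i : Fin n) :
    HasOrder (cotModel n) (cotOver e.source) 1 (partialP e i) :=
  ⟨isDiffOpOn_partialP he i, fun U hU hUe => (((isCoord_cot he).hasOrder_coordDeriv _).2 U hU
    hUe).of_eqOn fun f hf => partialP_eqOn he hU hUe hf i⟩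

theorem hasOrder_partialQ (i : Fin n) :
    HasOrder (cotModel n) (cotOver e.source) 1 (partialQ e i) :=
  ⟨isDiffOpOn_partialQ he i, fun U hU hUe => (((isCoord_cot he).hasOrder_coordDeriv _).2 U hU
    hUe).of_eqOn fun f hf => partialQ_eqOn he hU hUe hf i⟩

theorem hasBiOrder_chartCochain [T2Space Q] {nabla : CovariantDerivative (𝓡 n)
    𝔼(n) (TangentSpace (𝓡 n) : Q → Type _)}
    (hs : CovariantDerivative.ContMDiffCovariantDerivative nabla ∞) (N : ℕ) :
    HasBiOrder (cotModel n) (cotOver e.source) (2 * N) (chartCochain nabla e N) :=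
  hasBiOrder_localCochain (hasOrder_partialQ he) (hasOrder_partialP he)
    (smoothFunOn_momentum he) (smoothFunOn_cotChristoffel hs he) N

end

end

section

section Cover

variable {E : Type*} [NormedAddCommGroup E] [NormedSpace ℝ E]
  {H : Type*} [TopologicalSpace H] {J : ModelWithCorners ℝ E H}
  {M : Type*} [TopologicalSpace M] [ChartedSpace H M] {U₀ : Set M} {N : ℕ}
  {P : (M → ℂ) → M → ℂ} {B B' : (M → ℂ) → (M → ℂ) → M → ℂ}

theorem LinOn.of_cover {U : Set M} (hU : IsOpen U)
    (h : ∀ x ∈ U, ∃ U', IsOpen U' ∧ x ∈ U' ∧ LinOn J (U ∩ U') P) : LinOn J U P where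
  smooth f hf := SmoothFunOn.of_local fun x hx => by
    obtain ⟨U', h1, h2, h3⟩ := h x hx
    exact ⟨U', h1, h2, h3.smooth f (hf.mono Set.inter_subset_left)⟩
  congr f g hf hg hfg x hx := by
    obtain ⟨U', h1, h2, h3⟩ := h x hx
    exact h3.congr f g (hf.mono Set.inter_subset_left) (hg.mono Set.inter_subset_left)
      (hfg.mono Set.inter_subset_left) ⟨hx, h2⟩
  add f g hf hg x hx := by
    obtain ⟨U', h1, h2, h3⟩ := h x hx
    exact h3.add f g (hf.mono Set.inter_subset_left) (hg.mono Set.inter_subset_left) ⟨hx, h2⟩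
  smul c f hf x hx := by
    obtain ⟨U', h1, h2, h3⟩ := h x hx
    exact h3.smul c f (hf.mono Set.inter_subset_left) ⟨hx, h2⟩

theorem FunOrderLE.of_cover {U : Set M}
    (h : ∀ x ∈ U, ∃ U', x ∈ U' ∧ FunOrderLE J (U ∩ U') N P) : FunOrderLE J U N P :=
  OrderLE.of_cover fun x hx => by
    obtain ⟨U', h2, h3⟩ := h x hx
    exact ⟨U ∩ U', _, _, ⟨hx, h2⟩, fun a ha => SmoothFunOn.mono ha Set.inter_subset_left,
      fun a ha => SmoothFunOn.mono ha Set.inter_subset_left, h3⟩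

theorem HasOrder.of_cover (h : ∀ x, ∃ U₁, IsOpen U₁ ∧ x ∈ U₁ ∧ HasOrder J U₁ N P) :
    HasOrder J Set.univ N P := by
  have key : ∀ U, IsOpen U → LinOn J U P ∧ FunOrderLE J U N P := fun U hU =>
    ⟨LinOn.of_cover hU fun x _ => by
      obtain ⟨U', h1, h2, h3⟩ := h x
      exact ⟨U', h1, h2, h3.1.1 _ (hU.inter h1) Set.inter_subset_right⟩,
    FunOrderLE.of_cover fun x _ => by
      obtain ⟨U', h1, h2, h3⟩ := h x
      exact ⟨U', h2, h3.2 _ (hU.inter h1) Set.inter_subset_right⟩⟩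
  exact ⟨⟨fun U hU _ => (key U hU).1, N, fun U hU _ => (key U hU).2⟩, fun U hU _ => (key U hU).2⟩

theorem HasBiOrder.of_cover (h : ∀ x, ∃ U₁, IsOpen U₁ ∧ x ∈ U₁ ∧ HasBiOrder J U₁ N B) :
    IsBidiffOn J Set.univ B where
  left U hU _ g hg := LinOn.of_cover hU fun x _ => by
    obtain ⟨U', h1, h2, h3⟩ := h x
    exact ⟨U', h1, h2, h3.1.left _ (hU.inter h1) Set.inter_subset_right _
      (hg.mono Set.inter_subset_left)⟩
  right U hU _ g hg := LinOn.of_cover hU fun x _ => by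
    obtain ⟨U', h1, h2, h3⟩ := h x
    exact ⟨U', h1, h2, h3.1.right _ (hU.inter h1) Set.inter_subset_right _
      (hg.mono Set.inter_subset_left)⟩
  order := ⟨N, fun U hU _ => ⟨fun g hg => FunOrderLE.of_cover fun x _ => by
      obtain ⟨U', h1, h2, h3⟩ := h x
      exact ⟨U', h2, (h3.2 _ (hU.inter h1) Set.inter_subset_right).1 _
        (hg.mono Set.inter_subset_left)⟩,
    fun g hg => FunOrderLE.of_cover fun x _ => by
      obtain ⟨U', h1, h2, h3⟩ := h x
      exact ⟨U', h2, (h3.2 _ (hU.inter h1) Set.inter_subset_right).2 _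
        (hg.mono Set.inter_subset_left)⟩⟩⟩

theorem HasOrder.of_eqOn {P' : (M → ℂ) → M → ℂ} (h : HasOrder J U₀ N P)
    (heq : ∀ U, IsOpen U → U ⊆ U₀ → ∀ f, SmoothFunOn J U f → Set.EqOn (P' f) (P f) U) :
    HasOrder J U₀ N P' :=
  ⟨h.1.of_eqOn heq, fun U hU hU₀ => (h.2 U hU hU₀).of_eqOn (heq U hU hU₀)⟩

theorem HasBiOrder.of_eqOn (h : HasBiOrder J U₀ N B)
    (heq : ∀ U, IsOpen U → U ⊆ U₀ → ∀ f g, SmoothFunOn J U f → SmoothFunOn J U g →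
      Set.EqOn (B' f g) (B f g) U) : HasBiOrder J U₀ N B' :=
  ⟨h.1.of_eqOn heq, fun U hU hU₀ =>
    ⟨fun g hg => ((h.2 U hU hU₀).1 g hg).of_eqOn fun f hf => heq U hU hU₀ f g hf hg,
      fun f hf => ((h.2 U hU hU₀).2 f hf).of_eqOn fun g hg => heq U hU hU₀ f g hf hg⟩⟩

end Cover

/-! ### The star product of a phase algebra conjugated by a symbol transform -/

namespace PhaseAlgebra

variable {n : ℕ} {A B : Type*} [CommRing A] [Algebra ℂ A] [CommRing B] [Algebra ℂ B]
  {Φ : PhaseAlgebra n A B} {S R : ℕ → Module.End ℂ A}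

theorem conjCochain_formal_assoc (hR : IsInvSeries S R) (c : ℂ) (f g h : Formal A) :
    formalBilin (conjCochain (fun r => ⇑(R r)) (fun r x y => Φ.flatC c r x y) fun r => ⇑(S r))
        (formalBilin (conjCochain (fun r => ⇑(R r)) (fun r x y => Φ.flatC c r x y) fun r => ⇑(S r))
          f g) h =
      formalBilin (conjCochain (fun r => ⇑(R r)) (fun r x y => Φ.flatC c r x y) fun r => ⇑(S r)) f
        (formalBilin (conjCochain (fun r => ⇑(R r)) (fun r x y => Φ.flatC c r x y) fun r => ⇑(S r))
          g h) := by
  simp only [← formalOp_formalBilin_formalOp R (fun r => Φ.flatC c r) S, hR.formalOp_right,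
    flatC_formal_assoc]

theorem flatC_pull_left (c : ℂ) (r : ℕ) (u : B) (f : A) :
    Φ.flatC c r (Φ.pull u) f = if r = 0 then Φ.pull u * f else 0 := by
  cases r with
  | zero => simp [flatC_apply, flatB_zero]
  | succ r => simp [flatC_apply, flatB_succ, Φ.dp_pull]

theorem formalBilin_conjCochain_pull (hR : IsInvSeries S R)
    (hS : ∀ j u f, S j (Φ.pull u * f) = Φ.pull u * S j f) (hS' : ∀ j u, S (j + 1) (Φ.pull u) = 0)
    (c : ℂ) (u : B) (f : Formal A) :
    formalBilin (conjCochain (fun r => ⇑(R r)) (fun r x y => Φ.flatC c r x y) fun r => ⇑(S r))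
      (Formal.const (Φ.pull u)) f = fun N => Φ.pull u * f N := by
  have h1 : formalOp (fun r => ⇑(S r)) (Formal.const (Φ.pull u)) = Formal.const (Φ.pull u) := by
    rw [formalOp_const (fun r => map_zero _)]
    funext N
    cases N with
    | zero => simp [Formal.const, hR.left_zero]
    | succ N => simp [Formal.const, hS']
  have h2 : ∀ g : Formal A, formalBilin (fun r x y => Φ.flatC c r x y) (Formal.const (Φ.pull u)) g =
      fun N => Φ.pull u * g N := by
    intro g
    rw [formalBilin_const_left (by simp)]
    funext N
    rw [formalOp, Finset.sum_eq_single (0, N)]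
    · simp [flatC_pull_left]
    · intro m hm hne
      rw [flatC_pull_left, if_neg]
      intro h0
      rw [Finset.HasAntidiagonal.mem_antidiagonal] at hm
      exact hne (Prod.ext h0 (by omega))
    · simp
  rw [← formalOp_formalBilin_formalOp R (fun r => Φ.flatC c r) S, h1, h2]
  have h3 : (fun N => Φ.pull u * formalOp (fun r => ⇑(S r)) f N) =
      formalOp (fun r => ⇑(S r)) fun N => Φ.pull u * f N := by
    funext N
    simp [formalOp, hS, Finset.mul_sum]
  rw [h3, hR.formalOp_left]

theorem conjCochain_zero (hR : IsInvSeries S R) (c : ℂ) (f g : A) :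
    conjCochain (fun r => ⇑(R r)) (fun r x y => Φ.flatC c r x y) (fun r => ⇑(S r)) 0 f g =
      f * g := by
  simp [conjCochain, hR.left_zero, hR.right_zero, flatC_apply, flatB_zero]

theorem conjCochain_one (hR : IsInvSeries S R) (c : ℂ) (f g : A) :
    conjCochain (fun r => ⇑(R r)) (fun r x y => Φ.flatC c r x y) (fun r => ⇑(S r)) 1 f g -
      conjCochain (fun r => ⇑(R r)) (fun r x y => Φ.flatC c r x y) (fun r => ⇑(S r)) 1 g f =
      c • ∑ i, (Φ.dp i f * Φ.dq i g - Φ.dp i g * Φ.dq i f) := by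
  simp [conjCochain, Finset.Nat.antidiagonal_succ, hR.left_zero, hR.right_zero, flatC_apply, flatB_zero,
    flatB_succ, Finset.sum_sub_distrib, smul_sub, mul_comm g]
  ring

end PhaseAlgebra

end

section

section Star

variable {n : ℕ} {Q : Type*} [TopologicalSpace Q] [ChartedSpace 𝔼(n) Q]
  [IsManifold (𝓡 n) ∞ Q]

/-! ### Polynomials in the momenta -/

theorem iterate_partialP_line {f : Cotangent n Q → ℂ}
    (e : OpenPartialHomeomorph Q 𝔼(n)) (i : Fin n) {q : Q}
    (ζ : CotangentSpace n q) {P : Polynomial ℂ}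
    (hP : ∀ t : ℝ, f ⟨q, ζ + t • chartCovector e i q⟩ = P.eval (t : ℂ)) (k : ℕ) (t : ℝ) :
    (partialP e i)^[k] f ⟨q, ζ + t • chartCovector e i q⟩ =
      (Polynomial.derivative^[k] P).eval (t : ℂ) := by
  induction k generalizing t with
  | zero => exact hP t
  | succ k ih =>
    rw [Function.iterate_succ_apply', Function.iterate_succ_apply', partialP, fiberDeriv]
    have h1 : (fun s : ℝ => (partialP e i)^[k] f
        ⟨q, ζ + t • chartCovector e i q + s • chartCovector e i q⟩) =
        fun s : ℝ => (Polynomial.derivative^[k] P).eval ((t + s : ℝ) : ℂ) := by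
      funext s
      rw [← ih, add_smul, add_assoc]
    have h2 : HasDerivAt (fun s : ℝ => (Polynomial.derivative^[k] P).eval ((t + s : ℝ) : ℂ))
        ((Polynomial.derivative (Polynomial.derivative^[k] P)).eval (t : ℂ)) 0 := by
      have h3 := ((Polynomial.derivative^[k] P).hasDerivAt ((t + 0 : ℝ) : ℂ)).comp_ofReal
      have h4 : HasDerivAt (fun s : ℝ => t + s) 1 0 := (hasDerivAt_id (0 : ℝ)).const_add t
      have h5 := HasDerivAt.scomp (h := fun s : ℝ => t + s) (0 : ℝ) h3 h4
      rw [one_smul, add_zero] at h5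
      exact h5
    exact (congrArg (fun F => deriv F 0) h1).trans h2.deriv

theorem PolynomialInMomenta.exists_iterate_partialP {f : Cotangent n Q → ℂ}
    (hf : PolynomialInMomenta f) : ∃ d : ℕ, ∀ e i, (partialP e i)^[d] f = 0 := by
  obtain ⟨d, hd⟩ := hf
  refine ⟨d + 1, fun e i => funext fun ζ => ?_⟩
  obtain ⟨P, hP, h⟩ := hd ζ.1 ζ.2 (chartCovector e i ζ.1)
  have := iterate_partialP_line e i ζ.2 h (d + 1) 0
  rw [Polynomial.iterate_derivative_eq_zero (by omega), zero_smul, add_zero] at this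
  simpa using this

theorem Polynomial.exists_derivative_eq (P : Polynomial ℂ) :
    ∃ R : Polynomial ℂ, Polynomial.derivative R = P ∧ R.natDegree ≤ P.natDegree + 1 := by
  refine ⟨∑ k ∈ Finset.range (P.natDegree + 1),
    Polynomial.C (P.coeff k / ((k : ℂ) + 1)) * Polynomial.X ^ (k + 1), ?_, ?_⟩
  · conv_rhs => rw [P.as_sum_range_C_mul_X_pow]
    rw [Polynomial.derivative_sum]
    refine Finset.sum_congr rfl fun k _ => ?_
    rw [Polynomial.derivative_C_mul_X_pow]
    have : (k : ℂ) + 1 ≠ 0 := Nat.cast_add_one_ne_zero k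
    simp [this]
  · refine Polynomial.natDegree_sum_le_of_forall_le _ _ fun k hk => ?_
    refine (Polynomial.natDegree_C_mul_X_pow_le _ _).trans ?_
    have := Finset.mem_range.1 hk
    omega

variable {e : OpenPartialHomeomorph Q 𝔼(n)}
  (he : e ∈ atlas 𝔼(n) Q)

include he

theorem hasDerivAt_line {O : Set Q} (hO : IsOpen O) (hOe : O ⊆ e.source) {f : Cotangent n Q → ℂ}
    (hf : SmoothFunOn (cotModel n) (cotOver O) f) {q : Q} (hq : q ∈ O) (ζ γ : CotangentSpace n q)
    (t : ℝ) : HasDerivAt (fun t : ℝ => f ⟨q, ζ + t • γ⟩)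
      (∑ i, (γ (chartVector e i q) : ℂ) * partialP e i f ⟨q, ζ + t • γ⟩) t := by
  classical
  have hU := isOpen_cotOver (n := n) hO
  have hUe : (cotOver O : Set (Cotangent n Q)) ⊆ cotOver e.source := fun _ h => hOe h
  have hx : (⟨q, ζ + t • γ⟩ : Cotangent n Q) ∈ (cotOver O : Set (Cotangent n Q)) := hq
  have h0 : HasDerivAt (fun s : ℝ => f ⟨q, ζ + t • γ + s • γ⟩)
      (∑ i, (γ (chartVector e i q) : ℂ) * partialP e i f ⟨q, ζ + t • γ⟩) 0 := by
    have h1 := fiberDeriv_eq_sum he hU hUe hf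
      (Function.update (β := fun q : Q => CotangentSpace n q) (fun _ => 0) q γ) hx
    rw [fiberDeriv] at h1
    simp only [Function.update_self] at h1
    rw [← h1]
    refine DifferentiableAt.hasDerivAt ?_
    set v : Fin n → ℝ := fun i => γ (chartVector e i q)
    have h2 : (fun s : ℝ => f ⟨q, ζ + t • γ + s • γ⟩) =
        fun s : ℝ => f (cotCoordSymm e (cotCoord e ⟨q, ζ + t • γ⟩ + s • ((0, v) :
          𝔼(n) × (Fin n → ℝ)))) := by
      funext s
      rw [← cotPoint_add he (⟨q, ζ + t • γ⟩ : Cotangent n Q) (hOe hq) γ s]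
      change _ = f (cotPoint e (e q + s • 0) (momentum e ⟨q, ζ + t • γ⟩ + s • v))
      rw [smul_zero, add_zero]
    rw [h2]
    refine DifferentiableAt.comp (g := fun z => f (cotCoordSymm e z)) (0 : ℝ) ?_ (by fun_prop)
    simpa using (isCoord_cot he).differentiableAt hU hUe hf hx
  have h3 : HasDerivAt (fun r : ℝ => r - t) 1 t := (hasDerivAt_id t).sub_const t
  have h4 : HasDerivAt (fun s : ℝ => f ⟨q, ζ + t • γ + s • γ⟩)
      (∑ i, (γ (chartVector e i q) : ℂ) * partialP e i f ⟨q, ζ + t • γ⟩) (t - t) := by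
    simpa using h0
  have h5 := HasDerivAt.scomp (h := fun r : ℝ => r - t) t h4 h3
  rw [one_smul] at h5
  refine h5.congr_of_eventuallyEq (Filter.Eventually.of_forall fun r => ?_)
  simp only [Function.comp]
  rw [add_assoc, ← add_smul, add_sub_cancel]

theorem PhaseAlgebra.IsNil.exists_polynomial {O : Set Q} (hO : IsOpen O) (hOe : O ⊆ e.source)
    {m : ℕ} {a : Sm (cotModel n) (cotOver O)} {f : Cotangent n Q → ℂ} (ha : Represents a f)
    (h : (chartPhase he (isOpen_cotOver hO) hO hOe subset_rfl).IsNil m a) {q : Q} (hq : q ∈ O)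
    (ζ γ : CotangentSpace n q) :
    ∃ P : Polynomial ℂ, P.natDegree ≤ m ∧ ∀ t : ℝ, f ⟨q, ζ + t • γ⟩ = P.eval (t : ℂ) := by
  induction m generalizing a f with
  | zero =>
    have h0 : a = 0 := h
    subst h0
    refine ⟨0, by simp, fun t => ?_⟩
    rw [← ha.eq ⟨⟨q, ζ + t • γ⟩, hq⟩]
    simp
  | succ m ih =>
    choose P hP hPe using fun i => ih (represents_dp he (isOpen_cotOver hO) hO hOe subset_rfl ha i)
      (h i)
    obtain ⟨R, hR, hRd⟩ := Polynomial.exists_derivative_eq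
      (∑ i, Polynomial.C (γ (chartVector e i q) : ℂ) * P i)
    have hd : ∀ t : ℝ, HasDerivAt (fun t : ℝ => f ⟨q, ζ + t • γ⟩ - R.eval (t : ℂ)) 0 t := by
      intro t
      have h1 := (hasDerivAt_line he hO hOe ha.smooth hq ζ γ t).sub (R.hasDerivAt (t : ℂ)).comp_ofReal
      refine HasDerivAt.congr_deriv h1 ?_
      rw [hR, Polynomial.eval_finsetSum, sub_eq_zero]
      refine Finset.sum_congr rfl fun i _ => ?_
      rw [Polynomial.eval_mul, Polynomial.eval_C, hPe]
    have hc := is_const_of_deriv_eq_zero (fun t => (hd t).differentiableAt)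
      (fun t => (hd t).deriv)
    refine ⟨R + Polynomial.C (f ⟨q, ζ + (0 : ℝ) • γ⟩ - R.eval ((0 : ℝ) : ℂ)), ?_, fun t => ?_⟩
    · refine Polynomial.natDegree_add_le_of_degree_le (hRd.trans ?_) (by simp)
      refine Nat.succ_le_succ (Polynomial.natDegree_sum_le_of_forall_le _ _ fun i _ => ?_)
      exact (Polynomial.natDegree_C_mul_le _ _).trans (hP i)
    · have := hc t 0
      simp only [Polynomial.eval_add, Polynomial.eval_C]
      rw [← this]
      ring

theorem isNil_of_iterate_partialP {O : Set Q} (hO : IsOpen O) (hOe : O ⊆ e.source) {d : ℕ}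
    {a : Sm (cotModel n) (cotOver O)} {f : Cotangent n Q → ℂ} (ha : Represents a f)
    (h : ∀ i, (partialP e i)^[d] f = 0) :
    (chartPhase he (isOpen_cotOver hO) hO hOe subset_rfl).IsNil (∑ _i : Fin n, d + 1) a := by
  refine PhaseAlgebra.IsNil.of_dp_pow fun i => ?_
  have key : ∀ k, Represents (((chartPhase he (isOpen_cotOver hO) hO hOe subset_rfl).dp i ^ k) a)
      ((partialP e i)^[k] f) := by
    intro k
    induction k with
    | zero => exact ha
    | succ k ih =>
      rw [pow_succ', Function.iterate_succ_apply']
      exact represents_dp he (isOpen_cotOver hO) hO hOe subset_rfl ih i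
  have h1 := key d
  rw [h i] at h1
  exact h1.ext Represents.zero fun _ _ => rfl

end Star

end

section

theorem Represents.const {E : Type*} [NormedAddCommGroup E] [NormedSpace ℝ E]
    {H : Type*} [TopologicalSpace H] {J : ModelWithCorners ℝ E H}
    {M : Type*} [TopologicalSpace M] [ChartedSpace H M] {U : Set M} {a : Sm J U} {f : M → ℂ}
    (ha : Represents a f) (N : ℕ) : Represents (Formal.const a N) (Formal.const f N) := by
  simp only [Formal.const]
  split
  · exact ha
  · exact Represents.zero

section Star

variable {n : ℕ} {Q : Type*} [TopologicalSpace Q] [ChartedSpace 𝔼(n) Q]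
  [IsManifold (𝓡 n) ∞ Q]

/-- The cochains of the standard-ordered star product. -/
def globalCochain (nabla : CovariantDerivative (𝓡 n) 𝔼(n)
    (TangentSpace (𝓡 n) : Q → Type _)) (N : ℕ) (f g : Cotangent n Q → ℂ) : Cotangent n Q → ℂ :=
  fun ζ => chartCochain nabla (chartAt 𝔼(n) ζ.1) N f g ζ

variable {nabla : CovariantDerivative (𝓡 n) 𝔼(n)
    (TangentSpace (𝓡 n) : Q → Type _)} [T2Space Q]
  (hs : CovariantDerivative.ContMDiffCovariantDerivative nabla ∞)

include hs

theorem globalCochain_eqOn {e : OpenPartialHomeomorph Q 𝔼(n)}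
    (he : e ∈ atlas 𝔼(n) Q) {U : Set (Cotangent n Q)} (hU : IsOpen U)
    (hUe : U ⊆ cotOver e.source) {f g : Cotangent n Q → ℂ} (hf : SmoothFunOn (cotModel n) U f)
    (hg : SmoothFunOn (cotModel n) U g) (N : ℕ) :
    Set.EqOn (globalCochain nabla N f g) (chartCochain nabla e N f g) U := fun ζ hζ =>
  chartCochain_eqOn he (chart_mem_atlas 𝔼(n) ζ.1) hs
    (hU.inter (isOpen_cotOver (chartAt 𝔼(n) ζ.1).open_source))
    (Set.inter_subset_left.trans hUe) Set.inter_subset_right (hf.mono Set.inter_subset_left)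
    (hg.mono Set.inter_subset_left) N ⟨hζ, mem_chart_source 𝔼(n) ζ.1⟩

theorem isBidiffOn_globalCochain (N : ℕ) :
    IsBidiffOn (cotModel n) Set.univ (globalCochain nabla N) :=
  HasBiOrder.of_cover (N := 2 * N) fun ζ =>
    ⟨cotOver (chartAt 𝔼(n) ζ.1).source,
      isOpen_cotOver (chartAt 𝔼(n) ζ.1).open_source,
      mem_chart_source 𝔼(n) ζ.1,
      (hasBiOrder_chartCochain (chart_mem_atlas _ ζ.1) hs N).of_eqOn fun U hU hUe f g hf hg =>
        globalCochain_eqOn hs (chart_mem_atlas _ ζ.1) hU hUe hf hg N⟩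

theorem represents_globalCochain {e : OpenPartialHomeomorph Q 𝔼(n)}
    (he : e ∈ atlas 𝔼(n) Q) {U : Set (Cotangent n Q)} (hU : IsOpen U)
    {O : Set Q} (hO : IsOpen O) (hOe : O ⊆ e.source) (hUO : U ⊆ cotOver O) (N : ℕ)
    (a : Sm (cotModel n) U) (f : Cotangent n Q → ℂ) (b : Sm (cotModel n) U)
    (g : Cotangent n Q → ℂ) (ha : Represents a f) (hb : Represents b g) :
    Represents (conjCochain (fun r => ⇑(chartR hs he hU (cotOver_mono hOe hUO) r))
      (fun r x y => (chartPhase he hU hO hOe hUO).flatC (-Complex.I) r x y)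
      (fun j => ⇑((-Complex.I) ^ j • PhaseAlgebra.IsSymbolFamily.total
        (chartT hs he hU (cotOver_mono hOe hUO)) j)) N a b)
      (globalCochain nabla N f g) :=
  (represents_chartCochain hs he hU hO hOe hUO N a f b g ha hb).congr
    (globalCochain_eqOn hs he hU (cotOver_mono hOe hUO) ha.smooth hb.smooth N)

theorem globalCochain_zero {U : Set (Cotangent n Q)} (hU : IsOpen U) {f g : Cotangent n Q → ℂ}
    (hf : SmoothFunOn (cotModel n) U f) (hg : SmoothFunOn (cotModel n) U g) {ζ : Cotangent n Q}
    (hζ : ζ ∈ U) : globalCochain nabla 0 f g ζ = f ζ * g ζ := by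
  have he := chart_mem_atlas 𝔼(n) ζ.1
  set e := chartAt 𝔼(n) ζ.1
  have hU' := hU.inter (isOpen_cotOver (n := n) e.open_source)
  have hf' := hf.mono (U' := U ∩ cotOver e.source) Set.inter_subset_left
  have hg' := hg.mono (U' := U ∩ cotOver e.source) Set.inter_subset_left
  have h := represents_globalCochain hs he hU' e.open_source subset_rfl Set.inter_subset_right 0 _ _
    _ _ hf'.represents hg'.represents
  rw [PhaseAlgebra.conjCochain_zero (isInvSeries_chartR hs he hU' e.open_source subset_rfl
    Set.inter_subset_right)] at h
  exact h.eqOn (hf'.represents.mul hg'.represents)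
    ⟨hζ, mem_chart_source 𝔼(n) ζ.1⟩

theorem globalCochain_one {U : Set (Cotangent n Q)} (hU : IsOpen U) {f g : Cotangent n Q → ℂ}
    (hf : SmoothFunOn (cotModel n) U f) (hg : SmoothFunOn (cotModel n) U g) {ζ : Cotangent n Q}
    (hζ : ζ ∈ U) : globalCochain nabla 1 f g ζ - globalCochain nabla 1 g f ζ =
      Complex.I * cotPoisson f g ζ := by
  have he := chart_mem_atlas 𝔼(n) ζ.1
  set e := chartAt 𝔼(n) ζ.1 with hedef
  have hU' := hU.inter (isOpen_cotOver (n := n) e.open_source)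
  have hf' := (hf.mono (U' := U ∩ cotOver e.source) Set.inter_subset_left).represents
  have hg' := (hg.mono (U' := U ∩ cotOver e.source) Set.inter_subset_left).represents
  have h1 := represents_globalCochain hs he hU' e.open_source subset_rfl Set.inter_subset_right 1
    _ _ _ _ hf' hg'
  have h2 := represents_globalCochain hs he hU' e.open_source subset_rfl Set.inter_subset_right 1
    _ _ _ _ hg' hf'
  have h := h1.sub h2
  rw [PhaseAlgebra.conjCochain_one (isInvSeries_chartR hs he hU' e.open_source subset_rfl
    Set.inter_subset_right)] at h
  have hp := fun {a : Sm (cotModel n) (U ∩ cotOver e.source)} {f} (ha : Represents a f) i =>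
    represents_dp he hU' e.open_source subset_rfl Set.inter_subset_right ha i
  have hq := fun {a : Sm (cotModel n) (U ∩ cotOver e.source)} {f} (ha : Represents a f) i =>
    represents_dq he hU' e.open_source subset_rfl Set.inter_subset_right ha i
  have h' := (Represents.sum (s := Finset.univ) fun i _ =>
    ((hp hf' i).mul (hq hg' i)).sub ((hp hg' i).mul (hq hf' i))).smul (-Complex.I)
  have := h.eqOn h' ⟨hζ, mem_chart_source 𝔼(n) ζ.1⟩
  rw [Pi.sub_apply] at this
  rw [this, cotPoisson]
  simp only [Pi.smul_apply, Finset.sum_apply, Pi.sub_apply, smul_eq_mul, Finset.mul_sum, ← hedef]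
  exact Finset.sum_congr rfl fun i _ => by ring

theorem represents_formalBilin_globalCochain
    {e : OpenPartialHomeomorph Q 𝔼(n)}
    (he : e ∈ atlas 𝔼(n) Q) {U : Set (Cotangent n Q)} (hU : IsOpen U)
    {O : Set Q} (hO : IsOpen O) (hOe : O ⊆ e.source) (hUO : U ⊆ cotOver O)
    {a b : Formal (Sm (cotModel n) U)} {f g : Formal (Cotangent n Q → ℂ)}
    (ha : ∀ N, Represents (a N) (f N)) (hb : ∀ N, Represents (b N) (g N)) (N : ℕ) :
    Represents (formalBilin (conjCochain (fun r => ⇑(chartR hs he hU (cotOver_mono hOe hUO) r))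
      (fun r x y => (chartPhase he hU hO hOe hUO).flatC (-Complex.I) r x y)
      (fun j => ⇑((-Complex.I) ^ j • PhaseAlgebra.IsSymbolFamily.total
        (chartT hs he hU (cotOver_mono hOe hUO)) j))) a b N)
      (formalBilin (globalCochain nabla) f g N) :=
  Represents.formalBilin (represents_globalCochain hs he hU hO hOe hUO) ha hb N

theorem isStarProduct_globalCochain :
    IsStarProduct (cotModel n) cotPoisson (formalBilin (globalCochain (n := n) nabla)) where
  cochains := ⟨globalCochain nabla, fun r => (isBidiffOn_globalCochain hs r).isBidifferential,
    fun U _ f g _ _ N ζ _ => rfl, fun U hU f g hf hg ζ hζ => globalCochain_zero hs hU hf hg hζ,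
    fun U hU f g hf hg ζ hζ => globalCochain_one hs hU hf hg hζ⟩
  assoc U hU f g h hf hg hh N ζ hζ := by
    have he := chart_mem_atlas 𝔼(n) ζ.1
    set e := chartAt 𝔼(n) ζ.1
    have hU' := hU.inter (isOpen_cotOver (n := n) e.open_source)
    have rep : ∀ {f : Formal (Cotangent n Q → ℂ)} (hf : FormalSmoothFunOn (cotModel n) U f) (N : ℕ),
        Represents ((hf N).mono (U' := U ∩ cotOver e.source) Set.inter_subset_left).toSm (f N) :=
      fun hf N => SmoothFunOn.represents _
    have bil := fun {a b : Formal (Sm (cotModel n) (U ∩ cotOver e.source))}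
        {f g : Formal (Cotangent n Q → ℂ)} =>
      represents_formalBilin_globalCochain hs he hU' e.open_source subset_rfl
        Set.inter_subset_right (a := a) (b := b) (f := f) (g := g)
    have h1 := bil (bil (rep hf) (rep hg)) (rep hh) N
    have h2 := bil (rep hf) (bil (rep hg) (rep hh)) N
    rw [PhaseAlgebra.conjCochain_formal_assoc (isInvSeries_chartR hs he hU' e.open_source subset_rfl
      Set.inter_subset_right)] at h1
    exact h1.eqOn h2 ⟨hζ, mem_chart_source 𝔼(n) ζ.1⟩

theorem pull_globalCochain {O : Set Q} (hO : IsOpen O) {U : Set (Cotangent n Q)} (hU : IsOpen U)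
    (hUO : ∀ ζ ∈ U, ζ.1 ∈ O) {u : Q → ℂ} {f : Formal (Cotangent n Q → ℂ)}
    (hu : SmoothFunOn (𝓡 n) O u) (hf : FormalSmoothFunOn (cotModel n) U f) :
    FormalEqOn U (formalBilin (globalCochain nabla) (Formal.const (pullbackFun u)) f)
      (fun N ζ => pullbackFun u ζ * f N ζ) := by
  intro N ζ hζ
  have he := chart_mem_atlas 𝔼(n) ζ.1
  set e := chartAt 𝔼(n) ζ.1
  have hU' := hU.inter (isOpen_cotOver (n := n) e.open_source)
  have hO' := hO.inter e.open_source
  have hUO' : U ∩ cotOver e.source ⊆ cotOver (O ∩ e.source) := fun ζ h => ⟨hUO ζ h.1, h.2⟩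
  have hu' := (hu.mono (U' := O ∩ e.source) Set.inter_subset_left).represents
  have rep : ∀ N, Represents ((hf N).mono (U' := U ∩ cotOver e.source) Set.inter_subset_left).toSm
      (f N) := fun N => SmoothFunOn.represents _
  have hp := represents_pull he hU' hO' Set.inter_subset_right hUO' hu'
  have h := represents_formalBilin_globalCochain hs he hU' hO' Set.inter_subset_right hUO' hp.const rep N
  rw [PhaseAlgebra.formalBilin_conjCochain_pull (isInvSeries_chartR hs he hU' hO'
    Set.inter_subset_right hUO')] at h
  · exact h.eqOn (hp.mul (rep N)) ⟨hζ, mem_chart_source 𝔼(n) ζ.1⟩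
  · intro j v a
    simp [(isSymbolFamily_chartT hs he hU' hO' Set.inter_subset_right hUO').total_mulPull]
  · intro j v
    simp [(isSymbolFamily_chartT hs he hU' hO' Set.inter_subset_right hUO').total_pull]

theorem polynomialInMomenta_globalCochain {f g : Cotangent n Q → ℂ}
    (hf : SmoothFunOn (cotModel n) Set.univ f) (hg : SmoothFunOn (cotModel n) Set.univ g)
    (pf : PolynomialInMomenta f) (pg : PolynomialInMomenta g) (r : ℕ) :
    PolynomialInMomenta (globalCochain nabla r f g) := by
  obtain ⟨d, hd⟩ := pf.exists_iterate_partialP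
  obtain ⟨d', hd'⟩ := pg.exists_iterate_partialP
  refine ⟨∑ _i : Fin n, d + 1 + (∑ _i : Fin n, d' + 1) + 2 * r, fun q ζ γ => ?_⟩
  have he := chart_mem_atlas 𝔼(n) q
  set e := chartAt 𝔼(n) q
  have hU := isOpen_cotOver (n := n) e.open_source
  have hf' := (hf.mono (U' := cotOver e.source) (Set.subset_univ _)).represents
  have hg' := (hg.mono (U' := cotOver e.source) (Set.subset_univ _)).represents
  have hT := isSymbolFamily_chartT hs he hU e.open_source subset_rfl subset_rfl
  have hR := isInvSeries_chartR hs he hU e.open_source subset_rfl subset_rfl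
  have hL := PhaseAlgebra.IsSymbolFamily.total_lifts _ hT
  exact PhaseAlgebra.IsNil.exists_polynomial he e.open_source subset_rfl
    (represents_globalCochain hs he hU e.open_source subset_rfl subset_rfl r _ _ _ _ hf' hg')
    (PhaseAlgebra.IsNil.conjCochain hL (PhaseAlgebra.Lifts.of_invSeries hR hL) _
      (isNil_of_iterate_partialP he e.open_source subset_rfl hf' (hd e))
      (isNil_of_iterate_partialP he e.open_source subset_rfl hg' (hd' e)) r)
    (mem_chart_source 𝔼(n) q) ζ γ

theorem represents_stdRep {e : OpenPartialHomeomorph Q 𝔼(n)}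
    (he : e ∈ atlas 𝔼(n) Q) {O : Set Q} (hO : IsOpen O)
    (hOe : O ⊆ e.source) {a : Formal (Sm (cotModel n) (cotOver O))}
    {f : Formal (Cotangent n Q → ℂ)} (ha : ∀ N, Represents (a N) (f N)) {b : Formal (Sm (𝓡 n) O)}
    {u : Formal (Q → ℂ)} (hb : ∀ N, Represents (b N) (u N)) (N : ℕ) :
    Represents (formalBilin ((chartPhase he (isOpen_cotOver hO) hO hOe subset_rfl).repC
      (Sm.zeroSection O) (fun j => (-Complex.I) ^ j • PhaseAlgebra.IsSymbolFamily.total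
        (chartT hs he (isOpen_cotOver hO) (cotOver_mono hOe subset_rfl)) j)) a b N)
      (stdRep nabla f u N) := by
  refine Represents.sum fun m _ => Represents.sum fun m' _ => ?_
  have hu := (hb m'.2).smooth
  have hb' : b m'.2 = hu.toSm := (hb m'.2).ext hu.represents fun _ _ => rfl
  rw [hb', repC_chart hs he hO hOe hu]
  refine ((represents_covSum hs he hO hOe hu m.1 (ha m'.1)).smul _).congr fun q hq => ?_
  have h := chartSymD_eqOn he (chart_mem_atlas 𝔼(n) q) hs
    (hO.inter (chartAt 𝔼(n) q).open_source) (Set.inter_subset_left.trans hOe)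
    Set.inter_subset_right (hu.mono Set.inter_subset_left)
    ((ha m'.1).smooth.mono fun ζ h => h.1) m.1 ⟨hq, mem_chart_source _ q⟩
  exact congrArg _ h

theorem isStandardOrdered_globalCochain :
    IsStandardOrdered nabla (formalBilin (globalCochain (n := n) nabla)) where
  isStarProduct := isStarProduct_globalCochain hs
  rep f g u hf hg hu := by
    funext N q
    have he := chart_mem_atlas 𝔼(n) q
    set e := chartAt 𝔼(n) q
    have hO := e.open_source
    have rf : ∀ N, Represents ((hf N).mono (U' := cotOver e.source) (Set.subset_univ _)).toSm (f N) :=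
      fun N => SmoothFunOn.represents _
    have rg : ∀ N, Represents ((hg N).mono (U' := cotOver e.source) (Set.subset_univ _)).toSm (g N) :=
      fun N => SmoothFunOn.represents _
    have ru : ∀ N, Represents ((hu N).mono (U' := e.source) (Set.subset_univ _)).toSm (u N) :=
      fun N => SmoothFunOn.represents _
    have h1 := represents_stdRep hs he hO subset_rfl (represents_formalBilin_globalCochain hs he
      (isOpen_cotOver hO) hO subset_rfl subset_rfl rf rg) ru N
    have h2 := represents_stdRep hs he hO subset_rfl rf
      (represents_stdRep hs he hO subset_rfl rg ru) N
    rw [PhaseAlgebra.repC_hom (isSection_zeroSection he hO subset_rfl)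
      (isInvSeries_chartR hs he (isOpen_cotOver hO) hO subset_rfl subset_rfl)] at h1
    exact h1.eqOn h2 (mem_chart_source 𝔼(n) q)
  pull_star O hO U hU hUO u f hu hf := pull_globalCochain hs hO hU hUO hu hf
  polynomial f g hf hg pf pg r := by
    have hB := fun r => isBidiffOn_globalCochain (n := n) (Q := Q) hs r
    have rep : formalBilin (globalCochain nabla) (Formal.const f) (Formal.const g) r =
        globalCochain nabla r f g := by
      have h := Represents.formalBilin (fun r a f b g ha hb =>
        Represents.toBil (hB r) isOpen_univ subset_rfl ha hb) hf.represents.const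
        hg.represents.const r
      rw [formalBilin_const_const (by simp) (by simp)] at h
      exact funext fun ζ => h.eqOn (Represents.toBil (hB r) isOpen_univ subset_rfl hf.represents
        hg.represents) trivial
    rw [rep]
    exact polynomialInMomenta_globalCochain hs hf hg pf pg r

theorem isStandardOrdered_starS : IsStandardOrdered nabla (starS (n := n) nabla) :=
  Classical.epsilon_spec (p := IsStandardOrdered nabla)
    ⟨_, isStandardOrdered_globalCochain hs⟩

end Star

end

section

/-- Jacobi's formula. -/
theorem HasDerivAt.matrix_det {n : ℕ} {J : ℝ → Matrix (Fin n) (Fin n) ℝ}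
    {J' K : Matrix (Fin n) (Fin n) ℝ} {t : ℝ} (h : ∀ i j, HasDerivAt (fun s => J s i j) (J' i j) t)
    (hK : K * J t = 1) :
    HasDerivAt (fun s => (J s).det) ((J t).det * ∑ i, ∑ j, K j i * J' i j) t := by
  let D : ContinuousMultilinearMap ℝ (fun _ : Fin n => Fin n → ℝ) ℝ :=
    ⟨(Matrix.detRowAlternating (R := ℝ) (n := Fin n)).toMultilinearMap,
      Continuous.matrix_det (A := fun M : Fin n → Fin n → ℝ => Matrix.of M) continuous_id⟩
  have h1 : HasDerivAt (fun s => (J s : Fin n → Fin n → ℝ)) J' t :=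
    hasDerivAt_pi.2 fun i => hasDerivAt_pi.2 fun j => h i j
  have h2 := (D.hasFDerivAt (J t)).comp_hasDerivAt t h1
  refine HasDerivAt.congr_deriv h2 ?_
  refine (D.linearDeriv_apply _ _).trans ?_
  rw [Finset.mul_sum]
  refine Finset.sum_congr rfl fun i _ => ?_
  have h3 : D (Function.update (J t) i (J' i)) = ((J t).updateRow i (J' i)).det := rfl
  have h4 : (J t).adjugate = (J t).det • K := by
    calc (J t).adjugate = (K * J t) * (J t).adjugate := by rw [hK, one_mul]
      _ = _ := by rw [mul_assoc, Matrix.mul_adjugate, Matrix.mul_smul, mul_one]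
  rw [h3, ← Matrix.cramer_transpose_apply, Matrix.cramer_eq_adjugate_mulVec,
    ← Matrix.adjugate_transpose, h4, Matrix.mulVec, dotProduct, Finset.mul_sum]
  exact Finset.sum_congr rfl fun j _ => by simp [mul_assoc]

section Density

variable {n : ℕ} {Q : Type*} [TopologicalSpace Q] [ChartedSpace 𝔼(n) Q]
  [IsManifold (𝓡 n) ∞ Q] {e e' : OpenPartialHomeomorph Q 𝔼(n)}
  (he : e ∈ atlas 𝔼(n) Q) (he' : e' ∈ atlas 𝔼(n) Q)

section Real

variable {O : Set Q} (hO : IsOpen O) (hOe : O ⊆ e.source) {u : Q → ℝ}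
  (hu : ContMDiffOn (𝓡 n) 𝓘(ℝ, ℝ) ∞ u O)

include he hO hOe hu

theorem hasDerivAt_partialX (i : Fin n) {q : Q} (hq : q ∈ O) :
    HasDerivAt (fun t : ℝ => u (e.symm (e q + t • EuclideanSpace.single i (1 : ℝ))))
      (partialX e i u q) 0 := by
  have hu' : SmoothFunOn (𝓡 n) O (fun q => (u q : ℂ)) :=
    Complex.ofRealCLM.contDiff.contMDiff.comp_contMDiffOn hu
  have h1 : DifferentiableAt ℝ (fun t : ℝ =>
      (u (e.symm (e q + t • EuclideanSpace.single i (1 : ℝ))) : ℂ)) 0 := by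
    refine DifferentiableAt.comp (g := fun z => (u (e.symm z) : ℂ)) (0 : ℝ) ?_ (by fun_prop)
    simpa using (isCoord_chart he).differentiableAt hO hOe hu' hq
  exact (Complex.reCLM.differentiableAt.comp (0 : ℝ) h1).hasDerivAt

theorem partialX_ofReal_eq (i : Fin n) {q : Q} (hq : q ∈ O) :
    partialX e i (fun q => (u q : ℂ)) q = ((partialX e i u q : ℝ) : ℂ) :=
  (hasDerivAt_partialX he hO hOe hu i hq).ofReal_comp.deriv

theorem partialX_eq_mvfderiv_real (i : Fin n) {q : Q} (hq : q ∈ O) :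
    partialX e i u q = mvfderiv (𝓡 n) u q (chartVector e i q) := by
  have h := partialX_ofReal he hO hOe hu i hq
  rw [partialX_ofReal_eq he hO hOe hu i hq] at h
  exact_mod_cast h

end Real

include he

theorem partialX_change_real (he' : e' ∈ atlas 𝔼(n) Q) {O : Set Q}
    (hO : IsOpen O) (hOe : O ⊆ e.source) (hOe' : O ⊆ e'.source) {u : Q → ℝ}
    (hu : ContMDiffOn (𝓡 n) 𝓘(ℝ, ℝ) ∞ u O) (k : Fin n) {q : Q} (hq : q ∈ O) :
    partialX e' k u q = ∑ j, chartJacobian e e' j k q * partialX e j u q := by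
  have h := partialX_change he he' hO hOe hOe'
    (Complex.ofRealCLM.contDiff.contMDiff.comp_contMDiffOn hu) k hq
  have e1 := partialX_ofReal_eq he' hO hOe' hu k hq
  have e2 := fun j => partialX_ofReal_eq he hO hOe hu j hq
  have h' : ((partialX e' k u q : ℝ) : ℂ) = ∑ j, (chartJacobian e e' j k q : ℂ) * ((partialX e j u q : ℝ) : ℂ) := by
    rw [← e1]
    simp only [← e2]
    exact h
  exact_mod_cast h'

/-- The basis of coordinate vector fields. -/
def chartBasis {q : Q} (hq : q ∈ e.source) : Module.Basis (Fin n) ℝ (TangentSpace (𝓡 n) q) :=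
  Module.Basis.ofEquivFun
    { toFun := fun v i => chartCovector e i q v
      map_add' := fun v w => funext fun i => map_add _ v w
      map_smul' := fun c v => funext fun i => map_smul _ c v
      invFun := fun x => ∑ i, x i • chartVector e i q
      left_inv := fun v => sum_chartCovector_smul_chartVector he hq v
      right_inv := fun x => funext fun i => by
        simp [map_sum, chartCovector_chartVector he hq] }

theorem chartBasis_apply {q : Q} (hq : q ∈ e.source) (i : Fin n) :
    chartBasis he hq i = chartVector e i q := by
  simp [chartBasis, Module.Basis.coe_ofEquivFun, Pi.single_apply]

theorem chartBasis_repr {q : Q} (hq : q ∈ e.source) (v : TangentSpace (𝓡 n) q) (i : Fin n) :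
    (chartBasis he hq).repr v i = chartCovector e i q v := by
  simp [chartBasis]

/-- The density in the chart `e`. -/
def VolumeDensity.inChart (mu : VolumeDensity n Q)
    (e : OpenPartialHomeomorph Q 𝔼(n)) (q : Q) : ℝ :=
  mu.toFun q fun i => chartVector e i q

variable (mu : VolumeDensity n Q)

theorem VolumeDensity.inChart_pos {q : Q} (hq : q ∈ e.source) : 0 < mu.inChart e q :=
  mu.pos q _ <| by
    have := (chartBasis he hq).linearIndependent
    rwa [funext (chartBasis_apply he hq)] at this

theorem VolumeDensity.inChart_change {q : Q} (hq : q ∈ e.source) :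
    mu.inChart e' q =
      |(Matrix.of fun i j => chartJacobian e e' i j q).det| * mu.inChart e q := by
  let A : TangentSpace (𝓡 n) q →ₗ[ℝ] TangentSpace (𝓡 n) q :=
    (chartBasis he hq).constr ℝ fun i => chartVector e' i q
  have hA : ∀ i, A (chartVector e i q) = chartVector e' i q := fun i => by
    rw [← chartBasis_apply he hq, Module.Basis.constr_basis]
  have h := mu.map_comp q A fun i => chartVector e i q
  simp only [hA] at h
  rw [VolumeDensity.inChart, h, ← LinearMap.det_toMatrix (chartBasis he hq)]
  congr 3
  ext i j
  rw [LinearMap.toMatrix_apply, chartBasis_apply, hA, chartBasis_repr]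
  rfl

theorem contMDiffOn_log_inChart :
    ContMDiffOn (𝓡 n) 𝓘(ℝ, ℝ) ∞ (fun q => Real.log (mu.inChart e q)) e.source := fun q hq =>
  ((Real.contDiffAt_log.2 (mu.inChart_pos he hq).ne').contMDiffAt).comp_contMDiffWithinAt q
    (mu.smooth e he q hq)

/-- The components of the one-form of a density in a chart. -/
def chartDensity (nabla : CovariantDerivative (𝓡 n) 𝔼(n)
    (TangentSpace (𝓡 n) : Q → Type _)) (mu : VolumeDensity n Q)
    (e : OpenPartialHomeomorph Q 𝔼(n)) (i : Fin n) (q : Q) : ℝ :=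
  partialX e i (mu.inChart e) q / mu.inChart e q - ∑ j, christoffel nabla e j i j q

theorem partialX_inChart_div {q : Q} (hq : q ∈ e.source) (i : Fin n) :
    partialX e i (mu.inChart e) q / mu.inChart e q =
      partialX e i (fun q => Real.log (mu.inChart e q)) q := by
  have h := hasDerivAt_partialX he e.open_source subset_rfl (u := mu.inChart e) (mu.smooth e he) i hq
  have h0 : mu.inChart e (e.symm (e q + (0 : ℝ) • EuclideanSpace.single i (1 : ℝ))) =
      mu.inChart e q := by simp [e.left_inv hq]
  have h1 := h.log (by rw [h0]; exact (mu.inChart_pos he hq).ne')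
  rw [h0] at h1
  exact h1.deriv.symm

include he'

theorem partialX_log_inChart_change {q : Q} (hq : q ∈ e.source) (hq' : q ∈ e'.source) (c : Fin n) :
    partialX e' c (fun q => Real.log (mu.inChart e' q)) q =
      ∑ i, ∑ j, chartJacobian e' e j i q * partialX e' c (chartJacobian e e' i j) q +
        ∑ j, chartJacobian e e' j c q * partialX e j (fun q => Real.log (mu.inChart e q)) q := by
  have hO := e.open_source.inter e'.open_source
  have hO' := e'.open_source.inter e.open_source
  rw [← partialX_change_real he he' hO Set.inter_subset_left Set.inter_subset_right
    ((contMDiffOn_log_inChart he mu).mono Set.inter_subset_left) c ⟨hq, hq'⟩]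
  set γ : ℝ → Q := fun t => e'.symm (e' q + t • EuclideanSpace.single c (1 : ℝ)) with hγ
  have hγ0 : γ 0 = q := by simp [hγ, e'.left_inv hq']
  have h1 := hasDerivAt_partialX he' hO Set.inter_subset_right
    ((contMDiffOn_log_inChart he mu).mono Set.inter_subset_left) c ⟨hq, hq'⟩
  have h2 := fun i j => hasDerivAt_partialX he' hO' Set.inter_subset_left
    (contMDiffOn_chartJacobian he' he i j) c ⟨hq', hq⟩
  have hK : (Matrix.of fun i j => chartJacobian e' e i j q) *
      (Matrix.of fun i j => chartJacobian e e' i j (γ 0)) = 1 := by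
    ext l m
    rw [hγ0, Matrix.mul_apply, Matrix.one_apply]
    simp only [Matrix.of_apply]
    rw [chartJacobian_mul he e' l m hq e', chartJacobian_self he' l m hq']
  have h3 := HasDerivAt.matrix_det (J := fun t => Matrix.of fun i j => chartJacobian e e' i j (γ t))
    (J' := Matrix.of fun i j => partialX e' c (chartJacobian e e' i j) q) h2 hK
  have hne : (Matrix.of fun i j => chartJacobian e e' i j (γ 0)).det ≠ 0 := by
    intro h0
    have := congrArg Matrix.det hK
    rw [Matrix.det_mul, h0] at this
    simp at this
  have h4 := (h3.log hne).add h1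
  rw [mul_div_cancel_left₀ _ hne] at h4
  refine HasDerivAt.deriv (HasDerivAt.congr_of_eventuallyEq h4 ?_)
  have hc : ContinuousAt γ 0 := by
    refine ContinuousAt.comp (g := e'.symm) ?_ (by fun_prop)
    simpa using e'.continuousAt_symm (e'.map_source hq')
  have hev : ∀ᶠ t in 𝓝 (0 : ℝ), γ t ∈ e.source ∩ e'.source := by
    refine hc.eventually_mem ?_
    rw [hγ0]
    exact hO.mem_nhds ⟨hq, hq'⟩
  filter_upwards [hev] with t ht
  change Real.log (mu.inChart e' (γ t)) = _
  have hp := mu.inChart_change he (e' := e') ht.1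
  have hpos := mu.inChart_pos he' ht.2
  rw [hp, Real.log_mul, Real.log_abs]
  · rfl
  · intro h0
    rw [hp, h0, zero_mul] at hpos
    exact hpos.false
  · exact (mu.inChart_pos he ht.1).ne'

end Density

end

section

theorem trace_christoffel_change {n : ℕ} {K J : Fin n → Fin n → ℝ} {G G' D : Fin n → Fin n → Fin n → ℝ}
    (hKJ : ∀ l m, ∑ j, K l j * J j m = if l = m then 1 else 0)
    (hJK : ∀ l m, ∑ j, J l j * K j m = if l = m then 1 else 0)
    (h : ∀ l a b, ∑ j, ∑ k, G' l j k * K j a * K k b = ∑ m, K l m * G m a b - D l b a) (c : Fin n) :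
    ∑ l, G' l c l = ∑ a, J a c * ∑ m, G m a m - ∑ l, ∑ b, (∑ a, J a c * D l b a) * J b l := by
  let k : Matrix (Fin n) (Fin n) ℝ := Matrix.of K
  let j : Matrix (Fin n) (Fin n) ℝ := Matrix.of J
  have hkj : k * j = 1 := by ext l m; simpa [k, j, Matrix.mul_apply, Matrix.one_apply] using hKJ l m
  have key : ∀ l, Matrix.of (G' l) =
      j.transpose * Matrix.of (fun a b => ∑ m, K l m * G m a b - D l b a) * j := by
    intro l
    have h1 : Matrix.of (fun a b => ∑ m, K l m * G m a b - D l b a) =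
        k.transpose * Matrix.of (G' l) * k := by
      ext a b
      simp only [Matrix.mul_apply, Matrix.of_apply, Matrix.transpose_apply, k, ← h, Finset.sum_mul]
      rw [Finset.sum_comm]
      exact Finset.sum_congr rfl fun _ _ => Finset.sum_congr rfl fun _ _ => by ring
    calc Matrix.of (G' l) = (k * j).transpose * Matrix.of (G' l) * (k * j) := by simp [hkj]
      _ = _ := by rw [h1, Matrix.transpose_mul]; simp only [Matrix.mul_assoc]
  have h2 : ∀ l, G' l c l = ∑ b, (∑ a, J a c * ∑ m, K l m * G m a b) * J b l -
      ∑ b, (∑ a, J a c * D l b a) * J b l := by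
    intro l
    have := congrFun (congrFun (key l) c) l
    simp only [Matrix.of_apply, Matrix.mul_apply, Matrix.transpose_apply, j] at this
    rw [this, ← Finset.sum_sub_distrib]
    refine Finset.sum_congr rfl fun b _ => ?_
    rw [← sub_mul, ← Finset.sum_sub_distrib]
    simp only [mul_sub]
  rw [Finset.sum_congr rfl fun l _ => h2 l, Finset.sum_sub_distrib]
  congr 1
  calc ∑ l, ∑ b, (∑ a, J a c * ∑ m, K l m * G m a b) * J b l
      = ∑ l, ∑ b, ∑ a, ∑ m, J a c * G m a b * (J b l * K l m) := by
        simp only [Finset.sum_mul, Finset.mul_sum]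
        exact Finset.sum_congr rfl fun _ _ => Finset.sum_congr rfl fun _ _ =>
          Finset.sum_congr rfl fun _ _ => Finset.sum_congr rfl fun _ _ => by ring
    _ = ∑ b, ∑ a, ∑ m, J a c * G m a b * ∑ l, J b l * K l m := by
        rw [Finset.sum_comm]
        refine Finset.sum_congr rfl fun b _ => ?_
        rw [Finset.sum_comm]
        refine Finset.sum_congr rfl fun a _ => ?_
        rw [Finset.sum_comm]
        simp only [Finset.mul_sum]
    _ = _ := by
        simp only [hJK, mul_ite, mul_one, mul_zero, Finset.sum_ite_eq, Finset.mem_univ, if_true]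
        rw [Finset.sum_comm]
        simp only [Finset.mul_sum]

section Density

variable {n : ℕ} {Q : Type*} [TopologicalSpace Q] [ChartedSpace 𝔼(n) Q]
  [IsManifold (𝓡 n) ∞ Q] {e e' : OpenPartialHomeomorph Q 𝔼(n)}
  (he : e ∈ atlas 𝔼(n) Q) (he' : e' ∈ atlas 𝔼(n) Q)
  {nabla : CovariantDerivative (𝓡 n) 𝔼(n)
    (TangentSpace (𝓡 n) : Q → Type _)} (mu : VolumeDensity n Q)

include he he'

theorem chartDensity_change {q : Q} (hq : q ∈ e.source) (hq' : q ∈ e'.source) (c : Fin n) :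
    chartDensity nabla mu e' c q = ∑ a, chartJacobian e e' a c q * chartDensity nabla mu e a q := by
  have hO := e.open_source.inter e'.open_source
  have hO' := e'.open_source.inter e.open_source
  have hJ := fun i j => (contMDiffOn_chartJacobian he' he i j)
  have hK := fun i j => (contMDiffOn_chartJacobian he he' i j)
  have hKJ : ∀ x ∈ e.source ∩ e'.source, ∀ l m, ∑ j, chartJacobian e' e l j x *
      chartJacobian e e' j m x = if l = m then 1 else 0 := fun x hx l m => by
    rw [chartJacobian_mul he e' l m hx.1 e', chartJacobian_self he' l m hx.2]
  have hJK : ∀ l m, ∑ j, chartJacobian e e' l j q * chartJacobian e' e j m q =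
      if l = m then 1 else 0 := fun l m => by
    rw [chartJacobian_mul he' e l m hq' e, chartJacobian_self he l m hq]
  have h1 := trace_christoffel_change (hKJ q ⟨hq, hq'⟩) hJK
    (D := fun l b a => partialX e a (chartJacobian e' e l b) q)
    (fun l a b => (christoffel_change (nabla := nabla) he he' l a b hq hq').trans (by
      rw [partialX_eq_mvfderiv_real he hO Set.inter_subset_left (hK l b) a ⟨hq, hq'⟩])) c
  have h2 : ∑ l, ∑ b, (∑ a, chartJacobian e e' a c q * partialX e a (chartJacobian e' e l b) q) *
      chartJacobian e e' b l q =
        -∑ i, ∑ j, chartJacobian e' e j i q * partialX e' c (chartJacobian e e' i j) q := by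
    rw [eq_neg_iff_add_eq_zero]
    nth_rewrite 2 [Finset.sum_comm]
    rw [← Finset.sum_add_distrib]
    refine Finset.sum_eq_zero fun l _ => ?_
    rw [← Finset.sum_add_distrib]
    have hd := HasDerivAt.fun_sum (u := Finset.univ) fun b _ =>
      (hasDerivAt_partialX he' hO Set.inter_subset_right (hK l b) c ⟨hq, hq'⟩).mul
        (hasDerivAt_partialX he' hO' Set.inter_subset_left (hJ b l) c ⟨hq', hq⟩)
    simp only [zero_smul, add_zero, e'.left_inv hq'] at hd
    have h3 : ∀ b, ∑ a, chartJacobian e e' a c q * partialX e a (chartJacobian e' e l b) q =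
        partialX e' c (chartJacobian e' e l b) q := fun b =>
      (partialX_change_real he he' hO Set.inter_subset_left Set.inter_subset_right (hK l b) c
        ⟨hq, hq'⟩).symm
    simp only [h3]
    refine hd.unique ?_
    refine (hasDerivAt_const (0 : ℝ) (1 : ℝ)).congr_of_eventuallyEq ?_
    have hc : ContinuousAt (fun t : ℝ => e'.symm (e' q + t • EuclideanSpace.single c (1 : ℝ))) 0 := by
      refine ContinuousAt.comp (g := e'.symm) ?_ (by fun_prop)
      simpa using e'.continuousAt_symm (e'.map_source hq')
    have hev := hc.eventually_mem (s := e.source ∩ e'.source)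
      (by simpa [e'.left_inv hq'] using hO.mem_nhds ⟨hq, hq'⟩)
    filter_upwards [hev] with t ht
    simpa using hKJ _ ht l l
  rw [h2] at h1
  simp only [chartDensity]
  rw [h1, partialX_inChart_div he' mu hq', partialX_log_inChart_change he he' mu hq hq' c]
  simp only [partialX_inChart_div he mu hq, mul_sub, Finset.sum_sub_distrib]
  ring

variable (nabla) in
omit he he' in
theorem densityForm_eq (q : Q) : densityForm nabla mu q =
    ∑ i, chartDensity nabla mu (chartAt 𝔼(n) q) i q •
      chartCovector (chartAt 𝔼(n) q) i q := rfl

omit he' in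
theorem densityForm_chartVector {q : Q} (hq : q ∈ e.source) (i : Fin n) :
    densityForm nabla mu q (chartVector e i q) = chartDensity nabla mu e i q := by
  rw [densityForm_eq, sum_apply, chartDensity_change (chart_mem_atlas _ q) he mu
    (mem_chart_source _ q) hq]
  exact Finset.sum_congr rfl fun a _ => by
    rw [_root_.smul_apply, smul_eq_mul, mul_comm]; rfl

variable [T2Space Q] (hs : CovariantDerivative.ContMDiffCovariantDerivative nabla ∞)

include hs

omit he' in
theorem smoothFunOn_chartDensity (i : Fin n) :
    SmoothFunOn (𝓡 n) e.source (fun q => (chartDensity nabla mu e i q : ℂ)) := by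
  have h1 := smoothFunOn_partialX he e.open_source subset_rfl
    (Complex.ofRealCLM.contDiff.contMDiff.comp_contMDiffOn (contMDiffOn_log_inChart he mu)) i
  refine (h1.sub (SmoothFunOn.sum (s := Finset.univ) fun j _ =>
    smoothFunOn_christoffel hs he j i j)).congr fun q hq => ?_
  have h2 := partialX_ofReal_eq he e.open_source subset_rfl (contMDiffOn_log_inChart he mu) i hq
  simp only [chartDensity, partialX_inChart_div he mu hq, Pi.sub_apply, Finset.sum_apply]
  rw [Complex.ofReal_sub, ← h2]
  simp
  rfl

omit he' in
theorem hasOrder_fiberDeriv_densityForm :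
    HasOrder (cotModel n) (cotOver e.source) 1 (fiberDeriv (densityForm nabla mu)) := by
  have h : HasOrder (cotModel n) (cotOver e.source) 1 (fun f => ∑ i, fun ζ =>
      pullbackFun (fun q => (chartDensity nabla mu e i q : ℂ)) ζ * partialP e i f ζ) :=
    HasOrder.sum fun i _ => (hasOrder_partialP he i).mul_left
      ((smoothFunOn_chartDensity he mu hs i).pullbackFun subset_rfl)
  refine h.of_eqOn fun U hU hUe f hf ζ hζ => ?_
  rw [fiberDeriv_eq_sum he hU hUe hf _ hζ, Finset.sum_apply]
  exact Finset.sum_congr rfl fun i _ => by rw [densityForm_chartVector he mu (q := ζ.1) (hUe hζ)]; rfl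

variable (nabla) in
/-- The Laplacian in the chart `e`. -/
def chartLap (e : OpenPartialHomeomorph Q 𝔼(n)) (f : Cotangent n Q → ℂ) :
    Cotangent n Q → ℂ :=
  ∑ k, partialP e k (partialQ e k f) +
    ∑ k, ∑ l, ∑ j, (fun ζ => cotMomentum e l ζ * cotChristoffel nabla e l j k ζ *
      partialP e j (partialP e k f) ζ) +
    ∑ k, ∑ j, (fun ζ => cotChristoffel nabla e j j k ζ * partialP e k f ζ)

omit he' in
theorem hasOrder_chartLap : HasOrder (cotModel n) (cotOver e.source) 2 (chartLap nabla e) := by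
  refine HasOrder.add (HasOrder.add ?_ ?_) ?_
  · exact HasOrder.sum fun k _ => (hasOrder_partialP he k).comp (hasOrder_partialQ he k)
  · exact HasOrder.sum fun k _ => HasOrder.sum fun l _ => HasOrder.sum fun j _ =>
      HasOrder.mul_left ((smoothFunOn_momentum he l).mul (smoothFunOn_cotChristoffel hs he l j k))
        ((hasOrder_partialP he j).comp (hasOrder_partialP he k))
  · exact HasOrder.sum fun k _ => HasOrder.sum fun j _ => HasOrder.mul_left
      (smoothFunOn_cotChristoffel hs he j j k) ((hasOrder_partialP he k).mono one_le_two)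

omit he' in
theorem represents_lap {U : Set (Cotangent n Q)} (hU : IsOpen U) {O : Set Q} (hO : IsOpen O)
    (hOe : O ⊆ e.source) (hUO : U ⊆ cotOver O) {a : Sm (cotModel n) U} {f : Cotangent n Q → ℂ}
    (ha : Represents a f) :
    Represents ((chartPhase he hU hO hOe hUO).lap (chartG hs he hOe) a) (chartLap nabla e f) := by
  have hP := fun {a : Sm (cotModel n) U} {f} (ha : Represents a f) i =>
    represents_dp he hU hO hOe hUO ha i
  have hG := fun l j k => represents_pull he hU hO hOe hUO (represents_chartG hs he hOe l j k)
  refine Represents.add (Represents.add ?_ ?_) ?_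
  · exact Represents.sum fun k _ => hP (represents_dq he hU hO hOe hUO ha k) k
  · exact Represents.sum fun k _ => Represents.sum fun l _ => Represents.sum fun j _ =>
      ((represents_p he hU hO hOe hUO l).mul (hG l j k)).mul (hP (hP ha k) j)
  · exact Represents.sum fun k _ => Represents.sum fun j _ => (hG j j k).mul (hP ha k)

omit he in
theorem laplacian_eqOn {U : Set (Cotangent n Q)} (hU : IsOpen U) (hUe : U ⊆ cotOver e'.source)
    {f : Cotangent n Q → ℂ} (hf : SmoothFunOn (cotModel n) U f) :
    Set.EqOn (laplacian nabla f) (chartLap nabla e' f) U := by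
  intro ζ hζ
  have he := chart_mem_atlas 𝔼(n) ζ.1
  have h0 : laplacian nabla f ζ =
      chartLap nabla (chartAt 𝔼(n) ζ.1) f ζ := by
    simp [laplacian, chartLap, Finset.sum_apply, cotMomentum, cotChristoffel, pullbackFun]
  rw [h0]
  set e := chartAt 𝔼(n) ζ.1
  have hO := e.open_source.inter e'.open_source
  have hU' := hU.inter (isOpen_cotOver (n := n) e.open_source)
  have hUO : U ∩ cotOver e.source ⊆ cotOver (e.source ∩ e'.source) := fun x hx => ⟨hx.2, hUe hx.1⟩
  have hf' := (hf.mono (U' := U ∩ cotOver e.source) Set.inter_subset_left).represents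
  have h1 := represents_lap he hs hU' hO Set.inter_subset_left hUO hf'
  have h2 := represents_lap he' hs hU' hO Set.inter_subset_right hUO hf'
  rw [(chartChange he he' hs hU' hO Set.inter_subset_left Set.inter_subset_right hUO).lap_eq] at h2
  exact h1.eqOn h2 ⟨hζ, mem_chart_source 𝔼(n) ζ.1⟩

omit he he' in
theorem isDiffOpOn_kappa : IsDiffOpOn (cotModel n) Set.univ
    (fun f : Cotangent n Q → ℂ => laplacian nabla f + fiberDeriv (densityForm nabla mu) f) := by
  refine (HasOrder.of_cover (N := 2) fun ζ => ?_).1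
  have he := chart_mem_atlas 𝔼(n) ζ.1
  refine ⟨_, isOpen_cotOver (chartAt 𝔼(n) ζ.1).open_source,
    mem_chart_source 𝔼(n) ζ.1, ?_⟩
  exact ((hasOrder_chartLap he hs).of_eqOn fun U hU hUe f hf => laplacian_eqOn he hs hU hUe hf).add
    ((hasOrder_fiberDeriv_densityForm he mu hs).mono one_le_two)

end Density

end

section

/-- A star product on the algebra `A` with an invertible series of operators, both compatible with
the subalgebra of functions pulled back from `B`. -/
structure KappaAlgebra (A B : Type*) [CommRing A] [Algebra ℂ A] [CommRing B] [Algebra ℂ B] where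
  C : ℕ → A →ₗ[ℂ] A →ₗ[ℂ] A
  S : ℕ → Module.End ℂ A
  R : ℕ → Module.End ℂ A
  pull : B →ₐ[ℂ] A
  inv : IsInvSeries S R
  C_zero : ∀ a b, C 0 a b = a * b
  assoc : ∀ f g h : Formal A, formalBilin (fun r x y => C r x y)
    (formalBilin (fun r x y => C r x y) f g) h =
      formalBilin (fun r x y => C r x y) f (formalBilin (fun r x y => C r x y) g h)
  pull_star : ∀ u (f : Formal A), formalBilin (fun r x y => C r x y) (Formal.const (pull u)) f =
    fun N => pull u * f N
  S_pull : ∀ j u, S (j + 1) (pull u) = 0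

namespace KappaAlgebra

variable {A B : Type*} [CommRing A] [Algebra ℂ A] [CommRing B] [Algebra ℂ B] (K : KappaAlgebra A B)
  {ι : Type*} (s : Finset ι)

/-- The star product. -/
def star : Formal A → Formal A → Formal A := formalBilin (fun r x y => K.C r x y)

/-- The operator series `N`. -/
def op : Formal A → Formal A := formalOp (fun r => ⇑(K.S r))

/-- The inverse of `N`. -/
def opInv : Formal A → Formal A := formalOp (fun r => ⇑(K.R r))

/-- The star product transported by `N`. -/
def starK (f g : Formal A) : Formal A := K.opInv (K.star (K.op f) (K.op g))

theorem op_opInv (f : Formal A) : K.op (K.opInv f) = f := K.inv.formalOp_right f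

theorem opInv_op (f : Formal A) : K.opInv (K.op f) = f := K.inv.formalOp_left f

theorem op_sum (f : ι → Formal A) : K.op (∑ i ∈ s, f i) = ∑ i ∈ s, K.op (f i) :=
  map_sum (AddMonoidHom.mk' K.op fun f g => by
    funext N; simp [op, formalOp, Finset.sum_add_distrib]) f s

theorem star_sum_left (f : ι → Formal A) (g : Formal A) :
    K.star (∑ i ∈ s, f i) g = ∑ i ∈ s, K.star (f i) g :=
  map_sum (AddMonoidHom.mk' (fun f => K.star f g) fun f f' => by
    funext N; simp [star, formalBilin, Finset.sum_add_distrib]) f s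

theorem star_assoc (f g h : Formal A) : K.star (K.star f g) h = K.star f (K.star g h) :=
  K.assoc f g h

theorem starK_assoc (f g h : Formal A) : K.starK (K.starK f g) h = K.starK f (K.starK g h) := by
  simp only [starK, op_opInv, star_assoc]

theorem pull_star_eq (u : B) (f : Formal A) :
    K.star (Formal.const (K.pull u)) f = fun N => K.pull u * f N := K.pull_star u f

theorem one_star (f : Formal A) : K.star (Formal.const 1) f = f := by
  simpa using K.pull_star_eq 1 f

theorem pull_mul_star (u : B) (f g : Formal A) :
    K.star (fun N => K.pull u * f N) g = fun N => K.pull u * K.star f g N := by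
  rw [← pull_star_eq, star_assoc, pull_star_eq]

theorem star_one (f : Formal A) : K.star f (Formal.const 1) = f := by
  have h : ∀ f, K.star f (Formal.const 1) = formalOp (fun r => ⇑((K.C r).flip 1)) f := fun f =>
    formalBilin_const_right (by simp) f 1
  refine formalOp_injective (S := fun r => (K.C r).flip 1)
    (LinearMap.ext fun x => by simp [K.C_zero]) ?_
  rw [← h, ← h, star_assoc, one_star]

theorem star_zero_left (f : Formal A) : K.star 0 f = 0 := by
  funext N; simp [star, formalBilin]

theorem op_pull (u : B) : K.op (Formal.const (K.pull u)) = Formal.const (K.pull u) := by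
  rw [op, formalOp_const (fun r => map_zero _)]
  funext N
  cases N with
  | zero => simp [Formal.const, K.inv.left_zero]
  | succ N => simp [Formal.const, K.S_pull]

theorem opInv_pull (u : B) : K.opInv (Formal.const (K.pull u)) = Formal.const (K.pull u) := by
  rw [← K.op_pull, K.opInv_op, K.op_pull]

theorem starK_pull_pull (u v : B) : K.starK (Formal.const (K.pull u)) (Formal.const (K.pull v)) =
    Formal.const (K.pull (u * v)) := by
  rw [starK, op_pull, op_pull, pull_star_eq, ← K.opInv_pull (u * v)]
  congr 1
  funext N
  cases N <;> simp [Formal.const]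

theorem op_starK_pull (u : B) (f : Formal A) :
    K.op (K.starK (Formal.const (K.pull u)) f) = fun N => K.pull u * K.op f N := by
  rw [starK, op_opInv, op_pull, pull_star_eq]

theorem starK_one (f : Formal A) : K.starK f (Formal.const 1) = f := by
  have h : K.op (Formal.const 1) = Formal.const 1 := by simpa using K.op_pull 1
  rw [starK, h, star_one, opInv_op]

theorem conjCochain_zero (f g : A) :
    conjCochain (fun r => ⇑(K.R r)) (fun r x y => K.C r x y) (fun r => ⇑(K.S r)) 0 f g = f * g := by
  simp [conjCochain, K.inv.left_zero, K.inv.right_zero, K.C_zero]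

theorem conjCochain_one (f g : A) :
    conjCochain (fun r => ⇑(K.R r)) (fun r x y => K.C r x y) (fun r => ⇑(K.S r)) 1 f g -
      conjCochain (fun r => ⇑(K.R r)) (fun r x y => K.C r x y) (fun r => ⇑(K.S r)) 1 g f =
      K.C 1 f g - K.C 1 g f := by
  simp [conjCochain, Finset.Nat.antidiagonal_succ, K.inv.left_zero, K.inv.right_zero, K.C_zero,
    mul_comm g]
  ring

theorem starK_eq (f g : Formal A) : K.starK f g = formalBilin
    (conjCochain (fun r => ⇑(K.R r)) (fun r x y => K.C r x y) (fun r => ⇑(K.S r))) f g :=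
  formalOp_formalBilin_formalOp K.R K.C K.S f g

end KappaAlgebra

/-- The coefficients of `exp(c λ D)`. -/
def expEnd {A : Type*} [AddCommGroup A] [Module ℂ A] (c : ℂ) (D : Module.End ℂ A) (r : ℕ) :
    Module.End ℂ A := (c ^ r / (r.factorial : ℂ)) • D ^ r

theorem isInvSeries_expEnd {A : Type*} [AddCommGroup A] [Module ℂ A] {c c' : ℂ} (hc : c + c' = 0)
    (D : Module.End ℂ A) : IsInvSeries (expEnd c D) (expEnd c' D) where
  left_zero := by simp [expEnd]
  right_zero := by simp [expEnd]
  succ N := by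
    have h := PhaseAlgebra.sum_divided_pow
      (((Commute.refl D).smul_left c).smul_right c') (N + 1)
    rw [← add_smul, hc, zero_smul, zero_pow N.succ_ne_zero, smul_zero] at h
    rw [← h]
    refine Finset.sum_congr rfl fun m _ => ?_
    simp only [expEnd, smul_pow, smul_mul_smul_comm, smul_smul]
    congr 1
    ring

section Kappa

variable {n : ℕ} {Q : Type*} [TopologicalSpace Q] [ChartedSpace 𝔼(n) Q]
  [IsManifold (𝓡 n) ∞ Q] {nabla : CovariantDerivative (𝓡 n) 𝔼(n)
    (TangentSpace (𝓡 n) : Q → Type _)} (mu : VolumeDensity n Q) [T2Space Q]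
  (hs : CovariantDerivative.ContMDiffCovariantDerivative nabla ∞) (κ : ℝ)

include hs

/-- The cochains of `⋆_S`. -/
def starCochain : ℕ → (Cotangent n Q → ℂ) → (Cotangent n Q → ℂ) → Cotangent n Q → ℂ :=
  (isStandardOrdered_starS hs).isStarProduct.cochains.choose

theorem isBidiffOn_starCochain (r : ℕ) :
    IsBidiffOn (cotModel n) Set.univ (starCochain (n := n) (Q := Q) hs r) :=
  .of_isBidifferential ((isStandardOrdered_starS hs).isStarProduct.cochains.choose_spec.1 r)

variable (nabla) in
omit hs in
/-- The operators `c^r / r! (Δ + 𝖥(α))^r`. -/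
def kappaExp (c : ℂ) (r : ℕ) (f : Cotangent n Q → ℂ) : Cotangent n Q → ℂ :=
  (c ^ r / (r.factorial : ℂ)) •
    (fun f => laplacian nabla f + fiberDeriv (densityForm nabla mu) f)^[r] f

theorem isDiffOpOn_kappaExp (c : ℂ) (r : ℕ) :
    IsDiffOpOn (cotModel n) Set.univ (kappaExp (n := n) nabla mu c r) :=
  ((isDiffOpOn_kappa mu hs).iterate r).const_smul _

section Local

variable {U : Set (Cotangent n Q)} (hU : IsOpen U) {a b : Formal (Sm (cotModel n) U)}
  {f g : Formal (Cotangent n Q → ℂ)}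

include hU

theorem represents_toBil_starS (ha : ∀ N, Represents (a N) (f N)) (hb : ∀ N, Represents (b N) (g N))
    (N : ℕ) : Represents (formalBilin (fun r x y =>
      (isBidiffOn_starCochain hs r).toBil hU (Set.subset_univ U) x y) a b N) (starS nabla f g N) :=
  (Represents.formalBilin (fun r a f b g ha hb =>
    ha.toBil (isBidiffOn_starCochain hs r) hU _ hb) ha hb N).congr
    ((isStandardOrdered_starS hs).isStarProduct.cochains.choose_spec.2.1 U hU f g
      (fun N => (ha N).smooth) (fun N => (hb N).smooth) N)

/-- The operator `Δ + 𝖥(α)` on the smooth functions on `U`. -/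
def kappaEnd : Module.End ℂ (Sm (cotModel n) U) :=
  ((isDiffOpOn_kappa mu hs).linOn hU (Set.subset_univ U)).toEnd

theorem represents_expEnd (c : ℂ) (r : ℕ) (a : Sm (cotModel n) U) (f : Cotangent n Q → ℂ)
    (ha : Represents a f) :
    Represents (expEnd c (kappaEnd mu hs hU) r a) (kappaExp nabla mu c r f) := by
  refine Represents.smul _ ?_
  induction r with
  | zero => exact ha
  | succ r ih =>
    rw [pow_succ', Function.iterate_succ_apply']
    exact ih.toEnd ((isDiffOpOn_kappa mu hs).linOn hU (Set.subset_univ U))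

theorem kappaEnd_pull {O : Set Q} (hO : IsOpen O) (hUO : U ⊆ cotOver O) (u : Sm (𝓡 n) O) :
    kappaEnd mu hs hU (Sm.comap contMDiff_cotProj.contMDiffOn hUO u) = 0 := by
  have hu := represents_out u
  have hp := hu.comap contMDiff_cotProj.contMDiffOn hUO
  refine (hp.toEnd ((isDiffOpOn_kappa mu hs).linOn hU (Set.subset_univ U))).ext Represents.zero
    fun ζ hζ => ?_
  have he := chart_mem_atlas 𝔼(n) ζ.1
  set e := chartAt 𝔼(n) ζ.1
  have hO' := hO.inter e.open_source
  have hU' := hU.inter (isOpen_cotOver (n := n) e.open_source)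
  have hUO' : U ∩ cotOver e.source ⊆ cotOver (O ∩ e.source) := fun x hx => ⟨hUO hx.1, hx.2⟩
  have hζ' : ζ ∈ U ∩ cotOver e.source := ⟨hζ, mem_chart_source 𝔼(n) ζ.1⟩
  have hp' := represents_pull he hU' hO' Set.inter_subset_right hUO'
    (hu.smooth.mono Set.inter_subset_left).represents
  have h1 := represents_lap he hs hU' hO' Set.inter_subset_right hUO' hp'
  have h2 : fiberDeriv (densityForm nabla mu) (pullbackFun (Sm.out u)) ζ = 0 :=
    deriv_const (0 : ℝ) (Sm.out u ζ.1)
  have h3 : laplacian nabla (pullbackFun (Sm.out u)) ζ = 0 := by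
    rw [laplacian_eqOn he hs hU' Set.inter_subset_right hp'.smooth hζ']
    refine Represents.eqOn (a := (0 : Sm (cotModel n) (U ∩ cotOver e.source))) ?_ Represents.zero hζ'
    simpa [PhaseAlgebra.lap, PhaseAlgebra.dq_pull, PhaseAlgebra.dp_pull] using h1
  exact (congrArg₂ (· + ·) h3 h2).trans (add_zero 0)

/-- The functions on `U` with `⋆_S` and `N_κ`. -/
def kappaAlgebra {O : Set Q} (hO : IsOpen O) (hUO : U ⊆ cotOver O) :
    KappaAlgebra (Sm (cotModel n) U) (Sm (𝓡 n) O) where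
  C r := (isBidiffOn_starCochain hs r).toBil hU (Set.subset_univ U)
  S := expEnd (-Complex.I * κ) (kappaEnd mu hs hU)
  R := expEnd (Complex.I * κ) (kappaEnd mu hs hU)
  pull := Sm.comap contMDiff_cotProj.contMDiffOn hUO
  inv := isInvSeries_expEnd (by ring) _
  C_zero a b := by
    have ha := represents_out a
    have hb := represents_out b
    exact (ha.toBil (isBidiffOn_starCochain hs 0) hU _ hb).ext (ha.mul hb) fun ζ hζ =>
      (isStandardOrdered_starS hs).isStarProduct.cochains.choose_spec.2.2.1 U hU _ _ ha.smooth
        hb.smooth ζ hζ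
  assoc f g h := by
    have hr := fun (f : Formal (Sm (cotModel n) U)) N => represents_out (f N)
    have hB := fun {a b : Formal (Sm (cotModel n) U)} {f g : Formal (Cotangent n Q → ℂ)} =>
      represents_toBil_starS hs hU (a := a) (b := b) (f := f) (g := g)
    funext N
    exact (hB (hB (hr f) (hr g)) (hr h) N).ext (hB (hr f) (hB (hr g) (hr h)) N) fun ζ hζ =>
      (isStandardOrdered_starS hs).isStarProduct.assoc U hU _ _ _ (fun N => (hr f N).smooth)
        (fun N => (hr g N).smooth) (fun N => (hr h N).smooth) N ζ hζ
  pull_star u f := by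
    have hr := fun N => represents_out (f N)
    have hp := (represents_out u).comap contMDiff_cotProj.contMDiffOn hUO
    funext N
    exact (represents_toBil_starS hs hU hp.const hr N).ext (hp.mul (hr N)) fun ζ hζ =>
      (isStandardOrdered_starS hs).pull_star O hO U hU hUO _ _ (represents_out u).smooth
        (fun N => (hr N).smooth) N ζ hζ
  S_pull j u := by simp [expEnd, pow_succ, kappaEnd_pull mu hs hU hO hUO]

variable {O : Set Q} (hO : IsOpen O) (hUO : U ⊆ cotOver O)

theorem represents_star (ha : ∀ N, Represents (a N) (f N)) (hb : ∀ N, Represents (b N) (g N))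
    (N : ℕ) : Represents ((kappaAlgebra mu hs κ hU hO hUO).star a b N) (starS nabla f g N) :=
  represents_toBil_starS hs hU ha hb N

theorem represents_op (ha : ∀ N, Represents (a N) (f N)) (N : ℕ) :
    Represents ((kappaAlgebra mu hs κ hU hO hUO).op a N) (opN nabla mu κ f N) :=
  Represents.formalOp (represents_expEnd mu hs hU _) ha N

theorem represents_opInv (ha : ∀ N, Represents (a N) (f N)) (N : ℕ) :
    Represents ((kappaAlgebra mu hs κ hU hO hUO).opInv a N) (opNInv nabla mu κ f N) :=
  Represents.formalOp (represents_expEnd mu hs hU _) ha N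

theorem represents_starK (ha : ∀ N, Represents (a N) (f N)) (hb : ∀ N, Represents (b N) (g N))
    (N : ℕ) : Represents ((kappaAlgebra mu hs κ hU hO hUO).starK a b N)
      (starK nabla mu κ f g N) :=
  represents_opInv mu hs κ hU hO hUO (represents_star mu hs κ hU hO hUO
    (represents_op mu hs κ hU hO hUO ha) (represents_op mu hs κ hU hO hUO hb)) N

end Local

theorem represents_conjCochain_starK {U : Set (Cotangent n Q)} (hU : IsOpen U)
    {O : Set Q} (hO : IsOpen O) (hUO : U ⊆ cotOver O) (N : ℕ) {a b : Sm (cotModel n) U}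
    {f g : Cotangent n Q → ℂ} (ha : Represents a f) (hb : Represents b g) :
    Represents (conjCochain (fun r => ⇑((kappaAlgebra mu hs κ hU hO hUO).R r))
        (fun r x y => (kappaAlgebra mu hs κ hU hO hUO).C r x y)
        (fun r => ⇑((kappaAlgebra mu hs κ hU hO hUO).S r)) N a b)
      (conjCochain (kappaExp nabla mu (Complex.I * κ)) (starCochain hs)
        (kappaExp nabla mu (-Complex.I * κ)) N f g) :=
  Represents.conjCochain (represents_expEnd mu hs hU _)
    (fun r _ _ _ _ ha hb => ha.toBil (isBidiffOn_starCochain hs r) hU (Set.subset_univ U) hb)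
    (represents_expEnd mu hs hU _) N ha hb

theorem isStarProduct_starK : IsStarProduct (cotModel n) cotPoisson (starK (n := n) nabla mu κ) where
  cochains := by
    refine ⟨conjCochain (kappaExp nabla mu (Complex.I * κ)) (starCochain hs)
      (kappaExp nabla mu (-Complex.I * κ)), fun r => (IsBidiffOn.conjCochain
        (isDiffOpOn_kappaExp mu hs _) (isBidiffOn_starCochain hs)
        (isDiffOpOn_kappaExp mu hs _) r).isBidifferential, fun U hU f g hf hg N ζ hζ => ?_,
        fun U hU f g hf hg ζ hζ => ?_, fun U hU f g hf hg ζ hζ => ?_⟩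
    · have h1 := represents_starK mu hs κ hU isOpen_univ (Set.subset_univ _)
        (fun N => (hf N).represents) (fun N => (hg N).represents) N
      rw [KappaAlgebra.starK_eq] at h1
      exact h1.eqOn (Represents.formalBilin (fun r a f b g ha hb => represents_conjCochain_starK
        mu hs κ hU isOpen_univ (Set.subset_univ _) r ha hb) (fun N => (hf N).represents)
        (fun N => (hg N).represents) N) hζ
    · have h1 := represents_conjCochain_starK mu hs κ hU isOpen_univ (Set.subset_univ _) 0
        hf.represents hg.represents
      rw [KappaAlgebra.conjCochain_zero] at h1
      exact h1.eqOn (hf.represents.mul hg.represents) hζ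
    · have hr := fun {f g : Cotangent n Q → ℂ} (hf : SmoothFunOn (cotModel n) U f)
        (hg : SmoothFunOn (cotModel n) U g) => represents_conjCochain_starK mu hs κ hU isOpen_univ
          (Set.subset_univ _) 1 hf.represents hg.represents
      have hC := fun {f g : Cotangent n Q → ℂ} (hf : SmoothFunOn (cotModel n) U f)
        (hg : SmoothFunOn (cotModel n) U g) => hf.represents.toBil (isBidiffOn_starCochain hs 1) hU
          (Set.subset_univ _) hg.represents
      have h1 := (hr hf hg).sub (hr hg hf)
      rw [KappaAlgebra.conjCochain_one] at h1
      exact (h1.eqOn ((hC hf hg).sub (hC hg hf)) hζ).trans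
        ((isStandardOrdered_starS hs).isStarProduct.cochains.choose_spec.2.2.2 U hU f g hf hg ζ hζ)
  assoc U hU f g h hf hg hh N ζ hζ := by
    have hB := fun {a b : Formal (Sm (cotModel n) U)} {f g : Formal (Cotangent n Q → ℂ)} =>
      represents_starK mu hs κ hU isOpen_univ (Set.subset_univ _) (a := a) (b := b) (f := f) (g := g)
    have hr := fun {f : Formal (Cotangent n Q → ℂ)} (hf : FormalSmoothFunOn (cotModel n) U f) N =>
      (hf N).represents
    have h1 := hB (hB (hr hf) (hr hg)) (hr hh) N
    rw [KappaAlgebra.starK_assoc] at h1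
    exact h1.eqOn (hB (hr hf) (hB (hr hg) (hr hh)) N) hζ

end Kappa

end

section

/-! ### Coordinates in a basis -/

section Basis

variable {k : ℕ} {X : Type*} [AddCommMonoid X] [Module ℂ X] {b b' : Fin k → X}

theorem basisCoord_eq_repr {B : Module.Basis (Fin k) ℂ X} (hB : ⇑B = b) (v : X) (i : Fin k) :
    basisCoord b v i = B.repr v i := by
  have h : ∃ B : Module.Basis (Fin k) ℂ X, ⇑B = b := ⟨B, hB⟩
  have h' : h.choose = B := Module.Basis.eq_of_apply_eq fun i => by rw [h.choose_spec, hB]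
  rw [basisCoord, dif_pos h, h']

theorem basisCoord_smul (c : ℂ) (v : X) (i : Fin k) :
    basisCoord b (c • v) i = c * basisCoord b v i := by
  unfold basisCoord
  split <;> simp

theorem basisCoord_add (v w : X) (i : Fin k) :
    basisCoord b (v + w) i = basisCoord b v i + basisCoord b w i := by
  unfold basisCoord
  split <;> simp

theorem basisCoord_zero (i : Fin k) : basisCoord b (0 : X) i = 0 := by
  simpa using basisCoord_smul (b := b) 0 (0 : X) i

variable (h : ∃ B : Module.Basis (Fin k) ℂ X, ⇑B = b)

include h

theorem sum_basisCoord (v : X) : ∑ i, basisCoord b v i • b i = v := by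
  obtain ⟨B, rfl⟩ := h
  simp [basisCoord_eq_repr rfl, B.sum_repr]

theorem basisCoord_sum (c : Fin k → ℂ) (j : Fin k) : basisCoord b (∑ i, c i • b i) j = c j := by
  obtain ⟨B, rfl⟩ := h
  rw [basisCoord_eq_repr rfl, B.repr_sum_self]

theorem basisCoord_self (i j : Fin k) : basisCoord b (b i) j = if j = i then 1 else 0 := by
  obtain ⟨B, rfl⟩ := h
  simp [basisCoord_eq_repr rfl, Finsupp.single_apply, eq_comm]

theorem basisCoord_change (h' : ∃ B : Module.Basis (Fin k) ℂ X, ⇑B = b') (v : X) (i : Fin k) :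
    basisCoord b v i = ∑ j, basisCoord b (b' j) i * basisCoord b' v j := by
  conv_lhs => rw [← sum_basisCoord h' v]
  obtain ⟨B, rfl⟩ := h
  simp [basisCoord_eq_repr (b := ⇑B) rfl, mul_comm, Finsupp.finsetSum_apply]

end Basis

/-! ### Smooth frames -/

section Frames

variable {E : Type*} [NormedAddCommGroup E] [NormedSpace ℝ E]
  {H : Type*} [TopologicalSpace H] {J : ModelWithCorners ℝ E H}
  {M : Type*} [TopologicalSpace M] [ChartedSpace H M] {U U' : Set M}

theorem SmoothFunOn.inv {f : M → ℂ} (hf : SmoothFunOn J U f) (h : ∀ x ∈ U, f x ≠ 0) :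
    SmoothFunOn J U (fun x => (f x)⁻¹) := fun x hx =>
  ((contDiffAt_inv ℝ (h x hx)).contMDiffAt).comp_contMDiffWithinAt x (hf x hx)

theorem SmoothFunOn.det {k : ℕ} {A : M → Matrix (Fin k) (Fin k) ℂ}
    (h : ∀ i j, SmoothFunOn J U (fun x => A x i j)) : SmoothFunOn J U (fun x => (A x).det) := by
  have hp : ∀ (σ : Equiv.Perm (Fin k)) (s : Finset (Fin k)),
      SmoothFunOn J U (fun x => ∏ i ∈ s, A x (σ i) i) := by
    intro σ s
    induction s using Finset.induction_on with
    | empty => simpa using SmoothFunOn.const 1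
    | insert i s hi ih => simpa [Finset.prod_insert hi] using (h (σ i) i).mul ih
  have := SmoothFunOn.sum (s := Finset.univ) fun σ _ =>
    (hp σ Finset.univ).smul ((Equiv.Perm.sign σ : ℤ) : ℂ)
  refine this.congr fun x _ => ?_
  simp [Matrix.det_apply']

variable {F : Type*} [NormedAddCommGroup F] [NormedSpace ℂ F]
  {W : M → Type*} [∀ x, TopologicalSpace (W x)] [TopologicalSpace (TotalSpace F W)]
  [FiberBundle F W] {s s' : ∀ x, W x}

theorem SmoothSecOn.mono (h : SmoothSecOn J F U s) (hU : U' ⊆ U) : SmoothSecOn J F U' s :=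
  fun e _ => (h e).mono (Set.inter_subset_inter_left _ hU)

theorem SmoothSecOn.congr (h : SmoothSecOn J F U s) (hs : ∀ x ∈ U, s' x = s x) :
    SmoothSecOn J F U s' := fun e _ => (h e).congr fun x hx => by rw [hs x hx.1]

theorem SmoothSecOn.of_local (h : ∀ x ∈ U, ∃ U', IsOpen U' ∧ x ∈ U' ∧ SmoothSecOn J F (U ∩ U') s) :
    SmoothSecOn J F U s := fun e _ => contMDiffOn_of_locally_contMDiffOn fun x hx => by
  obtain ⟨U', h1, h2, h3⟩ := h x hx.1
  refine ⟨U', h1, h2, (h3 e).mono fun y hy => ⟨⟨hy.1.1, hy.2⟩, hy.1.2⟩⟩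

variable [∀ x, AddCommMonoid (W x)] [∀ x, Module ℂ (W x)] [VectorBundle ℂ F W] {k : ℕ}
  {e : Fin k → ∀ x, W x}

theorem SmoothSecOn.sum_smul {t : Fin k → M → ℂ} (ht : ∀ i, SmoothFunOn J U (t i))
    (he : ∀ i, SmoothSecOn J F U (e i)) : SmoothSecOn J F U (fun x => ∑ i, t i x • e i x) := by
  intro t' _
  have h1 : ∀ i, ContMDiffOn J 𝓘(ℝ, F) ∞ (fun x => t i x • (t' ⟨x, e i x⟩).2) (U ∩ t'.baseSet) :=
    fun i => (ContinuousLinearMap.lsmul ℝ ℂ (E := F)).isBoundedBilinearMap.contDiff.contMDiff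
      |>.comp_contMDiffOn (ContMDiffOn.prodMk_space ((ht i).mono Set.inter_subset_left) (he i t'))
  refine (contMDiffOn_finsetSum (t := Finset.univ) fun i _ => h1 i).congr fun x hx => ?_
  have hl : ∀ v, (t' ⟨x, v⟩).2 = t'.linearEquivAt ℂ x hx.2 v := fun v => rfl
  simp only [hl, map_sum, map_smul]

theorem SmoothSecOn.basisCoord [FiniteDimensional ℂ F] (he : ∀ i, SmoothSecOn J F U (e i))
    (hb : ∀ x ∈ U, ∃ B : Module.Basis (Fin k) ℂ (W x), ⇑B = fun i => e i x)
    (hs : SmoothSecOn J F U s) (i : Fin k) :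
    SmoothFunOn J U (fun x => basisCoord (fun j => e j x) (s x) i) := by
  refine SmoothFunOn.of_local fun x₀ hx₀ => ?_
  set t := trivializationAt F W x₀
  refine ⟨t.baseSet, t.open_baseSet, mem_baseSet_trivializationAt F W x₀, ?_⟩
  obtain ⟨B₀, hB₀⟩ := hb x₀ hx₀
  let b₀ := B₀.map (t.linearEquivAt ℂ x₀ (mem_baseSet_trivializationAt F W x₀))
  have hsm : ∀ {s : ∀ x, W x} (hs : SmoothSecOn J F U s) (j : Fin k),
      SmoothFunOn J (U ∩ t.baseSet) (fun x => b₀.repr (t ⟨x, s x⟩).2 j) := fun hs j =>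
    ((b₀.coord j).toContinuousLinearMap.restrictScalars ℝ).contDiff.contMDiff.comp_contMDiffOn (hs t)
  let A : M → Matrix (Fin k) (Fin k) ℂ := fun x i j => b₀.repr (t ⟨x, e j x⟩).2 i
  let w : M → Fin k → ℂ := fun x i => b₀.repr (t ⟨x, s x⟩).2 i
  have hA : ∀ i j, SmoothFunOn J (U ∩ t.baseSet) (fun x => A x i j) := fun i j => hsm (he j) i
  have hA' : ∀ l j, SmoothFunOn J (U ∩ t.baseSet) (fun x => (A x).updateCol i (w x) l j) := by
    intro l j
    by_cases hj : j = i
    · subst hj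
      simpa using hsm hs l
    · simpa [Matrix.updateCol_ne hj] using hA l j
  have hl : ∀ x (hx : x ∈ t.baseSet) v, (t ⟨x, v⟩).2 = t.linearEquivAt ℂ x hx v := fun _ _ _ => rfl
  have hdet : ∀ x ∈ U ∩ t.baseSet, (A x).det ≠ 0 := by
    intro x hx
    obtain ⟨B, hB⟩ := hb x hx.1
    have h1 : A x = b₀.toMatrix (B.map (t.linearEquivAt ℂ x hx.2)) := by
      ext l j
      simp only [A, Module.Basis.toMatrix_apply, Module.Basis.map_apply, hB, hl x hx.2]
    have h2 := congrArg Matrix.det (b₀.toMatrix_mul_toMatrix_flip (B.map (t.linearEquivAt ℂ x hx.2)))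
    rw [← h1, Matrix.det_mul, Matrix.det_one] at h2
    exact left_ne_zero_of_mul_eq_one h2
  refine (((SmoothFunOn.det hA).inv hdet).mul (SmoothFunOn.det hA')).congr fun x hx => ?_
  have h3 : w x = (A x).mulVec fun j => _root_.basisCoord (fun j => e j x) (s x) j := by
    funext l
    simp only [w, Matrix.mulVec, dotProduct, A]
    conv_lhs => rw [← sum_basisCoord (hb x hx.1) (s x)]
    rw [hl x hx.2, map_sum, map_sum, Finsupp.finsetSum_apply]
    refine Finset.sum_congr rfl fun j _ => ?_
    rw [map_smul, map_smul, Finsupp.smul_apply, smul_eq_mul, mul_comm, hl x hx.2]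
  change _ = (A x).det⁻¹ * ((A x).updateCol i (w x)).det
  rw [← Matrix.cramer_apply, h3, Matrix.cramer_eq_adjugate_mulVec, Matrix.mulVec_mulVec,
    Matrix.adjugate_mul, Matrix.smul_mulVec, Matrix.one_mulVec, Pi.smul_apply, smul_eq_mul,
    inv_mul_cancel_left₀ (hdet x hx)]

/-! ### Differential operators in frames -/

omit [∀ x, TopologicalSpace (W x)] [TopologicalSpace (TotalSpace F W)] [FiberBundle F W]
  [VectorBundle ℂ F W] [NormedAddCommGroup F] [NormedSpace ℂ F] in
theorem OrderLE.sum_smul_frame {X : M → Type*} [∀ x, AddCommMonoid (X x)] [∀ x, Module ℂ (X x)]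
    {A : Set (M → ℂ)} {S : Set (∀ x, X x)} {N : ℕ} {P : Fin k → (∀ x, X x) → M → ℂ}
    (h : ∀ i, OrderLE (Y := fun _ => ℂ) U A S N (P i)) (e : Fin k → ∀ x, W x) :
    OrderLE U A S N (fun s x => ∑ i, P i s x • e i x) := by
  induction N generalizing P with
  | zero =>
    intro a ha s hs x hx
    rw [Finset.smul_sum]
    exact Finset.sum_congr rfl fun i _ => by rw [h i a ha s hs x hx, smul_assoc]
  | succ N ih =>
    intro a ha
    convert ih fun i => h i a ha using 1
    funext s x
    simp [Finset.smul_sum, add_smul, smul_smul, Finset.sum_add_distrib]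

omit [∀ x, TopologicalSpace (W x)] [TopologicalSpace (TotalSpace F W)] [FiberBundle F W]
  [VectorBundle ℂ F W] [NormedAddCommGroup F] [NormedSpace ℂ F] in
theorem OrderLE.comp_basisCoord {A : Set (M → ℂ)} {S : Set (∀ x, W x)} {S' : Set (M → ℂ)} {N : ℕ}
    {P : (M → ℂ) → M → ℂ} (h : OrderLE (X := fun _ => ℂ) (Y := fun _ => ℂ) U A S' N P)
    (i : Fin k) (hS : ∀ s ∈ S, (fun x => basisCoord (fun j => e j x) (s x) i) ∈ S') :
    OrderLE (Y := fun _ => ℂ) U A S N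
      (fun s => P fun x => basisCoord (fun j => e j x) (s x) i) := by
  induction N generalizing P with
  | zero =>
    intro a ha s hs x hx
    simp only [basisCoord_smul]
    exact h a ha _ (hS s hs) x hx
  | succ N ih =>
    intro a ha
    convert ih (h a ha) using 1
    funext s x
    simp only [basisCoord_smul, smul_eq_mul]

end Frames

theorem SmoothSecOn.pullFrame {n : ℕ} {Q : Type*} [TopologicalSpace Q]
    [ChartedSpace 𝔼(n) Q] [IsManifold (𝓡 n) ∞ Q]
    {F : Type*} [NormedAddCommGroup F] [NormedSpace ℂ F] {V : Q → Type*}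
    [∀ q, TopologicalSpace (V q)] [∀ q, Zero (V q)] [TopologicalSpace (TotalSpace F V)]
    [FiberBundle F V] {O : Set Q} {k : ℕ} {ε : Fin k → ∀ q, V q}
    (h : ∀ i, SmoothSecOn (𝓡 n) F O (ε i)) (i : Fin k) :
    SmoothSecOn (cotModel n) F (cotOver O) (_root_.pullFrame (n := n) ε i) := by
  rintro _ ⟨e, he, rfl⟩
  exact (h i e).comp contMDiff_cotProj.contMDiffOn fun ζ hζ => hζ

end

section

namespace KappaAlgebra

variable {A B : Type*} [CommRing A] [Algebra ℂ A] [CommRing B] [Algebra ℂ B] (K : KappaAlgebra A B)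

theorem op_starK (f g : Formal A) : K.op (K.starK f g) = K.star (K.op f) (K.op g) := K.op_opInv _

theorem sum_const_pull {ι : Type*} (s : Finset ι) (u : ι → B) :
    ∑ i ∈ s, Formal.const (K.pull (u i)) = Formal.const (K.pull (∑ i ∈ s, u i)) := by
  funext N
  cases N <;> simp [Formal.const, Finset.sum_apply]

theorem starK_const_ite (f : Formal A) (p : Prop) [Decidable p] :
    K.starK f (Formal.const (if p then 1 else 0)) = if p then f else 0 := by
  split
  · exact K.starK_one f
  · have h : (Formal.const 0 : Formal A) = 0 := by funext N; simp [Formal.const]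
    rw [h]
    funext N
    simp [starK, op, opInv, star, formalOp, formalBilin]

end KappaAlgebra

section Bundle

variable {n : ℕ} {Q : Type*} [TopologicalSpace Q] [ChartedSpace 𝔼(n) Q]
  {F : Type*} [NormedAddCommGroup F] [NormedSpace ℂ F]
  {V : Q → Type*} [∀ q, AddCommGroup (V q)] [∀ q, Module ℂ (V q)]
  [∀ q, TopologicalSpace (V q)] [TopologicalSpace (TotalSpace F V)] [FiberBundle F V] {k : ℕ}

variable (n F) in
/-- `ε` is a smooth frame of `V` over the open set `O`. -/
structure IsFrameOn (O : Set Q) (ε : Fin k → ∀ q, V q) : Prop where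
  isOpen : IsOpen O
  smooth : ∀ i, SmoothSecOn (𝓡 n) F O (ε i)
  basis : ∀ q ∈ O, ∃ B : Module.Basis (Fin k) ℂ (V q), ⇑B = fun i => ε i q

variable [IsManifold (𝓡 n) ∞ Q] [VectorBundle ℂ F V] {O O' : Set Q} {ε ε' : Fin k → ∀ q, V q}

section Sections

variable {M : Type*} {W : M → Type*} [∀ x, AddCommMonoid (W x)] [∀ x, Module ℂ (W x)]

theorem frameCoord_const (e : Fin k → ∀ x, W x) (s : ∀ x, W x) (i : Fin k) :
    frameCoord e (Formal.const s) i =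
      Formal.const fun x => basisCoord (fun j => e j x) (s x) i := by
  funext N x
  simp only [frameCoord, Formal.const]
  split
  · rfl
  · exact basisCoord_zero i

end Sections

variable [FiniteDimensional ℂ F] (hF : IsFrameOn n F O ε) (hF' : IsFrameOn n F O' ε')

include hF

theorem IsFrameOn.smooth_basisCoord {U : Set (Cotangent n Q)} (hUO : U ⊆ cotOver O)
    {s : ∀ ζ, ((cotProj n Q : Cotangent n Q → Q) *ᵖ V) ζ} (hs : SmoothSecOn (cotModel n) F U s)
    (i : Fin k) : SmoothFunOn (cotModel n) U
      (fun ζ => basisCoord (fun j => pullFrame ε j ζ) (s ζ) i) :=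
  hs.basisCoord (fun i => (SmoothSecOn.pullFrame hF.smooth i).mono hUO)
    (fun ζ hζ => hF.basis ζ.1 (hUO hζ)) i

/-- The coordinates of a section. -/
def IsFrameOn.coord {U : Set (Cotangent n Q)} (hUO : U ⊆ cotOver O)
    {s : Formal (∀ ζ, ((cotProj n Q : Cotangent n Q → Q) *ᵖ V) ζ)}
    (hs : FormalSmoothPullSecOn F U s) (i : Fin k) : Formal (Sm (cotModel n) U) :=
  fun N => (hF.smooth_basisCoord hUO (hs N) i).toSm

theorem IsFrameOn.represents_coord {U : Set (Cotangent n Q)} (hUO : U ⊆ cotOver O)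
    {s : Formal (∀ ζ, ((cotProj n Q : Cotangent n Q → Q) *ᵖ V) ζ)}
    (hs : FormalSmoothPullSecOn F U s) (i : Fin k) (N : ℕ) :
    Represents (hF.coord hUO hs i N) (frameCoord (pullFrame ε) s i N) :=
  SmoothFunOn.represents _

include hF'

theorem IsFrameOn.smooth_transition (i j : Fin k) :
    SmoothFunOn (𝓡 n) (O ∩ O') (transitionMatrix ε ε' i j) :=
  ((hF'.smooth j).mono Set.inter_subset_right).basisCoord
    (fun i => (hF.smooth i).mono Set.inter_subset_left) (fun q hq => hF.basis q hq.1) i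

omit [FiniteDimensional ℂ F] [IsManifold (𝓡 n) ∞ Q] in
theorem IsFrameOn.frame_change {q : Q} (hq : q ∈ O ∩ O') (c c' : Fin k → ℂ) :
    ∑ i, c i • ε i q = ∑ i, c' i • ε' i q ↔ ∀ i, c i = ∑ j, transitionMatrix ε ε' i j q * c' j := by
  obtain ⟨hb, hb'⟩ := And.intro (hF.basis q hq.1) (hF'.basis q hq.2)
  have key : ∀ i, basisCoord (fun i => ε i q) (∑ j, c' j • ε' j q) i =
      ∑ j, transitionMatrix ε ε' i j q * c' j := fun i => by
    rw [basisCoord_change hb hb']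
    exact Finset.sum_congr rfl fun j _ => by
      rw [basisCoord_sum (b := fun i => ε' i q) hb']; rfl
  refine ⟨fun h i => ?_, fun h => ?_⟩
  · rw [← key, ← h, basisCoord_sum (b := fun i => ε i q) hb]
  · rw [← sum_basisCoord hb (∑ i, c' i • ε' i q)]
    exact Finset.sum_congr rfl fun i _ => by rw [key, h i]

variable {nabla : CovariantDerivative (𝓡 n) 𝔼(n)
    (TangentSpace (𝓡 n) : Q → Type _)} (mu : VolumeDensity n Q) [T2Space Q]
  (hs : CovariantDerivative.ContMDiffCovariantDerivative nabla ∞) (κ : ℝ)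

variable (nabla) in
omit hF hF' in
/-- The local formula `e (s_e ⋆_S N_κ f)`. -/
def locBullet (ε : Fin k → ∀ q, V q) (s : Formal (∀ ζ, ((cotProj n Q : Cotangent n Q → Q) *ᵖ V) ζ))
    (f : Formal (Cotangent n Q → ℂ)) : Formal (∀ ζ, ((cotProj n Q : Cotangent n Q → Q) *ᵖ V) ζ) :=
  frameComb (pullFrame ε) (fun i => starS nabla (frameCoord (pullFrame ε) s i) (opN nabla mu κ f))

include hs

theorem locBullet_change {U : Set (Cotangent n Q)} (hU : IsOpen U)
    {s : Formal (∀ ζ, ((cotProj n Q : Cotangent n Q → Q) *ᵖ V) ζ)}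
    {f : Formal (Cotangent n Q → ℂ)} (hS : FormalSmoothPullSecOn F U s)
    (hf : FormalSmoothFunOn (cotModel n) U f) :
    FormalEqOn (U ∩ cotOver (O ∩ O')) (locBullet nabla mu κ ε s f) (locBullet nabla mu κ ε' s f) := by
  intro N ζ hζ
  have hO := hF.isOpen.inter hF'.isOpen
  have hU' := hU.inter (isOpen_cotOver (n := n) hO)
  have hUO : U ∩ cotOver (O ∩ O') ⊆ cotOver (O ∩ O') := Set.inter_subset_right
  set K := kappaAlgebra mu hs κ hU' hO hUO
  have hS' : FormalSmoothPullSecOn F (U ∩ cotOver (O ∩ O')) s := fun N =>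
    (hS N).mono Set.inter_subset_left
  have hg := represents_op mu hs κ hU' hO hUO fun N =>
    ((hf N).mono (U' := U ∩ cotOver (O ∩ O')) Set.inter_subset_left).represents
  have hc := hF'.represents_coord (hUO.trans fun _ h => h.2) hS'
  have hφ := fun i j => (hF.smooth_transition hF' i j).represents.comap
    contMDiff_cotProj.contMDiffOn hUO
  have h1 : ∀ i N, Represents ((∑ j, fun N => K.pull (hF.smooth_transition hF' i j).toSm *
      hF'.coord (hUO.trans fun _ h => h.2) hS' j N : Formal _) N)
      (frameCoord (pullFrame ε) s i N) := by
    intro i N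
    rw [Finset.sum_apply]
    refine (Represents.sum fun j _ => (hφ i j).mul (hc j N)).congr fun ζ hζ => ?_
    rw [Finset.sum_apply]
    exact basisCoord_change (hF.basis ζ.1 hζ.2.1) (hF'.basis ζ.1 hζ.2.2) _ _
  refine (hF.frame_change hF' hζ.2 _ _).2 fun i => ?_
  have h2 := represents_star mu hs κ hU' hO hUO (h1 i) hg N
  rw [KappaAlgebra.star_sum_left, Finset.sum_apply] at h2
  have h3 : ∀ j g, K.star (fun N => K.pull (hF.smooth_transition hF' i j).toSm *
      hF'.coord (hUO.trans fun _ h => h.2) hS' j N) g N = K.pull (hF.smooth_transition hF' i j).toSm *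
      K.star (hF'.coord (hUO.trans fun _ h => h.2) hS' j) g N := fun j g =>
    congrFun (K.pull_mul_star _ _ g) N
  rw [Finset.sum_congr rfl fun j _ => h3 j _] at h2
  refine (h2.eqOn (Represents.sum fun j _ => (hφ i j).mul
    (represents_star mu hs κ hU' hO hUO (hc j) hg N)) hζ).trans (Finset.sum_apply ..)

/-! ### The cochains of the bundle deformation -/

omit hF hF' in
/-- The cochains of `(a, f) ↦ a ⋆_S N_κ f`. -/
def bulletCochain (r : ℕ) (a f : Cotangent n Q → ℂ) : Cotangent n Q → ℂ :=
  ∑ m ∈ Finset.HasAntidiagonal.antidiagonal r,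
    starCochain hs m.1 a (kappaExp nabla mu (-Complex.I * κ) m.2 f)

omit hF hF' in
theorem isBidiffOn_bulletCochain (r : ℕ) :
    IsBidiffOn (cotModel n) Set.univ (bulletCochain (n := n) mu hs κ r) :=
  IsBidiffOn.sum fun m _ => (isBidiffOn_starCochain hs m.1).comp_right
    (isDiffOpOn_kappaExp mu hs _ m.2)

section

variable {U : Set (Cotangent n Q)} (hU : IsOpen U) (hO : IsOpen O) (hUO : U ⊆ cotOver O)

include hU hO hUO

omit hF hF' in
theorem represents_bulletCochain (r : ℕ) (a : Sm (cotModel n) U) (f : Cotangent n Q → ℂ)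
    (b : Sm (cotModel n) U) (g : Cotangent n Q → ℂ) (ha : Represents a f) (hb : Represents b g) :
    Represents (∑ m ∈ Finset.HasAntidiagonal.antidiagonal r, (kappaAlgebra mu hs κ hU hO hUO).C m.1 a
      ((kappaAlgebra mu hs κ hU hO hUO).S m.2 b)) (bulletCochain mu hs κ r f g) :=
  Represents.sum fun m _ => ha.toBil (isBidiffOn_starCochain hs m.1) hU (Set.subset_univ U)
    (represents_expEnd mu hs hU _ m.2 b g hb)

omit hF hF' in
theorem starS_opN_eqOn {a f : Formal (Cotangent n Q → ℂ)} (ha : FormalSmoothFunOn (cotModel n) U a)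
    (hf : FormalSmoothFunOn (cotModel n) U f) (N : ℕ) : Set.EqOn
      (starS nabla a (opN nabla mu κ f) N) (formalBilin (bulletCochain mu hs κ) a f N) U := by
  have h := represents_star mu hs κ hU hO hUO (fun N => (ha N).represents)
    (represents_op mu hs κ hU hO hUO fun N => (hf N).represents) N
  rw [KappaAlgebra.star, KappaAlgebra.op, formalBilin_formalOp_right] at h
  exact h.eqOn (Represents.formalBilin (represents_bulletCochain mu hs κ hU hO hUO)
    (fun N => (ha N).represents) (fun N => (hf N).represents) N)

omit hF hF' in
theorem starS_opN_const_eqOn {a f : Cotangent n Q → ℂ} (ha : SmoothFunOn (cotModel n) U a)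
    (hf : SmoothFunOn (cotModel n) U f) (N : ℕ) : Set.EqOn
      (starS nabla (Formal.const a) (opN nabla mu κ (Formal.const f)) N)
      (bulletCochain mu hs κ N a f) U := by
  have h := represents_star mu hs κ hU hO hUO ha.represents.const
    (represents_op mu hs κ hU hO hUO hf.represents.const) N
  rw [KappaAlgebra.star, KappaAlgebra.op, formalBilin_formalOp_right,
    formalBilin_const_const (by simp) (by simp)] at h
  exact h.eqOn (represents_bulletCochain mu hs κ hU hO hUO N _ _ _ _ ha.represents hf.represents)

end

end Bundle

end

section

section Frames

variable {E : Type*} [NormedAddCommGroup E] [NormedSpace ℝ E]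
  {H : Type*} [TopologicalSpace H] {J : ModelWithCorners ℝ E H}
  {M : Type*} [TopologicalSpace M] [ChartedSpace H M] {U : Set M}
  {F : Type*} [NormedAddCommGroup F] [NormedSpace ℂ F]
  {W : M → Type*} [∀ x, TopologicalSpace (W x)] [TopologicalSpace (TotalSpace F W)]
  [FiberBundle F W] {s s' : ∀ x, W x} [∀ x, AddCommMonoid (W x)] [∀ x, Module ℂ (W x)]
  [VectorBundle ℂ F W] {k : ℕ}

theorem SmoothSecOn.smul {a : M → ℂ} (ha : SmoothFunOn J U a) (hs : SmoothSecOn J F U s) :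
    SmoothSecOn J F U (fun x => a x • s x) :=
  (SmoothSecOn.sum_smul (k := 1) (t := fun _ => a) (e := fun _ => s) (fun _ => ha) fun _ => hs).congr
    fun x _ => by simp

theorem SmoothSecOn.add (hs : SmoothSecOn J F U s) (hs' : SmoothSecOn J F U s') :
    SmoothSecOn J F U (s + s') :=
  (SmoothSecOn.sum_smul (k := 2) (t := fun _ _ => 1) (e := ![s, s']) (fun _ => SmoothFunOn.const 1)
    (Fin.forall_fin_two.2 ⟨hs, hs'⟩)).congr fun x _ => by simp [Fin.sum_univ_two]

theorem SmoothSecOn.const (hs : SmoothSecOn J F U s) : FormalSmoothSecOn J F U (Formal.const s) :=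
  fun N => (SmoothSecOn.smul (SmoothFunOn.const (if N = 0 then 1 else 0)) hs).congr fun x _ => by
    cases N <;> simp [Formal.const]

variable [FiniteDimensional ℂ F]

theorem isBidifferential_of_frames {B : (M → ℂ) → (M → ℂ) → M → ℂ} (hB : IsBidiffOn J Set.univ B)
    {R : (∀ x, W x) → (M → ℂ) → ∀ x, W x}
    (h : ∀ x, ∃ (U₁ : Set M) (e : Fin k → ∀ x, W x), IsOpen U₁ ∧ x ∈ U₁ ∧
      (∀ i, SmoothSecOn J F U₁ (e i)) ∧
      (∀ y ∈ U₁, ∃ B : Module.Basis (Fin k) ℂ (W y), ⇑B = fun i => e i y) ∧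
      ∀ U, IsOpen U → U ⊆ U₁ → ∀ s f, SmoothSecOn J F U s → SmoothFunOn J U f → ∀ y ∈ U,
        R s f y = ∑ i, B (fun z => basisCoord (fun j => e j z) (s z) i) f y • e i y) :
    IsBidifferential J (SmoothSecOn J F) (SmoothSecOn J F) R := by
  have key : ∀ U, IsOpen U → ∀ x ∈ U, ∃ (U' : Set M) (e : Fin k → ∀ x, W x), IsOpen U' ∧ x ∈ U' ∧
      IsOpen (U ∩ U') ∧ (∀ i, SmoothSecOn J F (U ∩ U') (e i)) ∧
      (∀ s : ∀ x, W x, SmoothSecOn J F U s → SmoothSecOn J F (U ∩ U') s) ∧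
      (∀ f, SmoothFunOn J U f → SmoothFunOn J (U ∩ U') f) ∧
      (∀ s : ∀ x, W x, SmoothSecOn J F (U ∩ U') s → ∀ i,
        SmoothFunOn J (U ∩ U') (fun z => basisCoord (fun j => e j z) (s z) i)) ∧
      ∀ (s : ∀ x, W x) f, SmoothSecOn J F (U ∩ U') s → SmoothFunOn J (U ∩ U') f → ∀ y ∈ U ∩ U',
        R s f y = ∑ i, B (fun z => basisCoord (fun j => e j z) (s z) i) f y • e i y := by
    intro U hU x hx
    obtain ⟨U₁, e, h1, h2, h3, h4, h5⟩ := h x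
    have he : ∀ i, SmoothSecOn J F (U ∩ U₁) (e i) := fun i => (h3 i).mono Set.inter_subset_right
    exact ⟨U₁, e, h1, h2, hU.inter h1, he, fun s hs => hs.mono Set.inter_subset_left,
      fun f hf => hf.mono Set.inter_subset_left,
      fun s hs => hs.basisCoord he fun y hy => h4 y hy.2,
      fun s f => h5 _ (hU.inter h1) Set.inter_subset_right s f⟩
  refine ⟨fun U hU s f hs hf => .of_local fun x hx => ?_, fun U hU s s' f f' hs hs' hf hf' hff hss x hx => ?_,
    fun U hU s s' f hs hs' hf x hx => ?_, fun U hU c s f hs hf x hx => ?_,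
    fun U hU s f f' hs hf hf' x hx => ?_, fun U hU c s f hs hf x hx => ?_, ?_⟩
  · obtain ⟨U', e, h1, h2, h3, h4, h5, h6, h7, h8⟩ := key U hU x hx
    exact ⟨U', h1, h2, (SmoothSecOn.sum_smul (fun i => (hB.left _ h3 (Set.subset_univ _) f
      (h6 f hf)).smooth _ (h7 s (h5 s hs) i)) h4).congr (h8 s f (h5 s hs) (h6 f hf))⟩
  · obtain ⟨U', e, h1, h2, h3, h4, h5, h6, h7, h8⟩ := key U hU x hx
    rw [h8 s f (h5 s hs) (h6 f hf) x ⟨hx, h2⟩, h8 s' f' (h5 s' hs') (h6 f' hf') x ⟨hx, h2⟩]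
    refine Finset.sum_congr rfl fun i _ => ?_
    rw [(hB.left _ h3 (Set.subset_univ _) f (h6 f hf)).congr _ _ (h7 s (h5 s hs) i)
      (h7 s' (h5 s' hs') i) (fun y hy => by simp only [hss y hy.1]) ⟨hx, h2⟩,
      (hB.right _ h3 (Set.subset_univ _) _ (h7 s' (h5 s' hs') i)).congr f f' (h6 f hf) (h6 f' hf')
        (hff.mono Set.inter_subset_left) ⟨hx, h2⟩]
  · obtain ⟨U', e, h1, h2, h3, h4, h5, h6, h7, h8⟩ := key U hU x hx
    rw [h8 _ f (h5 _ (hs.add hs')) (h6 f hf) x ⟨hx, h2⟩, h8 s f (h5 s hs) (h6 f hf) x ⟨hx, h2⟩,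
      h8 s' f (h5 s' hs') (h6 f hf) x ⟨hx, h2⟩, ← Finset.sum_add_distrib]
    refine Finset.sum_congr rfl fun i _ => ?_
    rw [← add_smul]
    congr 1
    simp only [Pi.add_apply, basisCoord_add]
    exact (hB.left _ h3 (Set.subset_univ _) f (h6 f hf)).add _ _ (h7 s (h5 s hs) i)
      (h7 s' (h5 s' hs') i) ⟨hx, h2⟩
  · obtain ⟨U', e, h1, h2, h3, h4, h5, h6, h7, h8⟩ := key U hU x hx
    have hc : SmoothSecOn J F U (c • s) := SmoothSecOn.smul (SmoothFunOn.const c) hs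
    rw [h8 _ f (h5 _ hc) (h6 f hf) x ⟨hx, h2⟩, h8 s f (h5 s hs) (h6 f hf) x ⟨hx, h2⟩,
      Finset.smul_sum]
    refine Finset.sum_congr rfl fun i _ => ?_
    rw [smul_smul]
    congr 1
    simp only [Pi.smul_apply, basisCoord_smul]
    exact (hB.left _ h3 (Set.subset_univ _) f (h6 f hf)).smul c _ (h7 s (h5 s hs) i) ⟨hx, h2⟩
  · obtain ⟨U', e, h1, h2, h3, h4, h5, h6, h7, h8⟩ := key U hU x hx
    rw [h8 s _ (h5 s hs) (h6 _ (hf.add hf')) x ⟨hx, h2⟩, h8 s f (h5 s hs) (h6 f hf) x ⟨hx, h2⟩,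
      h8 s f' (h5 s hs) (h6 f' hf') x ⟨hx, h2⟩, ← Finset.sum_add_distrib]
    refine Finset.sum_congr rfl fun i _ => ?_
    rw [← add_smul]
    exact congrArg (· • e i x) ((hB.right _ h3 (Set.subset_univ _) _ (h7 s (h5 s hs) i)).add f f'
      (h6 f hf) (h6 f' hf') ⟨hx, h2⟩)
  · obtain ⟨U', e, h1, h2, h3, h4, h5, h6, h7, h8⟩ := key U hU x hx
    rw [h8 s _ (h5 s hs) (h6 _ (hf.smul c)) x ⟨hx, h2⟩, h8 s f (h5 s hs) (h6 f hf) x ⟨hx, h2⟩,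
      Finset.smul_sum]
    refine Finset.sum_congr rfl fun i _ => ?_
    rw [smul_smul]
    exact congrArg (· • e i x) ((hB.right _ h3 (Set.subset_univ _) _ (h7 s (h5 s hs) i)).smul c f
      (h6 f hf) ⟨hx, h2⟩)
  · obtain ⟨N, hN⟩ := hB.order
    refine ⟨N, fun U hU => ⟨fun f hf => .of_cover fun x hx => ?_,
      fun s hs => .of_cover fun x hx => ?_⟩⟩
    · obtain ⟨U', e, h1, h2, h3, h4, h5, h6, h7, h8⟩ := key U hU x hx
      refine ⟨U ∩ U', {a | SmoothFunOn J (U ∩ U') a}, {s | SmoothSecOn J F (U ∩ U') s}, ⟨hx, h2⟩, h6, h5,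
        .of_eqOn (fun a ha s hs => SmoothSecOn.smul ha hs) (fun s hs => h8 s f hs (h6 f hf))
        (OrderLE.sum_smul_frame (fun i => OrderLE.comp_basisCoord
          ((hN _ h3 (Set.subset_univ _)).1 f (h6 f hf)) i fun s hs => h7 s hs i) e)⟩
    · obtain ⟨U', e, h1, h2, h3, h4, h5, h6, h7, h8⟩ := key U hU x hx
      exact ⟨U ∩ U', {a | SmoothFunOn J (U ∩ U') a}, {f | SmoothFunOn J (U ∩ U') f}, ⟨hx, h2⟩, h6, h6,
        .of_eqOn (X := fun _ => ℂ) (fun a ha f hf => SmoothFunOn.mul ha hf)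
        (fun f hf => h8 s f (h5 s hs) hf)
        (OrderLE.sum_smul_frame (X := fun _ => ℂ)
          (fun i => (hN _ h3 (Set.subset_univ _)).2 _ (h7 s (h5 s hs) i)) e)⟩

end Frames

end

section

section Formal

variable {E : Type*} [NormedAddCommGroup E] [NormedSpace ℝ E]
  {H : Type*} [TopologicalSpace H] {J : ModelWithCorners ℝ E H}
  {M : Type*} [TopologicalSpace M] [ChartedSpace H M] {U : Set M}

theorem formalEqOn_iff_of_represents {a b : Formal (Sm J U)} {f g : Formal (M → ℂ)}
    (ha : ∀ N, Represents (a N) (f N)) (hb : ∀ N, Represents (b N) (g N)) :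
    FormalEqOn U f g ↔ a = b := by
  refine ⟨fun h => funext fun N => (ha N).ext (hb N) (h N), ?_⟩
  rintro rfl N
  exact (ha N).eqOn (hb N)

theorem Represents.ite_one (p : Prop) [Decidable p] :
    Represents (if p then 1 else 0 : Sm J U) (fun _ => if p then 1 else 0) := by
  split
  · exact ⟨SmoothFunOn.const 1, fun _ => rfl⟩
  · exact Represents.zero

theorem frameComb_congr {W : M → Type*} [∀ x, AddCommMonoid (W x)] [∀ x, Module ℂ (W x)] {k : ℕ}
    {e : Fin k → ∀ x, W x} {t t' : Fin k → Formal (M → ℂ)} {N : ℕ} {x : M}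
    (h : ∀ i, t i N x = t' i N x) : frameComb e t N x = frameComb e t' N x :=
  Finset.sum_congr rfl fun i _ => by rw [h i]

end Formal

section Bundle

variable {n : ℕ} {Q : Type*} [TopologicalSpace Q] [ChartedSpace 𝔼(n) Q]
  {F : Type*} [NormedAddCommGroup F] [NormedSpace ℂ F]
  {V : Q → Type*} [∀ q, AddCommGroup (V q)] [∀ q, Module ℂ (V q)]
  [∀ q, TopologicalSpace (V q)] [TopologicalSpace (TotalSpace F V)] [FiberBundle F V] {k : ℕ}
  [IsManifold (𝓡 n) ∞ Q] [VectorBundle ℂ F V] [FiniteDimensional ℂ F]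
  {nabla : CovariantDerivative (𝓡 n) 𝔼(n)
    (TangentSpace (𝓡 n) : Q → Type _)} (mu : VolumeDensity n Q) [T2Space Q]
  (hs : CovariantDerivative.ContMDiffCovariantDerivative nabla ∞) (κ : ℝ)

include hs

/-! ### Matrices of functions pulled back from the base -/

section Matrices

variable {U : Set (Cotangent n Q)} {O : Set Q}

theorem matVecStar_ite (hU : IsOpen U) {Φ : Matrix (Fin k) (Fin k) (Formal (Cotangent n Q → ℂ))}
    {i : Fin k} (hΦ : ∀ j, FormalSmoothFunOn (cotModel n) U (Φ i j)) (m : Fin k) :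
    FormalEqOn U (matVecStar (starK nabla mu κ) Φ
      (fun j => Formal.const fun _ => if j = m then 1 else 0) i) (Φ i m) := by
  intro N ζ hζ
  have h1 := Represents.sum (s := Finset.univ) fun j _ => represents_starK mu hs κ hU isOpen_univ
    (Set.subset_univ U) (fun N => (hΦ j N).represents) (Represents.ite_one (j = m)).const N
  simp only [KappaAlgebra.starK_const_ite] at h1
  rw [← Finset.sum_apply, Finset.sum_ite_eq' Finset.univ m, if_pos (Finset.mem_univ m)] at h1
  rw [matVecStar, Finset.sum_apply]
  exact h1.eqOn (hΦ m N).represents hζ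

variable (hO : IsOpen O) {u v : Matrix (Fin k) (Fin k) (Q → ℂ)}
  (hu : ∀ i j, SmoothFunOn (𝓡 n) O (u i j)) (hv : ∀ i j, SmoothFunOn (𝓡 n) O (v i j))

include hO hu hv

theorem matStar_pull {A B : Matrix (Fin k) (Fin k) (Formal (Cotangent n Q → ℂ))}
    (hA : ∀ i j, FormalEqOn (cotOver O) (A i j) (matConst (pullMatrix u) i j))
    (hB : ∀ i j, FormalEqOn (cotOver O) (B i j) (matConst (pullMatrix v) i j)) (i j : Fin k) :
    FormalEqOn (cotOver O) (matStar (starK nabla mu κ) A B i j)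
      (matConst (pullMatrix fun i j => ∑ r, u i r * v r j) i j) := by
  intro N ζ hζ
  have hr : ∀ {w : Q → ℂ} (hw : SmoothFunOn (𝓡 n) O w) (N : ℕ), Represents (Formal.const
      ((kappaAlgebra mu hs κ (isOpen_cotOver hO) hO (subset_refl (cotOver O))).pull hw.toSm) N)
      (Formal.const (pullbackFun w) N) := fun hw =>
    (hw.represents.comap contMDiff_cotProj.contMDiffOn (subset_refl (cotOver O))).const
  have h1 := Represents.sum (s := Finset.univ) fun r _ => represents_starK mu hs κ
    (isOpen_cotOver hO) hO (subset_refl _) (fun N => (hr (hu i r) N).congr (hA i r N))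
    (fun N => (hr (hv r j) N).congr (hB r j N)) N
  have h2 : ∀ r, (kappaAlgebra mu hs κ (isOpen_cotOver hO) hO (subset_refl (cotOver O))).starK _ _ =
    _ := fun r => KappaAlgebra.starK_pull_pull _ (hu i r).toSm (hv r j).toSm
  rw [Finset.sum_congr rfl fun r _ => congrFun (h2 r) N, ← Finset.sum_apply,
    KappaAlgebra.sum_const_pull] at h1
  rw [matStar, Finset.sum_apply]
  exact h1.eqOn ((((Represents.sum fun r _ => (hu i r).represents.mul (hv r j).represents).comap
    contMDiff_cotProj.contMDiffOn (subset_refl (cotOver O))).const N).congr fun _ _ => by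
      cases N <;> simp [matConst, pullMatrix, pullbackFun, Formal.const]) hζ

end Matrices

/-! ### The bundle deformation -/

section Deformation

variable {ι : Type*} {O : ι → Set Q} {ε : ι → Fin k → ∀ q, V q}
  (hF : ∀ α, IsFrameOn n F (O α) (ε α))

include hF

theorem exists_isGivenLocally (hcover : ∀ q, ∃ α, q ∈ O α) :
    ∃ bullet, IsGivenLocally nabla mu κ F O ε bullet := by
  choose idx hidx using hcover
  exact ⟨fun s f N ζ => locBullet nabla mu κ (ε (idx ζ.1)) s f N ζ, fun α U hU s f hs' hf N ζ hζ =>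
    locBullet_change (hF (idx ζ.1)) (hF α) mu hs κ hU hs' hf N ζ ⟨hζ.1, hidx _, hζ.2⟩⟩

theorem locBullet_eqOn {α : ι} {U : Set (Cotangent n Q)} (hU : IsOpen U)
    {s : Formal (∀ ζ, ((cotProj n Q : Cotangent n Q → Q) *ᵖ V) ζ)}
    {f : Formal (Cotangent n Q → ℂ)} (hS : FormalSmoothPullSecOn F U s)
    (hf : FormalSmoothFunOn (cotModel n) U f) : FormalEqOn (U ∩ cotOver (O α))
      (locBullet nabla mu κ (ε α) s f) (frameComb (pullFrame (ε α)) fun i => opN nabla mu κ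
        (starK nabla mu κ (opNInv nabla mu κ (frameCoord (pullFrame (ε α)) s i)) f)) := by
  intro N ζ hζ
  have hU' := hU.inter (isOpen_cotOver (n := n) (hF α).isOpen)
  have hUO : U ∩ cotOver (O α) ⊆ cotOver (O α) := Set.inter_subset_right
  have hf' := fun N => ((hf N).mono (U' := U ∩ cotOver (O α)) Set.inter_subset_left).represents
  have hc := (hF α).represents_coord hUO fun N => (hS N).mono Set.inter_subset_left
  refine frameComb_congr fun i => ?_
  have h1 := represents_op mu hs κ hU' (hF α).isOpen hUO (represents_starK mu hs κ hU' (hF α).isOpen hUO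
    (represents_opInv mu hs κ hU' (hF α).isOpen hUO (hc i)) hf') N
  rw [KappaAlgebra.op_starK, KappaAlgebra.op_opInv] at h1
  exact (represents_star mu hs κ hU' (hF α).isOpen hUO (hc i)
    (represents_op mu hs κ hU' (hF α).isOpen hUO hf') N).eqOn h1 hζ

variable {bullet : Formal (∀ ζ, ((cotProj n Q : Cotangent n Q → Q) *ᵖ V) ζ) →
      Formal (Cotangent n Q → ℂ) → Formal (∀ ζ, ((cotProj n Q : Cotangent n Q → Q) *ᵖ V) ζ)}
  (hb : IsGivenLocally nabla mu κ F O ε bullet)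

include hb

theorem IsGivenLocally.represents {α : ι} {U : Set (Cotangent n Q)} (hU : IsOpen U)
    (hUO : U ⊆ cotOver (O α))
    {s : Formal (∀ ζ, ((cotProj n Q : Cotangent n Q → Q) *ᵖ V) ζ)}
    {f : Formal (Cotangent n Q → ℂ)} (hS : FormalSmoothPullSecOn F U s)
    (hf : FormalSmoothFunOn (cotModel n) U f) (i : Fin k) (N : ℕ) :
    Represents ((kappaAlgebra mu hs κ hU (hF α).isOpen hUO).star ((hF α).coord hUO hS i)
      ((kappaAlgebra mu hs κ hU (hF α).isOpen hUO).op fun N => (hf N).toSm) N)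
      (frameCoord (pullFrame (ε α)) (bullet s f) i N) :=
  (represents_star mu hs κ hU (hF α).isOpen hUO ((hF α).represents_coord hUO hS i)
    (represents_op mu hs κ hU (hF α).isOpen hUO fun N => (hf N).represents) N).congr fun ζ hζ => by
      rw [frameCoord, hb α U hU s f hS hf N ζ ⟨hζ, hUO hζ⟩]
      exact basisCoord_sum (b := fun j => ε α j ζ.1) ((hF α).basis ζ.1 (hUO hζ)) _ i

theorem IsGivenLocally.smooth {α : ι} {U : Set (Cotangent n Q)} (hU : IsOpen U)
    (hUO : U ⊆ cotOver (O α))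
    {s : Formal (∀ ζ, ((cotProj n Q : Cotangent n Q → Q) *ᵖ V) ζ)}
    {f : Formal (Cotangent n Q → ℂ)} (hS : FormalSmoothPullSecOn F U s)
    (hf : FormalSmoothFunOn (cotModel n) U f) : FormalSmoothPullSecOn F U (bullet s f) := fun N =>
  (SmoothSecOn.sum_smul (fun i => (hb.represents mu hs κ hF hU hUO hS hf i N).smooth)
    fun i => (SmoothSecOn.pullFrame (hF α).smooth i).mono hUO).congr fun ζ hζ =>
      (sum_basisCoord (b := fun j => ε α j ζ.1) ((hF α).basis ζ.1 (hUO hζ)) (bullet s f N ζ)).symm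

theorem IsGivenLocally.const_eq {α : ι} {U : Set (Cotangent n Q)} (hU : IsOpen U)
    (hUO : U ⊆ cotOver (O α)) {s : ∀ ζ, ((cotProj n Q : Cotangent n Q → Q) *ᵖ V) ζ}
    {f : Cotangent n Q → ℂ} (hS : SmoothSecOn (cotModel n) F U s) (hf : SmoothFunOn (cotModel n) U f)
    (r : ℕ) {ζ : Cotangent n Q} (hζ : ζ ∈ U) : bullet (Formal.const s) (Formal.const f) r ζ =
      ∑ i, bulletCochain mu hs κ r (fun z => basisCoord (fun j => pullFrame (ε α) j z) (s z) i) f ζ •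
        pullFrame (ε α) i ζ := by
  refine (hb α U hU _ _ hS.const (fun N => (hf.represents.const N).smooth) r ζ ⟨hζ, hUO hζ⟩).trans
    (Finset.sum_congr rfl fun i _ => ?_)
  beta_reduce
  rw [frameCoord_const, starS_opN_const_eqOn mu hs κ hU (hF α).isOpen hUO
    ((hF α).smooth_basisCoord hUO hS i) hf r hζ]

theorem IsGivenLocally.isDeformationQuantization (hcover : ∀ q, ∃ α, q ∈ O α) :
    IsDeformationQuantization (cotModel n) F (starK nabla mu κ) bullet where
  cochains := by
    refine ⟨fun r s f => bullet (Formal.const s) (Formal.const f) r, fun r =>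
      isBidifferential_of_frames (k := k) (isBidiffOn_bulletCochain mu hs κ r) fun ζ => ?_,
      fun U hU s f hS hf N ζ hζ => ?_, fun U hU s f hS hf ζ hζ => ?_⟩
    · obtain ⟨α, hα⟩ := hcover ζ.1
      exact ⟨cotOver (O α), pullFrame (ε α), isOpen_cotOver (hF α).isOpen, hα,
        SmoothSecOn.pullFrame (hF α).smooth, fun y hy => (hF α).basis y.1 hy,
        fun U hU hUO s f hS hf y hy => hb.const_eq mu hs κ hF hU hUO hS hf r hy⟩
    · obtain ⟨α, hα⟩ := hcover ζ.1
      have hU' := hU.inter (isOpen_cotOver (n := n) (hF α).isOpen)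
      have hUO : U ∩ cotOver (O α) ⊆ cotOver (O α) := Set.inter_subset_right
      have hS' : ∀ N, SmoothSecOn (cotModel n) F (U ∩ cotOver (O α)) (s N) := fun N =>
        (hS N).mono Set.inter_subset_left
      have hf' : ∀ N, SmoothFunOn (cotModel n) (U ∩ cotOver (O α)) (f N) := fun N =>
        (hf N).mono Set.inter_subset_left
      rw [hb α U hU s f hS hf N ζ ⟨hζ, hα⟩]
      simp only [frameComb, formalBilin, Finset.sum_apply]
      simp only [hb.const_eq mu hs κ hF hU' hUO (hS' _) (hf' _) _ ⟨hζ, hα⟩]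
      rw [Finset.sum_congr rfl fun m _ => Finset.sum_comm, Finset.sum_comm]
      refine Finset.sum_congr rfl fun i _ => ?_
      rw [starS_opN_eqOn mu hs κ hU' (hF α).isOpen hUO (a := frameCoord (pullFrame (ε α)) s i) (fun N =>
        (hF α).smooth_basisCoord hUO (hS' N) i) hf' N ⟨hζ, hα⟩]
      simp only [formalBilin, Finset.sum_apply, Finset.sum_smul]
      rfl
    · obtain ⟨α, hα⟩ := hcover ζ.1
      have hU' := hU.inter (isOpen_cotOver (n := n) (hF α).isOpen)
      have hUO : U ∩ cotOver (O α) ⊆ cotOver (O α) := Set.inter_subset_right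
      have hS' := hS.mono (Set.inter_subset_left (t := cotOver (O α)))
      have hf' := hf.mono (Set.inter_subset_left (t := cotOver (O α)))
      refine (hb.const_eq mu hs κ hF hU' hUO hS' hf' 0 ⟨hζ, hα⟩).trans ?_
      refine Eq.trans ?_ (congrArg (fun v : V ζ.1 => f ζ • v) (sum_basisCoord
        (b := fun j => ε α j ζ.1) ((hF α).basis ζ.1 hα) (s ζ)))
      beta_reduce
      rw [Finset.smul_sum]
      refine Finset.sum_congr rfl fun i _ => ?_
      rw [smul_smul, mul_comm]
      refine congrArg (fun c : ℂ => c • ε α i ζ.1) ?_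
      have h0 : kappaExp (n := n) nabla mu (-Complex.I * κ) 0 f = f := by simp [kappaExp]
      rw [bulletCochain, Finset.Nat.antidiagonal_zero, Finset.sum_singleton, h0]
      exact (isStandardOrdered_starS hs).isStarProduct.cochains.choose_spec.2.2.1 _ hU' _ _
        ((hF α).smooth_basisCoord hUO hS' i) hf' ζ ⟨hζ, hα⟩
  module_law U hU s f g hS hf hg N ζ hζ := by
    obtain ⟨α, hα⟩ := hcover ζ.1
    have hU' := hU.inter (isOpen_cotOver (n := n) (hF α).isOpen)
    have hUO : U ∩ cotOver (O α) ⊆ cotOver (O α) := Set.inter_subset_right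
    have hS' : FormalSmoothPullSecOn F (U ∩ cotOver (O α)) s := fun N =>
      (hS N).mono Set.inter_subset_left
    have hr := fun {f : Formal (Cotangent n Q → ℂ)} (hf : FormalSmoothFunOn (cotModel n) U f) N =>
      ((hf N).mono (U' := U ∩ cotOver (O α)) Set.inter_subset_left).represents
    have hfg := represents_starK mu hs κ hU' (hF α).isOpen hUO (hr hf) (hr hg)
    have hsf := hb.smooth mu hs κ hF hU' hUO hS' fun N => (hr hf N).smooth
    rw [hb α _ hU' s _ hS' (fun N => (hfg N).smooth) N ζ ⟨⟨hζ, hα⟩, hα⟩,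
      hb α _ hU' _ g hsf (fun N => (hr hg N).smooth) N ζ ⟨⟨hζ, hα⟩, hα⟩]
    refine frameComb_congr fun i => ?_
    have h1 := represents_star mu hs κ hU' (hF α).isOpen hUO ((hF α).represents_coord hUO hS' i)
      (represents_op mu hs κ hU' (hF α).isOpen hUO hfg) N
    rw [KappaAlgebra.op_starK, ← KappaAlgebra.star_assoc] at h1
    exact h1.eqOn (represents_star mu hs κ hU' (hF α).isOpen hUO
      (hb.represents mu hs κ hF hU' hUO hS' (fun N => (hr hf N).smooth) i)
      (represents_op mu hs κ hU' (hF α).isOpen hUO (hr hg)) N) ⟨hζ, hα⟩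

end Deformation

end Bundle

end

section

section Bundle

variable {n : ℕ} {Q : Type*} [TopologicalSpace Q] [ChartedSpace 𝔼(n) Q]
  {F : Type*} [NormedAddCommGroup F] [NormedSpace ℂ F]
  {V : Q → Type*} [∀ q, AddCommGroup (V q)] [∀ q, Module ℂ (V q)]
  [∀ q, TopologicalSpace (V q)] [TopologicalSpace (TotalSpace F V)] [FiberBundle F V] {k : ℕ}
  [IsManifold (𝓡 n) ∞ Q] [VectorBundle ℂ F V] [FiniteDimensional ℂ F]
  {nabla : CovariantDerivative (𝓡 n) 𝔼(n)
    (TangentSpace (𝓡 n) : Q → Type _)} (mu : VolumeDensity n Q) [T2Space Q]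
  (hs : CovariantDerivative.ContMDiffCovariantDerivative nabla ∞) (κ : ℝ)
  {ι : Type*} {O : ι → Set Q} {ε : ι → Fin k → ∀ q, V q} (hF : ∀ α, IsFrameOn n F (O α) (ε α))

include hF

theorem transition_comp {α β γ : ι} {q : Q} (hα : q ∈ O α) (hβ : q ∈ O β) (i j : Fin k) :
    (∑ r, transitionMatrix (ε α) (ε β) i r * transitionMatrix (ε β) (ε γ) r j) q =
      transitionMatrix (ε α) (ε γ) i j q := by
  rw [Finset.sum_apply]
  exact (basisCoord_change ((hF α).basis q hα) ((hF β).basis q hβ) _ _).symm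

theorem matConst_transition_self (α : ι) (i j : Fin k) : FormalEqOn (cotOver (O α))
    (matConst (pullMatrix (transitionMatrix (ε α) (ε α))) i j)
    (matUnit (Cotangent n Q) (Fin k) i j) := by
  intro N ζ hζ
  have h : transitionMatrix (ε α) (ε α) i j ζ.1 = if i = j then 1 else 0 :=
    basisCoord_self (b := fun l => ε α l ζ.1) ((hF α).basis ζ.1 hζ) j i
  by_cases hij : i = j <;> cases N <;>
    simp_all [matConst, pullMatrix, pullbackFun, matUnit, Formal.const]

include hs

theorem matStar_transition (α β γ : ι) {O' : Set Q} (hO' : IsOpen O')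
    (h : O' ⊆ O α ∩ O β ∩ O γ) {A : Matrix (Fin k) (Fin k) (Formal (Cotangent n Q → ℂ))}
    (hA : ∀ i j, FormalEqOn (cotOver O') (A i j) (pullTransition (ε α) (ε β) i j)) (i j : Fin k) :
    FormalEqOn (cotOver O') (matStar (starK nabla mu κ) A (pullTransition (ε β) (ε γ)) i j)
      (pullTransition (ε α) (ε γ) i j) := by
  intro N ζ hζ
  refine (matStar_pull mu hs κ hO' (fun i j => ((hF α).smooth_transition (hF β) i j).mono
    fun q hq => (h hq).1) (fun i j => ((hF β).smooth_transition (hF γ) i j).mono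
    fun q hq => ⟨(h hq).1.2, (h hq).2⟩) hA (fun _ _ _ _ _ => rfl) i j N ζ hζ).trans ?_
  cases N
  · exact transition_comp hF (h hζ).1.1 (h hζ).1.2 i j
  · rfl

theorem transition_cocycle_three (α β γ : ι) (i j : Fin k) :
    FormalEqOn (cotOver (O α ∩ O β ∩ O γ)) (matStar (starK nabla mu κ)
      (matStar (starK nabla mu κ) (pullTransition (ε α) (ε β)) (pullTransition (ε β) (ε γ)))
      (pullTransition (ε γ) (ε α)) i j) (matUnit (Cotangent n Q) (Fin k) i j) := fun N ζ hζ =>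
  have hO := ((hF α).isOpen.inter (hF β).isOpen).inter (hF γ).isOpen
  (matStar_transition mu hs κ hF α γ α hO (fun q hq => ⟨⟨hq.1.1, hq.2⟩, hq.1.1⟩)
    (matStar_transition mu hs κ hF α β γ hO subset_rfl fun _ _ _ _ _ => rfl) i j N ζ hζ).trans
    (matConst_transition_self hF α i j N ζ hζ.1.1)

theorem transition_cocycle_two (α β : ι) (i j : Fin k) : FormalEqOn (cotOver (O α ∩ O β))
    (matStar (starK nabla mu κ) (pullTransition (ε α) (ε β)) (pullTransition (ε β) (ε α)) i j)
    (matUnit (Cotangent n Q) (Fin k) i j) := fun N ζ hζ =>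
  (matStar_transition mu hs κ hF α β α ((hF α).isOpen.inter (hF β).isOpen) (fun q hq => ⟨hq, hq.1⟩)
    (fun _ _ _ _ _ => rfl) i j N ζ hζ).trans (matConst_transition_self hF α i j N ζ hζ.1)

variable {bullet : Formal (∀ ζ, ((cotProj n Q : Cotangent n Q → Q) *ᵖ V) ζ) →
      Formal (Cotangent n Q → ℂ) → Formal (∀ ζ, ((cotProj n Q : Cotangent n Q → Q) *ᵖ V) ζ)}
  (hb : IsGivenLocally nabla mu κ F O ε bullet)

include hb

theorem IsGivenLocally.frameBullet_eqOn {α : ι} {O' : Set Q} (hO' : IsOpen O') (hα : O' ⊆ O α)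
    {t : Fin k → Formal (Cotangent n Q → ℂ)}
    (ht : ∀ i, FormalSmoothFunOn (cotModel n) (cotOver O') (t i)) : FormalEqOn (cotOver O')
      (frameBullet bullet (pullFrame (ε α)) t)
      (frameComb (pullFrame (ε α)) fun i => opN nabla mu κ (t i)) := by
  intro N ζ hζ
  have hU := isOpen_cotOver (n := n) hO'
  have hg := fun i => represents_op mu hs κ hU hO' subset_rfl fun N => (ht i N).represents
  have key : ∀ i j, starS nabla (frameCoord (pullFrame (ε α)) (Formal.const (pullFrame (ε α) i)) j)
      (opN nabla mu κ (t i)) N ζ = if j = i then opN nabla mu κ (t i) N ζ else 0 := by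
    intro i j
    have hc : ∀ N, Represents (Formal.const (if j = i then 1 else 0 : Sm (cotModel n) (cotOver O')) N)
        (frameCoord (pullFrame (ε α)) (Formal.const (pullFrame (ε α) i)) j N) := fun N => by
      rw [frameCoord_const]
      have h2 : ∀ ζ ∈ cotOver (n := n) O', basisCoord (fun l => ε α l ζ.1) (ε α i ζ.1) j =
          if j = i then 1 else 0 := fun ζ hζ => basisCoord_self ((hF α).basis ζ.1 (hα hζ)) i j
      exact Represents.const ((Represents.ite_one (j = i)).congr h2) N
    have h := represents_star mu hs κ hU hO' subset_rfl hc (hg i) N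
    split at h
    · rw [KappaAlgebra.one_star] at h
      simpa [*] using h.eqOn (hg i N) hζ
    · have h0 : (Formal.const 0 : Formal (Sm (cotModel n) (cotOver (n := n) O'))) = 0 := by
        funext N; simp [Formal.const]
      rw [h0, KappaAlgebra.star_zero_left] at h
      simpa [*] using h.eqOn Represents.zero hζ
  have h1 : ∀ i, bullet (Formal.const (pullFrame (ε α) i)) (t i) N ζ =
      opN nabla mu κ (t i) N ζ • pullFrame (ε α) i ζ := by
    intro i
    rw [hb α _ hU _ _ (((SmoothSecOn.pullFrame (hF α).smooth i).mono
      (Set.preimage_mono hα)).const) (ht i) N ζ ⟨hζ, hα hζ⟩]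
    simp only [frameComb, key, ite_smul, zero_smul]
    rw [Finset.sum_ite_eq' Finset.univ i, if_pos (Finset.mem_univ i)]
  rw [frameBullet, Finset.sum_apply, Finset.sum_apply]
  exact Finset.sum_congr rfl fun i _ => h1 i

theorem IsGivenLocally.frameBullet_eq_iff (α β : ι) {t t' : Fin k → Formal (Cotangent n Q → ℂ)}
    (ht : ∀ i, FormalSmoothFunOn (cotModel n) (cotOver (O α ∩ O β)) (t i))
    (ht' : ∀ i, FormalSmoothFunOn (cotModel n) (cotOver (O α ∩ O β)) (t' i)) :
    FormalEqOn (cotOver (O α ∩ O β)) (frameBullet bullet (pullFrame (ε α)) t)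
      (frameBullet bullet (pullFrame (ε β)) t') ↔ ∀ i, FormalEqOn (cotOver (O α ∩ O β)) (t i)
        (matVecStar (starK nabla mu κ) (pullTransition (ε α) (ε β)) t' i) := by
  have hO := (hF α).isOpen.inter (hF β).isOpen
  have hU := isOpen_cotOver (n := n) hO
  set K := kappaAlgebra mu hs κ hU hO (subset_refl (cotOver (O α ∩ O β)))
  have hφ := fun i j => ((hF α).smooth_transition (hF β) i j).represents.comap
    contMDiff_cotProj.contMDiffOn (subset_refl (cotOver (O α ∩ O β)))
  have hm : ∀ i N, Represents ((∑ j, K.starK (Formal.const (K.pull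
      ((hF α).smooth_transition (hF β) i j).toSm)) fun N => (ht' j N).toSm) N)
      (matVecStar (starK nabla mu κ) (pullTransition (ε α) (ε β)) t' i N) := fun i N => by
    rw [matVecStar, Finset.sum_apply, Finset.sum_apply]
    exact Represents.sum fun j _ => represents_starK mu hs κ hU hO subset_rfl (hφ i j).const
      (fun N => (ht' j N).represents) N
  have hop := fun i N => represents_op mu hs κ hU hO subset_rfl (fun N => (ht i N).represents) N
  have hop' := fun i N => represents_op mu hs κ hU hO subset_rfl (fun N => (ht' i N).represents) N
  have key : (∀ i, FormalEqOn (cotOver (O α ∩ O β)) (t i)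
      (matVecStar (starK nabla mu κ) (pullTransition (ε α) (ε β)) t' i)) ↔
      ∀ i, FormalEqOn (cotOver (O α ∩ O β)) (opN nabla mu κ (t i)) fun N ζ =>
        ∑ j, transitionMatrix (ε α) (ε β) i j ζ.1 * opN nabla mu κ (t' j) N ζ := by
    refine forall_congr' fun i => ?_
    rw [formalEqOn_iff_of_represents (fun N => (ht i N).represents) (hm i),
      formalEqOn_iff_of_represents (hop i) fun N => (Represents.sum (s := Finset.univ) fun j _ =>
        (hφ i j).mul (hop' j N)).congr fun ζ _ => by rw [Finset.sum_apply]]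
    have h : K.op (∑ j, K.starK (Formal.const (K.pull
        ((hF α).smooth_transition (hF β) i j).toSm)) fun N => (ht' j N).toSm) = fun N =>
        ∑ j, K.pull ((hF α).smooth_transition (hF β) i j).toSm * K.op (fun N => (ht' j N).toSm) N := by
      rw [K.op_sum]
      simp only [K.op_starK_pull]
      funext N
      rw [Finset.sum_apply]
    exact ⟨fun h' => (congrArg K.op h').trans h, fun h' => by
      rw [← K.opInv_op (fun N => (ht i N).toSm), ← K.opInv_op (∑ j, _), h]; exact congrArg _ h'⟩
  rw [key]
  have e1 := hb.frameBullet_eqOn mu hs κ hF hO Set.inter_subset_left ht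
  have e2 := hb.frameBullet_eqOn mu hs κ hF hO Set.inter_subset_right ht'
  refine ⟨fun h i N ζ hζ => ?_, fun h N ζ hζ => ?_⟩
  · exact ((hF α).frame_change (hF β) hζ _ _).1
      ((e1 N ζ hζ).symm.trans ((h N ζ hζ).trans (e2 N ζ hζ))) i
  · exact (e1 N ζ hζ).trans ((((hF α).frame_change (hF β) hζ _ _).2 fun i => h i N ζ hζ).trans
      (e2 N ζ hζ).symm)

theorem IsGivenLocally.isQuantumTransitionMatrix_iff (α β : ι)
    {Φ : Matrix (Fin k) (Fin k) (Formal (Cotangent n Q → ℂ))}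
    (hΦ : ∀ i j, FormalSmoothFunOn (cotModel n) (cotOver (O α ∩ O β)) (Φ i j)) :
    IsQuantumTransitionMatrix (starK nabla mu κ) bullet (pullFrame (ε α)) (pullFrame (ε β))
      (cotOver (O α ∩ O β)) Φ ↔
    ∀ i j, FormalEqOn (cotOver (O α ∩ O β)) (Φ i j) (pullTransition (ε α) (ε β) i j) := by
  have hO := (hF α).isOpen.inter (hF β).isOpen
  have hU := isOpen_cotOver (n := n) hO
  have hP : ∀ i j, FormalSmoothFunOn (cotModel n) (cotOver (O α ∩ O β))
      (pullTransition (ε α) (ε β) i j) := fun i j N =>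
    ((((hF α).smooth_transition (hF β) i j).represents.comap contMDiff_cotProj.contMDiffOn
      (subset_refl (cotOver (O α ∩ O β)))).const N).smooth
  refine ⟨fun h i m N ζ hζ => ?_, fun h t t' ht ht' he i N ζ hζ => ?_⟩
  · have hδ : ∀ j, FormalSmoothFunOn (cotModel n) (cotOver (O α ∩ O β))
        (Formal.const fun _ : Cotangent n Q => if j = m then 1 else 0) := fun j N =>
      ((Represents.ite_one (j = m)).const N).smooth
    have h1 := h (fun i => pullTransition (ε α) (ε β) i m) _ (fun i => hP i m) hδ
      ((hb.frameBullet_eq_iff mu hs κ hF α β (fun i => hP i m) hδ).2 fun i N ζ hζ =>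
        (matVecStar_ite mu hs κ hU (hP i) m N ζ hζ).symm) i N ζ hζ
    rw [h1, matVecStar_ite mu hs κ hU (hΦ i) m N ζ hζ]
  · rw [(hb.frameBullet_eq_iff mu hs κ hF α β ht ht').1 he i N ζ hζ, matVecStar, matVecStar,
      Finset.sum_apply, Finset.sum_apply, Finset.sum_apply, Finset.sum_apply]
    refine Finset.sum_congr rfl fun j _ => ?_
    have hr := fun N => (hP i j N).represents
    exact (represents_starK mu hs κ hU hO subset_rfl hr (fun N => (ht' j N).represents) N).eqOn
      (represents_starK mu hs κ hU hO subset_rfl (fun N => (hr N).congr (h i j N))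
        (fun N => (ht' j N).represents) N) hζ

theorem IsGivenLocally.eqOn_frameBullet_iff (α : ι)
    {s : Formal (∀ ζ, ((cotProj n Q : Cotangent n Q → Q) *ᵖ V) ζ)}
    (hS : FormalSmoothPullSecOn F (cotOver (O α)) s) {t : Fin k → Formal (Cotangent n Q → ℂ)}
    (ht : ∀ i, FormalSmoothFunOn (cotModel n) (cotOver (O α)) (t i)) :
    FormalEqOn (cotOver (O α)) s (frameBullet bullet (pullFrame (ε α)) t) ↔
      ∀ i, FormalEqOn (cotOver (O α)) (t i)
        (opNInv nabla mu κ (frameCoord (pullFrame (ε α)) s i)) := by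
  have hO := (hF α).isOpen
  have hU := isOpen_cotOver (n := n) hO
  set K := kappaAlgebra mu hs κ hU hO (subset_refl (cotOver (O α)))
  have hc := (hF α).represents_coord subset_rfl hS
  have key : (∀ i, FormalEqOn (cotOver (O α)) (t i) (opNInv nabla mu κ
      (frameCoord (pullFrame (ε α)) s i))) ↔ ∀ i, FormalEqOn (cotOver (O α))
        (frameCoord (pullFrame (ε α)) s i) (opN nabla mu κ (t i)) := by
    refine forall_congr' fun i => ?_
    rw [formalEqOn_iff_of_represents (fun N => (ht i N).represents)
      (represents_opInv mu hs κ hU hO subset_rfl (hc i)), formalEqOn_iff_of_represents (hc i)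
      (represents_op mu hs κ hU hO subset_rfl fun N => (ht i N).represents)]
    exact ⟨fun h => by rw [h, K.op_opInv], fun h => by rw [h, K.opInv_op]⟩
  rw [key]
  have e1 := hb.frameBullet_eqOn mu hs κ hF hO subset_rfl ht
  refine ⟨fun h i N ζ hζ => ?_, fun h N ζ hζ => ?_⟩
  · rw [frameCoord, h N ζ hζ, e1 N ζ hζ]
    exact basisCoord_sum (b := fun j => ε α j ζ.1) ((hF α).basis ζ.1 hζ) _ i
  · rw [e1 N ζ hζ, ← frameComb_congr fun i => h i N ζ hζ]
    exact (sum_basisCoord (b := fun j => ε α j ζ.1) ((hF α).basis ζ.1 hζ) (s N ζ)).symm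

end Bundle

end

end

theorem mainTheorem10 {n : ℕ}
    {Q : Type*} [TopologicalSpace Q] [T2Space Q] [SecondCountableTopology Q]
    [ChartedSpace (EuclideanSpace ℝ (Fin n)) Q] [IsManifold (𝓡 n) ∞ Q]
    (nabla : CovariantDerivative (𝓡 n) (EuclideanSpace ℝ (Fin n))
      (TangentSpace (𝓡 n) : Q → Type _))
    (hsmooth : CovariantDerivative.ContMDiffCovariantDerivative nabla ∞) (htorsion : nabla.torsion = 0)
    (mu : VolumeDensity n Q) (κ : ℝ)
    (F : Type*) [NormedAddCommGroup F] [NormedSpace ℂ F] [FiniteDimensional ℂ F]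
    (V : Q → Type*) [∀ q, AddCommGroup (V q)] [∀ q, Module ℂ (V q)]
    [∀ q, TopologicalSpace (V q)] [TopologicalSpace (TotalSpace F V)] [FiberBundle F V]
    [VectorBundle ℂ F V] [SmoothComplexVectorBundle (𝓡 n) F V]
    {k : ℕ} {ι : Type*} (O : ι → Set Q) (hO : ∀ α, IsOpen (O α)) (hcover : ⋃ α, O α = Set.univ)
    (ε : ι → Fin k → ∀ q, V q) (hε : ∀ α i, SmoothSecOn (𝓡 n) F (O α) (ε α i))
    (hbasis : ∀ α, ∀ q ∈ O α, LinearIndependent ℂ (fun i => ε α i q) ∧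
      ⊤ ≤ Submodule.span ℂ (Set.range (fun i => ε α i q))) :
    -- `⋆_S` and `⋆_κ` are the star products they are meant to be
    IsStandardOrdered nabla (starS nabla) ∧
    IsStarProduct (cotModel n) cotPoisson (starK nabla mu κ) ∧
    -- the classical transition matrices satisfy the quantum cocycle condition
    (∀ α β γ i j, FormalEqOn (cotOver (O α ∩ O β ∩ O γ))
      (matStar (starK nabla mu κ)
        (matStar (starK nabla mu κ) (pullTransition (ε α) (ε β)) (pullTransition (ε β) (ε γ)))
        (pullTransition (ε γ) (ε α)) i j)
      (matUnit (Cotangent n Q) (Fin k) i j)) ∧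
    (∀ α β i j, FormalEqOn (cotOver (O α ∩ O β))
      (matStar (starK nabla mu κ) (pullTransition (ε α) (ε β)) (pullTransition (ε β) (ε α)) i j)
      (matUnit (Cotangent n Q) (Fin k) i j)) ∧
    -- the two local formulas agree
    (∀ α, ∀ U : Set (Cotangent n Q), IsOpen U → ∀ s f, FormalSmoothPullSecOn F U s →
      FormalSmoothFunOn (cotModel n) U f → FormalEqOn (U ∩ cotOver (O α))
        (frameComb (pullFrame (ε α))
          (fun i => starS nabla (frameCoord (pullFrame (ε α)) s i) (opN nabla mu κ f)))
        (frameComb (pullFrame (ε α)) (fun i => opN nabla mu κ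
          (starK nabla mu κ (opNInv nabla mu κ (frameCoord (pullFrame (ε α)) s i)) f)))) ∧
    -- they define a global deformation quantization
    (∃ bullet, IsGivenLocally nabla mu κ F O ε bullet) ∧
    ∀ bullet, IsGivenLocally nabla mu κ F O ε bullet →
      IsDeformationQuantization (cotModel n) F (starK nabla mu κ) bullet ∧
      -- the quantum transition matrices are the classical ones
      (∀ α β, ∀ Φ : Matrix (Fin k) (Fin k) (Formal (Cotangent n Q → ℂ)),
        (∀ i j, FormalSmoothFunOn (cotModel n) (cotOver (O α ∩ O β)) (Φ i j)) →
        (IsQuantumTransitionMatrix (starK nabla mu κ) bullet (pullFrame (ε α)) (pullFrame (ε β))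
            (cotOver (O α ∩ O β)) Φ ↔
          ∀ i j, FormalEqOn (cotOver (O α ∩ O β)) (Φ i j) (pullTransition (ε α) (ε β) i j))) ∧
      -- the quantum trivialization `s ↦ t`, `s = e_α • t`, is `s ↦ N_κ⁻¹(s_α)`
      (∀ α, ∀ s, FormalSmoothPullSecOn F (cotOver (O α)) s →
        (∀ i, FormalSmoothFunOn (cotModel n) (cotOver (O α))
          (opNInv nabla mu κ (frameCoord (pullFrame (ε α)) s i))) ∧
        ∀ t : Fin k → Formal (Cotangent n Q → ℂ),
          (∀ i, FormalSmoothFunOn (cotModel n) (cotOver (O α)) (t i)) →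
          (FormalEqOn (cotOver (O α)) s (frameBullet bullet (pullFrame (ε α)) t) ↔
            ∀ i, FormalEqOn (cotOver (O α)) (t i)
              (opNInv nabla mu κ (frameCoord (pullFrame (ε α)) s i)))) := by
  have hF : ∀ α, IsFrameOn n F (O α) (ε α) := fun α => ⟨hO α, hε α, fun q hq =>
    ⟨Module.Basis.mk (hbasis α q hq).1 (hbasis α q hq).2, Module.Basis.coe_mk _ _⟩⟩
  have hc : ∀ q, ∃ α, q ∈ O α := fun q => Set.mem_iUnion.1 (hcover ▸ Set.mem_univ q)
  refine ⟨isStandardOrdered_starS hsmooth, isStarProduct_starK mu hsmooth κ,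
    transition_cocycle_three mu hsmooth κ hF, transition_cocycle_two mu hsmooth κ hF,
    fun α U hU s f => locBullet_eqOn mu hsmooth κ hF hU, exists_isGivenLocally mu hsmooth κ hF hc,
    fun bullet hb => ⟨hb.isDeformationQuantization mu hsmooth κ hF hc,
      fun α β Φ => hb.isQuantumTransitionMatrix_iff mu hsmooth κ hF α β,
      fun α s hs => ⟨fun i N => ?_, fun t => hb.eqOn_frameBullet_iff mu hsmooth κ hF α hs⟩⟩⟩
  exact (represents_opInv mu hsmooth κ (isOpen_cotOver (hO α)) (hO α) subset_rfl
    ((hF α).represents_coord subset_rfl hs i) N).smooth
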